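/- Theorem 2. Let $n\ge 2$ and $d\ge 1$, let $U\le n^{c}$ and $\phi\le n^{c}$ be powers of $2$ ($c$ a constant), and let $\alpha>0$, $\epsilon\in(0,1)$. Two sets $A,B$, initially empty, undergo a sequence of point insertions and deletions, fixed in advance (independently of the random choices of the data structures), such that at all times $A,B\subseteq\{1,\dots,U\}^d\subset\mathbb{R}^d$, $|A|,|B|\le n$, and the aspect ratio, i.e. the ratio between the largest and the smallest nonzero value of $\|a-b\|_1$ ($a\in A$, $b\in B$), is at most $\phi$. The sequence may also contain queries, at times when $B\neq\emptyset$. The Chamfer distance is $\mathrm{dist}_{\mathrm{CH}}(A,B)=\sum_{a\in A}\min_{b\in B}\|a-b\|_1$, and for $\gamma\ge 1$ a number $\mu$ is a $\gamma$-approximation to a value $v$ if $\mu\le v\le\gamma\mu$. For $\beta>0$, a $(1+\beta)$-approximate dynamic nearest-neighbour data structure with update and query time $\tau(\beta)\ge 0$ is a (randomized) data structure that maintains a set $B\subset\mathbb{R}^d$ of at most $n$ points under insertions and deletions and, for each query $a\in\mathbb{R}^d$ asked when $B\ne\emptyset$, returns a value that is a $(1+\beta)$-approximation to $\min_{b\in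 B}\|a-b\|_1$ with probability at least $1-n^{-q}$, for every sequence of operations fixed in advance ($q>0$ a constant), each operation taking at most $\tau(\beta)$ time in the worst case. There is an absolute constant $\kappa>0$ such that the following holds. Given a $(1+\kappa\alpha)$-approximate dynamic nearest-neighbour data structure with update and query time $\tau(\kappa\alpha)$ (accessed as a black box, in independent copies), there is a randomized dynamic data structure on the real RAM (unit-cost real arithmetic, comparisons, memory accesses and uniform random numbers in $[0,1]$; no rounding) with worst-case update time $$O\bigl(d\log n+\log^2 n+\tau(\kappa\alpha)\bigr),$$ such that every query is answered in worst-case time $$O\bigl(\log^2 n\cdot\epsilon^{-2}\max\{\alpha^2,1\}\cdot(d\log^2 n+\tau(\kappa\alpha))\bigr)$$ and, with probability at least $3/4$, returns a $(1+\alpha+\epsilon)$-approximation to $\mathrm{dist}_{\mathrm{CH}}(A,B)$ for the current sets $A,B$. The constants in the $O$-notation depend only on $c$ and $q$. -/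

import Mathlib

open MeasureTheory
open scoped NNReal ENNReal

namespace DynChamfer

/-! ### Geometry -/

/-- Points of `ℝ^d`. -/
abbrev Pt (d : ℕ) : Type := Fin d → ℝ

/-- The `ℓ₁` distance. -/
noncomputable def l1 {d : ℕ} (x y : Pt d) : ℝ := ∑ i, |x i - y i|

/-- `min_{b ∈ B} ‖a - b‖₁` (meaningful for nonempty `B`). -/
noncomputable def distTo {d : ℕ} (a : Pt d) (B : Finset (Pt d)) : ℝ :=
  ⨅ b : {b : Pt d // b ∈ B}, l1 a b.1

/-- The Chamfer distance of `A` from `B` with respect to `ℓ₁`. -/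
noncomputable def chamfer {d : ℕ} (A B : Finset (Pt d)) : ℝ := ∑ a ∈ A, distTo a B

/-- `μ` is a `γ`-approximation of the value `v`. -/
def IsApprox (γ μ v : ℝ) : Prop := μ ≤ v ∧ v ≤ μ * γ

/-- The grid `[U]^d = {1, …, U}^d`. -/
def grid (d U : ℕ) : Set (Pt d) := {x | ∀ i, ∃ m : ℕ, 1 ≤ m ∧ m ≤ U ∧ x i = (m : ℝ)}

/-- The ratio between the largest and the smallest nonzero distance
between a point of `A` and a point of `B` is at most `φ`. -/
def AspectRatioLE {d : ℕ} (φ : ℝ) (A B : Finset (Pt d)) : Prop :=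
  ∀ a ∈ A, ∀ b ∈ B, ∀ a' ∈ A, ∀ b' ∈ B, 0 < l1 a' b' → l1 a b ≤ φ * l1 a' b'

/-! ### Dynamic nearest-neighbour data structures -/

/-- Operations on a dynamic nearest-neighbour data structure. -/
inductive NNOp (d : ℕ) : Type
  | insert (x : Pt d)
  | delete (x : Pt d)
  | query (x : Pt d)

open Classical in
/-- Effect of an operation on the maintained point set. -/
noncomputable def NNOp.apply {d : ℕ} (B : Finset (Pt d)) : NNOp d → Finset (Pt d)
  | .insert x => Insert.insert x B
  | .delete x => B.erase x
  | .query _ => B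

/-- Operations that may be applied when the maintained set is `B`: new points are inserted as
long as there are fewer than `n` points, present points are deleted, and queries are asked when
`B` is nonempty. -/
def NNOp.Legal {d : ℕ} (n : ℕ) (B : Finset (Pt d)) : NNOp d → Prop
  | .insert x => x ∉ B ∧ B.card < n
  | .delete x => x ∈ B
  | .query _ => B.Nonempty

/-- The point set after a history of operations (oldest first), starting from `∅`. -/
noncomputable def nnSet {d : ℕ} (h : List (NNOp d)) : Finset (Pt d) := h.foldl NNOp.apply ∅

/-- All operations of the list are legal, one after the other, starting from the set `B`. -/
def NNLegal {d : ℕ} (n : ℕ) : Finset (Pt d) → List (NNOp d) → Prop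
  | _, [] => True
  | B, o :: h => o.Legal n B ∧ NNLegal n (o.apply B) h

/-- A (randomized) data structure answering nearest-neighbour queries, seen from outside: all
its random choices are collected in a random seed, the answer to a query is a function of the
seed, of the operations performed so far (oldest first) and of the query point, and `time` is
the (worst-case) time of every single operation, update or query. -/
structure NNStructure (d : ℕ) where
  Seed : Type
  [ms : MeasurableSpace Seed]
  law : Measure Seed
  [prob : IsProbabilityMeasure law]
  answer : Seed → List (NNOp d) → Pt d → ℝ
  measurable_answer : ∀ h a, Measurable fun s => answer s h a
  time : ℝ≥0

attribute [instance] NNStructure.ms NNStructure.prob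

/-- `D` is a `(1+β)`-approximate dynamic nearest-neighbour data structure for sets of at most `n`
points with failure probability at most `δ` (for each query of each legal sequence of
operations). -/
def NNStructure.IsApproxNN {d : ℕ} (D : NNStructure d) (n : ℕ) (β δ : ℝ) : Prop :=
  ∀ (h : List (NNOp d)) (a : Pt d), NNLegal n ∅ (h ++ [.query a]) →
    D.law {s | ¬ IsApprox (1 + β) (D.answer s h a) (distTo a (nnSet h))} ≤ ENNReal.ofReal δ

/-! ### The machine: a randomized real RAM with access to nearest-neighbour structures

The memory consists of arrays of natural numbers and arrays of real numbers, both infinite;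
a program mentions only finitely many arrays. Natural numbers serve as addresses and have only
addition and (truncated) subtraction; there is no conversion from reals to natural numbers (no
rounding). Every elementary operation (memory access, arithmetic operation, comparison,
drawing a random number) costs one unit of time, and an operation of a nearest-neighbour
structure costs in addition the time of that structure. -/

/-- Integer expressions. -/
inductive IExp : Type
  | const (k : ℕ)
  | get (arr : ℕ) (i : IExp)
  | add (e f : IExp)
  | sub (e f : IExp)

/-- Real expressions. -/
inductive RExp : Type
  | const (q : ℚ)
  | get (arr : ℕ) (i : IExp)
  | ofInt (e : IExp)
  | add (e f : RExp)
  | sub (e f : RExp)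
  | mul (e f : RExp)
  | div (e f : RExp)

/-- Tests. -/
inductive BExp : Type
  | ilt (e f : IExp)
  | rlt (e f : RExp)
  | not (b : BExp)
  | and (b c : BExp)

/-- Programs. In `nnInsert`, `nnDelete` and `nnQuery`, `k` is the number of the nearest-neighbour
structure that is addressed, and the point handed over is the one stored in the real array `src` at the
positions `p, …, p + d - 1`. -/
inductive Cmd : Type
  | skip
  /-- `arr[i] := e` for an array of natural numbers -/
  | setI (arr : ℕ) (i e : IExp)
  /-- `arr[i] := e` for an array of reals -/
  | setR (arr : ℕ) (i : IExp) (e : RExp)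
  /-- `arr[i] :=` a fresh uniform random number of `[0,1]` -/
  | rand (arr : ℕ) (i : IExp)
  | nnInsert (k : IExp) (src : ℕ) (p : IExp)
  | nnDelete (k : IExp) (src : ℕ) (p : IExp)
  /-- `arr[i] :=` the answer to the query -/
  | nnQuery (k : IExp) (src : ℕ) (p : IExp) (arr : ℕ) (i : IExp)
  | seq (c₁ c₂ : Cmd)
  | ite (b : BExp) (c₁ c₂ : Cmd)
  | while (b : BExp) (c : Cmd)

/-- Machine states: the memory, the number of random numbers drawn so far, and the history of
each of the nearest-neighbour structures. -/
structure State (d : ℕ) where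
  ints : ℕ → ℕ → ℕ
  reals : ℕ → ℕ → ℝ
  drawn : ℕ
  hist : ℕ → List (NNOp d)

/-- Number of elementary operations of an integer expression. -/
def IExp.cost : IExp → ℕ
  | .const _ => 1
  | .get _ i => i.cost + 1
  | .add e f => e.cost + f.cost + 1
  | .sub e f => e.cost + f.cost + 1

/-- Number of elementary operations of a real expression. -/
def RExp.cost : RExp → ℕ
  | .const _ => 1
  | .get _ i => i.cost + 1
  | .ofInt e => e.cost + 1
  | .add e f => e.cost + f.cost + 1
  | .sub e f => e.cost + f.cost + 1
  | .mul e f => e.cost + f.cost + 1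
  | .div e f => e.cost + f.cost + 1

/-- Number of elementary operations of a test. -/
def BExp.cost : BExp → ℕ
  | .ilt e f => e.cost + f.cost + 1
  | .rlt e f => e.cost + f.cost + 1
  | .not b => b.cost + 1
  | .and b c => b.cost + c.cost + 1

/-- Value of an integer expression. -/
def IExp.eval {d : ℕ} (s : State d) : IExp → ℕ
  | .const k => k
  | .get arr i => s.ints arr (i.eval s)
  | .add e f => e.eval s + f.eval s
  | .sub e f => e.eval s - f.eval s

/-- Value of a real expression. -/
noncomputable def RExp.eval {d : ℕ} (s : State d) : RExp → ℝ
  | .const q => (q : ℝ)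
  | .get arr i => s.reals arr (i.eval s)
  | .ofInt e => (e.eval s : ℝ)
  | .add e f => e.eval s + f.eval s
  | .sub e f => e.eval s - f.eval s
  | .mul e f => e.eval s * f.eval s
  | .div e f => e.eval s / f.eval s

/-- Truth of a test. -/
def BExp.Holds {d : ℕ} (s : State d) : BExp → Prop
  | .ilt e f => e.eval s < f.eval s
  | .rlt e f => e.eval s < f.eval s
  | .not b => ¬ b.Holds s
  | .and b c => b.Holds s ∧ c.Holds s

/-- Writing into an array. -/
def write {α : Type} (m : ℕ → ℕ → α) (arr i : ℕ) (v : α) : ℕ → ℕ → α :=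
  Function.update m arr (Function.update (m arr) i v)

/-- The point stored in the real array `arr` at the positions `p, …, p + d - 1`. -/
def State.point {d : ℕ} (s : State d) (arr p : ℕ) : Pt d := fun i => s.reals arr (p + i)

/-- Appending an operation to the history of the `k`-th nearest-neighbour structure. -/
def State.log {d : ℕ} (s : State d) (k : ℕ) (o : NNOp d) : State d :=
  { s with hist := Function.update s.hist k (s.hist k ++ [o]) }

/-- An operation of the `k`-th nearest-neighbour structure is allowed now. -/
def State.Allows {d : ℕ} (n : ℕ) (s : State d) (k : ℕ) (o : NNOp d) : Prop :=
  o.Legal n (nnSet (s.hist k))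

/-- `Exec n D coins seeds c s t s'`: started in the state `s`, the program `c` halts in the state
`s'` after time `t`. The `m`-th random number drawn is `coins m`, and the nearest-neighbour
structure number `k` is a copy of `D` with the seed `seeds k`; it must be used legally. For given
`coins` and `seeds` the machine is deterministic. -/
inductive Exec {d : ℕ} (n : ℕ) (D : NNStructure d) (coins : ℕ → unitInterval)
    (seeds : ℕ → D.Seed) : Cmd → State d → ℝ → State d → Prop
  | skip (s : State d) : Exec n D coins seeds .skip s 1 s
  | setI (s : State d) (arr : ℕ) (i e : IExp) :
      Exec n D coins seeds (.setI arr i e) s (i.cost + e.cost + 1)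
        { s with ints := write s.ints arr (i.eval s) (e.eval s) }
  | setR (s : State d) (arr : ℕ) (i : IExp) (e : RExp) :
      Exec n D coins seeds (.setR arr i e) s (i.cost + e.cost + 1)
        { s with reals := write s.reals arr (i.eval s) (e.eval s) }
  | rand (s : State d) (arr : ℕ) (i : IExp) :
      Exec n D coins seeds (.rand arr i) s (i.cost + 1)
        { s with
          reals := write s.reals arr (i.eval s) (coins s.drawn : ℝ)
          drawn := s.drawn + 1 }
  | nnInsert (s : State d) (k : IExp) (src : ℕ) (p : IExp)
      (h : s.Allows n (k.eval s) (.insert (s.point src (p.eval s)))) :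
      Exec n D coins seeds (.nnInsert k src p) s (k.cost + p.cost + 1 + D.time)
        (s.log (k.eval s) (.insert (s.point src (p.eval s))))
  | nnDelete (s : State d) (k : IExp) (src : ℕ) (p : IExp)
      (h : s.Allows n (k.eval s) (.delete (s.point src (p.eval s)))) :
      Exec n D coins seeds (.nnDelete k src p) s (k.cost + p.cost + 1 + D.time)
        (s.log (k.eval s) (.delete (s.point src (p.eval s))))
  | nnQuery (s : State d) (k : IExp) (src : ℕ) (p : IExp) (arr : ℕ) (i : IExp)
      (h : s.Allows n (k.eval s) (.query (s.point src (p.eval s)))) :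
      Exec n D coins seeds (.nnQuery k src p arr i) s (k.cost + p.cost + i.cost + 1 + D.time)
        { s.log (k.eval s) (.query (s.point src (p.eval s))) with
          reals := write s.reals arr (i.eval s)
            (D.answer (seeds (k.eval s)) (s.hist (k.eval s)) (s.point src (p.eval s))) }
  | seq {s₁ s₂ s₃ : State d} {c₁ c₂ : Cmd} {t₁ t₂ : ℝ}
      (h₁ : Exec n D coins seeds c₁ s₁ t₁ s₂) (h₂ : Exec n D coins seeds c₂ s₂ t₂ s₃) :
      Exec n D coins seeds (.seq c₁ c₂) s₁ (t₁ + t₂) s₃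
  | iteTrue {s s' : State d} {b : BExp} {c₁ c₂ : Cmd} {t : ℝ} (hb : b.Holds s)
      (h : Exec n D coins seeds c₁ s t s') :
      Exec n D coins seeds (.ite b c₁ c₂) s (b.cost + 1 + t) s'
  | iteFalse {s s' : State d} {b : BExp} {c₁ c₂ : Cmd} {t : ℝ} (hb : ¬ b.Holds s)
      (h : Exec n D coins seeds c₂ s t s') :
      Exec n D coins seeds (.ite b c₁ c₂) s (b.cost + 1 + t) s'
  | whileTrue {s₁ s₂ s₃ : State d} {b : BExp} {c : Cmd} {t₁ t₂ : ℝ} (hb : b.Holds s₁)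
      (h₁ : Exec n D coins seeds c s₁ t₁ s₂) (h₂ : Exec n D coins seeds (.while b c) s₂ t₂ s₃) :
      Exec n D coins seeds (.while b c) s₁ (b.cost + 1 + t₁ + t₂) s₃
  | whileFalse {s : State d} {b : BExp} {c : Cmd} (hb : ¬ b.Holds s) :
      Exec n D coins seeds (.while b c) s (b.cost + 1) s

/-! ### Dynamic algorithms for the Chamfer distance -/

/-- Which of the two sets is updated. -/
inductive Side : Type
  | A
  | B

/-- Requests to the data structure. -/
inductive Op (d : ℕ) : Type
  | insert (S : Side) (x : Pt d)
  | delete (S : Side) (x : Pt d)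
  | query

/-- The current pair of point sets. -/
structure Config (d : ℕ) where
  A : Finset (Pt d)
  B : Finset (Pt d)

/-- The pair of empty sets. -/
def Config.empty (d : ℕ) : Config d := ⟨∅, ∅⟩

/-- The set on a given side. -/
def Config.side {d : ℕ} (K : Config d) : Side → Finset (Pt d)
  | .A => K.A
  | .B => K.B

open Classical in
/-- Effect of a request on the current sets. -/
noncomputable def Op.apply {d : ℕ} (K : Config d) : Op d → Config d
  | .insert .A x => ⟨Insert.insert x K.A, K.B⟩
  | .insert .B x => ⟨K.A, Insert.insert x K.B⟩
  | .delete .A x => ⟨K.A.erase x, K.B⟩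
  | .delete .B x => ⟨K.A, K.B.erase x⟩
  | .query => K

/-- The current sets after a sequence of requests. -/
noncomputable def configAfter {d : ℕ} (ops : List (Op d)) : Config d :=
  ops.foldl Op.apply (Config.empty d)

/-- Requests that may come when the current sets are `K`: insertion of a new point of `[U]^d` into
a set with fewer than `n` points such that the aspect ratio stays at most `φ`, deletion of a
present point, and a query when `B` is nonempty. -/
def Op.Legal {d : ℕ} (n U φ : ℕ) (K : Config d) : Op d → Prop
  | .insert S x => x ∈ grid d U ∧ x ∉ K.side S ∧ (K.side S).card < n ∧
      AspectRatioLE φ ((Op.insert S x).apply K).A ((Op.insert S x).apply K).B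
  | .delete S x => x ∈ K.side S
  | .query => K.B.Nonempty

/-- All requests of the list are legal, one after the other, starting from `K`. -/
def OpsLegal {d : ℕ} (n U φ : ℕ) : Config d → List (Op d) → Prop
  | _, [] => True
  | K, o :: ops => o.Legal n U φ K ∧ OpsLegal n U φ (o.apply K) ops

/-- A dynamic algorithm: one program for each kind of request. -/
structure Algorithm where
  insert : Side → Cmd
  delete : Side → Cmd
  query : Cmd

/-- The program that serves a request. -/
def Algorithm.code {d : ℕ} (P : Algorithm) : Op d → Cmd
  | .insert S _ => P.insert S
  | .delete S _ => P.delete S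
  | .query => P.query

/-- Initial state: the parameters `n, d, U, φ` are in the array `0` of natural numbers, the
parameters `α, ε` in the real array `1`; everything else is zero, no random numbers have been
drawn, and all nearest-neighbour structures are empty. -/
def initState (n d U φ : ℕ) (α ε : ℝ) : State d where
  ints := fun arr i =>
    if arr = 0 then
      (if i = 0 then n else if i = 1 then d else if i = 2 then U else if i = 3 then φ else 0)
    else 0
  reals := fun arr i =>
    if arr = 1 then (if i = 0 then α else if i = 1 then ε else 0) else 0
  drawn := 0
  hist := fun _ => []

/-- The coordinates of `x` are placed in the positions `0, …, d - 1` of the real array `0`. -/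
def State.putPoint {d : ℕ} (s : State d) (x : Pt d) : State d :=
  { s with
    reals := Function.update s.reals 0
      (fun i => if h : i < d then x ⟨i, h⟩ else s.reals 0 i) }

/-- Handing over the input of a request to the machine. -/
def State.load {d : ℕ} (s : State d) : Op d → State d
  | .insert _ x => s.putPoint x
  | .delete _ x => s.putPoint x
  | .query => s

/-- The output of a query: the entry `0` of the real array `2`. -/
def State.output {d : ℕ} (s : State d) : ℝ := s.reals 2 0

/-- `P.Serves n D coins seeds s ops s'`: started in the state `s`, the algorithm `P` serves the
requests `ops` one after the other and ends in the state `s'`. -/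
def Algorithm.Serves {d : ℕ} (P : Algorithm) (n : ℕ) (D : NNStructure d)
    (coins : ℕ → unitInterval) (seeds : ℕ → D.Seed) : State d → List (Op d) → State d → Prop
  | s, [], s' => s' = s
  | s, o :: ops, s' => ∃ t s₁, Exec n D coins seeds (P.code o) (s.load o) t s₁ ∧
      P.Serves n D coins seeds s₁ ops s'

/-- The law of the randomness: independent uniform random numbers of `[0,1]` and, independently of
them, independent seeds for the copies of the nearest-neighbour structure. -/
noncomputable def randomness {d : ℕ} (D : NNStructure d) :
    Measure ((ℕ → unitInterval) × (ℕ → D.Seed)) :=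
  (Measure.infinitePi fun _ : ℕ => (volume : Measure unitInterval)).prod
    (Measure.infinitePi fun _ : ℕ => D.law)

/-- Worst-case time: for all outcomes of the randomness and every legal sequence of requests, the
last request is served within time `Tu` if it is an update and within time `Tq` if it is a
query. -/
def Algorithm.WorstCaseTime {d : ℕ} (P : Algorithm) (n U φ : ℕ) (α ε : ℝ) (D : NNStructure d)
    (Tu Tq : ℝ) : Prop :=
  ∀ (coins : ℕ → unitInterval) (seeds : ℕ → D.Seed) (ops : List (Op d)) (o : Op d),
    OpsLegal n U φ (Config.empty d) (ops ++ [o]) →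
    ∃ (s s' : State d) (t : ℝ),
      P.Serves n D coins seeds (initState n d U φ α ε) ops s ∧
      Exec n D coins seeds (P.code o) (s.load o) t s' ∧
      t ≤ (match o with
        | .insert _ _ => Tu
        | .delete _ _ => Tu
        | .query => Tq)

/-- Correctness: for every legal sequence of requests (fixed in advance, independently of the
randomness) that ends with a query, the probability that the output of this query is not a
`γ`-approximation of the Chamfer distance is at most `δ`. -/
def Algorithm.Correct {d : ℕ} (P : Algorithm) (n U φ : ℕ) (α ε : ℝ) (D : NNStructure d)
    (γ : ℝ) (δ : ℝ≥0∞) : Prop :=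
  ∀ ops : List (Op d), OpsLegal n U φ (Config.empty d) (ops ++ [.query]) →
    randomness D {ρ | ¬ ∃ s : State d,
      P.Serves n D ρ.1 ρ.2 (initState n d U φ α ε) (ops ++ [.query]) s ∧
      IsApprox γ s.output (chamfer (configAfter ops).A (configAfter ops).B)} ≤ δ

end DynChamfer

namespace DynChamfer

/-! ### Reasoning about programs -/

-- Notation: U = 2^k, J = ⌈log₂ d⌉, Lg = ⌈log₂ n⌉, CH is the Chamfer distance. A random trie
-- supplies every a in A with a crude estimate D(a) of its distance from B, correct up to factors
-- O(log n). CH is then estimated by importance sampling: a is drawn with probability D(a)/W, where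
-- W = ∑ D(a), and dist(a,B)·W/D(a) is averaged, with dist(a,B) obtained from the nearest-neighbour
-- copies.
--
-- The trie. Every scale 2^e, 0 ≤ e ≤ J+k, carries a family of random cuts whose separation
-- probabilities for x and y, before truncation at 1, sum to exactly ‖x-y‖/2^e (`sum_sepProb`). For
-- e ≤ k there is one randomly shifted grid of side 2^e per coordinate; a coordinate uses one shift
-- for all e, so the cells are nested and the bits are the binary digits of the cell numbers. For e
-- > k a heap over the 2^J (padded) coordinates is used: a node of level J+k-e chooses a coordinate
-- below it and a threshold in [0,U], both from a single random number. The cuts of one scale use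
-- different random numbers. Hence x and y are separated at scale e with probability at most
-- ‖x-y‖/2^e by the union bound (`coinLaw_separated_le`), and not separated with probability at most
-- exp(-‖x-y‖/2^e) by independence (`coinLaw_not_separated_le`). Listed from coarse to fine, the
-- bits form strings of length only 2^J + d(k+1) = O(d log n).
--
-- The estimate. D(a) is 2^(e+1), where e is the scale of the bit at which a leaves the trie of B.
-- If D(a) is much too small, then some far pair is unseparated at a scale far below its distance;
-- this costs exp(-5 Lg) per pair. Conversely D(a) is at most 2^(e+1) for some scale e that
-- separates a from its nearest neighbour. Scales above 2^(Lg+5)·dist(a,B) are excluded by a union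
-- bound, and the O(log n) scales that remain above dist(a,B) contribute O(dist(a,B)) each in
-- expectation. So with probability 13/16, all dist(a,B) ≤ 5 Lg D(a) and W ≤ 256 Lg CH
-- (`coinLaw_not_goodTree_le`). These inequalities bound the second moment of one sample by O(Lg²
-- CH²), and Chebyshev's inequality with O(Lg²/ε²) samples gives relative error ε/8
-- (`coinLaw_estimator_le`). The trie reads the first 2^J + d random numbers and the samples read
-- later ones, so conditioning on the trie leaves the samples independent (`coinLaw_inter_eq`).
--
-- The nearest-neighbour answers. Each distance is the median of 2t+1 independent copies, which
-- lowers the failure probability from n^(-q) to O(n^(-4)) (`infinitePi_median_le`). The answers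
-- never influence later operations, so for fixed random numbers the histories of the copies are
-- fixed in advance (`exists_served`, `randomness_answers_le`). The number of queries is at most n²,
-- because otherwise, and also for small n, CH is computed exactly within the same time bound.
--
-- The data structure. A trie node stores the numbers of points of A and of B below it and, where B
-- is present, the sum of D over the points of A below it. All points leaving the trie of B along
-- one edge have the same D, so this sum obeys a recursion over children (`WeightRec.eq_msum`) and
-- an update repairs it along a single path. A descent guided by these sums realizes the sampling
-- distribution exactly (`integral_pick`). The `run_` lemmas show that concrete programs do all this
-- within the claimed time.

infixr:60 ";; " => Cmd.seq

theorem write_apply {α : Type} (m : ℕ → ℕ → α) (arr i : ℕ) (v : α) (a j : ℕ) :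
    write m arr i v a j = if a = arr ∧ j = i then v else m a j := by
  unfold write
  by_cases h : a = arr
  · subst h
    by_cases hj : j = i
    · subst hj; simp
    · simp [hj]
  · simp [h]

theorem write_ne {α : Type} (m : ℕ → ℕ → α) {arr a : ℕ} (i : ℕ) (v : α) (h : a ≠ arr) :
    write m arr i v a = m a := by
  unfold write; simp [h]

/-- Commands without loops and without calls of nearest-neighbour structures. -/
def Cmd.straight : Cmd → Bool
  | .skip => true
  | .setI _ _ _ => true
  | .setR _ _ _ => true
  | .rand _ _ => true
  | .seq c₁ c₂ => c₁.straight && c₂.straight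
  | .ite _ c₁ c₂ => c₁.straight && c₂.straight
  | _ => false

/-- Commands that neither draw random numbers nor call nearest-neighbour structures. -/
def Cmd.quiet : Cmd → Bool
  | .skip => true
  | .setI _ _ _ => true
  | .setR _ _ _ => true
  | .seq c₁ c₂ => c₁.quiet && c₂.quiet
  | .ite _ c₁ c₂ => c₁.quiet && c₂.quiet
  | .while _ c => c.quiet
  | _ => false

/-- The arrays of natural numbers into which a command writes. -/
def Cmd.wI : Cmd → List ℕ
  | .setI arr _ _ => [arr]
  | .seq c₁ c₂ => c₁.wI ++ c₂.wI
  | .ite _ c₁ c₂ => c₁.wI ++ c₂.wI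
  | .while _ c => c.wI
  | _ => []

/-- The arrays of reals into which a command writes. -/
def Cmd.wR : Cmd → List ℕ
  | .setR arr _ _ => [arr]
  | .rand arr _ => [arr]
  | .nnQuery _ _ _ arr _ => [arr]
  | .seq c₁ c₂ => c₁.wR ++ c₂.wR
  | .ite _ c₁ c₂ => c₁.wR ++ c₂.wR
  | .while _ c => c.wR
  | _ => []

/-- A bound for the running time of a straight command. -/
def Cmd.fuel : Cmd → ℕ
  | .skip => 1
  | .setI _ i e => i.cost + e.cost + 1
  | .setR _ i e => i.cost + e.cost + 1
  | .rand _ i => i.cost + 1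
  | .seq c₁ c₂ => c₁.fuel + c₂.fuel
  | .ite b c₁ c₂ => b.cost + 1 + (c₁.fuel + c₂.fuel)
  | _ => 0

open Classical in
/-- The effect of a straight command. -/
noncomputable def Cmd.sem {d : ℕ} (coins : ℕ → unitInterval) : Cmd → State d → State d
  | .setI arr i e, s => { s with ints := write s.ints arr (i.eval s) (e.eval s) }
  | .setR arr i e, s => { s with reals := write s.reals arr (i.eval s) (e.eval s) }
  | .rand arr i, s =>
      { s with
        reals := write s.reals arr (i.eval s) (coins s.drawn : ℝ)
        drawn := s.drawn + 1 }
  | .seq c₁ c₂, s => c₂.sem coins (c₁.sem coins s)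
  | .ite b c₁ c₂, s => if b.Holds s then c₁.sem coins s else c₂.sem coins s
  | _, s => s

/-- The command halts within the given time in a state with the given property. -/
def Run {d : ℕ} (n : ℕ) (D : NNStructure d) (coins : ℕ → unitInterval) (seeds : ℕ → D.Seed)
    (c : Cmd) (s : State d) (T : ℝ) (Q : State d → Prop) : Prop :=
  ∃ t s', Exec n D coins seeds c s t s' ∧ t ≤ T ∧ Q s'

/-! ### Hoare-style rules with time bounds -/

section Rules

variable {d n : ℕ} {D : NNStructure d} {coins : ℕ → unitInterval} {seeds : ℕ → D.Seed}

/-- Without loops and calls, a program is a total function of the state, so verification reduces to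
computing `Cmd.sem`. The bound `Cmd.fuel` adds up both branches of a conditional; the overestimate
only affects constants. -/
theorem Exec.of_straight (c : Cmd) (h : c.straight = true) (s : State d) :
    ∃ t, Exec n D coins seeds c s t (c.sem coins s) ∧ t ≤ c.fuel := by
  induction c generalizing s with
  | skip => exact ⟨1, .skip s, by simp [Cmd.fuel]⟩
  | setI arr i e => exact ⟨_, .setI s arr i e, by simp [Cmd.fuel]⟩
  | setR arr i e => exact ⟨_, .setR s arr i e, by simp [Cmd.fuel]⟩
  | rand arr i => exact ⟨_, .rand s arr i, by simp [Cmd.fuel]⟩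
  | seq c₁ c₂ h₁ h₂ =>
    obtain ⟨t₁, e₁, l₁⟩ := h₁ (by simp_all [Cmd.straight]) s
    obtain ⟨t₂, e₂, l₂⟩ := h₂ (by simp_all [Cmd.straight]) (c₁.sem coins s)
    exact ⟨_, .seq e₁ e₂, by simp only [Cmd.fuel]; push_cast; linarith⟩
  | ite b c₁ c₂ h₁ h₂ =>
    have p₁ : (0 : ℝ) ≤ c₁.fuel := by positivity
    have p₂ : (0 : ℝ) ≤ c₂.fuel := by positivity
    by_cases hb : b.Holds s
    · obtain ⟨t₁, e₁, l₁⟩ := h₁ (by simp_all [Cmd.straight]) s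
      refine ⟨b.cost + 1 + t₁, ?_, ?_⟩
      · simpa [Cmd.sem, hb] using Exec.iteTrue hb e₁
      · simp only [Cmd.fuel]; push_cast; linarith
    · obtain ⟨t₁, e₁, l₁⟩ := h₂ (by simp_all [Cmd.straight]) s
      refine ⟨b.cost + 1 + t₁, ?_, ?_⟩
      · simpa [Cmd.sem, hb] using Exec.iteFalse hb e₁
      · simp only [Cmd.fuel]; push_cast; linarith
  | _ => exact absurd h (by simp [Cmd.straight])

theorem Run.mono {c : Cmd} {s : State d} {T T' : ℝ} {Q Q' : State d → Prop}
    (h : Run n D coins seeds c s T Q) (hT : T ≤ T') (hQ : ∀ s', Q s' → Q' s') :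
    Run n D coins seeds c s T' Q' := by
  obtain ⟨t, s', e, l, q⟩ := h
  exact ⟨t, s', e, l.trans hT, hQ _ q⟩

theorem Run.straight {c : Cmd} (h : c.straight = true) {s : State d} {T : ℝ} {Q : State d → Prop}
    (hT : (c.fuel : ℝ) ≤ T) (hQ : Q (c.sem coins s)) : Run n D coins seeds c s T Q := by
  obtain ⟨t, e, l⟩ := Exec.of_straight (n := n) (D := D) (coins := coins) (seeds := seeds) c h s
  exact ⟨t, _, e, l.trans hT, hQ⟩

theorem Run.seq {c₁ c₂ : Cmd} {s : State d} {T₁ T₂ : ℝ} {Q : State d → Prop}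
    (h : Run n D coins seeds c₁ s T₁ fun s₁ => Run n D coins seeds c₂ s₁ T₂ Q) :
    Run n D coins seeds (c₁ ;; c₂) s (T₁ + T₂) Q := by
  obtain ⟨t₁, s₁, e₁, l₁, t₂, s₂, e₂, l₂, q⟩ := h
  exact ⟨_, _, .seq e₁ e₂, by linarith, q⟩

/-- A straight command in front of another one. -/
theorem Run.straight_seq {c₁ c₂ : Cmd} (h : c₁.straight = true) {s : State d} {T₁ T₂ : ℝ}
    {Q : State d → Prop} (hT : (c₁.fuel : ℝ) + T₂ ≤ T₁)
    (hQ : Run n D coins seeds c₂ (c₁.sem coins s) T₂ Q) :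
    Run n D coins seeds (c₁ ;; c₂) s T₁ Q :=
  (Run.seq (Run.straight h le_rfl hQ)).mono hT fun _ h => h

theorem Run.ite {b : BExp} {c₁ c₂ : Cmd} {s : State d} {T T' : ℝ} {Q : State d → Prop}
    (h₁ : b.Holds s → Run n D coins seeds c₁ s T Q)
    (h₂ : ¬ b.Holds s → Run n D coins seeds c₂ s T Q) (hT : b.cost + 1 + T ≤ T') :
    Run n D coins seeds (.ite b c₁ c₂) s T' Q := by
  by_cases hb : b.Holds s
  · obtain ⟨t, s', e, l, q⟩ := h₁ hb
    exact ⟨_, _, .iteTrue hb e, by linarith, q⟩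
  · obtain ⟨t, s', e, l, q⟩ := h₂ hb
    exact ⟨_, _, .iteFalse hb e, by linarith, q⟩

/-- Loops with a variant that counts the iterations, and a bound for each of them. -/
theorem Run.while_sum {b : BExp} {c : Cmd} (I : ℕ → State d → Prop) (N : ℕ) (T : ℕ → ℝ)
    (hstep : ∀ i < N, ∀ s, I i s → b.Holds s ∧ Run n D coins seeds c s (T i) (I (i + 1)))
    (hend : ∀ s, I N s → ¬ b.Holds s) {s : State d} (h0 : I 0 s) :
    Run n D coins seeds (.while b c) s
      ((∑ i ∈ Finset.range N, (T i + b.cost + 1)) + (b.cost + 1)) (I N) := by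
  -- Induction on the number m of remaining iterations, since `Exec.whileTrue` peels a loop off at
  -- its front.
  suffices H : ∀ m i, i + m = N → ∀ s, I i s → Run n D coins seeds (.while b c) s
      ((∑ j ∈ Finset.range m, (T (i + j) + b.cost + 1)) + (b.cost + 1)) (I N) by
    simpa using H N 0 (by simp) s h0
  intro m
  induction m with
  | zero =>
    intro i hi s hs
    obtain rfl : i = N := by simpa using hi
    exact ⟨_, _, .whileFalse (hend s hs), by simp, hs⟩
  | succ m ih =>
    intro i hi s hs
    obtain ⟨hb, t₁, s₁, e₁, l₁, q₁⟩ := hstep i (by omega) s hs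
    obtain ⟨t₂, s₂, e₂, l₂, q₂⟩ := ih (i + 1) (by omega) s₁ q₁
    refine ⟨_, _, .whileTrue hb e₁ e₂, ?_, q₂⟩
    rw [Finset.sum_range_succ']
    have : ∀ j, i + 1 + j = i + (j + 1) := fun j => by ring
    simp only [this] at l₂
    simp only [add_zero]
    linarith

end Rules

/-! ### Frames -/

/-- What a command leaves unchanged. -/
structure Cmd.Frame {d : ℕ} (c : Cmd) (s s' : State d) : Prop where
  ints : ∀ a, a ∉ c.wI → s'.ints a = s.ints a
  reals : ∀ a, a ∉ c.wR → s'.reals a = s.reals a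
  drawn : c.quiet = true → s'.drawn = s.drawn
  hist : c.quiet = true → s'.hist = s.hist

theorem Cmd.Frame.refl {d : ℕ} (c : Cmd) (s : State d) : c.Frame s s :=
  ⟨fun _ _ => rfl, fun _ _ => rfl, fun _ => rfl, fun _ => rfl⟩

theorem Cmd.Frame.trans {d : ℕ} {c : Cmd} {s s' s'' : State d} (h : c.Frame s s')
    (h' : c.Frame s' s'') : c.Frame s s'' :=
  ⟨fun a ha => (h'.ints a ha).trans (h.ints a ha), fun a ha => (h'.reals a ha).trans (h.reals a ha),
    fun q => (h'.drawn q).trans (h.drawn q), fun q => (h'.hist q).trans (h.hist q)⟩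

section Rules

variable {d n : ℕ} {D : NNStructure d} {coins : ℕ → unitInterval} {seeds : ℕ → D.Seed}

/-- Which arrays a program can change is visible in its text. Loop invariants and assertions
therefore mention only what changes, and everything else is recovered by evaluating `Cmd.wI` and
`Cmd.wR`. -/
theorem Exec.frame {c : Cmd} {s s' : State d} {t : ℝ} (h : Exec n D coins seeds c s t s') :
    c.Frame s s' := by
  induction h with
  | skip s => exact .refl _ _
  | setI s arr i e =>
    exact ⟨fun a ha => write_ne _ _ _ (by simpa [Cmd.wI] using ha), fun _ _ => rfl,
      fun _ => rfl, fun _ => rfl⟩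
  | setR s arr i e =>
    exact ⟨fun _ _ => rfl, fun a ha => write_ne _ _ _ (by simpa [Cmd.wR] using ha),
      fun _ => rfl, fun _ => rfl⟩
  | rand s arr i =>
    exact ⟨fun _ _ => rfl, fun a ha => write_ne _ _ _ (by simpa [Cmd.wR] using ha),
      fun h => by simp [Cmd.quiet] at h, fun _ => rfl⟩
  | nnInsert s k src p h =>
    exact ⟨fun _ _ => rfl, fun _ _ => rfl, fun _ => rfl, fun h => by simp [Cmd.quiet] at h⟩
  | nnDelete s k src p h =>
    exact ⟨fun _ _ => rfl, fun _ _ => rfl, fun _ => rfl, fun h => by simp [Cmd.quiet] at h⟩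
  | nnQuery s k src p arr i h =>
    exact ⟨fun _ _ => rfl, fun a ha => write_ne _ _ _ (by simpa [Cmd.wR] using ha),
      fun _ => rfl, fun h => by simp [Cmd.quiet] at h⟩
  | seq _ _ ih₁ ih₂ =>
    refine ⟨fun a ha => ?_, fun a ha => ?_, fun q => ?_, fun q => ?_⟩
    · simp only [Cmd.wI, List.mem_append, not_or] at ha
      exact (ih₂.ints a ha.2).trans (ih₁.ints a ha.1)
    · simp only [Cmd.wR, List.mem_append, not_or] at ha
      exact (ih₂.reals a ha.2).trans (ih₁.reals a ha.1)
    · simp only [Cmd.quiet, Bool.and_eq_true] at q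
      exact (ih₂.drawn q.2).trans (ih₁.drawn q.1)
    · simp only [Cmd.quiet, Bool.and_eq_true] at q
      exact (ih₂.hist q.2).trans (ih₁.hist q.1)
  | iteTrue _ _ ih =>
    refine ⟨fun a ha => ih.ints a ?_, fun a ha => ih.reals a ?_, fun q => ih.drawn ?_,
      fun q => ih.hist ?_⟩
    · simp only [Cmd.wI, List.mem_append, not_or] at ha; exact ha.1
    · simp only [Cmd.wR, List.mem_append, not_or] at ha; exact ha.1
    · simp only [Cmd.quiet, Bool.and_eq_true] at q; exact q.1
    · simp only [Cmd.quiet, Bool.and_eq_true] at q; exact q.1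
  | iteFalse _ _ ih =>
    refine ⟨fun a ha => ih.ints a ?_, fun a ha => ih.reals a ?_, fun q => ih.drawn ?_,
      fun q => ih.hist ?_⟩
    · simp only [Cmd.wI, List.mem_append, not_or] at ha; exact ha.2
    · simp only [Cmd.wR, List.mem_append, not_or] at ha; exact ha.2
    · simp only [Cmd.quiet, Bool.and_eq_true] at q; exact q.2
    · simp only [Cmd.quiet, Bool.and_eq_true] at q; exact q.2
  | whileTrue _ _ _ ih₁ ih₂ =>
    exact ⟨fun a ha => (ih₂.ints a ha).trans (ih₁.ints a ha),
      fun a ha => (ih₂.reals a ha).trans (ih₁.reals a ha),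
      fun q => (ih₂.drawn q).trans (ih₁.drawn q), fun q => (ih₂.hist q).trans (ih₁.hist q)⟩
  | whileFalse _ => exact .refl _ _

theorem Run.framed {c : Cmd} {s : State d} {T : ℝ} {Q : State d → Prop}
    (h : Run n D coins seeds c s T Q) :
    Run n D coins seeds c s T fun s' => c.Frame s s' ∧ Q s' := by
  obtain ⟨t, s', e, l, q⟩ := h
  exact ⟨t, s', e, l, e.frame, q⟩

/-- Loops with a variant that counts the iterations, and a bound for each of them. -/
theorem Run.loop_sum {b : BExp} {c : Cmd} {s₀ : State d} (I : ℕ → State d → Prop) (N : ℕ)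
    (T : ℕ → ℝ) {T' : ℝ} {Q : State d → Prop} (h0 : I 0 s₀)
    (hstep : ∀ i < N, ∀ s, c.Frame s₀ s → I i s →
      b.Holds s ∧ Run n D coins seeds c s (T i) (I (i + 1)))
    (hend : ∀ s, c.Frame s₀ s → I N s → ¬ b.Holds s)
    (hT : (∑ i ∈ Finset.range N, (T i + b.cost + 1)) + (b.cost + 1) ≤ T')
    (hQ : ∀ s, c.Frame s₀ s → I N s → Q s) :
    Run n D coins seeds (.while b c) s₀ T' Q := by
  -- The frame relative to the state before the loop is transitive, so it can ride along in the
  -- invariant.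
  refine (Run.while_sum (fun i s => c.Frame s₀ s ∧ I i s) N T ?_ ?_ ⟨.refl _ _, h0⟩).mono hT ?_
  · rintro i hi s ⟨hf, hI⟩
    obtain ⟨hb, hr⟩ := hstep i hi s hf hI
    exact ⟨hb, hr.framed.mono le_rfl fun s' hs' => ⟨hf.trans hs'.1, hs'.2⟩⟩
  · rintro s ⟨hf, hI⟩
    exact hend s hf hI
  · rintro s ⟨hf, hI⟩
    exact hQ s hf hI

/-- Loops with a uniform bound for the iterations. -/
theorem Run.loop {b : BExp} {c : Cmd} {s₀ : State d} (I : ℕ → State d → Prop) (N : ℕ)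
    {T T' : ℝ} {Q : State d → Prop} (h0 : I 0 s₀)
    (hstep : ∀ i < N, ∀ s, c.Frame s₀ s → I i s →
      b.Holds s ∧ Run n D coins seeds c s T (I (i + 1)))
    (hend : ∀ s, c.Frame s₀ s → I N s → ¬ b.Holds s)
    (hT : N * (T + b.cost + 1) + (b.cost + 1) ≤ T')
    (hQ : ∀ s, c.Frame s₀ s → I N s → Q s) :
    Run n D coins seeds (.while b c) s₀ T' Q :=
  Run.loop_sum I N (fun _ => T) h0 hstep hend
    (by rw [Finset.sum_const, Finset.card_range, nsmul_eq_mul]; linarith) hQ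

/-- Loops whose body is straight. -/
theorem Run.loop_straight {b : BExp} {c : Cmd} (hc : c.straight = true) {s₀ : State d}
    (I : ℕ → State d → Prop) (N : ℕ) {T' : ℝ} {Q : State d → Prop} (h0 : I 0 s₀)
    (hstep : ∀ i < N, ∀ s, c.Frame s₀ s → I i s → b.Holds s ∧ I (i + 1) (c.sem coins s))
    (hend : ∀ s, c.Frame s₀ s → I N s → ¬ b.Holds s)
    (hT : (N : ℝ) * ((c.fuel + b.cost + 1 : ℕ) : ℝ) + ((b.cost + 1 : ℕ) : ℝ) ≤ T')
    (hQ : ∀ s, c.Frame s₀ s → I N s → Q s) :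
    Run n D coins seeds (.while b c) s₀ T' Q :=
  Run.loop I N (T := c.fuel) h0
    (fun i hi s hf hs => ⟨(hstep i hi s hf hs).1, Run.straight hc le_rfl (hstep i hi s hf hs).2⟩)
    hend (by push_cast at hT; linarith) hQ

/-- Sequential composition with an intermediate assertion. -/
theorem Run.seq' {c₁ c₂ : Cmd} {s : State d} {T₁ T₂ T : ℝ} {P Q : State d → Prop}
    (h₁ : Run n D coins seeds c₁ s T₁ P)
    (h₂ : ∀ s₁, c₁.Frame s s₁ → P s₁ → Run n D coins seeds c₂ s₁ T₂ Q)
    (hT : T₁ + T₂ ≤ T) : Run n D coins seeds (c₁ ;; c₂) s T Q :=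
  (Run.seq (h₁.framed.mono le_rfl fun s₁ h => h₂ s₁ h.1 h.2)).mono hT fun _ h => h

end Rules

/-! ### Computation rules for straight programs -/

section Simp

variable {d : ℕ} (coins : ℕ → unitInterval) (s : State d)

@[simp] theorem Cmd.sem_skip : Cmd.skip.sem coins s = s := rfl

@[simp] theorem Cmd.sem_setI (arr : ℕ) (i e : IExp) : (Cmd.setI arr i e).sem coins s =
    { s with ints := write s.ints arr (i.eval s) (e.eval s) } := rfl

@[simp] theorem Cmd.sem_setR (arr : ℕ) (i : IExp) (e : RExp) : (Cmd.setR arr i e).sem coins s =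
    { s with reals := write s.reals arr (i.eval s) (e.eval s) } := rfl

@[simp] theorem Cmd.sem_rand (arr : ℕ) (i : IExp) : (Cmd.rand arr i).sem coins s =
    { s with
      reals := write s.reals arr (i.eval s) (coins s.drawn : ℝ)
      drawn := s.drawn + 1 } := rfl

@[simp] theorem Cmd.sem_seq (c₁ c₂ : Cmd) :
    (c₁ ;; c₂).sem coins s = c₂.sem coins (c₁.sem coins s) := rfl

theorem Cmd.sem_ite_pos {b : BExp} (c₁ c₂ : Cmd) (h : b.Holds s) :
    (Cmd.ite b c₁ c₂).sem coins s = c₁.sem coins s := if_pos h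

theorem Cmd.sem_ite_neg {b : BExp} (c₁ c₂ : Cmd) (h : ¬ b.Holds s) :
    (Cmd.ite b c₁ c₂).sem coins s = c₂.sem coins s := if_neg h

end Simp

attribute [simp] IExp.eval RExp.eval BExp.Holds write_apply

/-- The scalar stored in an array of natural numbers. -/
abbrev iv (a : ℕ) : IExp := .get a (.const 0)

/-- The scalar stored in an array of reals. -/
abbrev rv (a : ℕ) : RExp := .get a (.const 0)

/-! ### Prefix trees -/

section Prefix

variable {X : Type} (β : X → ℕ → Bool)

/-- The first `p` bits of `x`. -/
def pre (x : X) (p : ℕ) : List Bool := (List.range p).map (β x)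

@[simp] theorem pre_length (x : X) (p : ℕ) : (pre β x p).length = p := by simp [pre]

@[simp] theorem pre_zero (x : X) : pre β x 0 = [] := rfl

theorem pre_succ (x : X) (p : ℕ) : pre β x (p + 1) = pre β x p ++ [β x p] := by
  simp [pre, List.range_succ]

theorem pre_eq_iff (x y : X) (p : ℕ) : pre β x p = pre β y p ↔ ∀ i < p, β x i = β y i := by
  simp [pre]

theorem pre_mono {x y : X} {p q : ℕ} (h : pre β x q = pre β y q) (hp : p ≤ q) :
    pre β x p = pre β y p := by
  rw [pre_eq_iff] at *
  exact fun i hi => h i (by omega)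

theorem pre_append_iff (x : X) (l : List Bool) (b : Bool) :
    pre β x (l ++ [b]).length = l ++ [b] ↔ pre β x l.length = l ∧ β x l.length = b := by
  rw [List.length_append, List.length_singleton, pre_succ]
  constructor
  · intro h
    have := List.append_inj h (by simp)
    exact ⟨this.1, by simpa using this.2⟩
  · rintro ⟨h₁, h₂⟩
    rw [h₁, h₂]

open Classical in
/-- The sum of `f` over the elements of `S` below the node `l`. -/
noncomputable def msum {M : Type} [AddCommMonoid M] (S : Finset X) (f : X → M) (l : List Bool) :
    M :=
  ∑ x ∈ S with pre β x l.length = l, f x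

open Classical in
/-- The number of elements of `S` below the node `l`. -/
noncomputable def cnt (S : Finset X) (l : List Bool) : ℕ :=
  (S.filter fun x => pre β x l.length = l).card

theorem msum_nil {M : Type} [AddCommMonoid M] (S : Finset X) (f : X → M) :
    msum β S f [] = ∑ x ∈ S, f x := by
  simp [msum]

/-- The next bit of an element below the node decides to which child it belongs. -/
theorem msum_split {M : Type} [AddCommMonoid M] (S : Finset X) (f : X → M) (l : List Bool) :
    msum β S f l = msum β S f (l ++ [false]) + msum β S f (l ++ [true]) := by
  classical
  simp only [msum, pre_append_iff]
  rw [← Finset.sum_filter_add_sum_filter_not (S.filter fun x => pre β x l.length = l)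
    (fun x => β x l.length = false)]
  simp only [Finset.filter_filter, Bool.not_eq_false]

theorem cnt_eq_msum (S : Finset X) (l : List Bool) : cnt β S l = msum β S (fun _ => 1) l := by
  simp [cnt, msum]

theorem msum_one (S : Finset X) (l : List Bool) :
    msum β S (fun _ => (1 : ℝ)) l = cnt β S l := by
  simp [cnt, msum]

theorem cnt_split (S : Finset X) (l : List Bool) :
    cnt β S l = cnt β S (l ++ [false]) + cnt β S (l ++ [true]) := by
  simp only [cnt_eq_msum, ← msum_split]

theorem cnt_nil (S : Finset X) : cnt β S [] = S.card := by simp [cnt]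

theorem cnt_pos {S : Finset X} {l : List Bool} :
    0 < cnt β S l ↔ ∃ x ∈ S, pre β x l.length = l := by
  simp [cnt, Finset.card_pos, Finset.Nonempty]

theorem cnt_eq_zero {S : Finset X} {l : List Bool} :
    cnt β S l = 0 ↔ ∀ x ∈ S, pre β x l.length ≠ l := by
  simp [cnt, Finset.filter_eq_empty_iff]

open Classical in
theorem cnt_insert {S : Finset X} {x : X} (hx : x ∉ S) (l : List Bool) :
    cnt β (insert x S) l = cnt β S l + if pre β x l.length = l then 1 else 0 := by
  unfold cnt
  rw [Finset.filter_insert]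
  split_ifs with h
  · rw [Finset.card_insert_of_notMem (by simp [hx])]
  · simp

open Classical in
theorem cnt_erase {S : Finset X} {x : X} (hx : x ∈ S) (l : List Bool) :
    cnt β (S.erase x) l = cnt β S l - if pre β x l.length = l then 1 else 0 := by
  have := cnt_insert β (Finset.notMem_erase x S) l
  rw [Finset.insert_erase hx] at this
  omega

theorem msum_nonneg {S : Finset X} {f : X → ℝ} (hf : ∀ x ∈ S, 0 ≤ f x) (l : List Bool) :
    0 ≤ msum β S f l :=
  Finset.sum_nonneg fun x hx => hf x (Finset.mem_filter.1 hx).1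

theorem msum_pos {S : Finset X} {f : X → ℝ} {l : List Bool}
    (h : 0 < msum β S f l) : ∃ x ∈ S, pre β x l.length = l ∧ 0 < f x := by
  by_contra hc
  push Not at hc
  refine absurd h (not_lt.2 (Finset.sum_nonpos fun x hx => ?_))
  rw [Finset.mem_filter] at hx
  exact hc x hx.1 hx.2

/-! ### Distance estimates read off a prefix tree -/

variable (wt : ℕ → ℝ) (N : ℕ)

open Classical in
/-- The length of the longest common prefix of `a` with an element of `B`. -/
noncomputable def lcp (B : Finset X) (a : X) : ℕ :=
  Nat.findGreatest (fun p => ∃ b ∈ B, pre β b p = pre β a p) N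

/-- The crude estimate of the distance of `a` from `B` that is read off the tree. -/
noncomputable def treeDist (B : Finset X) (a : X) : ℝ :=
  if lcp β N B a < N then wt (lcp β N B a) else 0

theorem lcp_le (B : Finset X) (a : X) : lcp β N B a ≤ N := Nat.findGreatest_le _

theorem le_lcp {B : Finset X} {a b : X} (hb : b ∈ B) {p : ℕ} (hp : p ≤ N)
    (h : pre β b p = pre β a p) : p ≤ lcp β N B a :=
  Nat.le_findGreatest hp ⟨b, hb, h⟩

theorem lcp_spec {B : Finset X} (hB : B.Nonempty) (a : X) :
    ∃ b ∈ B, pre β b (lcp β N B a) = pre β a (lcp β N B a) := by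
  classical
  obtain ⟨b, hb⟩ := hB
  exact Nat.findGreatest_spec (P := fun p => ∃ b ∈ B, pre β b p = pre β a p) (Nat.zero_le N)
    ⟨b, hb, by simp⟩

theorem treeDist_nonneg (hwt : ∀ p, 0 ≤ wt p) (B : Finset X) (a : X) :
    0 ≤ treeDist β wt N B a := by
  unfold treeDist
  split_ifs
  exacts [hwt _, le_rfl]

/-- All elements that leave the tree of `B` along the same edge share one estimate, which depends
only on the depth of that edge. For them the tree needs a counter only. -/
theorem treeDist_of_leave {B : Finset X} {l : List Bool} {b : Bool} (hl : l.length < N)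
    (h₁ : 0 < cnt β B l) (h₂ : cnt β B (l ++ [b]) = 0) {a : X}
    (ha : pre β a (l ++ [b]).length = l ++ [b]) : treeDist β wt N B a = wt l.length := by
  have hlcp : lcp β N B a = l.length := by
    obtain ⟨b', hb', e⟩ := (cnt_pos β).1 h₁
    have hal := ((pre_append_iff β a l b).1 ha).1
    refine le_antisymm ?_ (le_lcp β N hb' hl.le (by rw [e, hal]))
    by_contra hc
    push Not at hc
    -- A longer common prefix would place an element of `B` below the empty child.
    obtain ⟨b'', hb'', e''⟩ := lcp_spec β N ⟨b', hb'⟩ a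
    have := pre_mono β e'' (p := (l ++ [b]).length) (by simp; omega)
    rw [ha] at this
    exact (cnt_eq_zero β).1 h₂ b'' hb'' this
  unfold treeDist
  rw [hlcp, if_pos hl]

/-- The weight of a child as it is computed from the entries of the tree. -/
noncomputable def childWeight (A B : Finset X) (W : List Bool → ℝ) (w : ℝ) (l : List Bool) : ℝ :=
  if 0 < cnt β B l then W l else cnt β A l * w

/-- `W` satisfies the recursion by which the weights in the tree are computed. -/
structure WeightRec (A B : Finset X) (W : List Bool → ℝ) : Prop where
  leaf : ∀ l, l.length = N → W l = 0
  inner : ∀ l, l.length < N → W l =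
    childWeight β A B W (wt l.length) (l ++ [false]) +
    childWeight β A B W (wt l.length) (l ++ [true])

variable {β wt N}

theorem msum_const {S : Finset X} {f : X → ℝ} {l : List Bool} {w : ℝ}
    (h : ∀ a ∈ S, pre β a l.length = l → f a = w) : msum β S f l = cnt β S l * w := by
  unfold msum cnt
  rw [Finset.sum_congr rfl (g := fun _ => w)]
  · simp
  · intro x hx
    rw [Finset.mem_filter] at hx
    exact h x hx.1 hx.2

/-- Induction from the leaves upwards. At a leaf that contains an element of `B` the estimate
vanishes, because all `N` bits agree. A child not reached by `B` contributes its number of elements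
of `A` times the weight of the current depth. Values stored at nodes without elements of `B` are not
such sums, and the recursion never reads them. -/
theorem WeightRec.eq_msum {A B : Finset X} {W : List Bool → ℝ} (h : WeightRec β wt N A B W) :
    ∀ l, l.length ≤ N → 0 < cnt β B l → W l = msum β A (treeDist β wt N B) l := by
  suffices H : ∀ k l, l.length + k = N → 0 < cnt β B l →
      W l = msum β A (treeDist β wt N B) l by
    intro l hl
    exact H (N - l.length) l (by omega)
  intro k
  induction k with
  | zero =>
    intro l hl hB
    rw [h.leaf l (by omega), msum_const (w := 0), mul_zero]
    intro a _ hal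
    obtain ⟨b, hb, e⟩ := (cnt_pos β).1 hB
    have := le_lcp β N hb (p := l.length) (by omega) (e.trans hal.symm)
    unfold treeDist
    rw [if_neg (by omega)]
  | succ k ih =>
    intro l hl hB
    rw [h.inner l (by omega), msum_split]
    have key : ∀ b, childWeight β A B W (wt l.length) (l ++ [b]) =
        msum β A (treeDist β wt N B) (l ++ [b]) := by
      intro b
      unfold childWeight
      split_ifs with hb
      · exact ih _ (by simp; omega) hb
      · rw [msum_const (w := wt l.length)]
        intro a _ ha
        exact treeDist_of_leave β wt N (by omega) hB (by omega) ha
    rw [key, key]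

/-- Serves the sampling descent, which needs the true weight of both children, including a child
that `B` does not reach. -/
theorem WeightRec.child_eq {A B : Finset X} {W : List Bool → ℝ} (h : WeightRec β wt N A B W)
    {l : List Bool} (hl : l.length < N) (hB : 0 < cnt β B l) (b : Bool) :
    childWeight β A B W (wt l.length) (l ++ [b]) = msum β A (treeDist β wt N B) (l ++ [b]) := by
  unfold childWeight
  split_ifs with hb
  · exact h.eq_msum _ (by simp; omega) hb
  · rw [msum_const (w := wt l.length)]
    intro a _ ha
    exact treeDist_of_leave β wt N hl hB (by omega) ha

/-! ### Selecting an element below a node -/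

/-- Descending `k` levels from the node `l`, guided by the weights `tot` and the number `r`. -/
noncomputable def pick (tot : List Bool → ℝ) : ℕ → List Bool → ℝ → List Bool
  | 0, l, _ => l
  | k + 1, l, r =>
    if r < tot (l ++ [false]) ∨ ¬ 0 < tot (l ++ [true]) then pick tot k (l ++ [false]) r
    else pick tot k (l ++ [true]) (r - tot (l ++ [false]))

theorem pick_length (tot : List Bool → ℝ) (k : ℕ) (l : List Bool) (r : ℝ) :
    (pick tot k l r).length = l.length + k := by
  induction k generalizing l r with
  | zero => rfl
  | succ k ih =>
    unfold pick
    split_ifs <;> rw [ih] <;> simp <;> omega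


theorem pick_left {tot : List Bool → ℝ} {k : ℕ} {l : List Bool} {r : ℝ}
    (h : r < tot (l ++ [false]) ∨ ¬ 0 < tot (l ++ [true])) :
    pick tot (k + 1) l r = pick tot k (l ++ [false]) r := by
  simp only [pick, if_pos h]

theorem pick_right {tot : List Bool → ℝ} {k : ℕ} {l : List Bool} {r : ℝ}
    (h : ¬ (r < tot (l ++ [false]) ∨ ¬ 0 < tot (l ++ [true]))) :
    pick tot (k + 1) l r = pick tot k (l ++ [true]) (r - tot (l ++ [false])) := by
  simp only [pick, if_neg h]

/-- The descent never enters a child of weight zero, not even for `r` equal to the total: the test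
in `pick` turns left whenever the right child has weight zero. Thus no exceptional value of `r` has
to be excluded on the machine. -/
theorem pick_spec {S : Finset X} {f : X → ℝ} (hf : ∀ x ∈ S, 0 ≤ f x) (k : ℕ) {l : List Bool}
    {r : ℝ} (hl : 0 < msum β S f l) (hr0 : 0 ≤ r) (hr : r ≤ msum β S f l) :
    ∃ x ∈ S, 0 < f x ∧ pick (msum β S f) k l r = pre β x (l.length + k) := by
  induction k generalizing l r with
  | zero =>
    obtain ⟨x, hx, e, h⟩ := msum_pos β hl
    exact ⟨x, hx, h, e.symm⟩
  | succ k ih =>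
    have hs := msum_split β S f l
    have h₁ := msum_nonneg β hf (l ++ [false])
    have h₂ := msum_nonneg β hf (l ++ [true])
    have e : ∀ b : Bool, (l ++ [b]).length + k = l.length + (k + 1) := by intro b; simp; omega
    by_cases h : r < msum β S f (l ++ [false]) ∨ ¬ 0 < msum β S f (l ++ [true])
    · rw [pick_left h, ← e false]
      refine ih ?_ hr0 ?_ <;> rcases h with h | h <;> linarith
    · rw [pick_right h, ← e true]
      push Not at h
      exact ih h.2 (by linarith) (by linarith)

theorem measurable_pick (tot : List Bool → ℝ) (k : ℕ) (l l' : List Bool) :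
    MeasurableSet {r | pick tot k l r = l'} := by
  induction k generalizing l with
  | zero => simp [pick]
  | succ k ih =>
    have : {r | pick tot (k + 1) l r = l'} =
        ({r | r < tot (l ++ [false]) ∨ ¬ 0 < tot (l ++ [true])} ∩
          {r | pick tot k (l ++ [false]) r = l'}) ∪
        ({r | r < tot (l ++ [false]) ∨ ¬ 0 < tot (l ++ [true])}ᶜ ∩
          (fun r => r - tot (l ++ [false])) ⁻¹' {r | pick tot k (l ++ [true]) r = l'}) := by
      ext r
      by_cases h : r < tot (l ++ [false]) ∨ ¬ 0 < tot (l ++ [true])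
      · simp only [Set.mem_ofPred_eq, Set.mem_union, Set.mem_inter_iff, Set.mem_compl_iff,
          Set.mem_preimage, h, pick_left h, true_and, not_true_eq_false, false_and, or_false]
      · simp only [Set.mem_ofPred_eq, Set.mem_union, Set.mem_inter_iff, Set.mem_compl_iff,
          Set.mem_preimage, h, pick_right h, true_and, not_false_eq_true, false_and, false_or]
    rw [this]
    have hm : MeasurableSet {r : ℝ | r < tot (l ++ [false]) ∨ ¬ 0 < tot (l ++ [true])} :=
      measurableSet_Iio.union (MeasurableSet.const _)
    exact (hm.inter (ih _)).union (hm.compl.inter ((measurable_sub_const _) (ih _)))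

theorem measurable_comp_pick (tot : List Bool → ℝ) (k : ℕ) (l : List Bool) (g : List Bool → ℝ) :
    Measurable fun r => g (pick tot k l r) := by
  intro s _
  have : (fun r => g (pick tot k l r)) ⁻¹' s = ⋃ l' ∈ g ⁻¹' s, {r | pick tot k l r = l'} := by
    ext r; simp
  rw [this]
  exact MeasurableSet.biUnion (Set.to_countable _) fun l' _ => measurable_pick tot k l l'

theorem exists_bound_pick (tot : List Bool → ℝ) (k : ℕ) (l : List Bool) (g : List Bool → ℝ) :
    ∃ C, ∀ r, ‖g (pick tot k l r)‖ ≤ C := by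
  obtain ⟨C, hC⟩ := ((List.finite_length_eq Bool (l.length + k)).image
    fun l' => ‖g l'‖).bddAbove
  exact ⟨C, fun r => hC ⟨_, pick_length tot k l r, rfl⟩⟩

theorem intervalIntegrable_pick (tot : List Bool → ℝ) (k : ℕ) (l : List Bool)
    (g : List Bool → ℝ) (a b : ℝ) :
    IntervalIntegrable (fun r => g (pick tot k l r)) volume a b := by
  obtain ⟨C, hC⟩ := exists_bound_pick tot k l g
  exact (intervalIntegrable_const (c := C)).mono_fun
    (measurable_comp_pick tot k l g).aestronglyMeasurable
    (Filter.Eventually.of_forall fun r => (hC r).trans (le_abs_self C))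

/-- If `r` is uniformly distributed, then every element of `S` is selected with probability
proportional to its weight. -/
theorem integral_pick {S : Finset X} {f : X → ℝ} (hf : ∀ x ∈ S, 0 ≤ f x) (g : List Bool → ℝ)
    (k : ℕ) (l : List Bool) :
    ∫ r in (0 : ℝ)..msum β S f l, g (pick (msum β S f) k l r) =
      msum β S (fun x => f x * g (pre β x (l.length + k))) l := by
  induction k generalizing l with
  | zero =>
    simp only [pick, intervalIntegral.integral_const, sub_zero, smul_eq_mul, add_zero]
    unfold msum
    rw [Finset.sum_mul]
    refine Finset.sum_congr rfl fun x hx => ?_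
    simp only [(Finset.mem_filter.1 hx).2]
  | succ k ih =>
    have h₁ := msum_nonneg β hf (l ++ [false])
    have h₂ := msum_nonneg β hf (l ++ [true])
    have e : ∀ b : Bool, l.length + (k + 1) = (l ++ [b]).length + k := by intro b; simp; omega
    have e₁ : ∫ r in (0 : ℝ)..msum β S f (l ++ [false]), g (pick (msum β S f) (k + 1) l r) =
        msum β S (fun x => f x * g (pre β x (l.length + (k + 1)))) (l ++ [false]) := by
      rw [e false, ← ih]
      refine intervalIntegral.integral_congr_ae ?_
      -- At the right end of the interval the descent may already turn right; a single point does
      -- not affect the integral.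
      have : ∀ᵐ r : ℝ, r ≠ msum β S f (l ++ [false]) := by simp [ae_iff]
      filter_upwards [this] with r hr hmem
      rw [Set.uIoc_of_le h₁] at hmem
      rw [pick_left (Or.inl (lt_of_le_of_ne hmem.2 hr))]
    have e₂ : ∫ r in msum β S f (l ++ [false])..msum β S f l,
        g (pick (msum β S f) (k + 1) l r) =
        msum β S (fun x => f x * g (pre β x (l.length + (k + 1)))) (l ++ [true]) := by
      rw [msum_split β S f l]
      by_cases hpos : 0 < msum β S f (l ++ [true])
      · rw [e true, ← ih]
        -- On this interval the descent turns right, and the remaining number is `r` shifted by the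
        -- weight of the left child.
        have : ∫ r in msum β S f (l ++ [false])..msum β S f (l ++ [false]) +
            msum β S f (l ++ [true]), g (pick (msum β S f) (k + 1) l r) =
            ∫ r in msum β S f (l ++ [false])..msum β S f (l ++ [false]) +
            msum β S f (l ++ [true]),
              g (pick (msum β S f) k (l ++ [true]) (r - msum β S f (l ++ [false]))) := by
          refine intervalIntegral.integral_congr fun r hr => ?_
          rw [Set.uIcc_of_le (by linarith)] at hr
          rw [pick_right]
          push Not
          exact ⟨hr.1, hpos⟩
        rw [this, intervalIntegral.integral_comp_sub_right
          (fun r => g (pick (msum β S f) k (l ++ [true]) r))]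
        simp
      -- The interval degenerates, and all summands of the right child vanish because the weights
      -- are nonnegative.
      · have h0 : msum β S f (l ++ [true]) = 0 := le_antisymm (not_lt.1 hpos) h₂
        rw [h0, add_zero, intervalIntegral.integral_same]
        symm
        refine Finset.sum_eq_zero fun x hx => ?_
        have := (Finset.sum_eq_zero_iff_of_nonneg
          (fun x hx => hf x (Finset.mem_filter.1 hx).1)).1 h0 x hx
        rw [this, zero_mul]
    rw [msum_split β S (fun x => f x * g (pre β x (l.length + (k + 1)))) l, ← e₁, ← e₂,
      intervalIntegral.integral_add_adjacent_intervals] <;>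
    exact intervalIntegrable_pick _ _ _ _ _ _

/-- Selecting the elements of `S` by their rank enumerates `S`. -/
theorem sum_pick {S : Finset X} (g : List Bool → ℝ) (k : ℕ) (l : List Bool) :
    ∑ j ∈ Finset.range (cnt β S l), g (pick (msum β S fun _ => (1 : ℝ)) k l j) =
      msum β S (fun x => g (pre β x (l.length + k))) l := by
  induction k generalizing l with
  | zero =>
    simp only [pick, Finset.sum_const, Finset.card_range, add_zero]
    unfold msum cnt
    rw [← Finset.sum_const]
    refine Finset.sum_congr rfl fun x hx => ?_
    simp only [(Finset.mem_filter.1 hx).2]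
  | succ k ih =>
    have e : ∀ b : Bool, l.length + (k + 1) = (l ++ [b]).length + k := by intro b; simp; omega
    -- Ranks smaller than the size of the left child stay there; the other ranks are reduced by this
    -- size.
    rw [cnt_split, Finset.sum_range_add, msum_split β S _ l]
    congr 1
    · rw [e false, ← ih]
      refine Finset.sum_congr rfl fun j hj => ?_
      rw [pick_left]
      left
      rw [msum_one]
      exact_mod_cast Finset.mem_range.1 hj
    · rw [e true, ← ih]
      refine Finset.sum_congr rfl fun j hj => ?_
      rw [pick_right]
      · rw [msum_one]; push_cast; congr 2; ring
      · simp only [msum_one]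
        have := Finset.mem_range.1 hj
        push Not
        constructor
        · push_cast; linarith [(Nat.cast_nonneg j : (0 : ℝ) ≤ j)]
        · exact_mod_cast (by omega)

end Prefix

/-! ### Tree nodes in the memory -/

/-- The address of the tree node `l`; address `0` means that there is no such node. -/
def node (ch : ℕ → ℕ) (root : ℕ) (l : List Bool) : ℕ :=
  l.foldl (fun v b => ch (v + b.toNat)) root

theorem node_append (ch : ℕ → ℕ) (root : ℕ) (l : List Bool) (b : Bool) :
    node ch root (l ++ [b]) = ch (node ch root l + b.toNat) := by
  simp [node]

/-- The child pointers form a binary tree; its nodes occupy blocks of length `e` below `nx`. -/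
structure TreeOK (e : ℕ) (ch : ℕ → ℕ) (nx : ℕ) : Prop where
  two_le : 2 ≤ e
  null₀ : ch 0 = 0
  null₁ : ch 1 = 0
  fresh : ∀ a, nx ≤ a → ch a = 0
  lt : ∀ a, ch a < nx
  dvd : ∀ a, e ∣ ch a
  root_lt : ∀ a, ch a ≠ 0 → e < ch a
  inj : ∀ a a', ch a ≠ 0 → ch a = ch a' → a = a'
  dvd_nx : e ∣ nx
  root_lt_nx : e < nx

namespace TreeOK

variable {e nx : ℕ} {ch : ℕ → ℕ}

/-- Block 0 is reserved for missing nodes and the root occupies the block starting at `e`, so the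
first free address is `e + e`. -/
theorem init {e : ℕ} (he : 2 ≤ e) : TreeOK e (fun _ => 0) (e + e) where
  two_le := he
  null₀ := rfl
  null₁ := rfl
  fresh _ _ := rfl
  lt _ := by omega
  dvd _ := dvd_zero e
  root_lt _ h := absurd rfl h
  inj _ _ h := absurd rfl h
  dvd_nx := ⟨2, by ring⟩
  root_lt_nx := by omega

theorem node_dvd (h : TreeOK e ch nx) (l : List Bool) : e ∣ node ch e l := by
  induction l using List.reverseRecOn with
  | nil => exact dvd_rfl
  | append_singleton l b _ => rw [node_append]; exact h.dvd _

theorem node_lt (h : TreeOK e ch nx) (l : List Bool) : node ch e l < nx := by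
  induction l using List.reverseRecOn with
  | nil => exact h.root_lt_nx
  | append_singleton l b _ => rw [node_append]; exact h.lt _

theorem node_add_lt (h : TreeOK e ch nx) (l : List Bool) {i : ℕ} (hi : i < e) :
    node ch e l + i < nx := by
  obtain ⟨a, ha⟩ := h.node_dvd l
  obtain ⟨b, hb⟩ := h.dvd_nx
  have := h.node_lt l
  rw [ha, hb] at this ⊢
  have : a < b := lt_of_mul_lt_mul_left this (Nat.zero_le e)
  calc e * a + i < e * a + e := by omega
    _ = e * (a + 1) := by ring
    _ ≤ e * b := Nat.mul_le_mul_left e this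

/-- Addresses of nodes are multiples of `e`, hence blocks of length `e` do not overlap: the offset
is a remainder. -/
theorem node_add_inj (h : TreeOK e ch nx) {l l' : List Bool} {i i' : ℕ} (hi : i < e)
    (hi' : i' < e) (heq : node ch e l + i = node ch e l' + i') :
    node ch e l = node ch e l' ∧ i = i' := by
  obtain ⟨a, ha⟩ := h.node_dvd l
  obtain ⟨b, hb⟩ := h.node_dvd l'
  rw [ha, hb] at heq ⊢
  have h₁ := congrArg (· / e) heq
  have h0 : 0 < e := by omega
  simp only [Nat.mul_add_div h0, Nat.div_eq_of_lt hi, Nat.div_eq_of_lt hi', add_zero] at h₁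
  subst h₁
  exact ⟨rfl, by omega⟩

/-- Reading below a missing node stays at address 0, whose entries are all zero. This lets the
contents of the tree be specified for all bit strings, whether or not they have a node. -/
theorem node_null (h : TreeOK e ch nx) {l : List Bool} (hl : node ch e l = 0) (b : Bool) :
    node ch e (l ++ [b]) = 0 := by
  rw [node_append, hl]
  cases b
  · exact h.null₀
  · exact h.null₁

/-- Distinct cells hold distinct nonzero pointers, so the last pointer determines the parent and the
last bit; induct. The root is not confused with anything because every nonzero pointer exceeds `e`.
-/
theorem node_inj (h : TreeOK e ch nx) : ∀ {l l' : List Bool}, node ch e l ≠ 0 →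
    node ch e l = node ch e l' → l = l' := by
  intro l
  induction l using List.reverseRecOn with
  | nil =>
    intro l' h0 heq
    induction l' using List.reverseRecOn with
    | nil => rfl
    | append_singleton l' b _ =>
      rw [node_append] at heq
      have h1 := h.root_lt (node ch e l' + b.toNat) (by rw [← heq]; exact h0)
      rw [← heq] at h1
      exact absurd h1 (lt_irrefl _)
  | append_singleton l b ih =>
    intro l' h0 heq
    induction l' using List.reverseRecOn with
    | nil =>
      rw [node_append] at heq h0
      have h1 := h.root_lt _ h0
      rw [heq] at h1
      exact absurd h1 (lt_irrefl _)
    | append_singleton l' b' _ =>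
      have h0' := h0
      rw [node_append, node_append] at heq
      rw [node_append] at h0
      have hb : ∀ b : Bool, b.toNat < e := fun b => lt_of_lt_of_le b.toNat_lt h.two_le
      obtain ⟨h1, h2⟩ := h.node_add_inj (hb b) (hb b') (h.inj _ _ h0 heq)
      rw [ih (fun hc => h0' (h.node_null hc b)) h1]
      revert h2
      cases b <;> cases b' <;> simp

/-- Creating a child of an existing node. -/
theorem extend (h : TreeOK e ch nx) {l : List Bool} {b : Bool} (hl : node ch e l ≠ 0) :
    TreeOK e (Function.update ch (node ch e l + b.toNat) nx) (nx + e) where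
  two_le := h.two_le
  null₀ := by
    rw [Function.update_of_ne, h.null₀]
    omega
  null₁ := by
    rw [Function.update_of_ne, h.null₁]
    have := Nat.le_of_dvd (Nat.pos_of_ne_zero hl) (h.node_dvd l)
    have := h.two_le
    omega
  fresh a ha := by
    rw [Function.update_of_ne, h.fresh a (by omega)]
    have := h.node_add_lt l (lt_of_lt_of_le b.toNat_lt h.two_le)
    omega
  lt a := by
    have := h.two_le
    by_cases ha : a = node ch e l + b.toNat
    · subst ha; rw [Function.update_self]; omega
    · rw [Function.update_of_ne ha]; have := h.lt a; omega
  dvd a := by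
    by_cases ha : a = node ch e l + b.toNat
    · subst ha; rw [Function.update_self]; exact h.dvd_nx
    · rw [Function.update_of_ne ha]; exact h.dvd a
  root_lt a := by
    by_cases ha : a = node ch e l + b.toNat
    · subst ha; rw [Function.update_self]; exact fun _ => h.root_lt_nx
    · rw [Function.update_of_ne ha]; exact h.root_lt a
  inj a a' := by
    by_cases ha : a = node ch e l + b.toNat <;> by_cases ha' : a' = node ch e l + b.toNat
    · intros; rw [ha, ha']
    · subst ha; rw [Function.update_self, Function.update_of_ne ha']
      intro _ h1; have := h.lt a'; omega
    · subst ha'; rw [Function.update_self, Function.update_of_ne ha]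
      intro _ h1; have := h.lt a; omega
    · rw [Function.update_of_ne ha, Function.update_of_ne ha']; exact h.inj a a'
  dvd_nx := (Nat.dvd_add_right h.dvd_nx).2 dvd_rfl
  root_lt_nx := by have := h.root_lt_nx; omega

/-- Old nodes keep their address when a child of an existing node is created; new ones get
addresses outside the range used so far. -/
theorem node_extend (h : TreeOK e ch nx) {l : List Bool} {b : Bool}
    (hb : ch (node ch e l + b.toNat) = 0) (l' : List Bool) :
    node (Function.update ch (node ch e l + b.toNat) nx) e l' = node ch e l' ∨
      node ch e l' = 0 ∧ nx ≤ node (Function.update ch (node ch e l + b.toNat) nx) e l' := by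
  have hlt := h.node_add_lt l (lt_of_lt_of_le b.toNat_lt h.two_le)
  induction l' using List.reverseRecOn with
  | nil => exact Or.inl rfl
  | append_singleton l' b' ih =>
    rw [node_append, node_append]
    rcases ih with ih | ⟨ih₁, ih₂⟩
    · rw [ih]
      by_cases ha : node ch e l' + b'.toNat = node ch e l + b.toNat
      · rw [ha, Function.update_self]
        exact Or.inr ⟨hb, le_rfl⟩
      · rw [Function.update_of_ne ha]
        exact Or.inl rfl
    -- The prefix is the node just created. Its block is unused, so its children are missing, as
    -- they were before.
    · left
      rw [Function.update_of_ne (by omega), h.fresh (_ + _) (by omega), ← node_append ch e,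
        h.node_null ih₁]

end TreeOK

/-! ### Random cuts -/

/-- The half-open interval splits evenly under doubling, which the binary descent needs; the end
point 1 is a null set. -/
theorem volume_unitInterval_eq (P : ℝ → Prop) :
    volume {u : unitInterval | P u} = volume (Set.Ico (0 : ℝ) 1 ∩ {u | P u}) := by
  rw [unitInterval.volume_apply]
  have : (Subtype.val '' {u : unitInterval | P u}) = Set.Icc (0 : ℝ) 1 ∩ {u | P u} := by
    ext u
    constructor
    · rintro ⟨v, hv, rfl⟩
      exact ⟨v.2, hv⟩
    · rintro ⟨h₁, h₂⟩
      exact ⟨⟨u, h₁⟩, h₂, rfl⟩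
  rw [this]
  exact measure_congr (Ico_ae_eq_Icc.symm.inter (ae_eq_refl _))

/-- Descending `j` levels in a heap from the node `v`, guided by the binary digits of `u`;
returns the node that is reached and the remaining fractional part. -/
noncomputable def desc : ℕ → ℕ → ℝ → ℕ × ℝ
  | 0, v, u => (v, u)
  | j + 1, v, u => if u + u < 1 then desc j (v + v) (u + u) else desc j (v + v + 1) (u + u - 1)

/-- The coordinates of a point, padded by zeros. -/
noncomputable def coord {d : ℕ} (x : Pt d) (i : ℕ) : ℝ := if h : i < d then x ⟨i, h⟩ else 0

/-- The side of a random cut on which a vector lies. -/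
def heapBit (U : ℝ) (o : ℕ) (X : ℕ → ℝ) (j v : ℕ) (u : ℝ) : Prop :=
  U * (desc j v u).2 < X ((desc j v u).1 - o)

theorem heapBit_left {u : ℝ} (h : u + u < 1) (U : ℝ) (o : ℕ) (X : ℕ → ℝ) (j v : ℕ) :
    heapBit U o X (j + 1) v u = heapBit U o X j (v + v) (u + u) := by
  simp only [heapBit, desc, if_pos h]

theorem heapBit_right {u : ℝ} (h : ¬ u + u < 1) (U : ℝ) (o : ℕ) (X : ℕ → ℝ) (j v : ℕ) :
    heapBit U o X (j + 1) v u = heapBit U o X j (v + v + 1) (u + u - 1) := by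
  simp only [heapBit, desc, if_neg h]

theorem measurableSet_heapBit (U : ℝ) (o : ℕ) (X : ℕ → ℝ) (j v : ℕ) :
    MeasurableSet {u | heapBit U o X j v u} := by
  induction j generalizing v with
  | zero =>
    simp only [heapBit, desc]
    exact measurableSet_lt (by fun_prop) (by fun_prop)
  | succ j ih =>
    have : {u | heapBit U o X (j + 1) v u} =
        ({u : ℝ | u + u < 1} ∩ (fun u => u + u) ⁻¹' {u | heapBit U o X j (v + v) u}) ∪
        ({u : ℝ | u + u < 1}ᶜ ∩
          (fun u => u + u - 1) ⁻¹' {u | heapBit U o X j (v + v + 1) u}) := by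
      ext u
      by_cases h : u + u < 1
      · simp only [heapBit, desc, h, Set.mem_ofPred_eq, Set.mem_union, Set.mem_inter_iff,
          Set.mem_compl_iff, Set.mem_preimage, if_true, true_and, not_true_eq_false, false_and,
          or_false]
      · simp only [heapBit, desc, h, Set.mem_ofPred_eq, Set.mem_union, Set.mem_inter_iff,
          Set.mem_compl_iff, Set.mem_preimage, if_false, true_and, not_false_eq_true, false_and,
          false_or]
    rw [this]
    have hm : MeasurableSet {u : ℝ | u + u < 1} :=
      measurableSet_lt (by fun_prop) (by fun_prop)
    exact (hm.inter ((by fun_prop : Measurable fun u : ℝ => u + u) (ih _))).union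
      (hm.compl.inter ((by fun_prop : Measurable fun u : ℝ => u + u - 1) (ih _)))

/-- The probability that a random cut separates two vectors. -/
noncomputable def heapSep (U : ℝ) (o : ℕ) (X Y : ℕ → ℝ) : ℕ → ℕ → ℝ
  | 0, v => |X (v - o) - Y (v - o)| / U
  | j + 1, v => (heapSep U o X Y j (v + v) + heapSep U o X Y j (v + v + 1)) / 2

theorem heapSep_nonneg {U : ℝ} (hU : 0 < U) (o : ℕ) (X Y : ℕ → ℝ) (j v : ℕ) :
    0 ≤ heapSep U o X Y j v := by
  induction j generalizing v with
  | zero => unfold heapSep; positivity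
  | succ j ih => unfold heapSep; linarith [ih (v + v), ih (v + v + 1)]

/-- The threshold `U * u` is uniform, and it separates the two numbers exactly when it lies between
them. -/
theorem volume_heapSep_zero {U X Y : ℝ} (hU : 0 < U) (hX : 0 ≤ X ∧ X ≤ U) (hY : 0 ≤ Y ∧ Y ≤ U) :
    volume (Set.Ico (0 : ℝ) 1 ∩ {u | ¬ (U * u < X ↔ U * u < Y)}) =
      ENNReal.ofReal (|X - Y| / U) := by
  wlog h : X ≤ Y generalizing X Y
  · rw [abs_sub_comm, ← this hY hX (by linarith)]
    congr 2
    ext u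
    simp only [Set.mem_ofPred_eq]
    tauto
  have : Set.Ico (0 : ℝ) 1 ∩ {u | ¬ (U * u < X ↔ U * u < Y)} = Set.Ico (X / U) (Y / U) := by
    ext u
    simp only [Set.mem_inter_iff, Set.mem_Ico, Set.mem_ofPred_eq]
    rw [div_le_iff₀ hU, lt_div_iff₀ hU]
    constructor
    · rintro ⟨_, h'⟩
      rw [mul_comm u U]
      by_cases h1 : U * u < X
      · exact absurd ⟨fun _ => h1.trans_le h, fun _ => h1⟩ h'
      · refine ⟨not_lt.1 h1, ?_⟩
        by_contra h2
        exact h' ⟨fun h3 => absurd h3 h1, fun h3 => absurd h3 h2⟩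
    · rintro ⟨h1, h2⟩
      rw [mul_comm u U] at h1 h2
      refine ⟨⟨?_, ?_⟩, fun h' => absurd (h'.2 h2) (not_lt.2 h1)⟩
      · by_contra hc
        push Not at hc
        nlinarith
      · by_contra hc
        push Not at hc
        nlinarith
  rw [this, Real.volume_Ico, abs_sub_comm, abs_of_nonneg (by linarith), sub_div]

/-- The leading binary digit of `u` chooses a child with probability one half each, and the
remaining digits are again uniform. Geometrically, the set consists of two copies of the sets for
the children, each shrunk by the factor two. -/
theorem volume_heapSep {U : ℝ} (hU : 0 < U) (o : ℕ) {X Y : ℕ → ℝ} (hX : ∀ i, 0 ≤ X i ∧ X i ≤ U)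
    (hY : ∀ i, 0 ≤ Y i ∧ Y i ≤ U) (j v : ℕ) :
    volume (Set.Ico (0 : ℝ) 1 ∩ {u | ¬ (heapBit U o X j v u ↔ heapBit U o Y j v u)}) =
      ENNReal.ofReal (heapSep U o X Y j v) := by
  induction j generalizing v with
  | zero =>
    simp only [heapBit, desc, heapSep]
    exact volume_heapSep_zero hU (hX _) (hY _)
  | succ j ih =>
    set S : ℕ → Set ℝ := fun v =>
      Set.Ico (0 : ℝ) 1 ∩ {u | ¬ (heapBit U o X j v u ↔ heapBit U o Y j v u)} with hS
    have hmeas : ∀ v, MeasurableSet (S v) := by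
      intro v
      refine measurableSet_Ico.inter ?_
      have h₁ := measurableSet_heapBit U o X j v
      have h₂ := measurableSet_heapBit U o Y j v
      have : {u | ¬ (heapBit U o X j v u ↔ heapBit U o Y j v u)} =
          symmDiff {u | heapBit U o X j v u} {u | heapBit U o Y j v u} := by
        ext u
        simp only [Set.mem_ofPred_eq, Set.mem_symmDiff]
        tauto
      rw [this]
      exact h₁.symmDiff h₂
    have : Set.Ico (0 : ℝ) 1 ∩ {u | ¬ (heapBit U o X (j + 1) v u ↔ heapBit U o Y (j + 1) v u)} =
        ((fun u => 2 * u) ⁻¹' S (v + v)) ∪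
          ((fun u => 2 * u) ⁻¹' ((fun u => u + (-1)) ⁻¹' S (v + v + 1))) := by
      ext u
      rw [Set.mem_union, Set.mem_inter_iff, Set.mem_preimage, Set.mem_preimage, Set.mem_preimage]
      simp only [hS, Set.mem_inter_iff, Set.mem_ofPred_eq, Set.mem_Ico, two_mul,
        ← sub_eq_add_neg]
      by_cases h : u + u < 1
      · rw [heapBit_left h, heapBit_left h]
        constructor
        · rintro ⟨⟨h1, h2⟩, h3⟩
          exact Or.inl ⟨⟨by linarith, by linarith⟩, h3⟩
        · rintro (⟨⟨h1, h2⟩, h3⟩ | ⟨⟨h1, h2⟩, h3⟩)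
          · exact ⟨⟨by linarith, by linarith⟩, h3⟩
          · linarith
      · rw [heapBit_right h, heapBit_right h]
        constructor
        · rintro ⟨⟨h1, h2⟩, h3⟩
          exact Or.inr ⟨⟨by linarith, by linarith⟩, h3⟩
        · rintro (⟨⟨h1, h2⟩, h3⟩ | ⟨⟨h1, h2⟩, h3⟩)
          · linarith
          · exact ⟨⟨by linarith, by linarith⟩, h3⟩
    have hm2 : Measurable fun u : ℝ => 2 * u := by fun_prop
    have hm1 : Measurable fun u : ℝ => u + (-1) := by fun_prop
    rw [this, measure_union _ (hm2 (hm1 (hmeas _))), Real.volume_preimage_mul_left two_ne_zero,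
      Real.volume_preimage_mul_left two_ne_zero, measure_preimage_add_right, ih, ih,
      ← ENNReal.ofReal_mul (abs_nonneg _), ← ENNReal.ofReal_mul (abs_nonneg _),
      ← ENNReal.ofReal_add]
    · congr 1
      rw [heapSep, abs_of_pos (by norm_num)]
      ring
    · exact mul_nonneg (abs_nonneg _) (heapSep_nonneg hU _ _ _ _ _)
    · exact mul_nonneg (abs_nonneg _) (heapSep_nonneg hU _ _ _ _ _)
    · rw [Set.disjoint_left]
      rintro u ⟨⟨_, h1⟩, _⟩ ⟨⟨h2, _⟩, _⟩
      simp only at h1 h2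
      linarith

theorem sum_Ico_double (f : ℕ → ℝ) (a b : ℕ) (h : a ≤ b) :
    ∑ v ∈ Finset.Ico (a + a) (b + b), f v =
      ∑ v ∈ Finset.Ico a b, (f (v + v) + f (v + v + 1)) := by
  induction b, h using Nat.le_induction with
  | base => simp
  | succ b hb ih =>
    rw [Finset.sum_Ico_succ_top hb, ← ih, show b + 1 + (b + 1) = (b + b + 1) + 1 by ring,
      Finset.sum_Ico_succ_top (by omega), Finset.sum_Ico_succ_top (by omega)]
    ring

/-- The children of the heap nodes in `[a, b)` are exactly the nodes in `[2a, 2b)`. After `j` levels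
of averaging, every descendant occurs once, with the factor `2 ^ (-j)`. -/
theorem sum_heapSep (U : ℝ) (o : ℕ) (X Y : ℕ → ℝ) (j a b : ℕ) (h : a ≤ b) :
    ∑ v ∈ Finset.Ico a b, heapSep U o X Y j v =
      (∑ v ∈ Finset.Ico (2 ^ j * a) (2 ^ j * b), |X (v - o) - Y (v - o)| / U) / 2 ^ j := by
  induction j generalizing a b with
  | zero => simp [heapSep]
  | succ j ih =>
    simp only [heapSep]
    rw [← Finset.sum_div, ← sum_Ico_double _ _ _ h, ih _ _ (by omega)]
    rw [show 2 ^ j * (a + a) = 2 ^ (j + 1) * a by ring,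
      show 2 ^ j * (b + b) = 2 ^ (j + 1) * b by ring, div_div, ← pow_succ]

/-! ### Random grids -/

theorem intervalIntegrable_fract (t c a b : ℝ) :
    IntervalIntegrable (fun u => Int.fract (t + c * u)) volume a b := by
  refine (intervalIntegrable_const (c := (1 : ℝ))).mono_fun
    (Measurable.aestronglyMeasurable (by fun_prop)) (Filter.Eventually.of_forall fun r => ?_)
  change |Int.fract (t + c * r)| ≤ |(1 : ℝ)|
  rw [abs_one, abs_of_nonneg (Int.fract_nonneg (t + c * r))]
  exact (Int.fract_lt_one _).le

/-- Since `M` is an integer, the argument runs through whole periods of the fractional part,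
wherever it starts. -/
theorem integral_fract_mul (t : ℝ) {M : ℕ} (hM : 0 < M) :
    ∫ u in (0 : ℝ)..1, Int.fract (t + M * u) = ∫ u in (0 : ℝ)..1, Int.fract u := by
  have hM' : (M : ℝ) ≠ 0 := by positivity
  have h := Int.fract_periodic ℝ
  rw [intervalIntegral.integral_comp_add_mul (fun u => Int.fract u) hM' t]
  simp only [mul_zero, add_zero, mul_one, smul_eq_mul]
  have := h.intervalIntegral_add_zsmul_eq (M : ℤ) t
  simp only [zsmul_eq_mul, Int.cast_natCast, mul_one] at this
  rw [this fun a b => by simpa using intervalIntegrable_fract 0 1 a b]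
  have h2 := h.intervalIntegral_add_eq t 0
  rw [zero_add] at h2
  rw [h2]
  field_simp

/-- The fractional parts of the two shifted numbers have the same mean, so the floors differ on
average exactly as the numbers do. -/
theorem integral_floor_sub (t t' : ℝ) {M : ℕ} (hM : 0 < M) :
    ∫ u in (0 : ℝ)..1, ((⌊t' + M * u⌋ : ℝ) - ⌊t + M * u⌋) = t' - t := by
  have : ∀ u : ℝ, ((⌊t' + M * u⌋ : ℝ) - ⌊t + M * u⌋) =
      (t' - t) - (Int.fract (t' + M * u) - Int.fract (t + M * u)) := by
    intro u
    rw [← Int.self_sub_fract, ← Int.self_sub_fract]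
    ring
  simp_rw [this]
  rw [intervalIntegral.integral_sub (by simp)
    ((intervalIntegrable_fract _ _ _ _).sub (intervalIntegrable_fract _ _ _ _)),
    intervalIntegral.integral_sub (intervalIntegrable_fract _ _ _ _)
    (intervalIntegrable_fract _ _ _ _), integral_fract_mul _ hM, integral_fract_mul _ hM]
  simp

/-- The probability that a randomly shifted grid separates two numbers. -/
theorem volume_floor_ne (t t' : ℝ) {M : ℕ} (hM : 0 < M) :
    volume (Set.Ico (0 : ℝ) 1 ∩ {u | ⌊t + M * u⌋ ≠ ⌊t' + M * u⌋}) =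
      ENNReal.ofReal (min 1 |t - t'|) := by
  wlog h : t ≤ t' generalizing t t'
  · rw [abs_sub_comm, ← this t' t (by linarith)]
    simp only [ne_comm]
  rw [abs_sub_comm, abs_of_nonneg (by linarith)]
  have hmono : ∀ u : ℝ, ⌊t + M * u⌋ ≤ ⌊t' + M * u⌋ := fun u => Int.floor_mono (by linarith)
  -- At distance at least one, the two numbers never share a cell. At smaller distance their floors
  -- differ by 0 or 1, so the difference of the floors is the indicator of separation and its
  -- integral is the probability.
  rcases le_total 1 (t' - t) with h1 | h1
  · rw [min_eq_left h1]
    have : Set.Ico (0 : ℝ) 1 ∩ {u | ⌊t + M * u⌋ ≠ ⌊t' + M * u⌋} = Set.Ico (0 : ℝ) 1 := by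
      refine Set.inter_eq_left.2 fun u _ => ne_of_lt ?_
      have : ⌊t + M * u⌋ + 1 ≤ ⌊t' + M * u⌋ := by
        rw [← Int.floor_add_one]
        exact Int.floor_mono (by linarith)
      omega
    rw [this]
    simp
  · rw [min_eq_right h1, ← integral_floor_sub t t' hM]
    set S := {u : ℝ | ⌊t + M * u⌋ ≠ ⌊t' + M * u⌋} with hS
    have hmeas : MeasurableSet S :=
      (measurableSet_eq_fun (by fun_prop) (by fun_prop)).compl
    have hind : ∀ u : ℝ, ((⌊t' + M * u⌋ : ℝ) - ⌊t + M * u⌋) = S.indicator 1 u := by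
      intro u
      by_cases hu : u ∈ S
      · rw [Set.indicator_of_mem hu]
        have h2 : ⌊t' + M * u⌋ ≤ ⌊t + M * u⌋ + 1 := by
          rw [← Int.floor_add_one]
          exact Int.floor_mono (by linarith)
        have h3 : ⌊t + M * u⌋ ≠ ⌊t' + M * u⌋ := hu
        have h4 : ⌊t' + M * u⌋ = ⌊t + M * u⌋ + 1 := by
          have := hmono u
          omega
        rw [h4]; push_cast; simp
      · rw [Set.indicator_of_notMem hu]
        have h3 : ⌊t + M * u⌋ = ⌊t' + M * u⌋ := by
          by_contra hc; exact hu hc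
        rw [h3, sub_self]
    simp_rw [hind]
    rw [intervalIntegral.integral_of_le zero_le_one, integral_indicator_one hmeas,
      measureReal_restrict_apply hmeas, measureReal_def, ENNReal.ofReal_toReal]
    · rw [Set.inter_comm]
      exact measure_congr ((ae_eq_refl _).inter Ico_ae_eq_Ioc)
    · exact ne_top_of_le_ne_top (by simp) (measure_mono (Set.inter_subset_right (s := S)
        (t := Set.Ioc (0 : ℝ) 1)))

/-! ### Families of independent cuts -/

/-- The law of the random numbers. -/
noncomputable abbrev coinLaw : Measure (ℕ → unitInterval) :=
  Measure.infinitePi fun _ : ℕ => (volume : Measure unitInterval)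

/-- Union bound. Allowing a truncated probability `min 1 p` covers the grids, where the untruncated
values are the ones that sum up nicely. -/
theorem coinLaw_exists_le (I : Finset ℕ) (S : ℕ → Set unitInterval) (p : ℕ → ℝ)
    (hp : ∀ m ∈ I, 0 ≤ p m) (hS : ∀ m ∈ I, MeasurableSet (S m))
    (hv : ∀ m ∈ I, volume (S m) = ENNReal.ofReal (min 1 (p m))) :
    coinLaw {ω | ∃ m ∈ I, ω m ∈ S m} ≤ ENNReal.ofReal (∑ m ∈ I, p m) := by
  have : {ω : ℕ → unitInterval | ∃ m ∈ I, ω m ∈ S m} = ⋃ m ∈ I, (fun ω => ω m) ⁻¹' S m := by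
    ext ω; simp
  rw [this, ENNReal.ofReal_sum_of_nonneg hp]
  refine (measure_biUnion_finset_le _ _).trans (Finset.sum_le_sum fun m hm => ?_)
  rw [(measurePreserving_eval_infinitePi _ m).measure_preimage (hS m hm).nullMeasurableSet,
    hv m hm]
  exact ENNReal.ofReal_le_ofReal (min_le_right _ _)

/-- The events refer to different random numbers, so the probability is a product, and `1 - min 1 p
≤ exp (-p)` holds for each factor; truncation does no harm here either. -/
theorem coinLaw_forall_le (I : Finset ℕ) (S : ℕ → Set unitInterval) (p : ℕ → ℝ)
    (hp : ∀ m ∈ I, 0 ≤ p m) (hS : ∀ m ∈ I, MeasurableSet (S m))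
    (hv : ∀ m ∈ I, volume (S m) = ENNReal.ofReal (min 1 (p m))) :
    coinLaw {ω | ∀ m ∈ I, ω m ∉ S m} ≤ ENNReal.ofReal (Real.exp (- ∑ m ∈ I, p m)) := by
  have : {ω : ℕ → unitInterval | ∀ m ∈ I, ω m ∉ S m} = Set.pi I fun m => (S m)ᶜ := by
    ext ω; simp
  rw [this, Measure.infinitePi_pi _ fun m hm => (hS m hm).compl, ← Finset.sum_neg_distrib,
    Real.exp_sum, ENNReal.ofReal_prod_of_nonneg fun _ _ => (Real.exp_pos _).le]
  refine Finset.prod_le_prod' fun m hm => ?_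
  rw [measure_compl (hS m hm) (measure_ne_top _ _), measure_univ, hv m hm,
    ← ENNReal.ofReal_one, ← ENNReal.ofReal_sub _ (le_min zero_le_one (hp m hm))]
  refine ENNReal.ofReal_le_ofReal ?_
  rcases le_total 1 (p m) with h | h
  · rw [min_eq_left h, sub_self]
    exact (Real.exp_pos _).le
  · rw [min_eq_right h]
    linarith [Real.add_one_le_exp (- p m)]

/-! ### The bit strings of the points -/

/-- The cell of a grid of side `2 ^ e`, shifted by `2 ^ k * u`, that contains `X`. -/
noncomputable def gridCell (k : ℕ) (X : ℝ) (e : ℕ) (u : ℝ) : ℕ := ⌊(X - 1 + 2 ^ k * u) / 2 ^ e⌋₊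

/-- The length of the bit strings. -/
def depth (d k J : ℕ) : ℕ := 2 ^ J + d * (k + 1)

/-- The binary logarithm of the scale to which the bit number `p` belongs. -/
def scaleExp (d k J p : ℕ) : ℕ := if p < 2 ^ J then J + k - Nat.log 2 p else k - (p - 2 ^ J) / d

/-- The weight of the points that are separated from the other set at the bit number `p`. -/
noncomputable def bitWeight (d k J p : ℕ) : ℝ := if p = 0 then 0 else 2 ^ (scaleExp d k J p + 1)

/-- The bit number `p` of the point `x`. -/
def rawBit {d : ℕ} (k J : ℕ) (z : ℕ → unitInterval) (x : Pt d) (p : ℕ) : Prop :=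
  p ≠ 0 ∧ if p < 2 ^ J then heapBit (2 ^ k) (2 ^ J) (coord x) (J - Nat.log 2 p) p (z p)
    else gridCell k (coord x ((p - 2 ^ J) % d)) (k - (p - 2 ^ J) / d)
      (z (2 ^ J + (p - 2 ^ J) % d)) % 2 = 1

open Classical in
/-- The bit string of a point of the grid, continued by zeros. -/
noncomputable def bits {d : ℕ} (k J : ℕ) (z : ℕ → unitInterval) (x : Pt d) (p : ℕ) : Bool :=
  decide (x ∈ grid d (2 ^ k) ∧ p < depth d k J ∧ rawBit k J z x p)

/-- The random numbers that determine the bits of the scale `2 ^ e`. -/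
def scaleIdx (d k J e : ℕ) : Finset ℕ :=
  if k < e then Finset.Ico (2 ^ (J + k - e)) (2 ^ (J + k - e + 1)) else Finset.Ico (2 ^ J) (2 ^ J + d)

/-- The values of the `m`-th random number that separate two points at the scale `2 ^ e`. -/
def sepSet {d : ℕ} (k J : ℕ) (x y : Pt d) (e m : ℕ) : Set unitInterval :=
  if k < e then
    {u | ¬ (heapBit (2 ^ k) (2 ^ J) (coord x) (e - k) m u ↔
      heapBit (2 ^ k) (2 ^ J) (coord y) (e - k) m u)}
  else {u | gridCell k (coord x (m - 2 ^ J)) e u ≠ gridCell k (coord y (m - 2 ^ J)) e u}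

/-- The points are separated at the scale `2 ^ e`. -/
def Separated {d : ℕ} (k J : ℕ) (x y : Pt d) (e : ℕ) (z : ℕ → unitInterval) : Prop :=
  ∃ m ∈ scaleIdx d k J e, z m ∈ sepSet k J x y e m

/-! ### Separation of grid points at a given scale -/

section Geometry

variable {d k J : ℕ}

theorem coord_nonneg_le {x : Pt d} (hx : x ∈ grid d (2 ^ k)) (i : ℕ) :
    0 ≤ coord x i ∧ coord x i ≤ 2 ^ k := by
  unfold coord
  split_ifs with h
  · obtain ⟨m, h1, h2, h3⟩ := hx ⟨i, h⟩
    rw [h3]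
    exact ⟨Nat.cast_nonneg _, by exact_mod_cast h2⟩
  · exact ⟨le_rfl, by positivity⟩

theorem one_le_coord {x : Pt d} (hx : x ∈ grid d (2 ^ k)) {i : ℕ} (hi : i < d) :
    1 ≤ coord x i := by
  unfold coord
  rw [dif_pos hi]
  obtain ⟨m, h1, h2, h3⟩ := hx ⟨i, hi⟩
  rw [h3]
  exact_mod_cast h1

theorem coord_eq_natCast {x : Pt d} (hx : x ∈ grid d (2 ^ k)) (i : ℕ) :
    ∃ m : ℕ, coord x i = m := by
  unfold coord
  split_ifs with h
  · obtain ⟨m, h1, h2, h3⟩ := hx ⟨i, h⟩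
    exact ⟨m, h3⟩
  · exact ⟨0, by simp⟩

theorem l1_eq_sum_coord (x y : Pt d) :
    l1 x y = ∑ i ∈ Finset.range d, |coord x i - coord y i| := by
  rw [l1, Finset.sum_range]
  simp [coord]

theorem l1_nonneg (x y : Pt d) : 0 ≤ l1 x y := Finset.sum_nonneg fun _ _ => abs_nonneg _

theorem l1_eq_zero {x y : Pt d} : l1 x y = 0 ↔ x = y := by
  rw [l1, Finset.sum_eq_zero_iff_of_nonneg fun _ _ => abs_nonneg _]
  constructor
  · intro h
    ext i
    exact sub_eq_zero.1 (abs_eq_zero.1 (h i (Finset.mem_univ i)))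
  · rintro rfl
    simp

theorem one_le_l1 {x y : Pt d} (hx : x ∈ grid d (2 ^ k)) (hy : y ∈ grid d (2 ^ k)) (h : x ≠ y) :
    1 ≤ l1 x y := by
  obtain ⟨i, hi⟩ := Function.ne_iff.1 h
  refine le_trans ?_ (Finset.single_le_sum (fun i _ => abs_nonneg (x i - y i))
    (Finset.mem_univ i))
  obtain ⟨m, _, _, hm⟩ := hx i
  obtain ⟨m', _, _, hm'⟩ := hy i
  rw [hm, hm'] at hi ⊢
  have h1 : (m : ℤ) - m' ≠ 0 := by
    intro h; apply hi; have : (m : ℤ) = m' := by omega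
    exact_mod_cast this
  have : (1 : ℤ) ≤ |(m : ℤ) - m'| := Int.one_le_abs h1
  exact_mod_cast this

/-- The coarsest scale exceeds every distance, so there is no need for cuts beyond it. -/
theorem l1_le {x y : Pt d} (hx : x ∈ grid d (2 ^ k)) (hy : y ∈ grid d (2 ^ k)) (hJ : d ≤ 2 ^ J) :
    l1 x y ≤ 2 ^ (J + k) := by
  rw [l1_eq_sum_coord]
  calc ∑ i ∈ Finset.range d, |coord x i - coord y i| ≤ ∑ i ∈ Finset.range d, (2 : ℝ) ^ k := by
        refine Finset.sum_le_sum fun i _ => abs_le.2 ?_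
        have h1 := coord_nonneg_le hx i
        have h2 := coord_nonneg_le hy i
        constructor <;> linarith
    _ = d * 2 ^ k := by simp
    _ ≤ 2 ^ J * 2 ^ k := by
        gcongr
        exact_mod_cast hJ
    _ = 2 ^ (J + k) := by rw [pow_add]

theorem gridCell_eq_floor {X u : ℝ} (hX : 1 ≤ X) (hu : 0 ≤ u) (e : ℕ) :
    (gridCell k X e u : ℤ) = ⌊(X - 1 + 2 ^ k * u) / 2 ^ e⌋ := by
  unfold gridCell
  refine Int.natCast_floor_eq_floor (div_nonneg ?_ (by positivity))
  have : 0 ≤ 2 ^ k * u := by positivity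
  linarith

theorem measurable_gridCell (X : ℝ) (e : ℕ) : Measurable (gridCell k X e) := by
  unfold gridCell
  exact Nat.measurable_floor.comp (by fun_prop)

/-- The grids of all scales use the same shift and are therefore nested: the parities of the cell
numbers are the binary digits of the finest one. -/
theorem gridCell_succ (X : ℝ) (e : ℕ) (u : ℝ) :
    gridCell k X (e + 1) u = gridCell k X e u / 2 := by
  unfold gridCell
  rw [pow_succ, ← div_div]
  exact_mod_cast Nat.floor_div_natCast ((X - 1 + 2 ^ k * u) / 2 ^ e) 2

/-- Coordinate and shift are at most `2 ^ k`, so one level above the coarsest grid all points share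
the cell 0. From there the digits determine all cells. -/
theorem gridCell_top {X u : ℝ} (hX : X ≤ 2 ^ k) (hu : u ≤ 1) :
    gridCell k X (k + 1) u = 0 := by
  unfold gridCell
  rw [Nat.floor_eq_zero, div_lt_one (by positivity), pow_succ]
  have : 2 ^ k * u ≤ 2 ^ k := mul_le_of_le_one_right (by positivity) hu
  linarith

/-- Measured in units of the side `2 ^ e`, the shift is `2 ^ (k - e) * u`, a whole number of
periods. One shift of amplitude `2 ^ k` is thus uniform modulo every grid with `e ≤ k` at once. -/
theorem volume_gridCell {X Y : ℝ} (hX : 1 ≤ X) (hY : 1 ≤ Y) {e : ℕ} (he : e ≤ k) :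
    volume {u : unitInterval | gridCell k X e u ≠ gridCell k Y e u} =
      ENNReal.ofReal (min 1 (|X - Y| / 2 ^ e)) := by
  rw [volume_unitInterval_eq fun u => gridCell k X e u ≠ gridCell k Y e u]
  have h := volume_floor_ne ((X - 1) / 2 ^ e) ((Y - 1) / 2 ^ e) (M := 2 ^ (k - e)) (by positivity)
  have e1 : |(X - 1) / 2 ^ e - (Y - 1) / 2 ^ e| = |X - Y| / 2 ^ e := by
    rw [← sub_div, abs_div, abs_of_pos (by positivity : (0 : ℝ) < 2 ^ e)]
    congr 2
    ring
  rw [e1] at h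
  rw [← h]
  congr 1
  ext u
  have e2 : ∀ Z : ℝ, (Z - 1) / 2 ^ e + ((2 ^ (k - e) : ℕ) : ℝ) * u =
      (Z - 1 + 2 ^ k * u) / 2 ^ e := by
    intro Z
    have : (2 : ℝ) ^ k = 2 ^ (k - e) * 2 ^ e := by rw [← pow_add]; congr 1; omega
    rw [this]
    push_cast
    field_simp
  simp only [Set.mem_inter_iff, Set.mem_Ico, Set.mem_ofPred_eq, e2]
  refine and_congr_right fun hu => ?_
  rw [← gridCell_eq_floor hX hu.1, ← gridCell_eq_floor hY hu.1]
  norm_cast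

/-- The probability that the `m`-th random number separates two points at the scale `2 ^ e`. -/
noncomputable def sepProb (k J : ℕ) (x y : Pt d) (e m : ℕ) : ℝ :=
  if k < e then heapSep (2 ^ k) (2 ^ J) (coord x) (coord y) (e - k) m
  else |coord x (m - 2 ^ J) - coord y (m - 2 ^ J)| / 2 ^ e

theorem sepProb_nonneg (x y : Pt d) (e m : ℕ) : 0 ≤ sepProb k J x y e m := by
  unfold sepProb
  split_ifs
  · exact heapSep_nonneg (by positivity) _ _ _ _ _
  · positivity

theorem measurableSet_sepSet (x y : Pt d) (e m : ℕ) : MeasurableSet (sepSet k J x y e m) := by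
  unfold sepSet
  split_ifs
  · have h₁ := measurableSet_heapBit (2 ^ k) (2 ^ J) (coord x) (e - k) m
    have h₂ := measurableSet_heapBit (2 ^ k) (2 ^ J) (coord y) (e - k) m
    have := (h₁.symmDiff h₂).preimage measurable_subtype_coe (α := unitInterval)
    convert this using 1
    ext u
    simp only [Set.mem_ofPred_eq, Set.mem_symmDiff, Set.mem_preimage]
    tauto
  · exact (measurableSet_eq_fun ((measurable_gridCell _ _).comp measurable_subtype_coe)
      ((measurable_gridCell _ _).comp measurable_subtype_coe)).compl

theorem volume_sepSet {x y : Pt d} (hx : x ∈ grid d (2 ^ k)) (hy : y ∈ grid d (2 ^ k)) {e m : ℕ}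
    (hm : m ∈ scaleIdx d k J e) :
    volume (sepSet k J x y e m) = ENNReal.ofReal (min 1 (sepProb k J x y e m)) := by
  unfold sepSet sepProb
  unfold scaleIdx at hm
  split_ifs with h
  · have h1 := volume_heapSep (U := 2 ^ k) (by positivity) (2 ^ J) (coord_nonneg_le hx)
      (coord_nonneg_le hy) (e - k) m
    rw [volume_unitInterval_eq fun u => ¬ (heapBit (2 ^ k) (2 ^ J) (coord x) (e - k) m u ↔
      heapBit (2 ^ k) (2 ^ J) (coord y) (e - k) m u), h1, min_eq_right]
    -- The value for a heap cut is the measure of a subset of `[0, 1)`, so the truncation at 1 is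
    -- void.
    have h2 := measure_mono (μ := volume) (Set.inter_subset_left (s := Set.Ico (0 : ℝ) 1)
      (t := {u | ¬ (heapBit (2 ^ k) (2 ^ J) (coord x) (e - k) m u ↔
        heapBit (2 ^ k) (2 ^ J) (coord y) (e - k) m u)}))
    rw [h1, Real.volume_Ico, sub_zero] at h2
    exact (ENNReal.ofReal_le_ofReal_iff zero_le_one).1 h2
  · rw [if_neg h, Finset.mem_Ico] at hm
    exact volume_gridCell (one_le_coord hx (by omega)) (one_le_coord hy (by omega)) (by omega)

/-- At a heap level every coordinate lies below exactly one node, where it is chosen with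
probability `2 ^ (k - e)`; together with the division by `2 ^ k` this gives `2 ^ (-e)`. At a grid
scale there is one cut per coordinate. -/
theorem sum_sepProb (hJ : d ≤ 2 ^ J) (x y : Pt d) {e : ℕ} (he : e ≤ J + k) :
    ∑ m ∈ scaleIdx d k J e, sepProb k J x y e m = l1 x y / 2 ^ e := by
  unfold scaleIdx sepProb
  rw [l1_eq_sum_coord]
  split_ifs with h
  · rw [sum_heapSep _ _ _ _ _ _ _ (Nat.pow_le_pow_right (by norm_num) (by omega)), ← pow_add,
      ← pow_add, show e - k + (J + k - e) = J by omega,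
      show e - k + (J + k - e + 1) = J + 1 by omega, ← Finset.sum_div, div_div, ← pow_add,
      show k + (e - k) = e by omega]
    congr 1
    rw [pow_succ, mul_two, Finset.sum_Ico_eq_sum_range, Nat.add_sub_cancel]
    simp only [Nat.add_sub_cancel_left]
    symm
    -- The coordinates that pad the dimension up to `2 ^ J` are zero for both points.
    refine Finset.sum_subset (fun i => ?_) fun i _ hi => ?_
    · simp only [Finset.mem_range]; omega
    · simp only [Finset.mem_range] at hi
      simp [coord, hi]
  · rw [Finset.sum_Ico_eq_sum_range, Nat.add_sub_cancel_left, Finset.sum_div]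
    simp only [Nat.add_sub_cancel_left]

/-- Union bound over the cuts of the scale; by `sum_sepProb` the dimension does not enter. -/
theorem coinLaw_separated_le (hJ : d ≤ 2 ^ J) {x y : Pt d} (hx : x ∈ grid d (2 ^ k))
    (hy : y ∈ grid d (2 ^ k)) {e : ℕ} (he : e ≤ J + k) :
    coinLaw {z | Separated k J x y e z} ≤ ENNReal.ofReal (l1 x y / 2 ^ e) := by
  rw [← sum_sepProb hJ x y he]
  exact coinLaw_exists_le _ _ _ (fun m _ => sepProb_nonneg x y e m)
    (fun m _ => measurableSet_sepSet x y e m) fun m hm => volume_sepSet hx hy hm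

/-- The cuts of one scale use different random numbers and are independent. Cuts of different grid
scales are not, and their independence is never needed. -/
theorem coinLaw_not_separated_le (hJ : d ≤ 2 ^ J) {x y : Pt d} (hx : x ∈ grid d (2 ^ k))
    (hy : y ∈ grid d (2 ^ k)) {e : ℕ} (he : e ≤ J + k) :
    coinLaw {z | ¬ Separated k J x y e z} ≤ ENNReal.ofReal (Real.exp (- (l1 x y / 2 ^ e))) := by
  rw [← sum_sepProb hJ x y he]
  have := coinLaw_forall_le (scaleIdx d k J e) (sepSet k J x y e) (sepProb k J x y e)
    (fun m _ => sepProb_nonneg x y e m)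
    (fun m _ => measurableSet_sepSet x y e m) fun m hm => volume_sepSet hx hy hm
  convert this using 3
  ext z
  simp [Separated]

theorem measurableSet_separated (x y : Pt d) (e : ℕ) :
    MeasurableSet {z | Separated k J x y e z} := by
  have : {z | Separated k J x y e z} =
      ⋃ m ∈ scaleIdx d k J e, (fun z : ℕ → unitInterval => z m) ⁻¹' sepSet k J x y e m := by
    ext z; simp [Separated]
  rw [this]
  exact Finset.measurableSet_biUnion _ fun m _ => measurable_pi_apply m (measurableSet_sepSet x y e m)

theorem not_separated_self (x : Pt d) (e : ℕ) (z : ℕ → unitInterval) :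
    ¬ Separated k J x x e z := by
  rintro ⟨m, _, hm⟩
  unfold sepSet at hm
  split_ifs at hm <;> simp at hm

theorem bits_of_mem {z : ℕ → unitInterval} {x : Pt d} (hx : x ∈ grid d (2 ^ k)) {p : ℕ}
    (hp : p < depth d k J) : bits k J z x p = true ↔ rawBit k J z x p := by
  simp [bits, hx, hp]

theorem bits_zero (z : ℕ → unitInterval) (x : Pt d) : bits k J z x 0 = false := by
  simp [bits, rawBit]

/-- Different bits mean that the points are separated at the scale of the bit. -/
theorem separated_of_bits_ne (hd : 0 < d) {z : ℕ → unitInterval} {x y : Pt d}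
    (hx : x ∈ grid d (2 ^ k)) (hy : y ∈ grid d (2 ^ k)) {p : ℕ}
    (h : bits k J z x p ≠ bits k J z y p) : Separated k J x y (scaleExp d k J p) z := by
  have hp : p < depth d k J := by
    by_contra hc
    simp [bits, hc] at h
  rw [Ne, Bool.eq_iff_iff, bits_of_mem hx hp, bits_of_mem hy hp] at h
  unfold rawBit at h
  unfold Separated scaleIdx sepSet scaleExp
  have hp0 : p ≠ 0 := by
    rintro rfl
    simp at h
  simp only [hp0, ne_eq, not_false_eq_true, true_and] at h
  by_cases hpJ : p < 2 ^ J
  · simp only [hpJ, if_true] at h ⊢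
    have h1 : Nat.log 2 p < J := Nat.log_lt_of_lt_pow hp0 hpJ
    simp only [show k < J + k - Nat.log 2 p by omega, if_true]
    refine ⟨p, ?_, ?_⟩
    · rw [show J + k - (J + k - Nat.log 2 p) = Nat.log 2 p by omega, Finset.mem_Ico]
      exact ⟨Nat.pow_log_le_self 2 hp0, Nat.lt_pow_succ_log_self (by norm_num) p⟩
    · rw [show J + k - Nat.log 2 p - k = J - Nat.log 2 p by omega]
      exact h
  · simp only [hpJ, if_false] at h ⊢
    simp only [not_lt.2 (Nat.sub_le k ((p - 2 ^ J) / d)), if_false]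
    refine ⟨2 ^ J + (p - 2 ^ J) % d, ?_, ?_⟩
    · have := Nat.mod_lt (p - 2 ^ J) hd
      rw [Finset.mem_Ico]; omega
    · simp only [Nat.add_sub_cancel_left]
      intro hc
      rw [hc] at h
      exact h Iff.rfl

/-- Points with the same bits up to the scale `2 ^ e` are not separated at this scale. -/
theorem not_separated_of_bits_eq (hd : 0 < d) {z : ℕ → unitInterval} {x y : Pt d}
    (hx : x ∈ grid d (2 ^ k)) (hy : y ∈ grid d (2 ^ k)) {e : ℕ} (he : e ≤ J + k)
    (h : ∀ p < depth d k J, p ≠ 0 → e ≤ scaleExp d k J p → bits k J z x p = bits k J z y p) :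
    ¬ Separated k J x y e z := by
  rintro ⟨m, hm, hs⟩
  unfold scaleIdx at hm
  unfold sepSet at hs
  by_cases hek : k < e
  · rw [if_pos hek, Finset.mem_Ico] at hm
    rw [if_pos hek] at hs
    have hm0 : m ≠ 0 := by
      have := Nat.two_pow_pos (J + k - e)
      omega
    have hlog : Nat.log 2 m = J + k - e := Nat.log_eq_of_pow_le_of_lt_pow hm.1 hm.2
    have hmJ : m < 2 ^ J := hm.2.trans_le (Nat.pow_le_pow_right (by norm_num) (by omega))
    have hmd : m < depth d k J := by unfold depth; omega
    have := h m hmd hm0 (by unfold scaleExp; rw [if_pos hmJ, hlog]; omega)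
    rw [Bool.eq_iff_iff, bits_of_mem hx hmd, bits_of_mem hy hmd] at this
    simp only [rawBit, hm0, ne_eq, not_false_eq_true, true_and, hmJ, if_true, hlog,
      show J - (J + k - e) = e - k by omega] at this
    exact hs this
  · rw [if_neg hek, Finset.mem_Ico] at hm
    rw [if_neg hek] at hs
    obtain ⟨i, rfl⟩ := Nat.exists_eq_add_of_le hm.1
    rw [Nat.add_sub_cancel_left] at hs
    have hi : i < d := by omega
    set u := z (2 ^ J + i)
    refine hs ?_
    -- Downward induction from the common top cell: the cell at scale `f` is determined by the cell
    -- at `f + 1` and a parity, and this parity is one of the agreeing bits.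
    suffices H : ∀ f, e ≤ f → f ≤ k + 1 →
        gridCell k (coord x i) f u = gridCell k (coord y i) f u from H e le_rfl (by omega)
    intro f hef hf
    induction hf using Nat.decreasingInduction with
    | self =>
      rw [gridCell_top (coord_nonneg_le hx i).2 u.2.2, gridCell_top (coord_nonneg_le hy i).2 u.2.2]
    | of_succ f hf ih =>
      have h1 := ih (by omega)
      rw [gridCell_succ, gridCell_succ] at h1
      -- The grid levels are listed from `k` downwards, `d` bits each, so the digit of coordinate
      -- `i` at scale `f` has offset `d * (k - f) + i`.
      have hdiv : (d * (k - f) + i) / d = k - f := by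
        rw [Nat.mul_add_div hd, Nat.div_eq_of_lt hi, add_zero]
      have hmod : (d * (k - f) + i) % d = i := by
        rw [Nat.mul_add_mod, Nat.mod_eq_of_lt hi]
      have hmul : d * (k - f) + d ≤ d * (k + 1) := by
        rw [← Nat.mul_succ]
        exact Nat.mul_le_mul_left d (by omega)
      have hpd : 2 ^ J + (d * (k - f) + i) < depth d k J := by unfold depth; omega
      have h2 := h (2 ^ J + (d * (k - f) + i)) hpd
        (by have := Nat.two_pow_pos J; omega)
        (by
          unfold scaleExp
          rw [if_neg (by omega), Nat.add_sub_cancel_left, hdiv]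
          omega)
      rw [Bool.eq_iff_iff, bits_of_mem hx hpd, bits_of_mem hy hpd] at h2
      have h0 : 2 ^ J + (d * (k - f) + i) ≠ 0 := by have := Nat.two_pow_pos J; omega
      simp only [rawBit, h0, ne_eq, not_false_eq_true, true_and,
        show ¬ (2 ^ J + (d * (k - f) + i) < 2 ^ J) by omega, if_false, Nat.add_sub_cancel_left,
        hdiv, hmod, show k - (k - f) = f by omega] at h2
      change (gridCell k (coord x i) f u % 2 = 1 ↔ gridCell k (coord y i) f u % 2 = 1) at h2
      omega

theorem scaleExp_le {p : ℕ} : scaleExp d k J p ≤ J + k := by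
  unfold scaleExp
  split_ifs
  · omega
  · exact (Nat.sub_le _ _).trans (by omega)

/-- The bits are ordered from coarse to fine scales, with all heap bits before all grid bits. -/
theorem scaleExp_anti {p q : ℕ} (h : p ≤ q) (hp : p ≠ 0) : scaleExp d k J q ≤ scaleExp d k J p := by
  unfold scaleExp
  split_ifs with h1 h2
  · have := Nat.log_mono_right (b := 2) h
    omega
  · omega
  · have : Nat.log 2 p < J := Nat.log_lt_of_lt_pow hp ‹_›
    exact (Nat.sub_le _ _).trans (by omega)
  · exact Nat.sub_le_sub_left (Nat.div_le_div_right (by omega)) k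

theorem bitWeight_nonneg (p : ℕ) : 0 ≤ bitWeight d k J p := by
  unfold bitWeight
  split_ifs <;> positivity

theorem bitWeight_pos {p : ℕ} (hp : p ≠ 0) : 0 < bitWeight d k J p := by
  unfold bitWeight
  rw [if_neg hp]
  positivity

theorem bitWeight_anti {p q : ℕ} (h : p ≤ q) (hp : p ≠ 0) :
    bitWeight d k J q ≤ bitWeight d k J p := by
  unfold bitWeight
  rw [if_neg hp, if_neg (by omega)]
  exact pow_le_pow_right₀ (by norm_num) (by have := scaleExp_anti (d := d) (k := k) (J := J) h hp; omega)

/-- Different points have different bit strings. -/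
theorem pre_bits_inj (hd : 0 < d) {z : ℕ → unitInterval} {x y : Pt d}
    (hx : x ∈ grid d (2 ^ k)) (hy : y ∈ grid d (2 ^ k))
    (h : pre (bits k J z) x (depth d k J) = pre (bits k J z) y (depth d k J)) : x = y := by
  rw [pre_eq_iff] at h
  have hns := not_separated_of_bits_eq hd hx hy (Nat.zero_le (J + k)) fun p hp _ _ => h p hp
  ext i
  by_contra hne
  refine hns ⟨2 ^ J + i, ?_, ?_⟩
  · rw [scaleIdx, if_neg (by omega), Finset.mem_Ico]
    exact ⟨by omega, by omega⟩
  · rw [sepSet, if_neg (by omega), Nat.add_sub_cancel_left]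
    intro hc
    apply hne
    have hu := (z (2 ^ J + i)).2.1
    have h1 : (gridCell k (coord x i) 0 (z (2 ^ J + i)) : ℤ) =
        gridCell k (coord y i) 0 (z (2 ^ J + i)) := by exact_mod_cast hc
    rw [gridCell_eq_floor (one_le_coord hx i.2) hu, gridCell_eq_floor (one_le_coord hy i.2) hu] at h1
    obtain ⟨m, hm⟩ := coord_eq_natCast hx i
    obtain ⟨m', hm'⟩ := coord_eq_natCast hy i
    have hcx : coord x i = x i := by simp [coord]
    have hcy : coord y i = y i := by simp [coord]
    rw [hm, hm', pow_zero, div_one, div_one] at h1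
    -- At scale 0 the cells have side 1, so two integers with the same shift lie in one cell only if
    -- they are equal.
    have e : ∀ m : ℕ, (m : ℝ) - 1 + 2 ^ k * (z (2 ^ J + i) : ℝ) =
        2 ^ k * (z (2 ^ J + i) : ℝ) + ((m : ℤ) - 1 : ℤ) := by intro m; push_cast; ring
    rw [e, e, Int.floor_add_intCast, Int.floor_add_intCast] at h1
    have : m = m' := by omega
    rw [← hcx, ← hcy, hm, hm', this]

end Geometry

/-! ### Quality of the tree estimates -/

theorem distTo_le {d : ℕ} {B : Finset (Pt d)} {b : Pt d} (hb : b ∈ B) (a : Pt d) :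
    distTo a B ≤ l1 a b :=
  ciInf_le (f := fun b : {b // b ∈ B} => l1 a b.1) (Set.finite_range _).bddBelow ⟨b, hb⟩

theorem exists_distTo {d : ℕ} {B : Finset (Pt d)} (hB : B.Nonempty) (a : Pt d) :
    ∃ b ∈ B, distTo a B = l1 a b := by
  obtain ⟨b, hb⟩ := hB
  have : Nonempty {b // b ∈ B} := ⟨⟨b, hb⟩⟩
  obtain ⟨b', hb'⟩ := exists_eq_ciInf_of_finite (f := fun b : {b // b ∈ B} => l1 a b.1)
  exact ⟨b'.1, b'.2, hb'.symm⟩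

theorem distTo_nonneg {d : ℕ} (B : Finset (Pt d)) (a : Pt d) : 0 ≤ distTo a B :=
  Real.iInf_nonneg fun _ => l1_nonneg _ _

theorem chamfer_nonneg {d : ℕ} (A B : Finset (Pt d)) : 0 ≤ chamfer A B :=
  Finset.sum_nonneg fun a _ => distTo_nonneg B a

theorem sum_Ico_half_pow_le (a b : ℕ) : ∑ e ∈ Finset.Ico a b, (1 : ℝ) / 2 ^ e ≤ 2 / 2 ^ a := by
  rcases le_or_gt a b with h | h
  · have : ∑ e ∈ Finset.Ico a b, (1 : ℝ) / 2 ^ e = 2 / 2 ^ a - 2 / 2 ^ b := by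
      induction b, h using Nat.le_induction with
      | base => simp
      | succ b hb ih =>
        rw [Finset.sum_Ico_succ_top hb, ih, pow_succ]
        field_simp
        ring
    rw [this]
    have : (0 : ℝ) < 2 / 2 ^ b := by positivity
    linarith
  · rw [Finset.Ico_eq_empty_of_le h.le, Finset.sum_empty]
    positivity

theorem sum_half_pow_filter_le (M : ℕ) {T : ℝ} (hT : 0 < T) :
    ∑ e ∈ Finset.range M with T ≤ 2 ^ e, (1 : ℝ) / 2 ^ e ≤ 2 / T := by
  classical
  obtain ⟨m, hm⟩ := pow_unbounded_of_one_lt T one_lt_two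
  have hex : ∃ m : ℕ, T ≤ 2 ^ m := ⟨m, hm.le⟩
  calc ∑ e ∈ Finset.range M with T ≤ 2 ^ e, (1 : ℝ) / 2 ^ e
      ≤ ∑ e ∈ Finset.Ico (Nat.find hex) M, (1 : ℝ) / 2 ^ e := by
        refine Finset.sum_le_sum_of_subset_of_nonneg (fun e he => ?_) fun _ _ _ => by positivity
        rw [Finset.mem_filter, Finset.mem_range] at he
        exact Finset.mem_Ico.2 ⟨Nat.find_min' hex he.2, he.1⟩
    _ ≤ 2 / 2 ^ Nat.find hex := sum_Ico_half_pow_le _ _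
    _ ≤ 2 / T := div_le_div_of_nonneg_left (by norm_num) hT (Nat.find_spec hex)

/-- Scales up to `δ` form a geometric series bounded by `4δ`; each of the at most `R` further scales
contributes at most `2δ`. -/
theorem sum_scales_le (M R : ℕ) {δ : ℝ} (hδ : 1 ≤ δ) :
    ∑ e ∈ Finset.range M with ((2 : ℝ) ^ e < 2 ^ R * δ), (2 : ℝ) ^ (e + 1) * min 1 (δ / 2 ^ e) ≤
      (4 + 2 * R) * δ := by
  obtain ⟨i, hi, hi'⟩ := exists_nat_pow_near hδ one_lt_two
  have hterm : ∀ e : ℕ, (2 : ℝ) ^ (e + 1) * min 1 (δ / 2 ^ e) ≤ 2 * δ := by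
    intro e
    calc (2 : ℝ) ^ (e + 1) * min 1 (δ / 2 ^ e) ≤ 2 ^ (e + 1) * (δ / 2 ^ e) := by
          gcongr; exact min_le_right _ _
      _ = 2 * δ := by rw [pow_succ]; field_simp
  calc ∑ e ∈ Finset.range M with ((2 : ℝ) ^ e < 2 ^ R * δ), (2 : ℝ) ^ (e + 1) * min 1 (δ / 2 ^ e)
      ≤ ∑ e ∈ Finset.range (i + 1 + R), (2 : ℝ) ^ (e + 1) * min 1 (δ / 2 ^ e) := by
        refine Finset.sum_le_sum_of_subset_of_nonneg (fun e he => ?_) fun _ _ _ => by positivity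
        rw [Finset.mem_filter] at he
        rw [Finset.mem_range]
        have : (2 : ℝ) ^ e < 2 ^ (i + 1 + R) := by
          rw [pow_add _ (i + 1), mul_comm]
          exact he.2.trans (by gcongr)
        exact (pow_lt_pow_iff_right₀ one_lt_two).1 this
    _ = ∑ e ∈ Finset.range (i + 1), (2 : ℝ) ^ (e + 1) * min 1 (δ / 2 ^ e) +
        ∑ j ∈ Finset.range R, (2 : ℝ) ^ (i + 1 + j + 1) * min 1 (δ / 2 ^ (i + 1 + j)) :=
        Finset.sum_range_add _ _ _
    _ ≤ ∑ e ∈ Finset.range (i + 1), (2 : ℝ) ^ (e + 1) + ∑ j ∈ Finset.range R, 2 * δ := by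
        refine add_le_add (Finset.sum_le_sum fun e _ => ?_) (Finset.sum_le_sum fun j _ => hterm _)
        exact mul_le_of_le_one_right (by positivity) (min_le_left _ _)
    _ ≤ 4 * δ + R * (2 * δ) := by
        refine add_le_add ?_ (by simp)
        have : ∑ e ∈ Finset.range (i + 1), (2 : ℝ) ^ (e + 1) = 2 * (2 ^ (i + 1) - 1) := by
          have := geom_sum_eq (by norm_num : (2 : ℝ) ≠ 1) (i + 1)
          simp_rw [pow_succ (2 : ℝ), ← Finset.sum_mul]
          simp_rw [pow_succ (2 : ℝ)] at this
          rw [this]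
          ring
        rw [this, pow_succ]
        linarith
    _ = (4 + 2 * R) * δ := by ring

section Quality

variable {d k J : ℕ}

theorem one_le_depth : 1 ≤ depth d k J := by
  have := Nat.two_pow_pos J
  unfold depth
  omega

/-- The bit number 0 is constant. It guarantees that a point outside `B` leaves the trie at a
position of positive weight. -/
theorem one_le_lcp {B : Finset (Pt d)} (hB : B.Nonempty) (z : ℕ → unitInterval) (a : Pt d) :
    1 ≤ lcp (bits k J z) (depth d k J) B a := by
  obtain ⟨b, hb⟩ := hB
  refine le_lcp _ _ hb one_le_depth ?_
  rw [pre_eq_iff]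
  intro i hi
  obtain rfl : i = 0 := by omega
  rw [bits_zero, bits_zero]

/-- Two distant points share a long prefix only with a small probability. -/
theorem coinLaw_far_le (hd : 0 < d) (hJ : d ≤ 2 ^ J) {a b : Pt d} (ha : a ∈ grid d (2 ^ k))
    (hb : b ∈ grid d (2 ^ k)) {Λ : ℝ} (hΛ : 1 ≤ Λ) :
    coinLaw {z | ∃ p, p ≠ 0 ∧ p < depth d k J ∧ pre (bits k J z) a p = pre (bits k J z) b p ∧
      Λ * bitWeight d k J p < l1 a b} ≤ ENNReal.ofReal (Real.exp (-Λ)) := by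
  by_cases h0 : Λ * 2 ^ 0 < l1 a b
  -- The coarsest scale that is still smaller than the distance by the factor `Λ`. A bad prefix of
  -- any length forces all bits of this one scale to agree, so a single event covers all lengths.
  · set e₁ := Nat.findGreatest (fun e => Λ * 2 ^ e < l1 a b) (J + k) with he₁
    have hle : e₁ ≤ J + k := Nat.findGreatest_le _
    have hspec : Λ * 2 ^ e₁ < l1 a b :=
      Nat.findGreatest_spec (P := fun e => Λ * (2 : ℝ) ^ e < l1 a b) (Nat.zero_le _) h0
    refine (measure_mono ?_).trans ((coinLaw_not_separated_le hJ ha hb hle).trans ?_)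
    · rintro z ⟨p, hp0, hp, hpre, hfar⟩
      refine not_separated_of_bits_eq hd ha hb hle fun p' _ hp'0 hep' => ?_
      refine (pre_eq_iff _ _ _ _).1 hpre p' ?_
      by_contra hc
      push Not at hc
      have h1 := scaleExp_anti (d := d) (k := k) (J := J) hc hp0
      rw [bitWeight, if_neg hp0] at hfar
      -- The bits of the scale of `p` itself may be compared only in part, but all bits of the next
      -- coarser scale precede `p`. This is the reason for the exponent `scaleExp + 1` in
      -- `bitWeight`.
      have h2 : scaleExp d k J p + 1 ≤ J + k := by
        by_contra hc'
        have h3 : (2 : ℝ) ^ (J + k) ≤ 2 ^ (scaleExp d k J p + 1) :=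
          pow_le_pow_right₀ (by norm_num) (by omega)
        have h4 := l1_le ha hb hJ
        nlinarith
      have h5 := Nat.le_findGreatest (P := fun e => Λ * (2 : ℝ) ^ e < l1 a b) h2 hfar
      omega
    · refine ENNReal.ofReal_le_ofReal (Real.exp_le_exp.2 (neg_le_neg ?_))
      rw [le_div_iff₀ (by positivity)]
      exact hspec.le
  · have : {z : ℕ → unitInterval | ∃ p, p ≠ 0 ∧ p < depth d k J ∧
        pre (bits k J z) a p = pre (bits k J z) b p ∧ Λ * bitWeight d k J p < l1 a b} = ∅ := by
      refine Set.eq_empty_of_forall_notMem ?_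
      rintro z ⟨p, hp0, _, _, hfar⟩
      rw [bitWeight, if_neg hp0] at hfar
      have : (1 : ℝ) ≤ 2 ^ (scaleExp d k J p + 1) := one_le_pow₀ (by norm_num)
      apply h0
      rw [pow_zero, mul_one]
      nlinarith
    rw [this, measure_empty]
    exact zero_le

/-- If no distant points share a long prefix, then the tree estimates are not much too small. -/
theorem distTo_le_treeDist (hd : 0 < d) {A B : Finset (Pt d)} (hA : ∀ a ∈ A, a ∈ grid d (2 ^ k))
    (hBg : ∀ b ∈ B, b ∈ grid d (2 ^ k)) (hB : B.Nonempty) {Λ : ℝ} {z : ℕ → unitInterval}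
    (hz : ∀ a ∈ A, ∀ b ∈ B, ¬ ∃ p, p ≠ 0 ∧ p < depth d k J ∧
      pre (bits k J z) a p = pre (bits k J z) b p ∧ Λ * bitWeight d k J p < l1 a b) {a : Pt d}
    (ha : a ∈ A) :
    distTo a B ≤ Λ * treeDist (bits k J z) (bitWeight d k J) (depth d k J) B a := by
  obtain ⟨b, hb, hpre⟩ := lcp_spec (bits k J z) (depth d k J) hB a
  have h1 := one_le_lcp (k := k) (J := J) hB z a
  unfold treeDist
  split_ifs with h
  · have := hz a ha b hb
    push Not at this
    exact (distTo_le hb a).trans (this _ (by omega) h hpre.symm)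
  · have h2 : lcp (bits k J z) (depth d k J) B a = depth d k J :=
      le_antisymm (lcp_le _ _ _ _) (not_lt.1 h)
    rw [h2] at hpre
    obtain rfl := pre_bits_inj hd (hBg b hb) (hA a ha) hpre
    rw [mul_zero]
    exact (distTo_le hb b).trans (l1_eq_zero.2 rfl).le

/-- The tree estimate is bounded in terms of the scales that separate the point from some point
of the other set. -/
theorem treeDist_le_of_mem (hd : 0 < d) {B : Finset (Pt d)} {a b : Pt d} (hb : b ∈ B)
    (hag : a ∈ grid d (2 ^ k)) (hbg : b ∈ grid d (2 ^ k)) (z : ℕ → unitInterval) (hab : a ≠ b) :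
    ∃ e ≤ J + k, Separated k J a b e z ∧
      treeDist (bits k J z) (bitWeight d k J) (depth d k J) B a ≤ 2 ^ (e + 1) := by
  classical
  have hex : ∃ p, bits k J z a p ≠ bits k J z b p := by
    by_contra hc
    push Not at hc
    exact hab (pre_bits_inj hd hag hbg ((pre_eq_iff _ _ _ _).2 fun p _ => hc p) (z := z) (J := J))
  set p := Nat.find hex with hp
  have hne : bits k J z a p ≠ bits k J z b p := Nat.find_spec hex
  have hp0 : p ≠ 0 := by
    intro h0
    rw [h0, bits_zero, bits_zero] at hne
    exact hne rfl
  have hpd : p < depth d k J := by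
    by_contra hc
    simp [bits, hc] at hne
  have hle : p ≤ lcp (bits k J z) (depth d k J) B a := by
    refine le_lcp _ _ hb hpd.le ((pre_eq_iff _ _ _ _).2 fun i hi => ?_)
    have := Nat.find_min hex hi
    push Not at this
    exact this.symm
  refine ⟨scaleExp d k J p, scaleExp_le, separated_of_bits_ne hd hag hbg hne, ?_⟩
  have : bitWeight d k J p = 2 ^ (scaleExp d k J p + 1) := if_neg hp0
  rw [← this]
  unfold treeDist
  split_ifs
  · exact bitWeight_anti hle hp0
  · exact bitWeight_nonneg p

/-- The separation probabilities at scales from `2 ^ R * l1 a b` on form a geometric series. With `R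
= Lg + 5`, the union over at most `2 ^ Lg` points still costs only 1/16. -/
theorem coinLaw_large_scale_le (hJ : d ≤ 2 ^ J) {a b : Pt d} (ha : a ∈ grid d (2 ^ k))
    (hb : b ∈ grid d (2 ^ k)) (R : ℕ) :
    coinLaw {z | ∃ e ≤ J + k, 2 ^ R * l1 a b ≤ 2 ^ e ∧ Separated k J a b e z} ≤
      ENNReal.ofReal (2 / 2 ^ R) := by
  by_cases hab : a = b
  · subst hab
    have : {z : ℕ → unitInterval | ∃ e ≤ J + k, 2 ^ R * l1 a a ≤ 2 ^ e ∧
        Separated k J a a e z} = ∅ := by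
      refine Set.eq_empty_of_forall_notMem ?_
      rintro z ⟨e, _, _, h⟩
      exact not_separated_self a e z h
    rw [this, measure_empty]
    exact zero_le
  have hδ := one_le_l1 ha hb hab
  have hT : 0 < 2 ^ R * l1 a b := by positivity
  have : {z : ℕ → unitInterval | ∃ e ≤ J + k, 2 ^ R * l1 a b ≤ 2 ^ e ∧
      Separated k J a b e z} ⊆
      ⋃ e ∈ (Finset.range (J + k + 1)).filter fun e => 2 ^ R * l1 a b ≤ 2 ^ e,
        {z | Separated k J a b e z} := by
    rintro z ⟨e, he, he', hs⟩
    simp only [Set.mem_iUnion, Finset.mem_filter, Finset.mem_range]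
    exact ⟨e, ⟨by omega, he'⟩, hs⟩
  refine (measure_mono this).trans ((measure_biUnion_finset_le _ _).trans ?_)
  calc ∑ e ∈ Finset.range (J + k + 1) with 2 ^ R * l1 a b ≤ 2 ^ e,
        coinLaw {z | Separated k J a b e z}
      ≤ ∑ e ∈ Finset.range (J + k + 1) with 2 ^ R * l1 a b ≤ 2 ^ e,
        ENNReal.ofReal (l1 a b / 2 ^ e) := by
        refine Finset.sum_le_sum fun e he => coinLaw_separated_le hJ ha hb ?_
        rw [Finset.mem_filter, Finset.mem_range] at he
        omega
    _ = ENNReal.ofReal (l1 a b * ∑ e ∈ Finset.range (J + k + 1) with 2 ^ R * l1 a b ≤ 2 ^ e,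
        (1 : ℝ) / 2 ^ e) := by
        rw [← ENNReal.ofReal_sum_of_nonneg fun _ _ => by positivity, Finset.mul_sum]
        congr 1
        exact Finset.sum_congr rfl fun _ _ => by ring
    _ ≤ ENNReal.ofReal (2 / 2 ^ R) := by
        refine ENNReal.ofReal_le_ofReal ?_
        refine (mul_le_mul_of_nonneg_left (sum_half_pow_filter_le _ hT) (by positivity)).trans
          (le_of_eq ?_)
        field_simp

open Classical in
/-- The part of the bound for the tree estimate that comes from the scales that are not too
large. -/
noncomputable def scaleSum (k J R : ℕ) (a b : Pt d) (z : ℕ → unitInterval) : ℝ≥0∞ :=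
  ∑ e ∈ Finset.range (J + k + 1) with ((2 : ℝ) ^ e < 2 ^ R * l1 a b),
    ENNReal.ofReal (2 ^ (e + 1)) * {z | Separated k J a b e z}.indicator 1 z

/-- Expectation of the truncated bound via `sum_scales_le`. Thanks to the truncation the factor is
linear in `R`, that is logarithmic in `n`, instead of linear in the number of scales. -/
theorem lintegral_scaleSum_le (hJ : d ≤ 2 ^ J) {a b : Pt d} (ha : a ∈ grid d (2 ^ k))
    (hb : b ∈ grid d (2 ^ k)) (R : ℕ) :
    ∫⁻ z, scaleSum k J R a b z ∂coinLaw ≤ ENNReal.ofReal ((4 + 2 * R) * l1 a b) := by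
  unfold scaleSum
  rw [lintegral_finsetSum _ fun e _ =>
    (measurable_one.indicator (measurableSet_separated a b e)).const_mul _]
  have hterm : ∀ e ∈ (Finset.range (J + k + 1)).filter fun e => (2 : ℝ) ^ e < 2 ^ R * l1 a b,
      ∫⁻ z, ENNReal.ofReal (2 ^ (e + 1)) * {z | Separated k J a b e z}.indicator 1 z ∂coinLaw ≤
        ENNReal.ofReal (2 ^ (e + 1) * min 1 (l1 a b / 2 ^ e)) := by
    intro e he
    rw [Finset.mem_filter, Finset.mem_range] at he
    rw [lintegral_const_mul _ (measurable_one.indicator (measurableSet_separated a b e)),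
      lintegral_indicator_one (measurableSet_separated a b e),
      ENNReal.ofReal_mul (by positivity)]
    gcongr
    rw [ENNReal.ofReal_min, ENNReal.ofReal_one]
    exact le_min prob_le_one (coinLaw_separated_le hJ ha hb (by omega))
  refine (Finset.sum_le_sum hterm).trans ?_
  have h0 := l1_nonneg a b
  rw [← ENNReal.ofReal_sum_of_nonneg fun _ _ => by positivity]
  refine ENNReal.ofReal_le_ofReal ?_
  by_cases hab : a = b
  · subst hab
    rw [l1_eq_zero.2 rfl]
    simp
  · exact sum_scales_le _ _ (one_le_l1 ha hb hab)

theorem treeDist_le_scaleSum (hd : 0 < d) {B : Finset (Pt d)} {a b : Pt d} (hb : b ∈ B)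
    (hag : a ∈ grid d (2 ^ k)) (hbg : b ∈ grid d (2 ^ k)) {z : ℕ → unitInterval} {R : ℕ}
    (hz : ¬ ∃ e ≤ J + k, 2 ^ R * l1 a b ≤ 2 ^ e ∧ Separated k J a b e z) :
    ENNReal.ofReal (treeDist (bits k J z) (bitWeight d k J) (depth d k J) B a) ≤
      scaleSum k J R a b z := by
  by_cases hab : a = b
  · subst hab
    have : lcp (bits k J z) (depth d k J) B a = depth d k J :=
      le_antisymm (lcp_le _ _ _ _) (le_lcp _ _ hb le_rfl rfl)
    rw [treeDist, this, if_neg (lt_irrefl _), ENNReal.ofReal_zero]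
    exact zero_le
  · obtain ⟨e, he, hs, hle⟩ := treeDist_le_of_mem (J := J) hd hb hag hbg z hab
    refine (ENNReal.ofReal_le_ofReal hle).trans ?_
    push Not at hz
    have hlt : (2 : ℝ) ^ e < 2 ^ R * l1 a b := by
      by_contra hc
      exact hz e he (not_lt.1 hc) hs
    unfold scaleSum
    refine le_trans ?_ (Finset.single_le_sum (f := fun e => ENNReal.ofReal (2 ^ (e + 1)) *
      {z | Separated k J a b e z}.indicator 1 z) (fun _ _ => zero_le)
      (Finset.mem_filter.2 ⟨Finset.mem_range.2 (by omega : e < J + k + 1), hlt⟩))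
    rw [Set.indicator_of_mem (show z ∈ {z | Separated k J a b e z} from hs)]
    simp

/-- The tree estimates are good: none of them is much too small, and their sum is not much too
large. -/
def GoodTree (k J : ℕ) (A B : Finset (Pt d)) (Lg : ℕ) (z : ℕ → unitInterval) : Prop :=
  (∀ a ∈ A, distTo a B ≤
    5 * Lg * treeDist (bits k J z) (bitWeight d k J) (depth d k J) B a) ∧
  ∑ a ∈ A, treeDist (bits k J z) (bitWeight d k J) (depth d k J) B a ≤ 256 * Lg * chamfer A B

/-- Three bad events of probability at most 1/16 each: some far pair shares a long prefix; some
point is separated from its nearest neighbour at a huge scale; the sum of the remaining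
contributions exceeds 16 times the bound on its mean (Markov's inequality). -/
theorem coinLaw_not_goodTree_le (hd : 0 < d) (hJ : d ≤ 2 ^ J) {A B : Finset (Pt d)}
    (hA : ∀ a ∈ A, a ∈ grid d (2 ^ k)) (hBg : ∀ b ∈ B, b ∈ grid d (2 ^ k)) (hB : B.Nonempty)
    {n Lg : ℕ} (hAn : A.card ≤ n) (hBn : B.card ≤ n) (hLg : 1 ≤ Lg) (hn : n ≤ 2 ^ Lg) :
    coinLaw {z | ¬ GoodTree k J A B Lg z} ≤ ENNReal.ofReal (3 / 16) := by
  classical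
  choose! b hbB hbd using fun a : Pt d => exists_distTo hB a
  have hLg' : (1 : ℝ) ≤ Lg := by exact_mod_cast hLg
  set Λ : ℝ := 5 * Lg with hΛ
  set Bad₁ : Set (ℕ → unitInterval) := ⋃ a ∈ A, ⋃ b ∈ B, {z | ∃ p, p ≠ 0 ∧ p < depth d k J ∧
    pre (bits k J z) a p = pre (bits k J z) b p ∧ Λ * bitWeight d k J p < l1 a b} with hBad₁
  set Bad₂ : Set (ℕ → unitInterval) := ⋃ a ∈ A,
    {z | ∃ e ≤ J + k, 2 ^ (Lg + 5) * l1 a (b a) ≤ 2 ^ e ∧ Separated k J a (b a) e z} with hBad₂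
  set Z : (ℕ → unitInterval) → ℝ≥0∞ := fun z => ∑ a ∈ A, scaleSum k J (Lg + 5) a (b a) z with hZ
  have hAn' : (A.card : ℝ) ≤ 2 ^ Lg := by exact_mod_cast hAn.trans hn
  have hBn' : (B.card : ℝ) ≤ 2 ^ Lg := by exact_mod_cast hBn.trans hn
  have h₁ : coinLaw Bad₁ ≤ ENNReal.ofReal (1 / 16) := by
    calc coinLaw Bad₁ ≤ ∑ a ∈ A, ∑ b ∈ B, ENNReal.ofReal (Real.exp (-Λ)) := by
          refine (measure_biUnion_finset_le _ _).trans (Finset.sum_le_sum fun a ha => ?_)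
          refine (measure_biUnion_finset_le _ _).trans (Finset.sum_le_sum fun b hb => ?_)
          exact coinLaw_far_le hd hJ (hA a ha) (hBg b hb) (by rw [hΛ]; linarith)
      _ = ENNReal.ofReal (A.card * (B.card * Real.exp (-Λ))) := by
          simp only [Finset.sum_const, nsmul_eq_mul]
          rw [ENNReal.ofReal_mul (by positivity), ENNReal.ofReal_mul (by positivity)]
          simp
      _ ≤ ENNReal.ofReal (1 / 16) := by
          refine ENNReal.ofReal_le_ofReal ?_
          -- The factor 5 in `Λ` is chosen so that `exp (-5) ≤ 1/64`: there are at most `4 ^ Lg`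
          -- pairs, which leaves `16 ^ (-Lg)`.
          have he : Real.exp (-Λ) ≤ (1 / 64) ^ Lg := by
            have h3 : Real.exp (-Λ) = Real.exp (-5) ^ Lg := by
              rw [← Real.exp_nat_mul]; congr 1; rw [hΛ]; ring
            rw [h3]
            refine pow_le_pow_left₀ (Real.exp_pos _).le ?_ _
            rw [Real.exp_neg, one_div]
            refine inv_anti₀ (by norm_num) ?_
            have h4 : Real.exp 5 = Real.exp 1 ^ 5 := by rw [← Real.exp_nat_mul]; norm_num
            rw [h4]
            have h5 := Real.exp_one_gt_d9
            calc (64 : ℝ) ≤ 2.7 ^ 5 := by norm_num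
              _ ≤ Real.exp 1 ^ 5 := pow_le_pow_left₀ (by norm_num) (by linarith) 5
          calc (A.card : ℝ) * (B.card * Real.exp (-Λ)) ≤ 2 ^ Lg * (2 ^ Lg * (1 / 64) ^ Lg) := by
                gcongr
            _ = (1 / 16) ^ Lg := by rw [← mul_pow, ← mul_pow]; norm_num
            _ ≤ (1 / 16) ^ 1 := pow_le_pow_of_le_one (by norm_num) (by norm_num) hLg
            _ = 1 / 16 := by norm_num
  have h₂ : coinLaw Bad₂ ≤ ENNReal.ofReal (1 / 16) := by
    calc coinLaw Bad₂ ≤ ∑ a ∈ A, ENNReal.ofReal (2 / 2 ^ (Lg + 5)) := by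
          refine (measure_biUnion_finset_le _ _).trans (Finset.sum_le_sum fun a ha => ?_)
          exact coinLaw_large_scale_le hJ (hA a ha) (hBg _ (hbB a)) _
      _ = ENNReal.ofReal (A.card * (2 / 2 ^ (Lg + 5))) := by
          rw [Finset.sum_const, nsmul_eq_mul, ENNReal.ofReal_mul (by positivity)]
          simp
      _ ≤ ENNReal.ofReal (1 / 16) := by
          refine ENNReal.ofReal_le_ofReal ?_
          calc (A.card : ℝ) * (2 / 2 ^ (Lg + 5)) ≤ 2 ^ Lg * (2 / 2 ^ (Lg + 5)) := by gcongr
            _ = 1 / 16 := by rw [pow_add]; field_simp; norm_num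
  have h₃ : 0 < chamfer A B →
      coinLaw {z | ENNReal.ofReal (256 * Lg * chamfer A B) ≤ Z z} ≤ ENNReal.ofReal (1 / 16) := by
    intro hpos
    have hpos' : 0 < 256 * Lg * chamfer A B := by positivity
    -- With `R = Lg + 5` the factor is `4 + 2 * (Lg + 5)`, at most `16 * Lg` since `Lg ≥ 1`. The
    -- constant 256 is 16 times this.
    have hint : ∫⁻ z, Z z ∂coinLaw ≤ ENNReal.ofReal (16 * Lg * chamfer A B) := by
      rw [hZ, lintegral_finsetSum]
      · calc ∑ a ∈ A, ∫⁻ z, scaleSum k J (Lg + 5) a (b a) z ∂coinLaw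
            ≤ ∑ a ∈ A, ENNReal.ofReal ((4 + 2 * (Lg + 5 : ℕ)) * l1 a (b a)) :=
              Finset.sum_le_sum fun a ha =>
                lintegral_scaleSum_le hJ (hA a ha) (hBg _ (hbB a)) _
          _ = ENNReal.ofReal ((4 + 2 * (Lg + 5 : ℕ)) * chamfer A B) := by
              have h0 : ∀ a, 0 ≤ l1 a (b a) := fun a => l1_nonneg _ _
              rw [← ENNReal.ofReal_sum_of_nonneg fun a _ => mul_nonneg (by positivity) (h0 a),
                ← Finset.mul_sum, chamfer]
              congr 2
              exact Finset.sum_congr rfl fun a _ => (hbd a).symm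
          _ ≤ ENNReal.ofReal (16 * Lg * chamfer A B) := by
              refine ENNReal.ofReal_le_ofReal (mul_le_mul_of_nonneg_right ?_ hpos.le)
              push_cast
              linarith
      · intro a _
        unfold scaleSum
        exact Finset.measurable_sum _ fun e _ =>
          (measurable_one.indicator (measurableSet_separated a (b a) e)).const_mul _
    have hmeas : AEMeasurable Z coinLaw := by
      refine Measurable.aemeasurable ?_
      refine Finset.measurable_sum _ fun a _ => ?_
      unfold scaleSum
      exact Finset.measurable_sum _ fun e _ =>
        (measurable_one.indicator (measurableSet_separated a (b a) e)).const_mul _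
    refine (meas_ge_le_lintegral_div hmeas ?_ ENNReal.ofReal_ne_top).trans ?_
    · exact (ENNReal.ofReal_pos.2 hpos').ne'
    · refine (ENNReal.div_le_div_right hint _).trans ?_
      rw [← ENNReal.ofReal_div_of_pos hpos']
      refine ENNReal.ofReal_le_ofReal (le_of_eq ?_)
      field_simp
      norm_num
  have hsub : {z | ¬ GoodTree k J A B Lg z} ⊆ Bad₁ ∪ Bad₂ ∪
      {z | 0 < chamfer A B ∧ ENNReal.ofReal (256 * Lg * chamfer A B) ≤ Z z} := by
    intro z hz
    by_contra hc
    simp only [Set.mem_union, not_or] at hc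
    obtain ⟨⟨hc₁, hc₂⟩, hc₃⟩ := hc
    apply hz
    simp only [hBad₁, Set.mem_iUnion, not_exists] at hc₁
    simp only [hBad₂, Set.mem_iUnion, not_exists] at hc₂
    refine ⟨fun a ha => distTo_le_treeDist hd hA hBg hB (fun a ha b hb hex => hc₁ a ha b hb hex)
      ha, ?_⟩
    have hle : ENNReal.ofReal (∑ a ∈ A,
        treeDist (bits k J z) (bitWeight d k J) (depth d k J) B a) ≤ Z z := by
      rw [ENNReal.ofReal_sum_of_nonneg fun a _ => treeDist_nonneg _ _ _ bitWeight_nonneg _ _]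
      refine Finset.sum_le_sum fun a ha => treeDist_le_scaleSum hd (hbB a) (hA a ha)
        (hBg _ (hbB a)) fun hex => hc₂ a ha ?_
      exact hex
    -- Markov's inequality says nothing when the Chamfer distance vanishes; then every point of `A`
    -- belongs to `B` and all estimates are zero.
    rcases (chamfer_nonneg A B).eq_or_lt with h0 | hpos
    · rw [← h0, mul_zero]
      refine Finset.sum_nonpos fun a ha => le_of_eq ?_
      have h1 : distTo a B = 0 :=
        (Finset.sum_eq_zero_iff_of_nonneg fun a _ => distTo_nonneg B a).1 h0.symm a ha
      rw [hbd a, l1_eq_zero] at h1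
      have : lcp (bits k J z) (depth d k J) B a = depth d k J :=
        le_antisymm (lcp_le _ _ _ _) (le_lcp _ _ (hbB a) le_rfl (by rw [← h1]))
      rw [treeDist, this, if_neg (lt_irrefl _)]
    · have h1 : ¬ ENNReal.ofReal (256 * Lg * chamfer A B) ≤ Z z := fun h => hc₃ ⟨hpos, h⟩
      have h2 := hle.trans (not_le.1 h1).le
      exact (ENNReal.ofReal_le_ofReal_iff (by positivity)).1 h2
  have h₃' : coinLaw {z | 0 < chamfer A B ∧ ENNReal.ofReal (256 * Lg * chamfer A B) ≤ Z z} ≤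
      ENNReal.ofReal (1 / 16) := by
    by_cases hpos : 0 < chamfer A B
    · simpa [hpos] using h₃ hpos
    · simp [hpos]
  calc coinLaw {z | ¬ GoodTree k J A B Lg z}
      ≤ coinLaw Bad₁ + coinLaw Bad₂ + coinLaw {z | 0 < chamfer A B ∧
        ENNReal.ofReal (256 * Lg * chamfer A B) ≤ Z z} :=
        (measure_mono hsub).trans ((measure_union_le _ _).trans (by gcongr; exact measure_union_le _ _))
    _ ≤ ENNReal.ofReal (1 / 16) + ENNReal.ofReal (1 / 16) + ENNReal.ofReal (1 / 16) := by gcongr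
    _ = ENNReal.ofReal (3 / 16) := by
        rw [← ENNReal.ofReal_add, ← ENNReal.ofReal_add] <;> norm_num

end Quality

/-! ### Discrete random variables -/

/-- Random variables that take countably many values, each on a measurable set. -/
structure Discrete {Ω X : Type*} [MeasurableSpace Ω] (T : Ω → X) : Prop where
  countable : (Set.range T).Countable
  fibre : ∀ x, MeasurableSet (T ⁻¹' {x})

namespace Discrete

variable {Ω X Y Z : Type*} [MeasurableSpace Ω]

theorem preimage {T : Ω → X} (h : Discrete T) (s : Set X) : MeasurableSet (T ⁻¹' s) := by
  have : T ⁻¹' s = ⋃ x ∈ Set.range T ∩ s, T ⁻¹' {x} := by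
    ext ω
    simp
  rw [this]
  exact MeasurableSet.biUnion (h.countable.mono Set.inter_subset_left) fun x _ => h.fibre x

theorem comp {T : Ω → X} (h : Discrete T) (f : X → Y) : Discrete fun ω => f (T ω) where
  countable := by
    rw [show (fun ω => f (T ω)) = f ∘ T from rfl, Set.range_comp]
    exact h.countable.image f
  fibre y := h.preimage (f ⁻¹' {y})

theorem prodMk {T : Ω → X} {T' : Ω → Y} (h : Discrete T) (h' : Discrete T') :
    Discrete fun ω => (T ω, T' ω) where
  countable := (h.countable.prod h'.countable).mono <| by
    rintro _ ⟨ω, rfl⟩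
    exact ⟨⟨ω, rfl⟩, ⟨ω, rfl⟩⟩
  fibre x := by
    have : (fun ω => (T ω, T' ω)) ⁻¹' {x} = T ⁻¹' {x.1} ∩ T' ⁻¹' {x.2} := by
      ext ω
      simp [Prod.ext_iff]
    rw [this]
    exact (h.fibre _).inter (h'.fibre _)

theorem comp₂ {T : Ω → X} {T' : Ω → Y} (h : Discrete T) (h' : Discrete T') (f : X → Y → Z) :
    Discrete fun ω => f (T ω) (T' ω) :=
  (h.prodMk h').comp fun x => f x.1 x.2

theorem const (x : X) : Discrete fun _ : Ω => x where
  countable := (Set.countable_singleton x).mono (by rintro _ ⟨ω, rfl⟩; rfl)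
  fibre y := by
    by_cases h : x = y <;> simp [h]

theorem list_map {S : Type*} (f : S → Ω → X) (hf : ∀ s, Discrete (f s)) (l : List S) :
    Discrete fun ω => l.map fun s => f s ω := by
  induction l with
  | nil => exact const []
  | cons s l ih => exact (hf s).comp₂ ih List.cons

theorem of_countable [Countable X] {T : Ω → X} (h : ∀ x, MeasurableSet (T ⁻¹' {x})) :
    Discrete T :=
  ⟨Set.to_countable _, h⟩

theorem pi {ι : Type*} [Finite ι] {T : ι → Ω → Bool} (h : ∀ i, MeasurableSet {ω | T i ω = true}) :
    Discrete fun ω i => T i ω := by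
  refine of_countable fun x => ?_
  have : (fun ω i => T i ω) ⁻¹' {x} = ⋂ i, {ω | T i ω = x i} := by
    ext ω
    simp [funext_iff]
  rw [this]
  refine MeasurableSet.iInter fun i => ?_
  cases x i
  · convert (h i).compl using 1
    ext ω
    simp
  · exact h i

theorem tsum_fibre {P : Measure Ω} [IsProbabilityMeasure P] {T : Ω → X} (h : Discrete T) :
    ∑' x : Set.range T, P (T ⁻¹' {x.1}) = 1 := by
  have := h.countable.to_subtype
  rw [← measure_iUnion, ← measure_univ (μ := P)]
  · congr 1
    ext ω
    simp
  · intro x y hxy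
    rw [Function.onFun, Set.disjoint_left]
    intro ω h₁ h₂
    apply hxy
    ext
    exact (show T ω = x.1 from h₁).symm.trans h₂
  · exact fun x => h.fibre _

/-- Conditioning on `T`, written as a sum over its countably many values. Only subadditivity is
used, so the sets `Bad x` need not be measurable. -/
theorem measure_le {P : Measure Ω} [IsProbabilityMeasure P] {T : Ω → X} (h : Discrete T)
    (Bad : X → Set Ω) {δ : ℝ≥0∞}
    (hBad : ∀ x ∈ Set.range T, P (T ⁻¹' {x} ∩ Bad x) ≤ P (T ⁻¹' {x}) * δ) :
    P {ω | ω ∈ Bad (T ω)} ≤ δ := by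
  have := h.countable.to_subtype
  have hsub : {ω | ω ∈ Bad (T ω)} ⊆ ⋃ x : Set.range T, T ⁻¹' {x.1} ∩ Bad x := by
    intro ω hω
    exact Set.mem_iUnion.2 ⟨⟨T ω, ω, rfl⟩, rfl, hω⟩
  calc P {ω | ω ∈ Bad (T ω)} ≤ ∑' x : Set.range T, P (T ⁻¹' {x.1} ∩ Bad x) :=
        (measure_mono hsub).trans (measure_iUnion_le _)
    _ ≤ ∑' x : Set.range T, P (T ⁻¹' {x.1}) * δ := ENNReal.tsum_le_tsum fun x => hBad x.1 x.2
    _ = δ := by rw [ENNReal.tsum_mul_right, h.tsum_fibre, one_mul]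

/-- Fubini's theorem for a countable partition of the first factor: if each fibre value leaves a
small bad set in the second factor, so does the whole. Again `Bad x` may be any set. -/
theorem measure_prod_le {Ω' : Type*} [MeasurableSpace Ω'] {P : Measure Ω} [IsProbabilityMeasure P]
    {Q : Measure Ω'} [IsProbabilityMeasure Q] {T : Ω → X} (h : Discrete T)
    (Bad : X → Set Ω') {δ : ℝ≥0∞} (hBad : ∀ x ∈ Set.range T, Q (Bad x) ≤ δ) :
    P.prod Q {ω | ω.2 ∈ Bad (T ω.1)} ≤ δ := by
  have := h.countable.to_subtype
  have hsub : {ω : Ω × Ω' | ω.2 ∈ Bad (T ω.1)} ⊆ ⋃ x : Set.range T, (T ⁻¹' {x.1}) ×ˢ Bad x := by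
    intro ω hω
    exact Set.mem_iUnion.2 ⟨⟨T ω.1, ω.1, rfl⟩, rfl, hω⟩
  calc P.prod Q {ω | ω.2 ∈ Bad (T ω.1)}
      ≤ ∑' x : Set.range T, P.prod Q ((T ⁻¹' {x.1}) ×ˢ Bad x) :=
        (measure_mono hsub).trans (measure_iUnion_le _)
    _ ≤ ∑' x : Set.range T, P (T ⁻¹' {x.1}) * δ := by
        refine ENNReal.tsum_le_tsum fun x => ?_
        rw [Measure.prod_prod]
        gcongr
        exact hBad x.1 x.2
    _ = δ := by rw [ENNReal.tsum_mul_right, h.tsum_fibre, one_mul]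

end Discrete

/-! ### Sampling -/

theorem integral_unitInterval (F : ℝ → ℝ) :
    ∫ u : unitInterval, F u = ∫ u in (0 : ℝ)..1, F u := by
  rw [intervalIntegral.integral_of_le zero_le_one, ← integral_Icc_eq_integral_Ioc]
  have h := unitInterval.measurePreserving_coe.integral_comp unitInterval.measurableEmbedding_coe F
  exact h

/-- Chebyshev's inequality for a sum of functions of independent random numbers. -/
theorem coinLaw_sum_le {F : unitInterval → ℝ} (hF : Measurable F) {C : ℝ} (hC : ∀ u, ‖F u‖ ≤ C)
    {V : ℝ} (hV : ∫ u, F u ^ 2 ≤ V) (b m : ℕ) {c : ℝ} (hc : 0 < c) :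
    coinLaw {z | c ≤ |∑ j ∈ Finset.range m, F (z (b + j)) - m * ∫ u, F u|} ≤
      ENNReal.ofReal (m * V / c ^ 2) := by
  set X : ℕ → (ℕ → unitInterval) → ℝ := fun j z => F (z (b + j)) with hX
  have hmp : ∀ j, MeasurePreserving (fun z : ℕ → unitInterval => z (b + j)) coinLaw volume :=
    fun j => measurePreserving_eval_infinitePi _ _
  have hXm : ∀ j, Measurable (X j) := fun j => hF.comp (measurable_pi_apply _)
  have hmem : ∀ j, MemLp (X j) 2 coinLaw := fun j =>
    MemLp.of_bound (hXm j).aestronglyMeasurable C (Filter.Eventually.of_forall fun z => hC _)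
  have hE : ∀ j, ∫ z, X j z ∂coinLaw = ∫ u, F u := by
    intro j
    have := integral_map (μ := coinLaw) (hmp j).measurable.aemeasurable
      (f := F) hF.aestronglyMeasurable
    rw [(hmp j).map_eq] at this
    exact this.symm
  have hE2 : ∀ j, ∫ z, X j z ^ 2 ∂coinLaw = ∫ u, F u ^ 2 := by
    intro j
    have := integral_map (μ := coinLaw) (hmp j).measurable.aemeasurable
      (f := fun u => F u ^ 2) (hF.pow_const 2).aestronglyMeasurable
    rw [(hmp j).map_eq] at this
    exact this.symm
  have hind : Set.Pairwise (Finset.range m : Set ℕ) fun i j =>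
      ProbabilityTheory.IndepFun (X i) (X j) coinLaw := by
    intro i _ j _ hij
    exact (ProbabilityTheory.iIndepFun_infinitePi (P := fun _ : ℕ => (volume : Measure unitInterval))
      (X := fun _ u => F u) fun _ => hF).indepFun (by omega : b + i ≠ b + j)
  have hvar := ProbabilityTheory.IndepFun.variance_sum (fun i _ => hmem i) hind
  have hcheb := ProbabilityTheory.meas_ge_le_variance_div_sq (μ := coinLaw)
    (X := ∑ j ∈ Finset.range m, X j) (memLp_finsetSum' _ fun i _ => hmem i) hc
  have hmean : ∫ z, (∑ j ∈ Finset.range m, X j) z ∂coinLaw = m * ∫ u, F u := by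
    simp only [Finset.sum_apply]
    rw [integral_finsetSum _ fun j _ => (hmem j).integrable one_le_two]
    simp [hE]
  rw [hmean] at hcheb
  simp only [Finset.sum_apply] at hcheb
  refine hcheb.trans (ENNReal.ofReal_le_ofReal ?_)
  gcongr
  rw [hvar]
  calc ∑ i ∈ Finset.range m, ProbabilityTheory.variance (X i) coinLaw
      ≤ ∑ i ∈ Finset.range m, V := by
        refine Finset.sum_le_sum fun i _ => ?_
        refine (ProbabilityTheory.variance_le_expectation_sq
          (hXm i).aestronglyMeasurable).trans ?_
        exact (hE2 i).le.trans hV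
    _ = m * V := by simp

section Sample

variable {X : Type} (β : X → ℕ → Bool) (wt : ℕ → ℝ) (N : ℕ)

open Classical in
/-- The element of `A` with a given bit string. -/
noncomputable def decode [Inhabited X] (A : Finset X) (l : List Bool) : X :=
  if h : ∃ a ∈ A, pre β a N = l then h.choose else default

variable {β wt N}

theorem decode_pre [Inhabited X] {A : Finset X}
    (hinj : ∀ a ∈ A, ∀ b ∈ A, pre β a N = pre β b N → a = b) {a : X} (ha : a ∈ A) :
    decode β N A (pre β a N) = a := by
  have h : ∃ b ∈ A, pre β b N = pre β a N := ⟨a, ha, rfl⟩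
  rw [decode, dif_pos h]
  exact hinj _ h.choose_spec.1 _ ha h.choose_spec.2

variable (β wt N) in
/-- The sum of the tree estimates. -/
noncomputable def treeSum (A B : Finset X) : ℝ := ∑ a ∈ A, treeDist β wt N B a

variable (β wt N) in
/-- The element of `A` that is selected by the number `u ∈ [0,1]`, with probability proportional
to the tree estimates. -/
noncomputable def sample [Inhabited X] (A B : Finset X) (u : ℝ) : X :=
  decode β N A (pick (msum β A (treeDist β wt N B)) N [] (u * treeSum β wt N A B))

/-- Holds for every `u` in the closed interval, without exceptional null set, since the programs
have to behave properly for all outcomes of the random numbers. -/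
theorem sample_mem [Inhabited X] {A B : Finset X} (hwt : ∀ p, 0 ≤ wt p)
    (hinj : ∀ a ∈ A, ∀ b ∈ A, pre β a N = pre β b N → a = b) (hpos : 0 < treeSum β wt N A B)
    {u : ℝ} (hu0 : 0 ≤ u) (hu1 : u ≤ 1) :
    sample β wt N A B u ∈ A ∧ 0 < treeDist β wt N B (sample β wt N A B u) ∧
      pick (msum β A (treeDist β wt N B)) N [] (u * treeSum β wt N A B) =
        pre β (sample β wt N A B u) N := by
  have hnil := msum_nil β A (treeDist β wt N B)
  obtain ⟨x, hx, h0, he⟩ := pick_spec (β := β) (S := A) (f := treeDist β wt N B)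
    (fun x _ => treeDist_nonneg β wt N hwt B x) N (l := [])
    (r := u * treeSum β wt N A B) (by rw [hnil]; exact hpos) (by positivity)
    (by rw [hnil]; exact mul_le_of_le_one_left hpos.le hu1)
  rw [List.length_nil, zero_add] at he
  have : sample β wt N A B u = x := by
    rw [sample, he, decode_pre hinj hx]
  rw [this]
  exact ⟨hx, h0, he⟩

theorem measurable_comp_sample [Inhabited X] (A B : Finset X) (g : X → ℝ) :
    Measurable fun u : unitInterval => g (sample β wt N A B u) :=
  (measurable_comp_pick (msum β A (treeDist β wt N B)) N [] fun l => g (decode β N A l)).comp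
    (measurable_subtype_coe.mul_const _)

theorem exists_bound_sample [Inhabited X] (A B : Finset X) (g : X → ℝ) :
    ∃ C, ∀ u : unitInterval, ‖g (sample β wt N A B u)‖ ≤ C := by
  obtain ⟨C, hC⟩ := exists_bound_pick (msum β A (treeDist β wt N B)) N []
    fun l => g (decode β N A l)
  exact ⟨C, fun u => hC _⟩

/-- Rescaling by the total weight reduces this to `integral_pick` at the root; distinct strings
allow passing from strings back to points. -/
theorem integral_sample [Inhabited X] {A B : Finset X} (hwt : ∀ p, 0 ≤ wt p)
    (hinj : ∀ a ∈ A, ∀ b ∈ A, pre β a N = pre β b N → a = b) (hpos : 0 < treeSum β wt N A B)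
    (g : X → ℝ) :
    ∫ u : unitInterval, g (sample β wt N A B u) =
      (∑ a ∈ A, treeDist β wt N B a * g a) / treeSum β wt N A B := by
  rw [integral_unitInterval fun u => g (sample β wt N A B u)]
  unfold sample
  rw [intervalIntegral.integral_comp_mul_right
    (fun r => g (decode β N A (pick (msum β A (treeDist β wt N B)) N [] r))) hpos.ne',
    zero_mul, one_mul]
  have h := integral_pick (β := β) (S := A) (f := treeDist β wt N B)
    (fun x _ => treeDist_nonneg β wt N hwt B x) (fun l => g (decode β N A l)) N []
  rw [msum_nil, msum_nil] at h
  rw [treeSum, h, smul_eq_mul, div_eq_inv_mul]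
  congr 1
  refine Finset.sum_congr rfl fun a ha => ?_
  rw [List.length_nil, zero_add, decode_pre hinj ha]

end Sample

/-! ### Concentration of the estimator -/

/-- For a fixed tree with good estimates, the estimator is unbiased and one sample has second moment
at most `W * 5 Lg * CH`, where `W ≤ 256 Lg * CH`; Chebyshev's inequality finishes. -/
theorem coinLaw_estimator_le {d : ℕ} {β : Pt d → ℕ → Bool} {wt : ℕ → ℝ} {N : ℕ}
    {A B : Finset (Pt d)} (hwt : ∀ p, 0 ≤ wt p)
    (hinj : ∀ a ∈ A, ∀ b ∈ A, pre β a N = pre β b N → a = b) (hpos : 0 < treeSum β wt N A B)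
    {Lg : ℕ} (h₁ : ∀ a ∈ A, distTo a B ≤ 5 * Lg * treeDist β wt N B a)
    (h₂ : treeSum β wt N A B ≤ 256 * Lg * chamfer A B) {ε : ℝ} (hε : 0 < ε) (b : ℕ) {m : ℕ}
    (hm : 2621440 * Lg ^ 2 / ε ^ 2 ≤ m) (hm0 : 0 < m) :
    coinLaw {z | ε / 8 * (m * chamfer A B) ≤
      |∑ j ∈ Finset.range m, (distTo (sample β wt N A B (z (b + j))) B *
        treeSum β wt N A B / treeDist β wt N B (sample β wt N A B (z (b + j)))) -
        m * chamfer A B|} ≤ ENNReal.ofReal (1 / 32) := by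
  set W := treeSum β wt N A B with hW
  set g : Pt d → ℝ := fun a => distTo a B * W / treeDist β wt N B a with hg
  have hCH : 0 < chamfer A B := by
    rcases (chamfer_nonneg A B).eq_or_lt with h | h
    · rw [← h, mul_zero] at h₂
      exact absurd (hpos.trans_le h₂) (lt_irrefl _)
    · exact h
  have hD : ∀ a ∈ A, 0 ≤ treeDist β wt N B a := fun a _ => treeDist_nonneg β wt N hwt B a
  have hmean : ∫ u : unitInterval, g (sample β wt N A B u) = chamfer A B := by
    rw [integral_sample hwt hinj hpos, div_eq_iff hpos.ne', chamfer, Finset.sum_mul]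
    refine Finset.sum_congr rfl fun a ha => ?_
    -- A point that is never sampled has estimate zero, and then `h₁` says that its distance is zero
    -- too; no part of the sum is lost.
    rcases (hD a ha).eq_or_lt with h | h
    · have h3 := h₁ a ha
      rw [← h, mul_zero] at h3
      rw [le_antisymm h3 (distTo_nonneg B a), ← h]
      simp
    · rw [hg]
      field_simp
  have hsq : ∫ u : unitInterval, g (sample β wt N A B u) ^ 2 ≤
      1280 * Lg ^ 2 * chamfer A B ^ 2 := by
    rw [integral_sample hwt hinj hpos fun a => g a ^ 2, div_le_iff₀ hpos]
    -- One factor `dist / D` is bounded by `5 * Lg`, the other distance is kept and summed up to the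
    -- Chamfer distance; 1280 = 5 · 256.
    calc ∑ a ∈ A, treeDist β wt N B a * g a ^ 2
        ≤ ∑ a ∈ A, W ^ 2 * (5 * Lg) * distTo a B := by
          refine Finset.sum_le_sum fun a ha => ?_
          have h0 := distTo_nonneg B a
          rcases (hD a ha).eq_or_lt with h | h
          · rw [← h, zero_mul]
            positivity
          · have : treeDist β wt N B a * g a ^ 2 =
                W ^ 2 * (distTo a B / treeDist β wt N B a) * distTo a B := by
              rw [hg]; field_simp
            rw [this]
            gcongr
            rw [div_le_iff₀ h]
            exact h₁ a ha
      _ = (W * (5 * Lg) * chamfer A B) * W := by rw [← Finset.mul_sum, chamfer]; ring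
      _ ≤ ((256 * Lg * chamfer A B) * (5 * Lg) * chamfer A B) * W := by gcongr
      _ = 1280 * Lg ^ 2 * chamfer A B ^ 2 * W := by ring
  obtain ⟨C, hC⟩ := exists_bound_sample (β := β) (wt := wt) (N := N) A B g
  have hm' : (0 : ℝ) < m := by exact_mod_cast hm0
  have := coinLaw_sum_le (F := fun u => g (sample β wt N A B u)) (measurable_comp_sample A B g)
    hC hsq b m (c := ε / 8 * (m * chamfer A B)) (by positivity)
  rw [hmean] at this
  refine this.trans (ENNReal.ofReal_le_ofReal ?_)
  rw [div_le_iff₀ (by positivity)] at hm ⊢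
  -- 2621440 = 1280 · 2048, where 2048 = 8² · 32 comes from the deviation `ε / 8` and the failure
  -- probability 1/32.
  have h3 : 1280 * (Lg : ℝ) ^ 2 ≤ ε ^ 2 * m / 2048 := by linarith
  calc (m : ℝ) * (1280 * Lg ^ 2 * chamfer A B ^ 2)
      ≤ m * (ε ^ 2 * m / 2048 * chamfer A B ^ 2) := by gcongr
    _ = 1 / 32 * (ε / 8 * (m * chamfer A B)) ^ 2 := by ring

/-! ### The random tree is independent of the random numbers used for sampling -/

section Independence

variable {d k J : ℕ}

theorem grid_finite (d U : ℕ) : (grid d U).Finite := by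
  have : grid d U = Set.pi Set.univ fun _ : Fin d => (fun m : ℕ => (m : ℝ)) '' Set.Icc 1 U := by
    ext x
    simp only [grid, Set.mem_ofPred_eq, Set.mem_pi, Set.mem_univ, true_imp_iff, Set.mem_image,
      Set.mem_Icc]
    refine forall_congr' fun i => exists_congr fun m => ?_
    constructor
    · rintro ⟨h1, h2, h3⟩; exact ⟨⟨h1, h2⟩, h3.symm⟩
    · rintro ⟨⟨h1, h2⟩, h3⟩; exact ⟨h1, h2, h3.symm⟩
  rw [this]
  exact Set.Finite.pi fun _ => (Set.finite_Icc 1 U).image _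

theorem measurableSet_rawBit (x : Pt d) (p : ℕ) :
    MeasurableSet {z : ℕ → unitInterval | rawBit k J z x p} := by
  by_cases h : p < 2 ^ J
  · have : {z : ℕ → unitInterval | rawBit k J z x p} = {_z | p ≠ 0} ∩ (fun z => (z p : ℝ)) ⁻¹'
        {u | heapBit (2 ^ k) (2 ^ J) (coord x) (J - Nat.log 2 p) p u} := by
      ext z
      simp [rawBit, h]
    rw [this]
    exact (MeasurableSet.const _).inter
      ((by fun_prop : Measurable fun z : ℕ → unitInterval => (z p : ℝ))
        (measurableSet_heapBit _ _ _ _ _))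
  · have : {z : ℕ → unitInterval | rawBit k J z x p} = {_z | p ≠ 0} ∩
        (fun z => gridCell k (coord x ((p - 2 ^ J) % d)) (k - (p - 2 ^ J) / d)
          (z (2 ^ J + (p - 2 ^ J) % d) : ℝ)) ⁻¹' {t : ℕ | t % 2 = 1} := by
      ext z
      simp [rawBit, h]
    rw [this]
    exact (MeasurableSet.const _).inter (((measurable_gridCell _ _).comp
      (by fun_prop : Measurable fun z : ℕ → unitInterval => (z (2 ^ J + (p - 2 ^ J) % d) : ℝ)))
      (MeasurableSet.of_discrete (s := {t : ℕ | t % 2 = 1})))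

/-- Outside the finite grid and beyond the depth all bits are false by definition, so the whole
family of strings is a function of finitely many measurable bits. -/
theorem discrete_bits : Discrete (bits (d := d) k J) := by
  classical
  have := (grid_finite d (2 ^ k)).to_subtype
  have h1 : Discrete fun (z : ℕ → unitInterval) (i : grid d (2 ^ k) × Fin (depth d k J)) =>
      bits k J z i.1.1 i.2 := by
    refine Discrete.pi (T := fun (i : grid d (2 ^ k) × Fin (depth d k J)) z =>
      bits k J z i.1.1 i.2) fun i => ?_
    have : {z : ℕ → unitInterval | bits k J z i.1.1 i.2 = true} =
        {z | rawBit k J z i.1.1 i.2} := by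
      ext z
      exact bits_of_mem i.1.2 i.2.2
    rw [this]
    exact measurableSet_rawBit _ _
  convert h1.comp fun t (x : Pt d) p =>
    if h : x ∈ grid d (2 ^ k) ∧ p < depth d k J then t (⟨x, h.1⟩, ⟨p, h.2⟩) else false using 1
  ext z x p
  by_cases h : x ∈ grid d (2 ^ k) ∧ p < depth d k J
  · simp [h]
  · rw [dif_neg h]
    have : ¬ (x ∈ grid d (2 ^ k) ∧ p < depth d k J ∧ rawBit k J z x p) := by tauto
    simp [bits, this]

/-- The trie depends on the first `2 ^ J + d` random numbers only: one per heap node and one shift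
per coordinate. -/
theorem bits_congr (hd : 0 < d) {z z' : ℕ → unitInterval} (h : ∀ i < 2 ^ J + d, z i = z' i) :
    bits (d := d) k J z = bits k J z' := by
  funext x p
  have : rawBit k J z x p ↔ rawBit k J z' x p := by
    unfold rawBit
    refine and_congr_right fun _ => ?_
    by_cases hp : p < 2 ^ J
    · rw [if_pos hp, if_pos hp, h p (by omega)]
    · rw [if_neg hp, if_neg hp, h _ (by have := Nat.mod_lt (p - 2 ^ J) hd; omega)]
  unfold bits
  rw [decide_eq_decide, this]

/-- Events about the bit strings are independent of events about later random numbers. -/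
theorem coinLaw_inter_eq (hd : 0 < d) (t : Pt d → ℕ → Bool) {b m : ℕ} (hb : 2 ^ J + d ≤ b)
    {S : Set (ℕ → unitInterval)} (hS : MeasurableSet S)
    (hSd : ∀ z z' : ℕ → unitInterval, (∀ j < m, z (b + j) = z' (b + j)) → z ∈ S → z' ∈ S) :
    coinLaw (bits k J ⁻¹' {t} ∩ S) = coinLaw (bits k J ⁻¹' {t}) * coinLaw S := by
  classical
  set I₁ := Finset.range (2 ^ J + d)
  set I₂ := Finset.Ico b (b + m)
  have hdisj : Disjoint I₁ I₂ := by
    rw [Finset.disjoint_left]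
    intro i h1 h2
    rw [Finset.mem_range] at h1
    rw [Finset.mem_Ico] at h2
    omega
  have hind := (ProbabilityTheory.iIndepFun_infinitePi
    (P := fun _ : ℕ => (volume : Measure unitInterval))
    (X := fun _ u => u) fun _ => measurable_id).indepFun_finset I₁ I₂ hdisj
    fun i => measurable_pi_apply i
  -- Both events depend on finitely many coordinates; filling the others with 0 expresses them
  -- through the restrictions, whose independence is available.
  set ext : (I : Finset ℕ) → (I → unitInterval) → ℕ → unitInterval :=
    fun I w i => if h : i ∈ I then w ⟨i, h⟩ else 0 with hext
  have hextm : ∀ I, Measurable (ext I) := by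
    intro I
    refine measurable_pi_lambda _ fun i => ?_
    by_cases h : i ∈ I
    · simp only [hext, h, dif_pos]
      exact measurable_pi_apply _
    · simp only [hext, h, dif_neg, not_false_eq_true]
      exact measurable_const
  have e₁ : bits k J ⁻¹' {t} = (fun (z : ℕ → unitInterval) (i : I₁) => z i) ⁻¹'
      (ext I₁ ⁻¹' (bits k J ⁻¹' {t})) := by
    ext z
    simp only [Set.mem_preimage]
    rw [bits_congr hd (z := ext I₁ fun i => z i) (z' := z)]
    intro i hi
    simp [hext, I₁, hi]
  have e₂ : S = (fun (z : ℕ → unitInterval) (i : I₂) => z i) ⁻¹' (ext I₂ ⁻¹' S) := by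
    ext z
    have hj : ∀ j < m, z (b + j) = ext I₂ (fun i => z i) (b + j) := by
      intro j hj
      simp [hext, I₂, hj]
    exact ⟨hSd _ _ hj, hSd _ _ fun j hjm => (hj j hjm).symm⟩
  have := hind.measure_inter_preimage_eq_mul _ _ (hextm I₁ ((discrete_bits (k := k) (J := J)).fibre t))
    (hextm I₂ hS)
  rw [← e₁, ← e₂] at this
  exact this

/-- The estimator of the Chamfer distance with exact distances of the samples. -/
noncomputable def estimator (k J : ℕ) (A B : Finset (Pt d)) (b m : ℕ) (z : ℕ → unitInterval) : ℝ :=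
  ∑ j ∈ Finset.range m,
    (distTo (sample (bits k J z) (bitWeight d k J) (depth d k J) A B (z (b + j))) B *
      treeSum (bits k J z) (bitWeight d k J) (depth d k J) A B /
      treeDist (bits k J z) (bitWeight d k J) (depth d k J) B
        (sample (bits k J z) (bitWeight d k J) (depth d k J) A B (z (b + j))))

/-- Given the bit strings, the random numbers used for sampling are still independent and uniform,
so the concentration bound applies to each good tree separately: 1/32. Bad trees add 3/16. -/
theorem coinLaw_bad_estimator_le (hd : 0 < d) (hJ : d ≤ 2 ^ J) {A B : Finset (Pt d)}
    (hA : ∀ a ∈ A, a ∈ grid d (2 ^ k)) (hBg : ∀ b ∈ B, b ∈ grid d (2 ^ k)) (hB : B.Nonempty)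
    {n Lg : ℕ} (hAn : A.card ≤ n) (hBn : B.card ≤ n) (hLg : 1 ≤ Lg) (hn : n ≤ 2 ^ Lg)
    {ε : ℝ} (hε : 0 < ε) {b m : ℕ} (hb : 2 ^ J + d ≤ b)
    (hm : 2621440 * Lg ^ 2 / ε ^ 2 ≤ m) (hm0 : 0 < m) :
    coinLaw {z | 0 < treeSum (bits k J z) (bitWeight d k J) (depth d k J) A B ∧
      ε / 8 * (m * chamfer A B) ≤ |estimator k J A B b m z - m * chamfer A B|} ≤
      ENNReal.ofReal (7 / 32) := by
  set N := depth d k J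
  set wt := bitWeight d k J
  set Bad : (Pt d → ℕ → Bool) → Set (ℕ → unitInterval) := fun β =>
    {z | 0 < treeSum β wt N A B ∧ (∀ a ∈ A, distTo a B ≤ 5 * Lg * treeDist β wt N B a) ∧
      treeSum β wt N A B ≤ 256 * Lg * chamfer A B ∧ ε / 8 * (m * chamfer A B) ≤
      |∑ j ∈ Finset.range m, (distTo (sample β wt N A B (z (b + j))) B *
        treeSum β wt N A B / treeDist β wt N B (sample β wt N A B (z (b + j)))) -
        m * chamfer A B|} with hBad
  have h₁ : coinLaw {z | z ∈ Bad (bits k J z)} ≤ ENNReal.ofReal (1 / 32) := by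
    refine discrete_bits.measure_le Bad ?_
    rintro _ ⟨z₀, rfl⟩
    set β := bits (d := d) k J z₀
    rw [coinLaw_inter_eq hd β hb (m := m)]
    · gcongr
      by_cases h : 0 < treeSum β wt N A B ∧ (∀ a ∈ A, distTo a B ≤ 5 * Lg * treeDist β wt N B a) ∧
          treeSum β wt N A B ≤ 256 * Lg * chamfer A B
      · refine (measure_mono fun z hz => hz.2.2.2).trans (coinLaw_estimator_le bitWeight_nonneg
          (fun a ha b hb hab => pre_bits_inj hd (hA a ha) (hA b hb) hab) h.1 h.2.1 h.2.2 hε b hm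
          hm0)
      · have : Bad β = ∅ := Set.eq_empty_of_forall_notMem fun z hz => h ⟨hz.1, hz.2.1, hz.2.2.1⟩
        rw [this, measure_empty]
        exact zero_le
    · have : Bad β = {_z | 0 < treeSum β wt N A B} ∩ ({_z | ∀ a ∈ A, distTo a B ≤
          5 * Lg * treeDist β wt N B a} ∩ ({_z | treeSum β wt N A B ≤ 256 * Lg * chamfer A B} ∩
          {z | ε / 8 * (m * chamfer A B) ≤
            |∑ j ∈ Finset.range m, (distTo (sample β wt N A B (z (b + j))) B *
            treeSum β wt N A B / treeDist β wt N B (sample β wt N A B (z (b + j)))) -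
            m * chamfer A B|})) := rfl
      rw [this]
      refine (MeasurableSet.const _).inter ((MeasurableSet.const _).inter
        ((MeasurableSet.const _).inter (measurableSet_le measurable_const ?_)))
      refine Measurable.abs (Measurable.sub_const (Finset.measurable_sum _ fun j _ => ?_) _)
      exact (measurable_comp_sample A B fun a => distTo a B * treeSum β wt N A B /
        treeDist β wt N B a).comp (measurable_pi_apply (b + j))
    · rintro z z' hzz ⟨h1, h2, h3, h4⟩
      refine ⟨h1, h2, h3, ?_⟩
      rw [Finset.sum_congr rfl fun j hj => ?_]
      · exact h4
      · rw [hzz j (Finset.mem_range.1 hj)]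
  have h₂ := coinLaw_not_goodTree_le (k := k) hd hJ hA hBg hB hAn hBn hLg hn
  calc coinLaw {z | 0 < treeSum (bits k J z) wt N A B ∧
        ε / 8 * (m * chamfer A B) ≤ |estimator k J A B b m z - m * chamfer A B|}
      ≤ coinLaw ({z | z ∈ Bad (bits k J z)} ∪ {z | ¬ GoodTree k J A B Lg z}) := by
        refine measure_mono fun z hz => ?_
        by_cases hg : GoodTree k J A B Lg z
        · exact Or.inl ⟨hz.1, hg.1, hg.2, hz.2⟩
        · exact Or.inr hg
    _ ≤ ENNReal.ofReal (1 / 32) + ENNReal.ofReal (3 / 16) :=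
        (measure_union_le _ _).trans (add_le_add h₁ h₂)
    _ = ENNReal.ofReal (7 / 32) := by
        rw [← ENNReal.ofReal_add] <;> norm_num

end Independence

/-! ### Initialization -/

/-- Repeated doubling; afterwards the scalar `c` is the logarithm of the bound. -/
def clogCmd (c : IExp) (bound : IExp) : Cmd :=
  .setI 1 c (.const 0) ;; .setI 10 (.const 0) (.const 1) ;;
  .while (.ilt (iv 10) bound)
    (.setI 10 (.const 0) (.add (iv 10) (iv 10)) ;;
      .setI 1 c (.add (.get 1 c) (.const 1)))

/-- The smallest power of two that is not smaller than the dimension. -/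
def powCmd : Cmd :=
  .setI 1 (.const 2) (.const 1) ;;
  .while (.ilt (.get 1 (.const 2)) (.get 0 (.const 1)))
    (.setI 1 (.const 2) (.add (.get 1 (.const 2)) (.get 1 (.const 2))))

/-- The length of the bit strings. -/
def depthCmd : Cmd :=
  .setI 1 (.const 3) (.get 1 (.const 2)) ;; .setI 10 (.const 0) (.const 0) ;;
  .while (.not (.ilt (.get 1 (.const 1)) (iv 10)))
    (.setI 1 (.const 3) (.add (.get 1 (.const 3)) (.get 0 (.const 1))) ;;
      .setI 10 (.const 0) (.add (iv 10) (.const 1)))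

/-- Drawing the random numbers that determine the bit strings. -/
def drawCmd : Cmd :=
  .setI 10 (.const 0) (.const 0) ;;
  .while (.ilt (iv 10) (.add (.get 1 (.const 2)) (.get 0 (.const 1))))
    (.rand 3 (iv 10) ;; .setI 10 (.const 0) (.add (iv 10) (.const 1)))

/-- Initialization of the memory. -/
def initCmd : Cmd :=
  clogCmd (.const 1) (.get 0 (.const 2)) ;; powCmd ;; clogCmd (.const 4) (.get 0 (.const 0)) ;;
  depthCmd ;; drawCmd ;;
  .setI 1 (.const 0) (.const 1) ;;
  .setI 1 (.const 5) (.add (.get 0 (.const 1)) (.const 1)) ;;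
  .setI 5 (.const 0) (.add (.get 1 (.const 5)) (.get 1 (.const 5)))

section

variable {d n : ℕ} {D : NNStructure d} {coins : ℕ → unitInterval} {seeds : ℕ → D.Seed}

theorem two_pow_lt_iff_lt_clog {x i : ℕ} : 2 ^ i < x ↔ i < Nat.clog 2 x := by
  rw [← not_le, ← not_le, Nat.clog_le_iff_le_pow (by norm_num)]

theorem run_clogCmd {i : ℕ} {bound : ℕ} (s : State d) :
    Run n D coins seeds (clogCmd (.const i) (.get 0 (.const bound))) s
      (20 * (Nat.clog 2 (s.ints 0 bound) + 1)) fun s' =>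
      s'.ints 1 i = Nat.clog 2 (s.ints 0 bound) ∧ ∀ j, j ≠ i → s'.ints 1 j = s.ints 1 j := by
  refine Run.straight_seq rfl (T₂ := 20 * Nat.clog 2 (s.ints 0 bound) + 14) ?_ ?_
  · norm_num [Cmd.fuel, IExp.cost]; linarith
  refine Run.straight_seq rfl (T₂ := 20 * Nat.clog 2 (s.ints 0 bound) + 10) ?_ ?_
  · norm_num [Cmd.fuel, IExp.cost]; linarith
  refine Run.loop_straight rfl (fun t s' => s'.ints 10 0 = 2 ^ t ∧ s'.ints 1 i = t ∧
    ∀ j, j ≠ i → s'.ints 1 j = s.ints 1 j) (Nat.clog 2 (s.ints 0 bound)) ?_ ?_ ?_ ?_ ?_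
  · simp +contextual
  · rintro t ht s' hf ⟨h1, h2, h3⟩
    have h0 := hf.ints 0 (by simp [Cmd.wI])
    simp at h0
    refine ⟨by simpa [h1, h0, two_pow_lt_iff_lt_clog] using ht, ?_, ?_, ?_⟩
    · simp [h1, pow_succ, mul_two]
    · simp [h2]
    · intro j hj
      simp [hj, h3 j hj]
  · rintro s' hf ⟨h1, h2, h3⟩
    have h0 := hf.ints 0 (by simp [Cmd.wI])
    simp at h0
    simp [h1, h0, two_pow_lt_iff_lt_clog]
  · norm_num [Cmd.fuel, IExp.cost, BExp.cost]; linarith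
  · rintro s' hf ⟨h1, h2, h3⟩
    exact ⟨h2, h3⟩

theorem run_powCmd (s : State d) :
    Run n D coins seeds powCmd s (20 * (Nat.clog 2 (s.ints 0 1) + 1)) fun s' =>
      s'.ints 1 2 = 2 ^ Nat.clog 2 (s.ints 0 1) ∧ ∀ j, j ≠ 2 → s'.ints 1 j = s.ints 1 j := by
  refine Run.straight_seq rfl (T₂ := 20 * Nat.clog 2 (s.ints 0 1) + 14) ?_ ?_
  · norm_num [Cmd.fuel, IExp.cost]; linarith
  refine Run.loop_straight rfl (fun t s' => s'.ints 1 2 = 2 ^ t ∧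
    ∀ j, j ≠ 2 → s'.ints 1 j = s.ints 1 j) (Nat.clog 2 (s.ints 0 1)) ?_ ?_ ?_ ?_ ?_
  · simp +contextual
  · rintro t ht s' hf ⟨h1, h3⟩
    have h0 := hf.ints 0 (by simp [Cmd.wI])
    simp at h0
    refine ⟨by simpa [h1, h0, two_pow_lt_iff_lt_clog] using ht, ?_, ?_⟩
    · simp [h1, pow_succ, mul_two]
    · intro j hj
      simp [hj, h3 j hj]
  · rintro s' hf ⟨h1, h3⟩
    have h0 := hf.ints 0 (by simp [Cmd.wI])
    simp at h0
    simp [h1, h0, two_pow_lt_iff_lt_clog]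
  · norm_num [Cmd.fuel, IExp.cost, BExp.cost]; linarith
  · rintro s' hf ⟨h1, h3⟩
    exact ⟨h1, h3⟩

theorem run_depthCmd (s : State d) :
    Run n D coins seeds depthCmd s (20 * (s.ints 1 1 + 2)) fun s' =>
      s'.ints 1 3 = s.ints 1 2 + s.ints 0 1 * (s.ints 1 1 + 1) ∧
        ∀ j, j ≠ 3 → s'.ints 1 j = s.ints 1 j := by
  refine Run.straight_seq rfl (T₂ := 20 * s.ints 1 1 + 34) ?_ ?_
  · norm_num [Cmd.fuel, IExp.cost]; linarith
  refine Run.straight_seq rfl (T₂ := 20 * s.ints 1 1 + 31) ?_ ?_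
  · norm_num [Cmd.fuel, IExp.cost]; linarith
  refine Run.loop_straight rfl (fun t s' => s'.ints 10 0 = t ∧
    s'.ints 1 3 = s.ints 1 2 + s.ints 0 1 * t ∧
    ∀ j, j ≠ 3 → s'.ints 1 j = s.ints 1 j) (s.ints 1 1 + 1) ?_ ?_ ?_ ?_ ?_
  · simp +contextual
  · rintro t ht s' hf ⟨h1, h2, h3⟩
    have h0 := hf.ints 0 (by simp [Cmd.wI])
    simp at h0
    refine ⟨by simp [h1, h3]; omega, ?_, ?_, ?_⟩
    · simp [h1]
    · simp [h0, h2]; ring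
    · intro j hj
      simp [hj, h3 j hj]
  · rintro s' hf ⟨h1, h2, h3⟩
    simp [h1, h3]
  · norm_num [Cmd.fuel, IExp.cost, BExp.cost]; linarith
  · rintro s' hf ⟨h1, h2, h3⟩
    exact ⟨h2, h3⟩

theorem run_drawCmd (s : State d) :
    Run n D coins seeds drawCmd s (20 * (s.ints 1 2 + s.ints 0 1 + 1)) fun s' =>
      (∀ i < s.ints 1 2 + s.ints 0 1, s'.reals 3 i = coins (s.drawn + i)) ∧
      s'.drawn = s.drawn + (s.ints 1 2 + s.ints 0 1) ∧ s'.hist = s.hist := by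
  refine Run.straight_seq rfl (T₂ := 20 * (s.ints 1 2 + s.ints 0 1) + 17) ?_ ?_
  · norm_num [Cmd.fuel, IExp.cost]; linarith
  refine Run.loop_straight rfl (fun t s' => s'.ints 10 0 = t ∧
    (∀ i < t, s'.reals 3 i = coins (s.drawn + i)) ∧ s'.drawn = s.drawn + t ∧ s'.hist = s.hist)
    (s.ints 1 2 + s.ints 0 1) ?_ ?_ ?_ ?_ ?_
  · simp
  · rintro t ht s' hf ⟨h1, h2, h3, h4⟩
    have h0 := hf.ints 0 (by simp [Cmd.wI])
    have h01 := hf.ints 1 (by simp [Cmd.wI])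
    simp at h0 h01
    refine ⟨by simpa [h0, h01, h1] using ht, by simp [h1], ?_, ?_, ?_⟩
    · intro i hi
      rcases Nat.lt_succ_iff_lt_or_eq.1 hi with h | rfl
      · simp [h1, h.ne, h2 i h]
      · simp [h1, h3]
    · simp [h3, add_assoc]
    · simp [h4]
  · rintro s' hf ⟨h1, h2, h3⟩
    have h0 := hf.ints 0 (by simp [Cmd.wI])
    have h01 := hf.ints 1 (by simp [Cmd.wI])
    simp at h0 h01
    simp [h1, h0, h01]
  · norm_num [Cmd.fuel, IExp.cost, BExp.cost]; linarith
  · rintro s' hf ⟨h1, h2, h3⟩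
    exact ⟨h2, h3⟩

/-! ### Assertions about the memory -/

/-- The parameters and the random numbers in the memory. -/
structure Env (n k J : ℕ) (ε : ℝ) (coins : ℕ → unitInterval) (s : State d) : Prop where
  size : s.ints 0 0 = n
  dim : s.ints 0 1 = d
  univ : s.ints 0 2 = 2 ^ k
  flag : s.ints 1 0 = 1
  logU : s.ints 1 1 = k
  half : s.ints 1 2 = 2 ^ J
  depth : s.ints 1 3 = depth d k J
  logn : s.ints 1 4 = Nat.clog 2 n
  root : s.ints 1 5 = d + 1
  eps : s.reals 1 1 = ε
  pad : ∀ i, d ≤ i → s.reals 0 i = 0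
  coin : ∀ i < 2 ^ J + d, s.reals 3 i = coins i

/-- The trie in the memory stores the sets `A` and `B`. -/
structure Forest (β : Pt d → ℕ → Bool) (wt : ℕ → ℝ) (N : ℕ) (A B : Finset (Pt d))
    (s : State d) : Prop where
  tree : TreeOK (d + 1) (s.ints 2) (s.ints 5 0)
  cntA : ∀ l, l.length ≤ N → s.ints 3 (node (s.ints 2) (d + 1) l) = cnt β A l
  cntB : ∀ l, l.length ≤ N → s.ints 4 (node (s.ints 2) (d + 1) l) = cnt β B l
  fresh : ∀ v, v = 0 ∨ s.ints 5 0 ≤ v → s.ints 3 v = 0 ∧ s.ints 4 v = 0 ∧ s.reals 5 v = 0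
  weight : WeightRec β wt N A B fun l => s.reals 5 (node (s.ints 2) (d + 1) l)
  point : ∀ x, x ∈ A ∨ x ∈ B → ∀ i : Fin d,
    s.reals 6 (node (s.ints 2) (d + 1) (pre β x N) + i) = x i

/-- A state before the initialization. -/
structure Fresh (n k : ℕ) (ε : ℝ) (s : State d) : Prop where
  size : s.ints 0 0 = n
  dim : s.ints 0 1 = d
  univ : s.ints 0 2 = 2 ^ k
  zeroI : ∀ a, a ≠ 0 → s.ints a = fun _ => 0
  eps : s.reals 1 1 = ε
  zeroR : ∀ a, 2 ≤ a → s.reals a = fun _ => 0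
  pad : ∀ i, d ≤ i → s.reals 0 i = 0
  drawn : s.drawn = 0
  hist : s.hist = fun _ => []

theorem Env.congr {k J : ℕ} {ε : ℝ} {s s' : State d} (h : Env n k J ε coins s)
    (h0 : s'.ints 0 = s.ints 0) (h1 : s'.ints 1 = s.ints 1) (r0 : s'.reals 0 = s.reals 0)
    (r1 : s'.reals 1 = s.reals 1) (r3 : s'.reals 3 = s.reals 3) : Env n k J ε coins s' := by
  obtain ⟨a1, a2, a3, a4, a5, a6, a7, a8, a9, a10, a11, a12⟩ := h
  constructor <;> simpa only [h0, h1, r0, r1, r3]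

theorem Forest.congr {β : Pt d → ℕ → Bool} {wt : ℕ → ℝ} {N : ℕ} {A B : Finset (Pt d)}
    {s s' : State d} (h : Forest β wt N A B s)
    (h2 : s'.ints 2 = s.ints 2) (h3 : s'.ints 3 = s.ints 3) (h4 : s'.ints 4 = s.ints 4)
    (h5 : s'.ints 5 = s.ints 5) (r5 : s'.reals 5 = s.reals 5) (r6 : s'.reals 6 = s.reals 6) :
    Forest β wt N A B s' := by
  obtain ⟨a1, a2, a3, a4, a5, a6⟩ := h
  constructor <;> simpa only [h2, h3, h4, h5, r5, r6]

theorem cnt_empty (β : Pt d → ℕ → Bool) (l : List Bool) : cnt β ∅ l = 0 := by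
  simp [cnt]

/-- The cost is linear in the dimension and the logarithms, so the first update can bear it. The
empty trie represents the empty sets for every choice of `β`, `wt` and `N`. -/
theorem run_initCmd {k : ℕ} {ε : ℝ} (hd : 1 ≤ d) {s : State d} (hs : Fresh n k ε s)
    (β : Pt d → ℕ → Bool) (wt : ℕ → ℝ) (N : ℕ) :
    Run n D coins seeds initCmd s
      (20 * (2 * k + Nat.clog 2 d + Nat.clog 2 n + 2 ^ Nat.clog 2 d + d + 10)) fun s' =>
      Env n k (Nat.clog 2 d) ε coins s' ∧ Forest β wt N ∅ ∅ s' ∧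
      s'.drawn = 2 ^ Nat.clog 2 d + d ∧ s'.hist = s.hist := by
  have hk : Nat.clog 2 (s.ints 0 2) = k := by rw [hs.univ, Nat.clog_pow _ _ (by norm_num)]
  have hz1 := hs.zeroI 1 (by norm_num)
  refine Run.seq' (run_clogCmd s) (T₂ := 20 * (k + Nat.clog 2 d + Nat.clog 2 n +
    2 ^ Nat.clog 2 d + d + 9)) ?_ (by rw [hk]; linarith)
  rintro s₁ f₁ ⟨a₁, b₁⟩
  have e₁ := f₁.ints 0 (by simp [clogCmd, Cmd.wI])
  refine Run.seq' (run_powCmd s₁) (T₂ := 20 * (k + Nat.clog 2 n +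
    2 ^ Nat.clog 2 d + d + 8)) ?_ (by rw [e₁, hs.dim]; linarith)
  rintro s₂ f₂ ⟨a₂, b₂⟩
  have e₂ := f₂.ints 0 (by simp [powCmd, Cmd.wI])
  refine Run.seq' (run_clogCmd s₂) (T₂ := 20 * (k + 2 ^ Nat.clog 2 d + d + 7)) ?_
    (by rw [e₂, e₁, hs.size]; linarith)
  rintro s₃ f₃ ⟨a₃, b₃⟩
  have e₃ := f₃.ints 0 (by simp [clogCmd, Cmd.wI])
  have h31 : s₃.ints 1 1 = k := by
    rw [b₃ 1 (by norm_num), b₂ 1 (by norm_num), a₁, hk]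
  have h32 : s₃.ints 1 2 = 2 ^ Nat.clog 2 d := by
    rw [b₃ 2 (by norm_num), a₂, e₁, hs.dim]
  refine Run.seq' (run_depthCmd s₃) (T₂ := 20 * (2 ^ Nat.clog 2 d + d + 5)) ?_
    (by rw [h31]; linarith)
  rintro s₄ f₄ ⟨a₄, b₄⟩
  have e₄ := f₄.ints 0 (by simp [depthCmd, Cmd.wI])
  have h40 : s₄.ints 0 = s.ints 0 := by rw [e₄, e₃, e₂, e₁]
  have hdr : s₄.drawn = 0 := by
    rw [f₄.drawn rfl, f₃.drawn rfl, f₂.drawn rfl, f₁.drawn rfl, hs.drawn]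
  have hhi : s₄.hist = s.hist := by
    rw [f₄.hist rfl, f₃.hist rfl, f₂.hist rfl, f₁.hist rfl]
  have h42 : s₄.ints 1 2 = 2 ^ Nat.clog 2 d := by rw [b₄ 2 (by norm_num), h32]
  refine Run.seq' (run_drawCmd s₄) (T₂ := 80) ?_
    (by rw [h40, hs.dim, h42]; push_cast; linarith)
  rintro s₅ f₅ ⟨a₅, b₅, c₅⟩
  have h5 : ∀ a, a ≠ 1 → a ≠ 10 → s₅.ints a = s.ints a := by
    intro a h1 h10
    rw [f₅.ints a (by simp [drawCmd, Cmd.wI, h10]), f₄.ints a (by simp [depthCmd, Cmd.wI, h1, h10]),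
      f₃.ints a (by simp [clogCmd, Cmd.wI, h1, h10]), f₂.ints a (by simp [powCmd, Cmd.wI, h1]),
      f₁.ints a (by simp [clogCmd, Cmd.wI, h1, h10])]
  have h51 : s₅.ints 1 = s₄.ints 1 := f₅.ints 1 (by simp [drawCmd, Cmd.wI])
  have h5r : ∀ a, a ≠ 3 → s₅.reals a = s.reals a := by
    intro a h3
    rw [f₅.reals a (by simp [drawCmd, Cmd.wR, h3]), f₄.reals a (by simp [depthCmd, Cmd.wR]),
      f₃.reals a (by simp [clogCmd, Cmd.wR]), f₂.reals a (by simp [powCmd, Cmd.wR]),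
      f₁.reals a (by simp [clogCmd, Cmd.wR])]
  rw [h40, hs.dim, h42, hdr] at a₅ b₅
  refine Run.straight rfl (by norm_num [Cmd.fuel, IExp.cost]) ⟨?_, ?_, ?_, ?_⟩
  · constructor
    · simp [h5, hs.size]
    · simp [h5, hs.dim]
    · simp [h5, hs.univ]
    · simp
    · simp [h51, b₄, h31]
    · simp [h51, h42]
    · simp [h51, a₄, h31, h32, e₃, e₂, e₁, hs.dim, DynChamfer.depth]
    · simp [h51, b₄, a₃, e₂, e₁, hs.size]
    · simp [h5, hs.dim]
    · simp [h5r, hs.eps]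
    · intro i hi
      simp [h5r, hs.pad i hi]
    · intro i hi
      simp [a₅ i hi]
  · have h2 : s₅.ints 2 = fun _ => 0 := by rw [h5 2 (by norm_num) (by norm_num), hs.zeroI 2 (by norm_num)]
    have h3 : s₅.ints 3 = fun _ => 0 := by rw [h5 3 (by norm_num) (by norm_num), hs.zeroI 3 (by norm_num)]
    have h4 : s₅.ints 4 = fun _ => 0 := by rw [h5 4 (by norm_num) (by norm_num), hs.zeroI 4 (by norm_num)]
    have hr : s₅.reals 5 = fun _ => 0 := by rw [h5r 5 (by norm_num), hs.zeroR 5 (by norm_num)]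
    constructor
    · have : TreeOK (d + 1) (fun _ => 0) (d + 1 + (d + 1)) := TreeOK.init (by omega)
      have e1 : s₅.ints 0 1 = d := by rw [h5 0 (by norm_num) (by norm_num), hs.dim]
      simpa [write_ne, h2, e1] using this
    · intro l _
      simp [write_ne, h3, cnt_empty]
    · intro l _
      simp [write_ne, h4, cnt_empty]
    · intro v _
      simp [h3, h4, hr]
    · constructor
      · intro l _
        simp [write_ne, hr]
      · intro l _
        simp [write_ne, hr, childWeight, cnt_empty]
    · simp
  · simpa using b₅
  · simp [c₅, hhi]

end

/-! ### Computing the bit string of a point -/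

/-- Descending in the heap of the coordinates. -/
def heapDescendCmd : Cmd :=
  .while (.ilt (iv 14) (.get 1 (.const 2)))
    (.ite (.rlt (.add (rv 10) (rv 10)) (.const 1))
      (.setI 14 (.const 0) (.add (iv 14) (iv 14)) ;; .setR 10 (.const 0) (.add (rv 10) (rv 10)))
      (.setI 14 (.const 0) (.add (.add (iv 14) (iv 14)) (.const 1)) ;;
        .setR 10 (.const 0) (.sub (.add (rv 10) (rv 10)) (.const 1))))

/-- Storing the bit and the weight of the heap node `v`, and proceeding to the next node. -/
def heapStoreCmd : Cmd :=
  .ite (.rlt (.mul (.ofInt (.get 0 (.const 2))) (rv 10))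
      (.get 0 (.sub (iv 14) (.get 1 (.const 2)))))
    (.setI 11 (iv 13) (.const 1)) (.setI 11 (iv 13) (.const 0)) ;;
  .setR 4 (iv 13) (rv 11) ;;
  .setI 13 (.const 0) (.add (iv 13) (.const 1)) ;;
  .ite (.ilt (iv 13) (.add (iv 15) (iv 15))) .skip
    (.setI 15 (.const 0) (.add (iv 15) (iv 15)) ;; .setR 11 (.const 0) (.div (rv 11) (.const 2)))

/-- The bits that belong to the nodes of the heap. -/
def heapBitsCmd : Cmd :=
  (.setI 11 (.const 0) (.const 0) ;; .setR 4 (.const 0) (.const 0) ;;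
    .setI 13 (.const 0) (.const 1) ;; .setI 15 (.const 0) (.const 1) ;;
    .setR 11 (.const 0) (.ofInt (.add (.get 0 (.const 2)) (.get 0 (.const 2)))) ;;
    .setR 11 (.const 0) (.mul (rv 11) (.ofInt (.get 1 (.const 2))))) ;;
  .while (.ilt (iv 13) (.get 1 (.const 2)))
    ((.setI 14 (.const 0) (iv 13) ;; .setR 10 (.const 0) (.get 3 (iv 13))) ;;
      heapDescendCmd ;; heapStoreCmd)

/-- The distances of the coordinates from the corner of the shifted grid. -/
def gridInitCmd : Cmd :=
  .setI 14 (.const 0) (.const 0) ;;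
  .while (.ilt (iv 14) (.get 0 (.const 1)))
    (.setR 12 (iv 14) (.add (.sub (.get 0 (iv 14)) (.const 1))
        (.mul (.ofInt (.get 0 (.const 2))) (.get 3 (.add (.get 1 (.const 2)) (iv 14))))) ;;
      .setI 14 (.const 0) (.add (iv 14) (.const 1)))

/-- The bits of one level of the grid. -/
def gridLevelCmd : Cmd :=
  .setI 14 (.const 0) (.const 0) ;;
  .while (.ilt (iv 14) (.get 0 (.const 1)))
    (.ite (.rlt (.get 12 (iv 14)) (rv 13)) (.setI 11 (iv 13) (.const 0))
        (.setI 11 (iv 13) (.const 1) ;;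
          .setR 12 (iv 14) (.sub (.get 12 (iv 14)) (rv 13))) ;;
      .setR 4 (iv 13) (.add (rv 13) (rv 13)) ;;
      .setI 13 (.const 0) (.add (iv 13) (.const 1)) ;;
      .setI 14 (.const 0) (.add (iv 14) (.const 1)))

/-- The bits that belong to the grid. -/
def gridBitsCmd : Cmd :=
  gridInitCmd ;;
  (.setR 13 (.const 0) (.ofInt (.get 0 (.const 2))) ;;
    .setI 13 (.const 0) (.get 1 (.const 2)) ;; .setI 15 (.const 0) (.const 0)) ;;
  .while (.not (.ilt (.get 1 (.const 1)) (iv 15)))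
    (gridLevelCmd ;; .setR 13 (.const 0) (.div (rv 13) (.const 2)) ;;
      .setI 15 (.const 0) (.add (iv 15) (.const 1)))

/-- The bit string of the point in the input, and the weights of the bits. -/
def bitsCmd : Cmd := heapBitsCmd ;; gridBitsCmd

section

variable {d n : ℕ} {D : NNStructure d} {coins : ℕ → unitInterval} {seeds : ℕ → D.Seed}

/-- The descendants of the current node on the bottom level are `v * 2 ^ j, …, (v + 1) * 2 ^ j - 1`.
Keeping this range inside `[2 ^ J, 2 ^ (J + 1))` makes the test `v < 2 ^ J` fail exactly after `j`
steps, although `j` is not known to the program. -/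
theorem run_heapDescendCmd {J j v : ℕ} (s : State d) (hs : s.ints 1 2 = 2 ^ J)
    (hi : s.ints 14 0 = v) (h₁ : 2 ^ J ≤ v * 2 ^ j) (h₂ : (v + 1) * 2 ^ j ≤ 2 * 2 ^ J) :
    Run n D coins seeds heapDescendCmd s (50 * j + 7) fun s' =>
      (s'.ints 14 0, s'.reals 10 0) = desc j v (s.reals 10 0) := by
  refine Run.loop_straight rfl (fun t s' =>
    desc (j - t) (s'.ints 14 0) (s'.reals 10 0) = desc j v (s.reals 10 0) ∧
    2 ^ J ≤ s'.ints 14 0 * 2 ^ (j - t) ∧ (s'.ints 14 0 + 1) * 2 ^ (j - t) ≤ 2 * 2 ^ J)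
    j ?_ ?_ ?_ ?_ ?_
  · simp [hi, h₁, h₂]
  · rintro t ht s' hf ⟨h3, h4, h5⟩
    have h0 := hf.ints 1 (by simp [Cmd.wI])
    obtain ⟨m, hm⟩ : ∃ m, j - t = m + 1 := ⟨j - t - 1, by omega⟩
    have hm' : j - (t + 1) = m := by omega
    rw [hm, pow_succ] at h4 h5
    rw [hm] at h3
    have hp : 0 < 2 ^ m := by positivity
    refine ⟨?_, ?_⟩
    · have : (s'.ints 14 0 + 1) * 2 ≤ 2 * 2 ^ J := by nlinarith
      simp [h0, hs]
      omega
    · rw [hm']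
      by_cases hb : s'.reals 10 0 + s'.reals 10 0 < 1
      · rw [Cmd.sem_ite_pos _ _ _ _ (by simpa using hb)]
        rw [desc, if_pos hb] at h3
        refine ⟨by simpa using h3, ?_, ?_⟩
        · simp; linarith
        · simp; nlinarith
      · rw [Cmd.sem_ite_neg _ _ _ _ (by simpa using hb)]
        rw [desc, if_neg hb] at h3
        refine ⟨by simpa using h3, ?_, ?_⟩
        · simp; nlinarith
        · simp; nlinarith
  · rintro s' hf ⟨h3, h4, h5⟩
    have h0 := hf.ints 1 (by simp [Cmd.wI])
    simp at h4
    simp [h0, hs, h4]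
  · norm_num [Cmd.fuel, IExp.cost, BExp.cost, RExp.cost]; linarith
  · rintro s' hf ⟨h3, h4, h5⟩
    simpa [desc] using h3

/-- The total height of the nodes of a heap is linear in its size: raising `J` by one adds one to
every summand, and there are fewer than `2 ^ (J + 1)` of them. Hence all heap bits together take
time `O(d)`, without a factor `log d`. -/
theorem sum_log_le (J : ℕ) :
    ∑ t ∈ Finset.range (2 ^ J - 1), (J - Nat.log 2 (t + 1)) ≤ 2 * 2 ^ J := by
  induction J with
  | zero => simp
  | succ J ih =>
    have hp : 0 < 2 ^ J := by positivity
    have hlog : ∀ t, t < 2 ^ (J + 1) - 1 → Nat.log 2 (t + 1) ≤ J := by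
      intro t ht
      have : t + 1 < 2 ^ (J + 1) := by omega
      have := Nat.log_lt_of_lt_pow (by omega) this
      omega
    have h1 : ∑ t ∈ Finset.range (2 ^ (J + 1) - 1), (J + 1 - Nat.log 2 (t + 1)) =
        ∑ t ∈ Finset.range (2 ^ (J + 1) - 1), ((J - Nat.log 2 (t + 1)) + 1) := by
      refine Finset.sum_congr rfl fun t ht => ?_
      have := hlog t (Finset.mem_range.1 ht)
      omega
    have h2 : ∑ t ∈ Finset.range (2 ^ (J + 1) - 1), (J - Nat.log 2 (t + 1)) =
        ∑ t ∈ Finset.range (2 ^ J - 1), (J - Nat.log 2 (t + 1)) := by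
      symm
      refine Finset.sum_subset (Finset.range_mono (by rw [pow_succ]; omega)) fun t _ ht => ?_
      rw [Finset.mem_range, not_lt] at ht
      have : J ≤ Nat.log 2 (t + 1) := Nat.le_log_of_pow_le (by norm_num) (by omega)
      omega
    rw [h1, Finset.sum_add_distrib, h2, Finset.sum_const, Finset.card_range, smul_eq_mul, pow_succ]
    omega

/-- The power of two at which the current heap level starts and the weight of this level are kept in
registers, since logarithms and powers are not machine operations. -/
theorem run_heapBitsCmd {k J : ℕ} {ε : ℝ} {x : Pt d} (s : State d)
    (hs : Env n k J ε coins s) (hx : ∀ i, s.reals 0 i = coord x i) (hg : x ∈ grid d (2 ^ k)) :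
    Run n D coins seeds heapBitsCmd s (500 * 2 ^ J) fun s' =>
      (∀ p < 2 ^ J, s'.ints 11 p = (bits k J coins x p).toNat) ∧
      (∀ p < 2 ^ J, s'.reals 4 p = bitWeight d k J p) := by
  have hpJ : 0 < 2 ^ J := by positivity
  have hpJ' : (1 : ℝ) ≤ 2 ^ J := one_le_pow₀ (by norm_num)
  refine Run.straight_seq rfl (T₂ := 450 * 2 ^ J) ?_ ?_
  · norm_num [Cmd.fuel, IExp.cost, RExp.cost]; linarith
  refine Run.loop_sum (fun t s' => s'.ints 13 0 = t + 1 ∧ s'.ints 15 0 = 2 ^ Nat.log 2 (t + 1) ∧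
    s'.reals 11 0 = 2 ^ (J + k + 1) / 2 ^ Nat.log 2 (t + 1) ∧
    (∀ p ≤ t, s'.ints 11 p = (bits k J coins x p).toNat) ∧
    (∀ p ≤ t, s'.reals 4 p = bitWeight d k J p)) (2 ^ J - 1)
    (fun t => ((50 * (J - Nat.log 2 (t + 1)) + 120 : ℕ) : ℝ)) ?_ ?_ ?_ ?_ ?_
  · refine ⟨by simp, by simp, ?_, ?_, ?_⟩
    · simp [hs.univ, hs.half]
      ring
    · intro p hp
      obtain rfl : p = 0 := by omega
      simp [bits_zero]
    · intro p hp
      obtain rfl : p = 0 := by omega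
      simp [bitWeight]
  · rintro t ht s' hf ⟨h1, h2, h3, h4, h5⟩
    have e0 := hf.ints 0 (by simp [Cmd.wI, heapDescendCmd, heapStoreCmd])
    have e1 := hf.ints 1 (by simp [Cmd.wI, heapDescendCmd, heapStoreCmd])
    have r0 := hf.reals 0 (by simp [Cmd.wR, heapDescendCmd, heapStoreCmd])
    have r3 := hf.reals 3 (by simp [Cmd.wR, heapDescendCmd, heapStoreCmd])
    simp [write_ne] at e0 e1 r0 r3
    have hu : s'.ints 0 2 = 2 ^ k := by rw [e0, hs.univ]
    have hh : s'.ints 1 2 = 2 ^ J := by rw [e1, hs.half]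
    have hlt : t + 1 < 2 ^ J := by omega
    set ℓ := Nat.log 2 (t + 1) with hℓ
    have hℓJ : ℓ < J := Nat.log_lt_of_lt_pow (by omega) hlt
    have hl1 : 2 ^ ℓ ≤ t + 1 := Nat.pow_log_le_self 2 (by omega)
    have hl2 : t + 1 < 2 ^ (ℓ + 1) := Nat.lt_pow_succ_log_self (by norm_num) _
    have hsplit : 2 ^ J = 2 ^ ℓ * 2 ^ (J - ℓ) := by rw [← pow_add]; congr 1; omega
    refine ⟨by simp [h1, hh, hlt], ?_⟩
    refine Run.straight_seq rfl (T₂ := 50 * ((J - ℓ : ℕ) : ℝ) + 110) ?_ ?_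
    · norm_num [Cmd.fuel, IExp.cost, RExp.cost]; linarith
    refine Run.seq' (T₂ := 90) (run_heapDescendCmd (J := J) (j := J - ℓ) (v := t + 1) _ (by simp [hh])
      (by simp [h1]) ?_ ?_) ?_ (by linarith)
    · rw [hsplit]; gcongr
    · rw [hsplit, ← mul_assoc]
      refine Nat.mul_le_mul_right _ ?_
      rw [pow_succ] at hl2; omega
    · intro s'' hf' hdesc
      have hz : s'.reals 3 (t + 1) = coins (t + 1) := by rw [r3, hs.coin _ (by omega)]
      simp [h1, hz] at hdesc
      have e0' := hf'.ints 0 (by simp [Cmd.wI, heapDescendCmd])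
      have e1' := hf'.ints 1 (by simp [Cmd.wI, heapDescendCmd])
      have e11' := hf'.ints 11 (by simp [Cmd.wI, heapDescendCmd])
      have e13' := hf'.ints 13 (by simp [Cmd.wI, heapDescendCmd])
      have e15' := hf'.ints 15 (by simp [Cmd.wI, heapDescendCmd])
      have r0' := hf'.reals 0 (by simp [Cmd.wR, heapDescendCmd])
      have r4' := hf'.reals 4 (by simp [Cmd.wR, heapDescendCmd])
      have r11' := hf'.reals 11 (by simp [Cmd.wR, heapDescendCmd])
      simp [write_ne] at e0' e1' e11' e13' e15' r0' r4' r11'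
      have hu' : s''.ints 0 2 = 2 ^ k := by rw [e0', hu]
      have hh' : s''.ints 1 2 = 2 ^ J := by rw [e1', hh]
      have h1' : s''.ints 13 0 = t + 1 := by rw [e13', h1]
      have h2' : s''.ints 15 0 = 2 ^ ℓ := by rw [e15', h2]
      have h3' : s''.reals 11 0 = 2 ^ (J + k + 1) / 2 ^ ℓ := by rw [r11', h3]
      have hbit : bits k J coins x (t + 1) = true ↔
          2 ^ k * s''.reals 10 0 < s''.reals 0 (s''.ints 14 0 - 2 ^ J) := by
        rw [bits_of_mem hg (by unfold depth; omega), rawBit, if_pos hlt, heapBit, ← hℓ, ← hdesc, r0', r0, hx]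
        simp
      have hw : bitWeight d k J (t + 1) = 2 ^ (J + k + 1) / 2 ^ ℓ := by
        rw [bitWeight, if_neg (by omega), scaleExp, if_pos hlt, ← hℓ, eq_div_iff (by positivity), ← pow_add]
        congr 1
        omega
      -- A new heap level begins exactly when the next index reaches twice the start of the current
      -- level.
      have hlog : Nat.log 2 (t + 1 + 1) = if t + 2 < 2 ^ ℓ + 2 ^ ℓ then ℓ else ℓ + 1 := by
        rw [pow_succ] at hl2
        split_ifs with h
        · exact (Nat.log_eq_iff (Or.inr ⟨by norm_num, by omega⟩)).2 ⟨by omega, by rw [pow_succ]; omega⟩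
        · exact (Nat.log_eq_iff (Or.inr ⟨by norm_num, by omega⟩)).2 ⟨by rw [pow_succ]; omega, by rw [pow_succ, pow_succ]; omega⟩
      -- Both outcomes of the comparison continue with the same commands, which are analysed once
      -- for an arbitrary stored bit `b`.
      have key : ∀ b : ℕ, b = (bits k J coins x (t + 1)).toNat →
          ∀ s₂ : State d, s₂ = { s'' with ints := write s''.ints 11 (t + 1) b } →
          ∃ s₃ : State d, s₃ = ((Cmd.setR 4 (iv 13) (rv 11) ;;
            Cmd.setI 13 (.const 0) (.add (iv 13) (.const 1)) ;;
            Cmd.ite (.ilt (iv 13) (.add (iv 15) (iv 15))) .skip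
              (.setI 15 (.const 0) (.add (iv 15) (iv 15)) ;; .setR 11 (.const 0) (.div (rv 11) (.const 2)))).sem
              coins s₂) ∧ s₃.ints 13 0 = t + 1 + 1 ∧ s₃.ints 15 0 = 2 ^ Nat.log 2 (t + 1 + 1) ∧
            s₃.reals 11 0 = 2 ^ (J + k + 1) / 2 ^ Nat.log 2 (t + 1 + 1) ∧
            (∀ p ≤ t + 1, s₃.ints 11 p = (bits k J coins x p).toNat) ∧
            (∀ p ≤ t + 1, s₃.reals 4 p = bitWeight d k J p) := by
        rintro b hb s₂ rfl
        have ha : ∀ p ≤ t + 1, (if p = t + 1 then b else s''.ints 11 p) = (bits k J coins x p).toNat := by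
          intro p hp
          split_ifs with h
          · rw [h, hb]
          · rw [e11', h4 p (by omega)]
        have hc : ∀ p ≤ t + 1, (if p = t + 1 then (2 : ℝ) ^ (J + k + 1) / 2 ^ ℓ else s''.reals 4 p) =
            bitWeight d k J p := by
          intro p hp
          split_ifs with h
          · rw [h, hw]
          · rw [r4', h5 p (by omega)]
        refine ⟨_, rfl, ?_⟩
        rw [hlog]
        simp only [Cmd.sem_seq]
        by_cases h : t + 2 < 2 ^ ℓ + 2 ^ ℓ
        · rw [Cmd.sem_ite_pos _ _ _ _ (by simpa [h1', h2'] using h)]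
          simp [h1', h2', h3', h, write_apply]
          exact ⟨ha, hc⟩
        · rw [Cmd.sem_ite_neg _ _ _ _ (by simpa [h1', h2'] using h)]
          simp [h1', h2', h3', h, write_apply]
          refine ⟨by ring, by rw [div_div, ← pow_succ], ha, hc⟩
      refine Run.straight rfl (by norm_num [Cmd.fuel, heapStoreCmd, IExp.cost, BExp.cost, RExp.cost]) ?_
      rw [heapStoreCmd, Cmd.sem_seq]
      by_cases hb : 2 ^ k * s''.reals 10 0 < s''.reals 0 (s''.ints 14 0 - 2 ^ J)
      · rw [Cmd.sem_ite_pos _ _ _ _ (by simpa [hu', hh'] using hb)]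
        obtain ⟨s₃, hs₃, hq⟩ := key 1 (by rw [hbit.2 hb]; rfl) _ rfl
        simp only [Cmd.sem_setI, IExp.eval, h1']
        rw [← hs₃]
        exact hq
      · rw [Cmd.sem_ite_neg _ _ _ _ (by simpa [hu', hh'] using hb)]
        obtain ⟨s₃, hs₃, hq⟩ := key 0 (by rw [Bool.eq_false_iff.2 (mt hbit.1 hb)]; rfl) _ rfl
        simp only [Cmd.sem_setI, IExp.eval, h1']
        rw [← hs₃]
        exact hq
  · rintro s' hf ⟨h1, -⟩
    have e1 := hf.ints 1 (by simp [Cmd.wI, heapDescendCmd, heapStoreCmd])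
    simp [write_ne] at e1
    simp [h1, e1, hs.half]
    omega
  · have h := sum_log_le J
    have h' : ((∑ t ∈ Finset.range (2 ^ J - 1), (J - Nat.log 2 (t + 1)) : ℕ) : ℝ) ≤ 2 * 2 ^ J := by
      exact_mod_cast h
    have h'' : ((2 ^ J - 1 : ℕ) : ℝ) = 2 ^ J - 1 := by
      rw [Nat.cast_sub hpJ]; simp
    simp only [Finset.sum_add_distrib, Nat.cast_add, Nat.cast_mul, ← Finset.mul_sum, Finset.sum_const,
      Finset.card_range, nsmul_eq_mul, h'']
    push_cast at h'
    norm_num [BExp.cost, IExp.cost]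
    linarith
  · rintro s' hf ⟨h1, h2, h3, h4, h5⟩
    exact ⟨fun p hp => h4 p (by omega), fun p hp => h5 p (by omega)⟩

theorem run_gridInitCmd {k J : ℕ} {ε : ℝ} {x : Pt d} (s : State d)
    (hs : Env n k J ε coins s) (hx : ∀ i, s.reals 0 i = coord x i) :
    Run n D coins seeds gridInitCmd s (50 * (d + 1)) fun s' =>
      ∀ i < d, s'.reals 12 i = coord x i - 1 + 2 ^ k * coins (2 ^ J + i) := by
  refine Run.straight_seq rfl (T₂ := 50 * d + 47) ?_ ?_
  · norm_num [Cmd.fuel, IExp.cost]; linarith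
  refine Run.loop_straight rfl (fun t s' => s'.ints 14 0 = t ∧
    ∀ i < t, s'.reals 12 i = coord x i - 1 + 2 ^ k * coins (2 ^ J + i)) d ?_ ?_ ?_ ?_ ?_
  · simp
  · rintro t ht s' hf ⟨h1, h2⟩
    have e0 := hf.ints 0 (by simp [Cmd.wI])
    have e1 := hf.ints 1 (by simp [Cmd.wI])
    have r0 := hf.reals 0 (by simp [Cmd.wR])
    have r3 := hf.reals 3 (by simp [Cmd.wR])
    simp [write_ne] at e0 e1 r0 r3
    refine ⟨by simpa [h1, e0, hs.dim] using ht, by simp [h1], ?_⟩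
    intro i hi
    rcases Nat.lt_succ_iff_lt_or_eq.1 hi with h | rfl
    · simp [h1, h.ne, h2 i h]
    · simp [h1, e0, e1, r0, r3, hs.univ, hs.half, hx, hs.coin (2 ^ J + i) (by omega)]
  · rintro s' hf ⟨h1, h2⟩
    have e0 := hf.ints 0 (by simp [Cmd.wI])
    simp [write_ne] at e0
    simp [h1, e0, hs.dim]
  · norm_num [Cmd.fuel, IExp.cost, BExp.cost, RExp.cost]; linarith
  · rintro s' hf ⟨h1, h2⟩
    exact h2

/-- Long division in base two: after subtracting the corner of the coarser cell, the remainder lies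
in the upper half of that cell exactly when the next digit is 1. Comparison and subtraction thus
replace the floor function. -/
theorem gridCell_step {k e : ℕ} {X u : ℝ} (hX : 1 ≤ X) (hu : 0 ≤ u) :
    (X - 1 + 2 ^ k * u - 2 ^ (e + 1) * gridCell k X (e + 1) u < 2 ^ e →
      gridCell k X e u % 2 = 0 ∧ (2 : ℝ) ^ e * gridCell k X e u = 2 ^ (e + 1) * gridCell k X (e + 1) u) ∧
    (¬ X - 1 + 2 ^ k * u - 2 ^ (e + 1) * gridCell k X (e + 1) u < 2 ^ e →
      gridCell k X e u % 2 = 1 ∧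
        (2 : ℝ) ^ e * gridCell k X e u = 2 ^ (e + 1) * gridCell k X (e + 1) u + 2 ^ e) := by
  have hsucc := gridCell_succ (k := k) X e u
  have hY : 0 ≤ X - 1 + 2 ^ k * u := by
    have : 0 ≤ 2 ^ k * u := by positivity
    linarith
  have hp : (0 : ℝ) < 2 ^ e := by positivity
  set g := gridCell k X e u with hg
  set g' := gridCell k X (e + 1) u
  have h1 : (g : ℝ) * 2 ^ e ≤ X - 1 + 2 ^ k * u := by
    rw [← le_div_iff₀ hp]
    exact Nat.floor_le (by positivity)
  have h2 : X - 1 + 2 ^ k * u < (g + 1) * 2 ^ e := by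
    rw [← div_lt_iff₀ hp]
    exact Nat.lt_floor_add_one _
  have h3 : g = 2 * g' + g % 2 := by omega
  have h4 : (g : ℝ) = 2 * g' + (g % 2 : ℕ) := by exact_mod_cast h3
  rw [pow_succ]
  rcases Nat.mod_two_eq_zero_or_one g with h | h
  · rw [h] at h4 ⊢
    push_cast at h4
    refine ⟨fun _ => ⟨rfl, by rw [h4]; ring⟩, fun hc => absurd ?_ hc⟩
    rw [h4] at h2
    nlinarith
  · rw [h] at h4 ⊢
    push_cast at h4
    refine ⟨fun hc => absurd hc ?_, fun _ => ⟨rfl, by rw [h4]; ring⟩⟩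
    rw [h4] at h1
    nlinarith

/-- For each coordinate the array 12 holds the distance from the corner of its cell at the previous,
coarser scale; one comparison with the side extracts the digit and refines the cell. -/
theorem run_gridLevelCmd {k J : ℕ} {x : Pt d} (s : State d) (hdim : s.ints 0 1 = d)
    (hg : x ∈ grid d (2 ^ k)) {q : ℕ} (hq : q ≤ k) (hp : s.ints 13 0 = 2 ^ J + q * d)
    (hsc : s.reals 13 0 = 2 ^ (k - q))
    (hrem : ∀ i < d, s.reals 12 i = coord x i - 1 + 2 ^ k * coins (2 ^ J + i) -
      2 ^ (k - q + 1) * gridCell k (coord x i) (k - q + 1) (coins (2 ^ J + i))) :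
    Run n D coins seeds gridLevelCmd s (100 * (d + 1)) fun s' =>
      s'.ints 13 0 = 2 ^ J + (q + 1) * d ∧
      (∀ i < d, s'.reals 12 i = coord x i - 1 + 2 ^ k * coins (2 ^ J + i) -
        2 ^ (k - q) * gridCell k (coord x i) (k - q) (coins (2 ^ J + i))) ∧
      (∀ p < 2 ^ J + (q + 1) * d, s'.ints 11 p = if p < 2 ^ J + q * d then s.ints 11 p else
        (bits k J coins x p).toNat) ∧
      (∀ p < 2 ^ J + (q + 1) * d, s'.reals 4 p = if p < 2 ^ J + q * d then s.reals 4 p else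
        bitWeight d k J p) := by
  refine Run.straight_seq rfl (T₂ := 100 * d + 90) ?_ ?_
  · norm_num [Cmd.fuel, IExp.cost]; linarith
  refine Run.loop_straight rfl (fun t s' => s'.ints 14 0 = t ∧ s'.ints 13 0 = 2 ^ J + q * d + t ∧
    (∀ i < d, s'.reals 12 i = if i < t then coord x i - 1 + 2 ^ k * coins (2 ^ J + i) -
        2 ^ (k - q) * gridCell k (coord x i) (k - q) (coins (2 ^ J + i)) else s.reals 12 i) ∧
    (∀ p < 2 ^ J + q * d + t, s'.ints 11 p = if p < 2 ^ J + q * d then s.ints 11 p else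
        (bits k J coins x p).toNat) ∧
    (∀ p < 2 ^ J + q * d + t, s'.reals 4 p = if p < 2 ^ J + q * d then s.reals 4 p else
        bitWeight d k J p)) d ?_ ?_ ?_ ?_ ?_
  · refine ⟨by simp, by simp [hp], by simp, ?_, ?_⟩
    · intro p hp
      rw [add_zero] at hp
      simp [hp]
    · intro p hp
      rw [add_zero] at hp
      simp [hp]
  · rintro t ht s' hf ⟨h1, h2, h3, h4, h5⟩
    have e0 := hf.ints 0 (by simp [Cmd.wI])
    have r13 := hf.reals 13 (by simp [Cmd.wR])
    simp [write_ne] at e0 r13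
    have hcoin : (0 : ℝ) ≤ coins (2 ^ J + t) := (coins _).2.1
    have hmod : (2 ^ J + q * d + t - 2 ^ J) % d = t := by
      rw [add_assoc, Nat.add_sub_cancel_left, mul_comm, Nat.mul_add_mod, Nat.mod_eq_of_lt ht]
    have hdiv : (2 ^ J + q * d + t - 2 ^ J) / d = q := by
      rw [add_assoc, Nat.add_sub_cancel_left, mul_comm, Nat.mul_add_div (by omega),
        Nat.div_eq_of_lt ht, add_zero]
    have hdep : 2 ^ J + q * d + t < depth d k J := by
      unfold depth
      have : (q + 1) * d ≤ d * (k + 1) := by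
        rw [mul_comm]; exact Nat.mul_le_mul_left _ (by omega)
      rw [add_mul] at this
      omega
    have hpos : 0 < 2 ^ J := by positivity
    have hbit : bits k J coins x (2 ^ J + q * d + t) = true ↔
        gridCell k (coord x t) (k - q) (coins (2 ^ J + t)) % 2 = 1 := by
      rw [bits_of_mem hg hdep, rawBit, if_neg (by omega), hmod, hdiv]
      simp
    have hw : bitWeight d k J (2 ^ J + q * d + t) = 2 ^ (k - q) + 2 ^ (k - q) := by
      rw [bitWeight, if_neg (by omega), scaleExp, if_neg (by omega), hdiv, pow_succ, mul_two]
    have hr : s'.reals 12 t = _ := (h3 t ht).trans ((if_neg (lt_irrefl t)).trans (hrem t ht))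
    obtain ⟨hlo, hhi⟩ := gridCell_step (k := k) (e := k - q) (one_le_coord hg ht) hcoin
    refine ⟨by simpa [h1, e0, hdim] using ht, ?_⟩
    have hc : ∀ p < 2 ^ J + q * d + (t + 1), (if p = 2 ^ J + q * d + t then
        (2 : ℝ) ^ (k - q) + 2 ^ (k - q) else s'.reals 4 p) =
        if p < 2 ^ J + q * d then s.reals 4 p else bitWeight d k J p := by
      intro p hp
      by_cases h : p = 2 ^ J + q * d + t
      · rw [if_pos h, if_neg (by omega), h, hw]
      · rw [if_neg h, h5 p (by omega)]
    have ha : ∀ b : ℕ, b = (bits k J coins x (2 ^ J + q * d + t)).toNat →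
        ∀ p < 2 ^ J + q * d + (t + 1), (if p = 2 ^ J + q * d + t then
        b else s'.ints 11 p) =
        if p < 2 ^ J + q * d then s.ints 11 p else (bits k J coins x p).toNat := by
      intro b hb p hp
      by_cases h : p = 2 ^ J + q * d + t
      · rw [if_pos h, if_neg (by omega), h, hb]
      · rw [if_neg h, h4 p (by omega)]
    rw [Cmd.sem_seq]
    by_cases hb : s'.reals 12 t < 2 ^ (k - q)
    · rw [Cmd.sem_ite_pos _ _ _ _ (by simpa [h1, r13, hsc] using hb)]
      rw [hr] at hb
      obtain ⟨m1, m2⟩ := hlo hb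
      have hb0 : 0 = (bits k J coins x (2 ^ J + q * d + t)).toNat := by
        rw [Bool.eq_false_iff.2 (mt hbit.1 (by omega))]; rfl
      refine ⟨by simp [h1], by simp [h2, add_assoc], ?_, ?_, ?_⟩
      · intro i hi
        rcases lt_trichotomy i t with h | rfl | h
        · simpa [h, Nat.lt_succ_of_lt h] using h3 i hi
        · simp [hr, m2]
        · simpa [h.not_gt, show ¬ i < t + 1 by omega] using h3 i hi
      · simpa [h2] using ha 0 hb0
      · simpa [h2, r13, hsc] using hc
    · rw [Cmd.sem_ite_neg _ _ _ _ (by simpa [h1, r13, hsc] using hb)]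
      rw [hr] at hb
      obtain ⟨m1, m2⟩ := hhi hb
      have hb0 : 1 = (bits k J coins x (2 ^ J + q * d + t)).toNat := by
        rw [hbit.2 m1]; rfl
      refine ⟨by simp [h1], by simp [h2, add_assoc], ?_, ?_, ?_⟩
      · intro i hi
        rcases lt_trichotomy i t with h | rfl | h
        · simpa [h1, h.ne, h, Nat.lt_succ_of_lt h] using h3 i hi
        · simp [h1, hr, m2, r13, hsc]; ring
        · simpa [h1, h.ne', h.not_gt, show ¬ i < t + 1 by omega] using h3 i hi
      · simpa [h2] using ha 1 hb0
      · simpa [h2, r13, hsc] using hc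
  · rintro s' hf ⟨h1, -⟩
    have e0 := hf.ints 0 (by simp [Cmd.wI])
    simp [write_ne] at e0
    simp [h1, e0, hdim]
  · norm_num [Cmd.fuel, IExp.cost, BExp.cost, RExp.cost]; linarith
  · rintro s' hf ⟨h1, h2, h3, h4, h5⟩
    have : 2 ^ J + q * d + d = 2 ^ J + (q + 1) * d := by ring
    rw [this] at h2 h4 h5
    refine ⟨h2, fun i hi => by simp [h3 i hi, hi], h4, h5⟩

theorem run_bitsCmd {k J : ℕ} {ε : ℝ} {x : Pt d} (s : State d)
    (hs : Env n k J ε coins s) (hx : ∀ i, s.reals 0 i = coord x i) (hg : x ∈ grid d (2 ^ k)) :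
    Run n D coins seeds bitsCmd s (500 * (2 ^ J + d * (k + 2) + k + 2)) fun s' =>
      (∀ p < depth d k J, s'.ints 11 p = (bits k J coins x p).toNat) ∧
      (∀ p < depth d k J, s'.reals 4 p = bitWeight d k J p) := by
  refine Run.seq' (run_heapBitsCmd s hs hx hg) (T₂ := 500 * (d * (k + 2) + k + 2)) ?_ (by linarith)
  rintro s₁ f₁ ⟨a₁, b₁⟩
  have hs₁ : Env n k J ε coins s₁ := hs.congr (f₁.ints 0 (by decide)) (f₁.ints 1 (by decide))
    (f₁.reals 0 (by decide)) (f₁.reals 1 (by decide)) (f₁.reals 3 (by decide))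
  have hx₁ : ∀ i, s₁.reals 0 i = coord x i := by rw [f₁.reals 0 (by decide)]; exact hx
  refine Run.seq' (run_gridInitCmd s₁ hs₁ hx₁) (T₂ := 500 * (d * (k + 1) + k + 1)) ?_
    (by nlinarith [Nat.cast_nonneg (α := ℝ) d])
  rintro s₂ f₂ a₂
  have hs₂ : Env n k J ε coins s₂ := hs₁.congr (f₂.ints 0 (by decide)) (f₂.ints 1 (by decide))
    (f₂.reals 0 (by decide)) (f₂.reals 1 (by decide)) (f₂.reals 3 (by decide))
  have c₂ : s₂.ints 11 = s₁.ints 11 := f₂.ints 11 (by decide)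
  have d₂ : s₂.reals 4 = s₁.reals 4 := f₂.reals 4 (by decide)
  refine Run.straight_seq rfl (T₂ := 500 * (d * (k + 1) + k + 1) - 20) ?_ ?_
  · norm_num [Cmd.fuel, IExp.cost, RExp.cost]; linarith
  refine Run.loop (fun q s' => s'.ints 15 0 = q ∧ s'.ints 13 0 = 2 ^ J + q * d ∧
    s'.reals 13 0 = 2 ^ k / 2 ^ q ∧
    (∀ i < d, s'.reals 12 i = coord x i - 1 + 2 ^ k * coins (2 ^ J + i) -
      2 ^ (k + 1 - q) * gridCell k (coord x i) (k + 1 - q) (coins (2 ^ J + i))) ∧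
    (∀ p < 2 ^ J + q * d, s'.ints 11 p = (bits k J coins x p).toNat) ∧
    (∀ p < 2 ^ J + q * d, s'.reals 4 p = bitWeight d k J p)) (k + 1)
    (T := 100 * (d + 1) + 20) ?_ ?_ ?_ ?_ ?_
  · refine ⟨by simp, by simp [hs₂.half], by simp [hs₂.univ], ?_, ?_, ?_⟩
    · intro i hi
      -- The division starts from the common cell 0 one level above the coarsest grid, so the first
      -- remainder is the shifted coordinate itself.
      have h0 : gridCell k (coord x i) (k + 1) (coins (2 ^ J + i)) = 0 :=
        gridCell_top (coord_nonneg_le hg i).2 (coins _).2.2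
      simp [a₂ i hi, h0]
    · intro p hp
      simp at hp
      simp [c₂, a₁ p hp]
    · intro p hp
      simp at hp
      simp [d₂, b₁ p hp]
  · rintro q hq s' hf ⟨h1, h2, h3, h4, h5, h6⟩
    have e0 := hf.ints 0 (by decide)
    have e1 := hf.ints 1 (by decide)
    simp [write_ne] at e0 e1
    refine ⟨by simp [h1, e1, hs₂.logU]; omega, ?_⟩
    refine Run.seq' (run_gridLevelCmd s' (by rw [e0, hs₂.dim]) hg (q := q) (by omega) h2
      (by rw [h3, pow_sub₀ _ (by norm_num) (by omega)]; rfl) ?_) (T₂ := 20) ?_ le_rfl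
    · intro i hi
      rw [h4 i hi, show k + 1 - q = k - q + 1 by omega]
    · rintro s₃ f₃ ⟨g1, g2, g3, g4⟩
      have e15 := f₃.ints 15 (by decide)
      have e13 := f₃.reals 13 (by decide)
      refine Run.straight rfl (by norm_num [Cmd.fuel, IExp.cost, RExp.cost]) ?_
      refine ⟨by simp [e15, h1], by simp [g1], ?_, ?_, ?_, ?_⟩
      · simp [e13, h3, pow_succ, div_div]
      · intro i hi
        simp [g2 i hi]
      · intro p hp
        have := g3 p hp
        split_ifs at this with h
        · simp [this, h5 p h]
        · simp [this]
      · intro p hp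
        have := g4 p hp
        split_ifs at this with h
        · simp [this, h6 p h]
        · simp [this]
  · rintro s' hf ⟨h1, -⟩
    have e1 := hf.ints 1 (by decide)
    simp [write_ne] at e1
    simp [h1, e1, hs₂.logU]
  · norm_num [BExp.cost, IExp.cost]
    nlinarith [Nat.cast_nonneg (α := ℝ) d, Nat.cast_nonneg (α := ℝ) k,
      mul_nonneg (Nat.cast_nonneg (α := ℝ) d) (Nat.cast_nonneg (α := ℝ) k)]
  · rintro s' hf ⟨h1, h2, h3, h4, h5, h6⟩
    have : 2 ^ J + (k + 1) * d = depth d k J := by unfold depth; ring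
    rw [this] at h5 h6
    exact ⟨h5, h6⟩

end

/-! ### Updating the trie -/

/-- Walking down the path of a bit string; missing nodes are created. -/
def pathCmd : Cmd :=
  .setI 14 (.const 0) (.get 1 (.const 5)) ;; .setI 12 (.const 0) (.get 1 (.const 5)) ;;
  .setI 13 (.const 0) (.const 0) ;;
  .while (.ilt (iv 13) (.get 1 (.const 3)))
    (.setI 15 (.const 0) (.add (iv 14) (.get 11 (iv 13))) ;;
      .ite (.ilt (.get 2 (iv 15)) (.const 1))
        (.setI 2 (iv 15) (iv 5) ;; .setI 5 (.const 0) (.add (iv 5) (.get 1 (.const 5)))) .skip ;;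
      .setI 14 (.const 0) (.get 2 (iv 15)) ;;
      .setI 13 (.const 0) (.add (iv 13) (.const 1)) ;;
      .setI 12 (iv 13) (iv 14))

/-- Storing the coordinates of the input at the end of the path. -/
def storeCmd : Cmd :=
  .setI 14 (.const 0) (.const 0) ;;
  .while (.ilt (iv 14) (.get 0 (.const 1)))
    (.setR 6 (.add (.get 12 (.get 1 (.const 3))) (iv 14)) (.get 0 (iv 14)) ;;
      .setI 14 (.const 0) (.add (iv 14) (.const 1)))

/-- Increments or decrements. -/
def bump (ins : Bool) (m : ℕ) : ℕ := bif ins then m + 1 else m - 1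

/-- Updating the counters on the path. -/
def countCmd (arr : ℕ) (ins : Bool) : Cmd :=
  .setI 13 (.const 0) (.const 0) ;;
  .while (.not (.ilt (.get 1 (.const 3)) (iv 13)))
    (.setI arr (.get 12 (iv 13)) (bif ins then .add (.get arr (.get 12 (iv 13))) (.const 1)
        else .sub (.get arr (.get 12 (iv 13))) (.const 1)) ;;
      .setI 13 (.const 0) (.add (iv 13) (.const 1)))

/-- The weight of the part of `A` below a child of the node `v`; the points that leave the trie of
`B` there have the weight `w`. -/
def childCmd (v : IExp) (w : RExp) (b r : ℕ) : Cmd :=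
  .setI 14 (.const 0) (.get 2 (.add v (.const b))) ;;
  .ite (.ilt (.const 0) (.get 4 (iv 14))) (.setR r (.const 0) (.get 5 (iv 14)))
    (.setR r (.const 0) (.mul (.ofInt (.get 3 (iv 14))) w))

/-- Recomputing the weights on the path. -/
def weighCmd : Cmd :=
  .setI 13 (.const 0) (.get 1 (.const 3)) ;;
  .while (.ilt (.const 0) (iv 13))
    (.setI 13 (.const 0) (.sub (iv 13) (.const 1)) ;;
      childCmd (.get 12 (iv 13)) (.get 4 (iv 13)) 0 10 ;; childCmd (.get 12 (iv 13)) (.get 4 (iv 13)) 1 11 ;;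
      .setR 5 (.get 12 (iv 13)) (.add (rv 10) (rv 11)))

theorem write_same {α : Type} (m : ℕ → ℕ → α) (arr i : ℕ) (v : α) :
    write m arr i v arr = Function.update (m arr) i v := by
  simp [write]

section

variable {d n : ℕ} {D : NNStructure d} {coins : ℕ → unitInterval} {seeds : ℕ → D.Seed}
variable {β : Pt d → ℕ → Bool} {wt : ℕ → ℝ} {N : ℕ} {A B A' B' : Finset (Pt d)} {x : Pt d}

/-- The path of the point `x` in the trie. -/
structure Path (β : Pt d → ℕ → Bool) (N : ℕ) (x : Pt d) (s : State d) : Prop where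
  eq : ∀ p ≤ N, s.ints 12 p = node (s.ints 2) (d + 1) (pre β x p)
  ne : ∀ p ≤ N, node (s.ints 2) (d + 1) (pre β x p) ≠ 0

theorem Path.congr {s s' : State d} (h : Path β N x s) (h2 : s'.ints 2 = s.ints 2)
    (h12 : s'.ints 12 = s.ints 12) : Path β N x s' := by
  obtain ⟨a, b⟩ := h
  constructor <;> simpa only [h2, h12]

theorem Path.node_eq_iff {s : State d} (h : Path β N x s)
    (ht : TreeOK (d + 1) (s.ints 2) (s.ints 5 0)) {p : ℕ} (hp : p ≤ N) (l : List Bool) :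
    node (s.ints 2) (d + 1) l = node (s.ints 2) (d + 1) (pre β x p) ↔ l = pre β x p :=
  ⟨fun e => (ht.node_inj (h.ne p hp) e.symm).symm, fun e => by rw [e]⟩

/-- The trie may grow without changing its contents. -/
theorem Forest.grow {s s' : State d} (h : Forest β wt N A B s)
    (ht : TreeOK (d + 1) (s'.ints 2) (s'.ints 5 0)) (hle : s.ints 5 0 ≤ s'.ints 5 0)
    (hn : ∀ l, node (s'.ints 2) (d + 1) l = node (s.ints 2) (d + 1) l ∨
      node (s.ints 2) (d + 1) l = 0 ∧ s.ints 5 0 ≤ node (s'.ints 2) (d + 1) l)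
    (h3 : s'.ints 3 = s.ints 3) (h4 : s'.ints 4 = s.ints 4)
    (r5 : s'.reals 5 = s.reals 5) (r6 : s'.reals 6 = s.reals 6) : Forest β wt N A B s' := by
  have z := h.fresh 0 (Or.inl rfl)
  refine ⟨ht, fun l hl => ?_, fun l hl => ?_, fun v hv => ?_, ?_, fun y hy i => ?_⟩
  · rw [← h.cntA l hl, h3]
    rcases hn l with e | ⟨e, e'⟩
    · rw [e]
    · rw [e, z.1, (h.fresh _ (Or.inr e')).1]
  · rw [← h.cntB l hl, h4]
    rcases hn l with e | ⟨e, e'⟩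
    · rw [e]
    · rw [e, z.2.1, (h.fresh _ (Or.inr e')).2.1]
  · rw [h3, h4, r5]
    exact h.fresh v (hv.imp_right hle.trans)
  · have : (fun l => s'.reals 5 (node (s'.ints 2) (d + 1) l)) =
        fun l => s.reals 5 (node (s.ints 2) (d + 1) l) := by
      funext l
      rw [r5]
      rcases hn l with e | ⟨e, e'⟩
      · rw [e]
      · rw [e, z.2.2, (h.fresh _ (Or.inr e')).2.2]
    rw [this]
    exact h.weight
  · have hne : node (s.ints 2) (d + 1) (pre β y N) ≠ 0 := by
      intro e
      rcases hy with hy | hy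
      · have := (cnt_pos β (S := A) (l := pre β y N)).2 ⟨y, hy, by simp⟩
        rw [← h.cntA _ (by simp), e, z.1] at this
        exact lt_irrefl _ this
      · have := (cnt_pos β (S := B) (l := pre β y N)).2 ⟨y, hy, by simp⟩
        rw [← h.cntB _ (by simp), e, z.2.1] at this
        exact lt_irrefl _ this
    rcases hn (pre β y N) with e | ⟨e, -⟩
    · rw [r6, e, h.point y hy i]
    · exact absurd e hne

/-- Growing the tree does not change what it represents: missing nodes and unused blocks both carry
zero counters and zero weights (`Forest.grow`). -/
theorem run_pathCmd (s : State d) (hroot : s.ints 1 5 = d + 1) (hN : s.ints 1 3 = N)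
    (hb : ∀ p < N, s.ints 11 p = (β x p).toNat) (hF : Forest β wt N A B s) :
    Run n D coins seeds pathCmd s (60 * (N + 1)) fun s' =>
      Forest β wt N A B s' ∧ Path β N x s' := by
  refine Run.straight_seq rfl (T₂ := 60 * N + 56) ?_ ?_
  · norm_num [Cmd.fuel, IExp.cost]; linarith
  refine Run.straight_seq rfl (T₂ := 60 * N + 50) ?_ ?_
  · norm_num [Cmd.fuel, IExp.cost]; linarith
  refine Run.straight_seq rfl (T₂ := 60 * N + 40) ?_ ?_
  · norm_num [Cmd.fuel, IExp.cost]; linarith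
  refine Run.loop_straight rfl (fun t s' => s'.ints 13 0 = t ∧
    s'.ints 14 0 = node (s'.ints 2) (d + 1) (pre β x t) ∧ Path β t x s' ∧
    TreeOK (d + 1) (s'.ints 2) (s'.ints 5 0) ∧ s.ints 5 0 ≤ s'.ints 5 0 ∧
    ∀ l, node (s'.ints 2) (d + 1) l = node (s.ints 2) (d + 1) l ∨
      node (s.ints 2) (d + 1) l = 0 ∧ s.ints 5 0 ≤ node (s'.ints 2) (d + 1) l) N
    ?_ ?_ ?_ ?_ ?_
  · have hr : node (s.ints 2) (d + 1) [] = d + 1 := rfl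
    refine ⟨by simp, by simp [write_ne, hroot, hr], ⟨?_, ?_⟩, ?_, by simp, ?_⟩
    · intro p hp
      obtain rfl : p = 0 := by omega
      simp [write_ne, hroot, hr]
    · intro p hp
      obtain rfl : p = 0 := by omega
      simp [write_ne, hr]
    · simpa [write_ne] using hF.tree
    · simp [write_ne]
  · rintro t ht s' hf ⟨h1, h2, h3, h4, h5, h6⟩
    have e1 := hf.ints 1 (by decide)
    have e11 := hf.ints 11 (by decide)
    simp [write_ne] at e1 e11
    have hbt : s'.ints 11 t = (β x t).toNat := by rw [e11, hb t ht]
    refine ⟨by simp [h1, e1, hN, ht], ?_⟩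
    have hne := h3.ne t le_rfl
    have happ : pre β x (t + 1) = pre β x t ++ [β x t] := pre_succ β x t
    rw [Cmd.sem_seq]
    set a := node (s'.ints 2) (d + 1) (pre β x t) + (β x t).toNat with ha
    have hs₂ : (Cmd.setI 15 (.const 0) (.add (iv 14) (.get 11 (iv 13)))).sem coins s' =
        { s' with ints := write s'.ints 15 0 a } := by
      simp [h1, h2, hbt, ha]
    rw [hs₂, Cmd.sem_seq]
    -- A missing child is created at the first free block; by `TreeOK.node_extend` no existing node
    -- moves.
    by_cases hz : s'.ints 2 a = 0
    · rw [Cmd.sem_ite_pos _ _ _ _ (by simp [hz])]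
      have ht' := h4.extend (b := β x t) hne
      have hext := h4.node_extend (l := pre β x t) (b := β x t) hz
      rw [← ha] at ht' hext
      have hnew : node (Function.update (s'.ints 2) a (s'.ints 5 0)) (d + 1) (pre β x (t + 1)) =
          s'.ints 5 0 := by
        rw [happ, node_append]
        have : node (Function.update (s'.ints 2) a (s'.ints 5 0)) (d + 1) (pre β x t) =
            node (s'.ints 2) (d + 1) (pre β x t) :=
          (hext (pre β x t)).resolve_right fun h => hne h.1
        rw [this, ← ha, Function.update_self]
      have hnx : s'.ints 5 0 ≠ 0 := by
        have := h4.lt 0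
        omega
      have hroot' : s'.ints 1 5 = d + 1 := by rw [e1, hroot]
      refine ⟨by simp [h1], ?_, ⟨?_, ?_⟩, ?_, ?_, ?_⟩
      · simp [write_same, write_ne, hnew]
      · intro p hp
        rcases Nat.le_succ_iff.1 hp with h | rfl
        · have := (hext (pre β x p)).resolve_right fun h' => h3.ne p h h'.1
          have h' : p ≠ t + 1 := by omega
          simp [write_same, write_ne, h1, h', this, h3.eq p h]
        · simp [write_same, write_ne, h1, hnew]
      · intro p hp
        rcases Nat.le_succ_iff.1 hp with h | rfl
        · have := (hext (pre β x p)).resolve_right fun h' => h3.ne p h h'.1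
          simpa [write_same, write_ne, this] using h3.ne p h
        · simpa [write_same, write_ne, hnew] using hnx
      · simpa [write_same, write_ne, hroot'] using ht'
      · simp
        omega
      · have hold : ∀ l, node (Function.update (s'.ints 2) a (s'.ints 5 0)) (d + 1) l =
            node (s.ints 2) (d + 1) l ∨ node (s.ints 2) (d + 1) l = 0 ∧
            s.ints 5 0 ≤ node (Function.update (s'.ints 2) a (s'.ints 5 0)) (d + 1) l := by
          intro l
          rcases hext l with e | ⟨e, e'⟩
          · rw [e]; exact h6 l
          · refine Or.inr ⟨?_, h5.trans e'⟩
            rcases h6 l with h | h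
            · rw [← h, e]
            · exact h.1
        simpa [write_same, write_ne] using hold
    · rw [Cmd.sem_ite_neg _ _ _ _ (by simp; omega)]
      have hnew : node (s'.ints 2) (d + 1) (pre β x (t + 1)) = s'.ints 2 a := by
        rw [happ, node_append]
      refine ⟨by simp [h1], ?_, ⟨?_, ?_⟩, ?_, ?_, ?_⟩
      · simp [write_ne, hnew]
      · intro p hp
        rcases Nat.le_succ_iff.1 hp with h | rfl
        · have h' : p ≠ t + 1 := by omega
          simp [write_ne, h1, h', h3.eq p h]
        · simp [write_ne, h1, hnew]
      · intro p hp
        rcases Nat.le_succ_iff.1 hp with h | rfl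
        · simpa [write_ne] using h3.ne p h
        · simpa [write_ne, hnew] using hz
      · simpa [write_ne] using h4
      · simpa using h5
      · simpa [write_ne] using h6
  · rintro s' hf ⟨h1, -⟩
    have e1 := hf.ints 1 (by decide)
    simp [write_ne] at e1
    simp [h1, e1, hN]
  · norm_num [Cmd.fuel, IExp.cost, BExp.cost]; linarith
  · rintro s' hf ⟨h1, h2, h3, h4, h5, h6⟩
    refine ⟨hF.grow h4 h5 h6 ?_ ?_ ?_ ?_, h3⟩
    · rw [hf.ints 3 (by decide)]; simp [write_ne]
    · rw [hf.ints 4 (by decide)]; simp [write_ne]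
    · rw [hf.reals 5 (by decide)]; simp
    · rw [hf.reals 6 (by decide)]; simp

theorem run_storeCmd (s : State d) (hdim : s.ints 0 1 = d) (hN : s.ints 1 3 = N)
    (hx : ∀ i : Fin d, s.reals 0 i = x i) (hF : Forest β wt N A B s) (hP : Path β N x s)
    (hinj : ∀ y, y ∈ A ∨ y ∈ B → pre β y N = pre β x N → y = x) :
    Run n D coins seeds storeCmd s (50 * (d + 1)) fun s' =>
      (∀ y, y ∈ A ∨ y ∈ B ∨ y = x → ∀ i : Fin d,
        s'.reals 6 (node (s.ints 2) (d + 1) (pre β y N) + i) = y i) := by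
  refine Run.straight_seq rfl (T₂ := 50 * d + 47) ?_ ?_
  · norm_num [Cmd.fuel, IExp.cost]; linarith
  set v := node (s.ints 2) (d + 1) (pre β x N) with hv
  refine Run.loop_straight rfl (fun t s' => s'.ints 14 0 = t ∧
    ∀ a, s'.reals 6 a = if v ≤ a ∧ a < v + t then s.reals 0 (a - v) else s.reals 6 a) d
    ?_ ?_ ?_ ?_ ?_
  · refine ⟨by simp, fun a => ?_⟩
    rw [if_neg (by omega)]
    rfl
  · rintro t ht s' hf ⟨h1, h2⟩
    have e0 := hf.ints 0 (by decide)
    have e1 := hf.ints 1 (by decide)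
    have e12 := hf.ints 12 (by decide)
    have r0 := hf.reals 0 (by decide)
    simp [write_ne] at e0 e1 e12 r0
    refine ⟨by simp [h1, e0, hdim, ht], by simp [h1], fun a => ?_⟩
    simp only [Cmd.sem_seq, Cmd.sem_setI, Cmd.sem_setR, IExp.eval, RExp.eval, write_apply, e1, hN,
      e12, hP.eq N le_rfl, h1, r0, ← hv, h2, true_and]
    by_cases h : a = v + t
    · rw [if_pos h, if_pos (by omega), h, Nat.add_sub_cancel_left]
    · rw [if_neg h]
      congr 1
      simp only [eq_iff_iff]
      omega
  · rintro s' hf ⟨h1, -⟩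
    have e0 := hf.ints 0 (by decide)
    simp [write_ne] at e0
    simp [h1, e0, hdim]
  · norm_num [Cmd.fuel, IExp.cost, BExp.cost, RExp.cost]; linarith
  · rintro s' hf ⟨-, h2⟩ y hy i
    rw [h2]
    by_cases hyx : y = x
    · subst hyx
      rw [if_pos ⟨by omega, by have := i.2; omega⟩, Nat.add_sub_cancel_left, hx]
    · have hy' : y ∈ A ∨ y ∈ B := by tauto
      rw [if_neg, hF.point y hy' i]
      rintro ⟨h3, h4⟩
      -- The overwritten cells lie in the block of the leaf of `x`, and blocks are disjoint, so `y`
      -- would have the bit string of `x`.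
      have := hF.tree.node_add_inj (l := pre β y N) (l' := pre β x N) (i := i)
        (i' := node (s.ints 2) (d + 1) (pre β y N) + i - v) (by omega) (by omega)
        (by rw [← hv]; omega)
      exact hyx (hinj y hy' ((hP.node_eq_iff hF.tree le_rfl _).1 this.1))

/-- The `N + 1` nodes of the path have distinct addresses, so each counter is changed exactly once;
cells of missing nodes and unused blocks are not touched. -/
theorem run_countCmd {arr : ℕ} (harr : arr = 3 ∨ arr = 4) (ins : Bool) (s : State d)
    (hN : s.ints 1 3 = N) (ht : TreeOK (d + 1) (s.ints 2) (s.ints 5 0)) (hP : Path β N x s) :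
    Run n D coins seeds (countCmd arr ins) s (50 * (N + 2)) fun s' =>
      (∀ l, l.length ≤ N → s'.ints arr (node (s.ints 2) (d + 1) l) =
        if pre β x l.length = l then bump ins (s.ints arr (node (s.ints 2) (d + 1) l))
        else s.ints arr (node (s.ints 2) (d + 1) l)) ∧
      (∀ v, v = 0 ∨ s.ints 5 0 ≤ v → s'.ints arr v = s.ints arr v) := by
  have hcost : (bif ins then IExp.add (.get arr (.get 12 (iv 13))) (.const 1)
        else .sub (.get arr (.get 12 (iv 13))) (.const 1)).cost = 6 := by
    cases ins <;> rfl
  refine Run.straight_seq rfl (T₂ := 50 * (N + 2) - 10) ?_ ?_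
  · norm_num [Cmd.fuel, IExp.cost]; linarith
  refine Run.loop_straight rfl (fun t s' => s'.ints 13 0 = t ∧
    (∀ l, l.length ≤ N → s'.ints arr (node (s.ints 2) (d + 1) l) =
        if pre β x l.length = l ∧ l.length < t then
          bump ins (s.ints arr (node (s.ints 2) (d + 1) l))
        else s.ints arr (node (s.ints 2) (d + 1) l)) ∧
      (∀ v, v = 0 ∨ s.ints 5 0 ≤ v → s'.ints arr v = s.ints arr v)) (N + 1)
    ?_ ?_ ?_ ?_ ?_
  · rcases harr with rfl | rfl <;> simp
  · rintro t ht' s' hf ⟨h1, h2, h3⟩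
    have e1 := hf.ints 1 (by rcases harr with rfl | rfl <;> simp [Cmd.wI])
    have e12 := hf.ints 12 (by rcases harr with rfl | rfl <;> simp [Cmd.wI])
    simp [write_ne] at e1 e12
    have hpath : s'.ints 12 t = node (s.ints 2) (d + 1) (pre β x t) := by
      rw [e12, hP.eq t (by omega)]
    -- So far only counters of strictly shorter prefixes have been changed.
    have hval : s'.ints arr (node (s.ints 2) (d + 1) (pre β x t)) =
        s.ints arr (node (s.ints 2) (d + 1) (pre β x t)) := by
      rw [h2 _ (by simp; omega), if_neg (by simp)]
    have hsem : (Cmd.setI arr (.get 12 (iv 13)) (bif ins then .add (.get arr (.get 12 (iv 13))) (.const 1)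
        else .sub (.get arr (.get 12 (iv 13))) (.const 1))).sem coins s' =
        { s' with
          ints := write s'.ints arr (node (s.ints 2) (d + 1) (pre β x t)) (bump ins
            (s.ints arr (node (s.ints 2) (d + 1) (pre β x t)))) } := by
      cases ins <;> simp [h1, hpath, hval, bump]
    have harr' : arr ≠ 13 ∧ (13 : ℕ) ≠ arr := by omega
    refine ⟨by simp [h1, e1, hN]; omega, ?_⟩
    rw [Cmd.sem_seq, hsem]
    refine ⟨by simp [harr'.2, h1], fun l hl => ?_, fun v hv => ?_⟩
    · simp only [Cmd.sem_setI, write_apply, harr'.1, false_and, if_false, true_and,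
        hP.node_eq_iff ht (show t ≤ N by omega), h2 l hl]
      by_cases h : l = pre β x t
      · subst h
        simp
      · rw [if_neg h]
        congr 1
        simp only [eq_iff_iff, and_congr_right_iff]
        intro h'
        have : l.length ≠ t := fun h'' => h (by rw [← h', h''])
        omega
    · simp only [Cmd.sem_setI, write_apply, harr'.1, false_and, if_false, true_and]
      rw [if_neg, h3 v hv]
      rintro rfl
      have h₁ := hP.ne t (by omega)
      have h₂ := ht.node_lt (pre β x t)
      omega
  · rintro s' hf ⟨h1, -⟩
    have e1 := hf.ints 1 (by rcases harr with rfl | rfl <;> simp [Cmd.wI])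
    simp [write_ne] at e1
    simp [h1, e1, hN]
  · norm_num [Cmd.fuel, hcost, IExp.cost, BExp.cost]
    linarith
  · rintro s' hf ⟨-, h2, h3⟩
    refine ⟨fun l hl => ?_, h3⟩
    rw [h2 l hl]
    simp [Nat.lt_succ_of_le hl]

open Classical in
theorem sem_childCmd (v : IExp) (w : RExp) (b r : ℕ) (s : State d) :
    (childCmd v w b r).sem coins s =
      { s with
        ints := write s.ints 14 0 (s.ints 2 (v.eval s + b))
        reals := write s.reals r 0 (if 0 < s.ints 4 (s.ints 2 (v.eval s + b)) then
          s.reals 5 (s.ints 2 (v.eval s + b)) else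
          s.ints 3 (s.ints 2 (v.eval s + b)) *
            w.eval { s with ints := write s.ints 14 0 (s.ints 2 (v.eval s + b)) }) } := by
  rw [childCmd, Cmd.sem_seq]
  by_cases h : 0 < s.ints 4 (s.ints 2 (v.eval s + b))
  · rw [Cmd.sem_ite_pos _ _ _ _ (by simpa using h)]
    simp [h]
  · rw [Cmd.sem_ite_neg _ _ _ _ (by simpa using h)]
    simp [h]

/-- Bottom-up repair. A node off the path has both children off the path, so its equation survives
the change of the counters. A node on the path is recomputed after its child on the path, and then
its equation holds for good. -/
theorem run_weighCmd (s : State d) (hN : s.ints 1 3 = N) (hwt : ∀ p < N, s.reals 4 p = wt p)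
    (ht : TreeOK (d + 1) (s.ints 2) (s.ints 5 0)) (hP : Path β N x s)
    (hA : ∀ l, l.length ≤ N → s.ints 3 (node (s.ints 2) (d + 1) l) = cnt β A l)
    (hB : ∀ l, l.length ≤ N → s.ints 4 (node (s.ints 2) (d + 1) l) = cnt β B l)
    (hleaf : ∀ l, l.length = N → s.reals 5 (node (s.ints 2) (d + 1) l) = 0)
    (hinner : ∀ l, l.length < N → pre β x l.length ≠ l →
      s.reals 5 (node (s.ints 2) (d + 1) l) =
        childWeight β A B (fun l => s.reals 5 (node (s.ints 2) (d + 1) l)) (wt l.length) (l ++ [false]) +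
        childWeight β A B (fun l => s.reals 5 (node (s.ints 2) (d + 1) l)) (wt l.length) (l ++ [true])) :
    Run n D coins seeds weighCmd s (100 * (N + 1)) fun s' =>
      WeightRec β wt N A B (fun l => s'.reals 5 (node (s.ints 2) (d + 1) l)) ∧
      (∀ v, v = 0 ∨ s.ints 5 0 ≤ v → s'.reals 5 v = s.reals 5 v) := by
  refine Run.straight_seq rfl (T₂ := 100 * N + 90) ?_ ?_
  · norm_num [Cmd.fuel, IExp.cost]; linarith
  refine Run.loop_straight rfl (fun t s' => s'.ints 13 0 = N - t ∧
    (∀ l, l.length = N → s'.reals 5 (node (s.ints 2) (d + 1) l) = 0) ∧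
    (∀ l, l.length < N → ¬ (pre β x l.length = l ∧ l.length < N - t) →
      s'.reals 5 (node (s.ints 2) (d + 1) l) =
        childWeight β A B (fun l => s'.reals 5 (node (s.ints 2) (d + 1) l)) (wt l.length) (l ++ [false]) +
        childWeight β A B (fun l => s'.reals 5 (node (s.ints 2) (d + 1) l)) (wt l.length) (l ++ [true])) ∧
    (∀ v, v = 0 ∨ s.ints 5 0 ≤ v → s'.reals 5 v = s.reals 5 v)) N ?_ ?_ ?_ ?_ ?_
  · refine ⟨by simp [hN], by simpa using hleaf, fun l hl h => ?_, by simp⟩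
    rw [tsub_zero] at h
    simpa using hinner l hl fun h' => h ⟨h', hl⟩
  · rintro t htN s' hf ⟨h1, h2, h3, h4⟩
    have e1 := hf.ints 1 (by decide)
    have e2 := hf.ints 2 (by decide)
    have e3 := hf.ints 3 (by decide)
    have e4 := hf.ints 4 (by decide)
    have e12 := hf.ints 12 (by decide)
    have r4 := hf.reals 4 (by decide)
    simp [write_ne] at e1 e2 e3 e4 e12 r4
    refine ⟨by simp [h1]; omega, ?_⟩
    obtain ⟨p, hp⟩ : ∃ p, N - t = p + 1 := ⟨N - t - 1, by omega⟩
    have hp' : N - (t + 1) = p := by omega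
    have hpN : p < N := by omega
    have hpath : s.ints 12 p = node (s.ints 2) (d + 1) (pre β x p) := hP.eq p hpN.le
    have hcw : ∀ b : Bool, (if 0 < s.ints 4 (node (s.ints 2) (d + 1) (pre β x p ++ [b])) then
        s'.reals 5 (node (s.ints 2) (d + 1) (pre β x p ++ [b])) else
        s.ints 3 (node (s.ints 2) (d + 1) (pre β x p ++ [b])) * wt p) =
        childWeight β A B (fun l => s'.reals 5 (node (s.ints 2) (d + 1) l)) (wt p)
          (pre β x p ++ [b]) := by
      intro b
      rw [hA _ (by simp; omega), hB _ (by simp; omega), childWeight]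
    have h0 := hcw false
    have h1' := hcw true
    simp only [node_append, Bool.toNat_false, Bool.toNat_true, add_zero] at h0 h1'
    set w := childWeight β A B (fun l => s'.reals 5 (node (s.ints 2) (d + 1) l)) (wt p)
          (pre β x p ++ [false]) + childWeight β A B (fun l => s'.reals 5 (node (s.ints 2) (d + 1) l)) (wt p)
          (pre β x p ++ [true]) with hw
    have hsem : ∀ s₂ : State d, s₂ = (Cmd.setI 13 (.const 0) (.sub (iv 13) (.const 1)) ;;
      childCmd (.get 12 (iv 13)) (.get 4 (iv 13)) 0 10 ;; childCmd (.get 12 (iv 13)) (.get 4 (iv 13)) 1 11 ;;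
      .setR 5 (.get 12 (iv 13)) (.add (rv 10) (rv 11))).sem coins s' →
        s₂.ints 13 0 = p ∧ s₂.reals 5 = Function.update (s'.reals 5)
          (node (s.ints 2) (d + 1) (pre β x p)) w := by
      rintro s₂ rfl
      simp only [Cmd.sem_seq, sem_childCmd]
      constructor
      · simp [h1, hp]
      · simp [write_same, write_ne, h1, hp, e2, e12, hpath, e3, e4, r4, hwt p hpN, h0, h1', hw]
    obtain ⟨g1, g2⟩ := hsem _ rfl
    have hupd : ∀ l, Function.update (s'.reals 5) (node (s.ints 2) (d + 1) (pre β x p)) w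
        (node (s.ints 2) (d + 1) l) = if l = pre β x p then w else
          s'.reals 5 (node (s.ints 2) (d + 1) l) := by
      intro l
      simp only [Function.update_apply, hP.node_eq_iff ht hpN.le]
    -- The node of depth `p` that is being rewritten is not a child of any node of depth at least
    -- `p`.
    have hcong : ∀ l b w', p ≤ l.length → childWeight β A B (fun l => if l = pre β x p then w else
          s'.reals 5 (node (s.ints 2) (d + 1) l)) w' (l ++ [b]) =
        childWeight β A B (fun l => s'.reals 5 (node (s.ints 2) (d + 1) l)) w' (l ++ [b]) := by
      intro l b w' hl
      have : l ++ [b] ≠ pre β x p := fun h => by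
        have := congrArg List.length h
        simp at this
        omega
      simp only [childWeight, if_neg this]
    rw [hp', g2]
    refine ⟨g1, fun l hl => ?_, fun l hl h => ?_, fun v hv => ?_⟩
    · rw [hupd, if_neg, h2 l hl]
      rintro rfl
      simp at hl
      omega
    · simp only [hupd]
      by_cases hlp : l = pre β x p
      · subst hlp
        rw [if_pos rfl, hcong _ _ _ (by simp), hcong _ _ _ (by simp), hw]
        simp
      · rw [if_neg hlp]
        have hnot : ¬ (pre β x l.length = l ∧ l.length < N - t) := by
          rintro ⟨q1, q2⟩
          rcases Nat.lt_or_ge l.length p with q | q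
          · exact h ⟨q1, q⟩
          · exact hlp (by rw [← q1]; congr 1; omega)
        -- Only the parent of the rewritten node has it as a child. This parent lies on the path at
        -- depth `p - 1`, and its equation is not claimed yet.
        have hch : ∀ b, childWeight β A B (fun l => if l = pre β x p then w else
            s'.reals 5 (node (s.ints 2) (d + 1) l)) (wt l.length) (l ++ [b]) =
            childWeight β A B (fun l => s'.reals 5 (node (s.ints 2) (d + 1) l)) (wt l.length)
              (l ++ [b]) := by
          intro b
          have hne : l ++ [b] ≠ pre β x p := by
            intro e
            have hlen := congrArg List.length e
            simp at hlen
            have hpre : pre β x l.length = l := by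
              have : pre β x (l ++ [b]).length = l ++ [b] := by rw [e]; simp
              exact ((pre_append_iff β x l b).1 this).1
            exact h ⟨hpre, by omega⟩
          simp only [childWeight, if_neg hne]
        rw [hch, hch, h3 l hl hnot]
    · rw [Function.update_of_ne, h4 v hv]
      rintro rfl
      have q₁ := hP.ne p hpN.le
      have q₂ := ht.node_lt (pre β x p)
      omega
  · rintro s' hf ⟨h1, -⟩
    simp [h1]
  · norm_num [Cmd.fuel, childCmd, IExp.cost, BExp.cost, RExp.cost]; linarith
  · rintro s' hf ⟨-, h2, h3, h4⟩
    exact ⟨⟨h2, fun l hl => h3 l hl (by simp)⟩, h4⟩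

end

/-- Updating the trie for the point in the input. -/
def treeCmd (arr : ℕ) (ins : Bool) : Cmd :=
  bitsCmd ;; pathCmd ;; storeCmd ;; countCmd arr ins ;; weighCmd

/-- Updating the first `r` nearest-neighbour structures. -/
def nnUpdateCmd (ins : Bool) : ℕ → Cmd
  | 0 => .skip
  | r + 1 => nnUpdateCmd ins r ;;
    bif ins then .nnInsert (.const r) 0 (.const 0) else .nnDelete (.const r) 0 (.const 0)

/-- The counters of the points of a side. -/
def Side.arr : Side → ℕ
  | .A => 3
  | .B => 4

/-- The program for updates, with `r` nearest-neighbour structures. -/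
def updateCmd (r : ℕ) (ins : Bool) (S : Side) : Cmd :=
  .ite (.ilt (.get 1 (.const 0)) (.const 1)) initCmd .skip ;;
  treeCmd S.arr ins ;;
  match S with
  | .A => .skip
  | .B => nnUpdateCmd ins r

section

variable {d n : ℕ} {D : NNStructure d} {coins : ℕ → unitInterval} {seeds : ℕ → D.Seed}

/-- Insertions and deletions follow the same path and differ only in the direction of the counters;
nodes are never freed. The new sets enter through their counters alone, so all four kinds of update
are treated at once. -/
theorem run_treeCmd {k J : ℕ} {ε : ℝ} {A B A' B' : Finset (Pt d)} {x : Pt d} {arr : ℕ}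
    (harr : arr = 3 ∨ arr = 4) (ins : Bool) (s : State d) (hd : 0 < d)
    (hs : Env n k J ε coins s) (hx : ∀ i, s.reals 0 i = coord x i) (hg : x ∈ grid d (2 ^ k))
    (hAB : ∀ y, y ∈ A ∨ y ∈ B → y ∈ grid d (2 ^ k))
    (hF : Forest (bits k J coins) (bitWeight d k J) (depth d k J) A B s)
    (hA : ∀ l, cnt (bits k J coins) A' l = if arr = 3 ∧ pre (bits k J coins) x l.length = l then
      bump ins (cnt (bits k J coins) A l) else cnt (bits k J coins) A l)
    (hB : ∀ l, cnt (bits k J coins) B' l = if arr = 4 ∧ pre (bits k J coins) x l.length = l then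
      bump ins (cnt (bits k J coins) B l) else cnt (bits k J coins) B l)
    (hmem : ∀ y, y ∈ A' ∨ y ∈ B' → y ∈ A ∨ y ∈ B ∨ y = x) :
    Run n D coins seeds (treeCmd arr ins) s (1000 * (2 ^ J + d * (k + 2) + k + 2)) fun s' =>
      Forest (bits k J coins) (bitWeight d k J) (depth d k J) A' B' s' ∧
      ∀ p < depth d k J, s'.reals 4 p = bitWeight d k J p := by
  set β : Pt d → ℕ → Bool := bits k J coins with hβ
  have hdep : ((depth d k J : ℕ) : ℝ) = 2 ^ J + d * (k + 1) := by unfold depth; push_cast; ring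
  have hd0 : (0 : ℝ) ≤ d := Nat.cast_nonneg d
  have hk0 : (0 : ℝ) ≤ k := Nat.cast_nonneg k
  have hdk := mul_nonneg hd0 hk0
  have hJ0 : (0 : ℝ) ≤ 2 ^ J := by positivity
  refine Run.seq' (run_bitsCmd s hs hx hg) (T₂ := 500 * (2 ^ J + d * (k + 2) + k + 2)) ?_
    (by linarith)
  rintro s₁ f₁ ⟨a₁, w₁⟩
  have hs₁ : Env n k J ε coins s₁ := hs.congr (f₁.ints 0 (by decide)) (f₁.ints 1 (by decide))
    (f₁.reals 0 (by decide)) (f₁.reals 1 (by decide)) (f₁.reals 3 (by decide))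
  have hF₁ : Forest β (bitWeight d k J) (depth d k J) A B s₁ := hF.congr (f₁.ints 2 (by decide))
    (f₁.ints 3 (by decide)) (f₁.ints 4 (by decide)) (f₁.ints 5 (by decide))
    (f₁.reals 5 (by decide)) (f₁.reals 6 (by decide))
  have hx₁ : ∀ i, s₁.reals 0 i = coord x i := by rw [f₁.reals 0 (by decide)]; exact hx
  refine Run.seq' (run_pathCmd (x := x) (β := β) s₁ hs₁.root hs₁.depth a₁ hF₁)
    (T₂ := 440 * (2 ^ J + d * (k + 2) + k + 2)) ?_ (by rw [hdep]; nlinarith)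
  rintro s₂ f₂ ⟨hF₂, hP₂⟩
  have hs₂ : Env n k J ε coins s₂ := hs₁.congr (f₂.ints 0 (by decide)) (f₂.ints 1 (by decide))
    (f₂.reals 0 (by decide)) (f₂.reals 1 (by decide)) (f₂.reals 3 (by decide))
  have hx₂ : ∀ i : Fin d, s₂.reals 0 i = x i := by
    intro i
    rw [f₂.reals 0 (by decide), hx₁, coord, dif_pos i.2]
  refine Run.seq' (run_storeCmd s₂ hs₂.dim hs₂.depth hx₂ hF₂ hP₂ fun y hy h =>
    pre_bits_inj hd (hAB y hy) hg h) (T₂ := 300 * (2 ^ J + d * (k + 2) + k + 2)) ?_ (by nlinarith)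
  rintro s₃ f₃ hpt
  have hs₃ : Env n k J ε coins s₃ := hs₂.congr (f₃.ints 0 (by decide)) (f₃.ints 1 (by decide))
    (f₃.reals 0 (by decide)) (f₃.reals 1 (by decide)) (f₃.reals 3 (by decide))
  have i2₃ := f₃.ints 2 (by decide)
  have i3₃ := f₃.ints 3 (by decide)
  have i4₃ := f₃.ints 4 (by decide)
  have i5₃ := f₃.ints 5 (by decide)
  have r5₃ := f₃.reals 5 (by decide)
  have hP₃ : Path β (depth d k J) x s₃ := hP₂.congr i2₃ (f₃.ints 12 (by decide))
  have ht₃ : TreeOK (d + 1) (s₃.ints 2) (s₃.ints 5 0) := by rw [i2₃, i5₃]; exact hF₂.tree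
  refine Run.seq' (run_countCmd harr ins s₃ hs₃.depth ht₃ hP₃)
    (T₂ := 200 * (2 ^ J + d * (k + 2) + k + 2)) ?_ (by rw [hdep]; nlinarith)
  rintro s₄ f₄ ⟨hc, hcf⟩
  have i2₄ : s₄.ints 2 = s₂.ints 2 :=
    (f₄.ints 2 (by rcases harr with rfl | rfl <;> cases ins <;> decide)).trans i2₃
  have i5₄ : s₄.ints 5 = s₂.ints 5 :=
    (f₄.ints 5 (by rcases harr with rfl | rfl <;> cases ins <;> decide)).trans i5₃
  have i12₄ : s₄.ints 12 = s₃.ints 12 :=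
    f₄.ints 12 (by rcases harr with rfl | rfl <;> cases ins <;> decide)
  have hrw : ∀ a, s₄.reals a = s₃.reals a := fun a => f₄.reals a (by cases ins <;> simp [countCmd, Cmd.wR])
  have hP₄ : Path β (depth d k J) x s₄ := hP₃.congr (i2₄.trans i2₃.symm) i12₄
  have hcA : ∀ l, l.length ≤ depth d k J → s₄.ints 3 (node (s₂.ints 2) (d + 1) l) = cnt β A' l := by
    intro l hl
    rw [hA l, ← hF₂.cntA l hl]
    rcases harr with rfl | rfl
    · have := hc l hl
      rw [i2₃, i3₃] at this
      simpa using this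
    · rw [f₄.ints 3 (by cases ins <;> decide), i3₃]
      simp
  have hcB : ∀ l, l.length ≤ depth d k J → s₄.ints 4 (node (s₂.ints 2) (d + 1) l) = cnt β B' l := by
    intro l hl
    rw [hB l, ← hF₂.cntB l hl]
    rcases harr with rfl | rfl
    · rw [f₄.ints 4 (by cases ins <;> decide), i4₃]
      simp
    · have := hc l hl
      rw [i2₃, i4₃] at this
      simpa using this
  have hfr : ∀ v, v = 0 ∨ s₂.ints 5 0 ≤ v → s₄.ints 3 v = 0 ∧ s₄.ints 4 v = 0 := by
    intro v hv
    have hz := hF₂.fresh v hv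
    have := hcf v (by rwa [i5₃])
    rcases harr with rfl | rfl
    · rw [this, i3₃, f₄.ints 4 (by cases ins <;> decide), i4₃]
      exact ⟨hz.1, hz.2.1⟩
    · rw [this, i4₃, f₄.ints 3 (by cases ins <;> decide), i3₃]
      exact ⟨hz.1, hz.2.1⟩
  have hr5 : s₄.reals 5 = s₂.reals 5 := (hrw 5).trans r5₃
  have h13 : s₄.ints 1 3 = depth d k J := by
    rw [f₄.ints 1 (by rcases harr with rfl | rfl <;> cases ins <;> decide), hs₃.depth]
  have hw₄ : ∀ p < depth d k J, s₄.reals 4 p = bitWeight d k J p := by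
    rw [hrw, f₃.reals 4 (by decide), f₂.reals 4 (by decide)]
    exact w₁
  refine (run_weighCmd (β := β) (x := x) (A := A') (B := B') (wt := bitWeight d k J) s₄ h13 hw₄
    (by rw [i2₄, i5₄]; exact hF₂.tree) hP₄ (by rw [i2₄]; exact hcA) (by rw [i2₄]; exact hcB)
    (by rw [i2₄, hr5]; exact hF₂.weight.leaf) ?_).framed.mono (by rw [hdep]; nlinarith) ?_
  · intro l hl hne
    rw [i2₄, hr5]
    have hch : ∀ b w, childWeight β A' B' (fun l => s₂.reals 5 (node (s₂.ints 2) (d + 1) l)) w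
        (l ++ [b]) = childWeight β A B (fun l => s₂.reals 5 (node (s₂.ints 2) (d + 1) l)) w
        (l ++ [b]) := by
      intro b w
      have : ¬ pre β x (l ++ [b]).length = l ++ [b] := fun h =>
        hne ((pre_append_iff β x l b).1 h).1
      have eA := hA (l ++ [b])
      have eB := hB (l ++ [b])
      rw [if_neg fun h => this h.2] at eA eB
      rw [childWeight, childWeight, eA, eB]
    rw [hch, hch]
    exact hF₂.weight.inner l hl
  · rintro s₅ ⟨f₅, hw, hwf⟩
    have i2₅ : s₅.ints 2 = s₂.ints 2 := (f₅.ints 2 (by decide)).trans i2₄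
    have i3₅ : s₅.ints 3 = s₄.ints 3 := f₅.ints 3 (by decide)
    have i4₅ : s₅.ints 4 = s₄.ints 4 := f₅.ints 4 (by decide)
    have i5₅ : s₅.ints 5 = s₂.ints 5 := (f₅.ints 5 (by decide)).trans i5₄
    have r6₅ : s₅.reals 6 = s₃.reals 6 := (f₅.reals 6 (by decide)).trans (hrw 6)
    refine ⟨⟨?_, ?_, ?_, ?_, ?_, ?_⟩, ?_⟩
    · rw [i2₅, i5₅]; exact hF₂.tree
    · rw [i2₅, i3₅]; exact hcA
    · rw [i2₅, i4₅]; exact hcB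
    · intro v hv
      rw [i5₅] at hv
      rw [i3₅, i4₅, hwf v (by rwa [i5₄]), hr5]
      exact ⟨(hfr v hv).1, (hfr v hv).2, (hF₂.fresh v hv).2.2⟩
    · rw [i2₅, ← i2₄]; exact hw
    · intro y hy i
      rw [i2₅, r6₅, hpt y (by have := hmem y hy; tauto) i]
    · rw [f₅.reals 4 (by decide)]; exact hw₄

/-- The update of a nearest-neighbour structure. -/
def nnOp (ins : Bool) (x : Pt d) : NNOp d := bif ins then .insert x else .delete x

/-- All copies receive the same operations and share one history, so that their answers differ only
through their seeds. -/
theorem run_nnUpdateCmd (ins : Bool) {x : Pt d} {H : List (NNOp d)}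
    (hl : (nnOp ins x).Legal n (nnSet H)) (r : ℕ) (s : State d)
    (hx : ∀ i : Fin d, s.reals 0 i = x i) (hH : ∀ j < r, s.hist j = H) :
    Run n D coins seeds (nnUpdateCmd ins r) s (r * (D.time + 3) + 1) fun s' =>
      (∀ j < r, s'.hist j = H ++ [nnOp ins x]) ∧ (∀ j, r ≤ j → s'.hist j = s.hist j) ∧
        s'.drawn = s.drawn := by
  induction r with
  | zero => exact Run.straight rfl (by norm_num [Cmd.fuel, nnUpdateCmd]) (by simp [nnUpdateCmd])
  | succ r ih =>
    refine Run.seq' (ih fun j hj => hH j (by omega)) (T₂ := D.time + 3) ?_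
      (by push_cast; linarith)
    rintro s₁ f₁ ⟨a₁, b₁, c₁⟩
    have hpt : s₁.point 0 0 = x := by
      funext i
      have : s₁.reals 0 = s.reals 0 := by
        refine f₁.reals 0 ?_
        have : ∀ r, (nnUpdateCmd ins r).wR = [] := by
          intro r
          induction r with
          | zero => rfl
          | succ r ih => cases ins <;> simp [nnUpdateCmd, Cmd.wR, ih]
        simp [this]
      simp [State.point, this, hx]
    have hh : s₁.hist r = H := by rw [b₁ r le_rfl, hH r (by omega)]
    have hpost : ∀ s₂ : State d, s₂ = s₁.log r (nnOp ins x) →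
        (∀ j < r + 1, s₂.hist j = H ++ [nnOp ins x]) ∧ (∀ j, r + 1 ≤ j → s₂.hist j = s.hist j) ∧
          s₂.drawn = s.drawn := by
      rintro s₂ rfl
      refine ⟨fun j hj => ?_, fun j hj => ?_, c₁⟩
      · rcases Nat.lt_succ_iff_lt_or_eq.1 hj with h | rfl
        · simp [State.log, h.ne, a₁ j h]
        · simp [State.log, hh]
      · have : j ≠ r := by omega
        simp [State.log, this, b₁ j (by omega)]
    cases ins
    · refine ⟨_, _, Exec.nnDelete s₁ (.const r) 0 (.const 0) ?_, ?_, hpost _ ?_⟩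
      · simpa [State.Allows, hpt, hh, nnOp] using hl
      · norm_num [IExp.cost]; linarith
      · simp [hpt, nnOp]
    · refine ⟨_, _, Exec.nnInsert s₁ (.const r) 0 (.const 0) ?_, ?_, hpost _ ?_⟩
      · simpa [State.Allows, hpt, hh, nnOp] using hl
      · norm_num [IExp.cost]; linarith
      · simp [hpt, nnOp]

/-- The state after the initialization: the sets `A`, `B` are stored, `m` random numbers have been
drawn, and `r` nearest-neighbour structures have the history `H`. -/
structure Good (n k : ℕ) (ε : ℝ) (coins : ℕ → unitInterval) (r : ℕ) (A B : Finset (Pt d))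
    (m : ℕ) (H : List (NNOp d)) (s : State d) : Prop where
  env : Env n k (Nat.clog 2 d) ε coins s
  forest : Forest (bits k (Nat.clog 2 d) coins) (bitWeight d k (Nat.clog 2 d))
    (depth d k (Nat.clog 2 d)) A B s
  weights : ∀ p < depth d k (Nat.clog 2 d), s.reals 4 p = bitWeight d k (Nat.clog 2 d) p
  drawn : s.drawn = m
  hist : ∀ j < r, s.hist j = H

/-- The state before or after the initialization. -/
def Inv (n k : ℕ) (ε : ℝ) (coins : ℕ → unitInterval) (r : ℕ) (A B : Finset (Pt d))
    (m : ℕ) (H : List (NNOp d)) (s : State d) : Prop :=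
  (Fresh n k ε s ∧ A = ∅ ∧ B = ∅ ∧ m = 0 ∧ H = []) ∨ m ≠ 0 ∧ Good n k ε coins r A B m H s

theorem putPoint_coord (s : State d) (hpad : ∀ i, d ≤ i → s.reals 0 i = 0) (x : Pt d) (i : ℕ) :
    (s.putPoint x).reals 0 i = coord x i := by
  unfold State.putPoint coord
  simp only [Function.update_self]
  split_ifs with h
  · rfl
  · exact hpad i (by omega)

theorem putPoint_reals (s : State d) (x : Pt d) {a : ℕ} (ha : a ≠ 0) :
    (s.putPoint x).reals a = s.reals a := by
  unfold State.putPoint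
  exact Function.update_of_ne ha _ _

theorem Fresh.putPoint {k : ℕ} {ε : ℝ} {s : State d} (h : Fresh n k ε s) (x : Pt d) :
    Fresh n k ε (s.putPoint x) where
  size := h.size
  dim := h.dim
  univ := h.univ
  zeroI := h.zeroI
  eps := by rw [putPoint_reals _ _ (by norm_num), h.eps]
  zeroR a ha := by rw [putPoint_reals _ _ (by omega), h.zeroR a ha]
  pad i hi := by rw [putPoint_coord _ h.pad, coord, dif_neg (by omega)]
  drawn := h.drawn
  hist := h.hist

theorem Good.putPoint {k r m : ℕ} {ε : ℝ} {A B : Finset (Pt d)} {H : List (NNOp d)} {s : State d}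
    (h : Good n k ε coins r A B m H s) (x : Pt d) :
    Good n k ε coins r A B m H (s.putPoint x) where
  env := by
    obtain ⟨a1, a2, a3, a4, a5, a6, a7, a8, a9, a10, a11, a12⟩ := h.env
    refine ⟨a1, a2, a3, a4, a5, a6, a7, a8, a9, ?_, ?_, ?_⟩
    · rw [putPoint_reals _ _ (by norm_num), a10]
    · intro i hi
      rw [putPoint_coord _ a11, coord, dif_neg (by omega)]
    · rwa [putPoint_reals _ _ (by norm_num)]
  forest := h.forest.congr rfl rfl rfl rfl (putPoint_reals _ _ (by norm_num))
    (putPoint_reals _ _ (by norm_num))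
  weights := by rw [putPoint_reals _ _ (by norm_num)]; exact h.weights
  drawn := h.drawn
  hist := h.hist

/-- A bound for the time of an update. -/
noncomputable def updateTime (n d k r : ℕ) (τ : ℝ) : ℝ :=
  2000 * (2 ^ Nat.clog 2 d + d * (k + 2) + k + Nat.clog 2 n + 2) + (r * (τ + 3) + 1)

/-- The first update also initializes the memory and draws the random numbers of the trie; this is
the jump of the number of draws from 0 to `2 ^ Nat.clog 2 d + d`. -/
theorem run_updateCmd {k r m : ℕ} {ε : ℝ} {A B A' B' : Finset (Pt d)} {H H' : List (NNOp d)}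
    {x : Pt d} (S : Side) (ins : Bool) (s : State d) (hd : 1 ≤ d)
    (hs : Inv n k ε coins r A B m H s) (hg : x ∈ grid d (2 ^ k))
    (hAB : ∀ y, y ∈ A ∨ y ∈ B → y ∈ grid d (2 ^ k))
    (hA : ∀ l, cnt (bits k (Nat.clog 2 d) coins) A' l =
      if S.arr = 3 ∧ pre (bits k (Nat.clog 2 d) coins) x l.length = l then
        bump ins (cnt (bits k (Nat.clog 2 d) coins) A l) else cnt (bits k (Nat.clog 2 d) coins) A l)
    (hB : ∀ l, cnt (bits k (Nat.clog 2 d) coins) B' l =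
      if S.arr = 4 ∧ pre (bits k (Nat.clog 2 d) coins) x l.length = l then
        bump ins (cnt (bits k (Nat.clog 2 d) coins) B l) else cnt (bits k (Nat.clog 2 d) coins) B l)
    (hmem : ∀ y, y ∈ A' ∨ y ∈ B' → y ∈ A ∨ y ∈ B ∨ y = x)
    (hH : S = .A ∧ H' = H ∨ S = .B ∧ H' = H ++ [nnOp ins x] ∧ (nnOp ins x).Legal n (nnSet H)) :
    Run n D coins seeds (updateCmd r ins S) (s.putPoint x) (updateTime n d k r D.time)
      (Good n k ε coins r A' B' (if m = 0 then 2 ^ Nat.clog 2 d + d else m) H') := by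
  have hs' : Run n D coins seeds (.ite (.ilt (.get 1 (.const 0)) (.const 1)) initCmd .skip)
      (s.putPoint x) (200 * (2 ^ Nat.clog 2 d + d + k + Nat.clog 2 n + 2)) fun s₁ =>
      Env n k (Nat.clog 2 d) ε coins s₁ ∧
      Forest (bits k (Nat.clog 2 d) coins) (bitWeight d k (Nat.clog 2 d))
        (depth d k (Nat.clog 2 d)) A B s₁ ∧
      s₁.drawn = (if m = 0 then 2 ^ Nat.clog 2 d + d else m) ∧
      (∀ j < r, s₁.hist j = H) ∧ s₁.reals 0 = (s.putPoint x).reals 0 := by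
    have hd0 : (0 : ℝ) ≤ d := Nat.cast_nonneg d
    have hk0 : (0 : ℝ) ≤ k := Nat.cast_nonneg k
    have hn0 : (0 : ℝ) ≤ Nat.clog 2 n := Nat.cast_nonneg _
    have hJ0 : (0 : ℝ) ≤ 2 ^ Nat.clog 2 d := by positivity
    have hJ : (Nat.clog 2 d : ℝ) ≤ 2 ^ Nat.clog 2 d := by
      exact_mod_cast (Nat.lt_two_pow_self (n := Nat.clog 2 d)).le
    rcases hs with ⟨hf, rfl, rfl, rfl, rfl⟩ | ⟨hm, hgood⟩
    · have hf' := hf.putPoint x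
      have hfl : (s.putPoint x).ints 1 0 = 0 := by rw [hf'.zeroI 1 (by norm_num)]
      refine Run.ite (T := 20 * (2 * k + Nat.clog 2 d + Nat.clog 2 n + 2 ^ Nat.clog 2 d + d + 10))
        (fun _ => (run_initCmd (coins := coins) hd hf' (bits k (Nat.clog 2 d) coins) (bitWeight d k (Nat.clog 2 d))
          (depth d k (Nat.clog 2 d))).framed.mono le_rfl ?_) (fun h => absurd h (by simp [hfl])) ?_
      · rintro s₁ ⟨fr, h1, h2, h3, h4⟩
        refine ⟨h1, h2, by simpa using h3, fun j _ => ?_, fr.reals 0 (by decide)⟩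
        rw [h4, hf'.hist]
      · norm_num [BExp.cost, IExp.cost]
        linarith
    · have hg' := hgood.putPoint x
      have hfl : (s.putPoint x).ints 1 0 = 1 := hg'.env.flag
      refine Run.ite (T := 1) (fun h => absurd h (by simp [hfl])) (fun _ => Run.straight rfl
        (by norm_num [Cmd.fuel]) ⟨hg'.env, hg'.forest, ?_, hg'.hist, rfl⟩) ?_
      · rw [if_neg hm]; exact hg'.drawn
      · norm_num [BExp.cost, IExp.cost]
        linarith
  have hd0 : (0 : ℝ) ≤ d := Nat.cast_nonneg d
  have hk0 : (0 : ℝ) ≤ k := Nat.cast_nonneg k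
  have hdk := mul_nonneg hd0 hk0
  have hn0 : (0 : ℝ) ≤ Nat.clog 2 n := Nat.cast_nonneg _
  have hJ0 : (0 : ℝ) ≤ 2 ^ Nat.clog 2 d := by positivity
  have hpad : ∀ i, d ≤ i → s.reals 0 i = 0 := by
    rcases hs with ⟨hf, -⟩ | ⟨-, hgood⟩
    exacts [hf.pad, hgood.env.pad]
  have harr : S.arr = 3 ∨ S.arr = 4 := by cases S <;> simp [Side.arr]
  refine Run.seq' hs' (T₂ := 1000 * (2 ^ Nat.clog 2 d + d * (k + 2) + k + 2) +
    (r * (D.time + 3) + 1)) ?_ (by unfold updateTime; nlinarith)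
  rintro s₁ f₁ ⟨e₁, F₁, d₁, h₁, p₁⟩
  have hx₁ : ∀ i, s₁.reals 0 i = coord x i := by
    intro i
    rw [p₁, putPoint_coord _ hpad]
  refine Run.seq' (run_treeCmd harr ins s₁ hd e₁ hx₁ hg hAB F₁ hA hB hmem) ?_ le_rfl
  rintro s₂ f₂ ⟨F₂, w₂⟩
  have e₂ : Env n k (Nat.clog 2 d) ε coins s₂ := by
    refine e₁.congr (f₂.ints 0 ?_) (f₂.ints 1 ?_) (f₂.reals 0 ?_) (f₂.reals 1 ?_) (f₂.reals 3 ?_) <;>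
      cases S <;> cases ins <;> decide
  have d₂ : s₂.drawn = s₁.drawn := f₂.drawn (by cases S <;> cases ins <;> rfl)
  have h₂ : s₂.hist = s₁.hist := f₂.hist (by cases S <;> cases ins <;> rfl)
  rcases hH with ⟨rfl, rfl⟩ | ⟨rfl, rfl, hl⟩
  · refine Run.straight rfl ?_ ⟨e₂, F₂, w₂, d₂.trans d₁, by rw [Cmd.sem_skip, h₂]; exact h₁⟩
    have : (0 : ℝ) ≤ r * (D.time + 3) := by positivity
    norm_num [Cmd.fuel]
    linarith
  · have hx₂ : ∀ i : Fin d, s₂.reals 0 i = x i := by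
      intro i
      rw [f₂.reals 0 (by cases ins <;> decide), hx₁, coord, dif_pos i.2]
    have hwI : ∀ r, (nnUpdateCmd ins r).wI = [] ∧ (nnUpdateCmd ins r).wR = [] := by
      intro r
      induction r with
      | zero => exact ⟨rfl, rfl⟩
      | succ r ih => cases ins <;> simp [nnUpdateCmd, Cmd.wI, Cmd.wR, ih]
    refine (run_nnUpdateCmd ins hl r s₂ hx₂ (by rw [h₂]; exact h₁)).framed.mono le_rfl ?_
    rintro s₃ ⟨f₃, h₃, -, d₃⟩
    have hi : s₃.ints = s₂.ints := funext fun a => f₃.ints a (by simp [hwI])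
    have hr : s₃.reals = s₂.reals := funext fun a => f₃.reals a (by simp [hwI])
    refine ⟨e₂.congr ?_ ?_ ?_ ?_ ?_, F₂.congr ?_ ?_ ?_ ?_ ?_ ?_, by rw [hr]; exact w₂,
      d₃.trans (d₂.trans d₁), h₃⟩ <;> simp only [hi, hr]

end

/-! ### Selecting points of the trie -/

/-- Descending in the trie, guided by the number in the real scalar `15`; the command `e` computes
the weights of the children. -/
def descendCmd (e : Cmd) : Cmd :=
  (.setI 15 (.const 0) (.get 1 (.const 5)) ;; .setI 13 (.const 0) (.const 0)) ;;
  .while (.ilt (iv 13) (.get 1 (.const 3)))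
    (e ;; .ite (.and (.not (.rlt (rv 15) (rv 10))) (.rlt (.const 0) (rv 11)))
        (.setR 15 (.const 0) (.sub (rv 15) (rv 10)) ;;
          .setI 15 (.const 0) (.get 2 (.add (iv 15) (.const 1))))
        (.setI 15 (.const 0) (.get 2 (iv 15))) ;;
      .setI 13 (.const 0) (.add (iv 13) (.const 1)))

/-- The numbers of points below the children. -/
def countChildrenCmd (arr : ℕ) : Cmd :=
  .setR 10 (.const 0) (.ofInt (.get arr (.get 2 (iv 15)))) ;;
  .setR 11 (.const 0) (.ofInt (.get arr (.get 2 (.add (iv 15) (.const 1)))))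

/-- The `ℓ₁` distance of two stored points. -/
def distCmd (v w : IExp) : Cmd :=
  (.setR 16 (.const 0) (.const 0) ;; .setI 14 (.const 0) (.const 0)) ;;
  .while (.ilt (iv 14) (.get 0 (.const 1)))
    (.ite (.rlt (.get 6 (.add v (iv 14))) (.get 6 (.add w (iv 14))))
      (.setR 16 (.const 0) (.add (rv 16) (.sub (.get 6 (.add w (iv 14))) (.get 6 (.add v (iv 14))))))
      (.setR 16 (.const 0) (.add (rv 16) (.sub (.get 6 (.add v (iv 14))) (.get 6 (.add w (iv 14)))))) ;;
      .setI 14 (.const 0) (.add (iv 14) (.const 1)))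

/-- The distance of a stored point from `B`. -/
def nearestCmd : Cmd :=
  .setI 18 (.const 0) (.const 0) ;;
  .while (.ilt (iv 18) (.get 4 (.get 1 (.const 5))))
    (.setR 15 (.const 0) (.ofInt (iv 18)) ;; descendCmd (countChildrenCmd 4) ;;
      distCmd (iv 17) (iv 15) ;;
      .ite (.and (.ilt (.const 0) (iv 18)) (.not (.rlt (rv 16) (rv 17)))) .skip
        (.setR 17 (.const 0) (rv 16)) ;;
      .setI 18 (.const 0) (.add (iv 18) (.const 1)))

/-- The Chamfer distance, computed exactly. -/
def bruteCmd : Cmd :=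
  (.setI 16 (.const 0) (.const 0) ;; .setR 14 (.const 0) (.const 0)) ;;
  .while (.ilt (iv 16) (.get 3 (.get 1 (.const 5))))
    (.setR 15 (.const 0) (.ofInt (iv 16)) ;; descendCmd (countChildrenCmd 3) ;;
      .setI 17 (.const 0) (iv 15) ;; nearestCmd ;;
      .setR 14 (.const 0) (.add (rv 14) (rv 17)) ;;
      .setI 16 (.const 0) (.add (iv 16) (.const 1))) ;;
  .setR 2 (.const 0) (rv 14)

section

variable {d n : ℕ} {D : NNStructure d} {coins : ℕ → unitInterval} {seeds : ℕ → D.Seed}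
variable {β : Pt d → ℕ → Bool} {wt : ℕ → ℝ} {N : ℕ} {A B S : Finset (Pt d)}

/-- A straight command makes no calls, so it can be executed next to a dummy nearest-neighbour
structure, and `Exec.frame` applies to that run. -/
theorem Cmd.frame_sem {c : Cmd} (h : c.straight = true) (s : State d) :
    c.Frame s (c.sem coins s) := by
  let D : NNStructure d :=
    { Seed := Unit, law := Measure.dirac (), answer := fun _ _ _ => 0,
      measurable_answer := fun _ _ => measurable_const, time := 0 }
  obtain ⟨t, e, -⟩ := Exec.of_straight (n := 0) (D := D) (coins := coins) (seeds := fun _ => ()) c h s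
  exact e.frame

/-- One descent serves both for selection by rank and for weighted sampling. The parameter `e`
computes the weights of the children, and the predicate `I` allows it to maintain extra information
about the current node in the real register 18. -/
theorem run_descendCmd (e : Cmd) (tot : List Bool → ℝ) (I : List Bool → ℝ → Prop) (s : State d)
    (hroot : s.ints 1 5 = d + 1) (hN : s.ints 1 3 = N) (he : e.straight = true)
    (hfuel : e.fuel ≤ 100) (heI : ∀ a ∈ e.wI, a = 14)
    (heR : ∀ a ∈ e.wR, a = 10 ∨ a = 11 ∨ a = 18) (h0 : I [] (s.reals 18 0))
    (hstep : ∀ l (s' : State d), l.length < N →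
      (∀ a, a ≠ 13 → a ≠ 14 → a ≠ 15 → s'.ints a = s.ints a) →
      (∀ a, a ≠ 10 → a ≠ 11 → a ≠ 15 → a ≠ 18 → s'.reals a = s.reals a) →
      s'.ints 15 0 = node (s.ints 2) (d + 1) l → s'.ints 13 0 = l.length → I l (s'.reals 18 0) →
      (e.sem coins s').reals 10 0 = tot (l ++ [false]) ∧
      (e.sem coins s').reals 11 0 = tot (l ++ [true]) ∧
      ∀ b, I (l ++ [b]) ((e.sem coins s').reals 18 0)) :
    Run n D coins seeds (descendCmd e) s (200 * (N + 1)) fun s' =>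
      s'.ints 15 0 = node (s.ints 2) (d + 1) (pick tot N [] (s.reals 15 0)) ∧
      I (pick tot N [] (s.reals 15 0)) (s'.reals 18 0) := by
  refine Run.straight_seq rfl (T₂ := 200 * N + 170) ?_ ?_
  · norm_num [Cmd.fuel, IExp.cost]; linarith
  refine Run.loop_straight (by simp [Cmd.straight, he]) (fun t s' => ∃ l, l.length = t ∧
    s'.ints 15 0 = node (s.ints 2) (d + 1) l ∧ s'.ints 13 0 = t ∧ I l (s'.reals 18 0) ∧
    pick tot (N - t) l (s'.reals 15 0) = pick tot N [] (s.reals 15 0)) N ?_ ?_ ?_ ?_ ?_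
  · exact ⟨[], rfl, by simp [hroot, node], by simp, by simpa using h0, by simp⟩
  · rintro t ht s' hf ⟨l, hl, h1, h2, h3, h4⟩
    have fI : ∀ a, a ≠ 13 → a ≠ 14 → a ≠ 15 → s'.ints a = s.ints a := by
      intro a q1 q2 q3
      rw [hf.ints a]
      · simp [write_ne, q1, q3]
      · simp only [Cmd.wI, List.mem_append, List.mem_singleton]
        have := heI a
        tauto
    have fR : ∀ a, a ≠ 10 → a ≠ 11 → a ≠ 15 → a ≠ 18 → s'.reals a = s.reals a := by
      intro a q1 q2 q3 q4
      rw [hf.reals a]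
      · simp
      · simp only [Cmd.wR, List.mem_append, List.mem_singleton, List.not_mem_nil]
        have := heR a
        tauto
    obtain ⟨g1, g2, g3⟩ := hstep l s' (by omega) fI fR h1 (by rw [h2, hl]) h3
    have fe := Cmd.frame_sem (coins := coins) he s'
    have e15 : (e.sem coins s').ints 15 = s'.ints 15 := fe.ints 15 fun h => by have := heI _ h; omega
    have e13 : (e.sem coins s').ints 13 = s'.ints 13 := fe.ints 13 fun h => by have := heI _ h; omega
    have e2 : (e.sem coins s').ints 2 = s.ints 2 := (fe.ints 2 fun h => by have := heI _ h; omega).trans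
      (fI 2 (by norm_num) (by norm_num) (by norm_num))
    have r15 : (e.sem coins s').reals 15 = s'.reals 15 := fe.reals 15 fun h => by
      have := heR _ h; omega
    have e1 : s'.ints 1 = s.ints 1 := fI 1 (by norm_num) (by norm_num) (by norm_num)
    refine ⟨by simp [e1, h2, hN, ht], ?_⟩
    obtain ⟨m, hm⟩ : ∃ m, N - t = m + 1 := ⟨N - t - 1, by omega⟩
    have hm' : N - (t + 1) = m := by omega
    rw [hm] at h4
    rw [hm', Cmd.sem_seq, Cmd.sem_seq]
    by_cases hb : s'.reals 15 0 < tot (l ++ [false]) ∨ ¬ 0 < tot (l ++ [true])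
    · rw [Cmd.sem_ite_neg _ _ _ _ (by simp [g1, g2, r15]; intro h; rcases hb with hb | hb <;> linarith)]
      rw [pick_left hb] at h4
      exact ⟨l ++ [false], by simp [hl], by simp [e2, e15, h1, node_append], by simp [e13, h2],
        by simpa using g3 false, by simpa [r15] using h4⟩
    · have hb' := hb
      push Not at hb'
      rw [Cmd.sem_ite_pos _ _ _ _ (by simp [g1, g2, r15, hb'])]
      rw [pick_right hb] at h4
      exact ⟨l ++ [true], by simp [hl], by simp [e2, e15, h1, node_append], by simp [e13, h2],
        by simpa using g3 true, by simpa [r15, g1] using h4⟩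
  · rintro s' hf ⟨l, hl, h1, h2, h3, h4⟩
    have hn : 1 ∉ e.wI := fun h => by have := heI _ h; omega
    have e1 : s'.ints 1 = s.ints 1 := by
      rw [hf.ints 1 (by simp [Cmd.wI, hn])]
      simp [write_ne]
    simp [h2, e1, hN]
  · have : ((e.fuel : ℕ) : ℝ) ≤ 100 := by exact_mod_cast hfuel
    have hN0 : (0 : ℝ) ≤ N := Nat.cast_nonneg _
    norm_num [Cmd.fuel, IExp.cost, BExp.cost, RExp.cost]
    nlinarith
  · rintro s' hf ⟨l, hl, h1, h2, h3, h4⟩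
    rw [Nat.sub_self, pick] at h4
    rw [← h4]
    exact ⟨h1, h3⟩

theorem run_selectCmd {arr : ℕ} (harr : arr = 3 ∨ arr = 4) (s : State d)
    (hroot : s.ints 1 5 = d + 1) (hN : s.ints 1 3 = N)
    (hc : ∀ l, l.length ≤ N → s.ints arr (node (s.ints 2) (d + 1) l) = cnt β S l) :
    Run n D coins seeds (descendCmd (countChildrenCmd arr)) s (200 * (N + 1)) fun s' =>
      s'.ints 15 0 = node (s.ints 2) (d + 1)
        (pick (msum β S fun _ => (1 : ℝ)) N [] (s.reals 15 0)) := by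
  refine (run_descendCmd (countChildrenCmd arr) (msum β S fun _ => (1 : ℝ)) (fun _ _ => True) s
    hroot hN rfl (by norm_num [countChildrenCmd, Cmd.fuel, IExp.cost, RExp.cost]) (by simp [countChildrenCmd, Cmd.wI])
    (by simp [countChildrenCmd, Cmd.wR]) trivial ?_).mono le_rfl fun s' h => h.1
  intro l s' hl fI _ h15 _ _
  have e2 : s'.ints 2 = s.ints 2 := fI 2 (by norm_num) (by norm_num) (by norm_num)
  have e3 : s'.ints arr = s.ints arr := fI arr (by omega) (by omega) (by omega)
  have h1 := hc (l ++ [false]) (by simp; omega)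
  have h2 := hc (l ++ [true]) (by simp; omega)
  rw [node_append] at h1 h2
  simp only [Bool.toNat_false, Bool.toNat_true, add_zero] at h1 h2
  refine ⟨?_, ?_, fun _ => trivial⟩
  · simp [countChildrenCmd, h15, e2, e3, h1, msum_one]
  · simp [countChildrenCmd, h15, e2, e3, h2, msum_one]

theorem run_distCmd {a b : ℕ} {x y : Pt d} (ha : a ≠ 14) (hb : b ≠ 14) (s : State d)
    (hdim : s.ints 0 1 = d)
    (hx : ∀ i : Fin d, s.reals 6 (s.ints a 0 + i) = x i)
    (hy : ∀ i : Fin d, s.reals 6 (s.ints b 0 + i) = y i) :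
    Run n D coins seeds (distCmd (iv a) (iv b)) s (100 * (d + 1)) fun s' =>
      s'.reals 16 0 = l1 x y := by
  have hx' : ∀ i < d, s.reals 6 (s.ints a 0 + i) = coord x i := by
    intro i hi
    rw [coord, dif_pos hi]; exact hx ⟨i, hi⟩
  have hy' : ∀ i < d, s.reals 6 (s.ints b 0 + i) = coord y i := by
    intro i hi
    rw [coord, dif_pos hi]; exact hy ⟨i, hi⟩
  refine Run.straight_seq rfl (T₂ := 100 * d + 90) ?_ ?_
  · norm_num [Cmd.fuel, IExp.cost, RExp.cost]; linarith
  refine Run.loop_straight rfl (fun t s' => s'.ints 14 0 = t ∧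
    s'.reals 16 0 = ∑ i ∈ Finset.range t, |coord x i - coord y i|) d ?_ ?_ ?_ ?_ ?_
  · simp
  · rintro t ht s' hf ⟨h1, h2⟩
    have e0 := hf.ints 0 (by simp [Cmd.wI])
    have ea := hf.ints a (by simpa [Cmd.wI] using ha)
    have eb := hf.ints b (by simpa [Cmd.wI] using hb)
    have r6 := hf.reals 6 (by simp [Cmd.wR])
    simp [write_ne, ha, hb] at e0 ea eb r6
    have qx := hx' t ht
    have qy := hy' t ht
    refine ⟨by simp [h1, e0, hdim, ht], ?_⟩
    rw [Cmd.sem_seq, Finset.sum_range_succ]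
    by_cases h : coord x t < coord y t
    · rw [Cmd.sem_ite_pos _ _ _ _ (by simp [h1, ea, eb, r6, qx, qy, h]), abs_of_neg (by linarith)]
      simp [h1, ea, eb, r6, qx, qy, h2]
    · rw [Cmd.sem_ite_neg _ _ _ _ (by simp [h1, ea, eb, r6, qx, qy]; linarith),
        abs_of_nonneg (by linarith)]
      simp [h1, ea, eb, r6, qx, qy, h2]
  · rintro s' hf ⟨h1, -⟩
    have e0 := hf.ints 0 (by simp [Cmd.wI])
    simp [write_ne] at e0
    simp [h1, e0, hdim]
  · norm_num [Cmd.fuel, IExp.cost, BExp.cost, RExp.cost]; linarith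
  · rintro s' hf ⟨-, h2⟩
    rw [h2, l1_eq_sum_coord]

/-- The points of a finite set are the strings that are picked. -/
theorem pick_count_mem {j : ℕ} (hj : j < S.card) :
    ∃ x ∈ S, pick (msum β S fun _ => (1 : ℝ)) N [] j = pre β x N := by
  have h1 : (msum β S fun _ => (1 : ℝ)) [] = S.card := by rw [msum_one, cnt_nil]
  obtain ⟨x, hx, -, h⟩ := pick_spec (β := β) (S := S) (f := fun _ => (1 : ℝ)) (fun _ _ => zero_le_one) N
    (l := []) (r := j) (by rw [h1]; exact_mod_cast (by omega : 0 < S.card)) (Nat.cast_nonneg j)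
    (by rw [h1]; exact_mod_cast hj.le)
  exact ⟨x, hx, by simpa using h⟩

/-- Double counting: by `sum_pick`, the number of ranks that lead to the string of `x` equals the
number of points with this string, which is positive. -/
theorem exists_pick_count {x : Pt d} (hx : x ∈ S) :
    ∃ j < S.card, pick (msum β S fun _ => (1 : ℝ)) N [] (j : ℝ) = pre β x N := by
  classical
  by_contra hc
  push Not at hc
  have h := sum_pick (β := β) (S := S) (fun l => if l = pre β x N then (1 : ℝ) else 0) N []
  rw [cnt_nil, Finset.sum_congr rfl (g := fun _ => (0 : ℝ)) fun j hj =>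
    if_neg (hc j (Finset.mem_range.1 hj)), Finset.sum_const_zero, msum_nil] at h
  have h2 := Finset.single_le_sum (f := fun y => if pre β y (([] : List Bool).length + N) = pre β x N then (1 : ℝ) else 0)
    (fun y _ => by positivity) hx
  simp only [List.length_nil, zero_add] at h2 h
  rw [← h] at h2
  simp at h2
  linarith

theorem Forest.root_count {s : State d} (hF : Forest β wt N A B s) :
    s.ints 3 (d + 1) = A.card ∧ s.ints 4 (d + 1) = B.card := by
  have h1 := hF.cntA [] (by simp)
  have h2 := hF.cntB [] (by simp)
  rw [cnt_nil] at h1 h2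
  exact ⟨h1, h2⟩

/-- Runs through `B` by rank. The minimum is attained because every element of `B` is reached by
some rank. -/
theorem run_nearestCmd {a : Pt d} (s : State d) (hdim : s.ints 0 1 = d)
    (hroot : s.ints 1 5 = d + 1) (hN : s.ints 1 3 = N) (hF : Forest β wt N A B s)
    (hB : B.Nonempty) (ha : ∀ i : Fin d, s.reals 6 (s.ints 17 0 + i) = a i) :
    Run n D coins seeds nearestCmd s ((B.card + 1) * (300 * (N + d + 3))) fun s' =>
      s'.reals 17 0 = distTo a B := by
  have hd0 : (0 : ℝ) ≤ d := Nat.cast_nonneg d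
  have hN0 : (0 : ℝ) ≤ N := Nat.cast_nonneg N
  refine Run.straight_seq rfl (T₂ := B.card * (300 * (N + d + 3)) + 20) ?_ ?_
  · norm_num [Cmd.fuel, IExp.cost]; nlinarith
  refine Run.loop (T := 200 * (N + 1) + 100 * (d + 1) + 50) (fun j s' => s'.ints 18 0 = j ∧
    (0 < j → (∃ b ∈ B, s'.reals 17 0 = l1 a b) ∧ ∀ j' < j, ∀ b ∈ B,
      pick (msum β B fun _ => (1 : ℝ)) N [] j' = pre β b N → s'.reals 17 0 ≤ l1 a b)) B.card
    ?_ ?_ ?_ ?_ ?_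
  · simp
  · rintro j hj s' hf ⟨h1, h2⟩
    have e0 := hf.ints 0 (by decide)
    have e1 := hf.ints 1 (by decide)
    have e2 := hf.ints 2 (by decide)
    have e3 := hf.ints 3 (by decide)
    have e4 := hf.ints 4 (by decide)
    have e17 := hf.ints 17 (by decide)
    have r6 := hf.reals 6 (by decide)
    simp [write_ne] at e0 e1 e2 e3 e4 e17 r6
    refine ⟨by simp [h1, e1, e4, hroot, hF.root_count.2, hj], ?_⟩
    refine Run.straight_seq rfl (T₂ := 200 * (N + 1) + 100 * (d + 1) + 40) ?_ ?_
    · norm_num [Cmd.fuel, IExp.cost, RExp.cost]; linarith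
    refine Run.seq' (run_selectCmd (β := β) (S := B) (N := N) (Or.inr rfl) _ (by simp [e1, hroot])
      (by simp [e1, hN]) (by simpa [e2, e4] using hF.cntB)) (T₂ := 100 * (d + 1) + 40) ?_ (by linarith)
    rintro s₁ f₁ a₁
    obtain ⟨b, hb, hpb⟩ := pick_count_mem (β := β) (S := B) (N := N) hj
    have e0₁ := f₁.ints 0 (by decide)
    have e17₁ := f₁.ints 17 (by decide)
    have e18₁ := f₁.ints 18 (by decide)
    have r6₁ := f₁.reals 6 (by decide)
    have r17₁ := f₁.reals 17 (by decide)
    simp [write_ne] at e0₁ e17₁ e18₁ r6₁ r17₁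
    have a₁' : s₁.ints 15 0 = node (s.ints 2) (d + 1) (pre β b N) := by
      rw [a₁]; simp [h1, hpb, e2]
    refine Run.seq' (run_distCmd (a := 17) (b := 15) (x := a) (y := b) (by norm_num) (by norm_num) s₁
      (by rw [e0₁, e0, hdim]) (by rw [r6₁, e17₁, r6, e17]; exact ha)
      (by rw [r6₁, r6, a₁']; exact hF.point b (Or.inr hb))) (T₂ := 40) ?_ (by linarith)
    rintro s₂ f₂ a₂
    have h18 : s₂.ints 18 0 = j := by
      rw [f₂.ints 18 (by decide), e18₁, h1]
    have h17 : s₂.reals 17 0 = s'.reals 17 0 := by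
      rw [f₂.reals 17 (by decide), r17₁]
    refine Run.straight rfl (by norm_num [Cmd.fuel, BExp.cost, RExp.cost, IExp.cost]) ?_
    -- Points with the same string are read from the same cells, so their coordinates agree;
    -- injectivity of the strings need not be assumed.
    have huniq : ∀ j' < j + 1, ∀ b' ∈ B, pick (msum β B fun _ => (1 : ℝ)) N [] (j' : ℝ) = pre β b' N →
        j' = j → l1 a b' = l1 a b := by
      rintro j' - b' hb' hp rfl
      have hpp : pre β b' N = pre β b N := by rw [← hp, hpb]
      unfold l1
      refine Finset.sum_congr rfl fun i _ => ?_
      rw [← hF.point b (Or.inr hb) i, ← hF.point b' (Or.inr hb') i, hpp]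
    rw [Cmd.sem_seq]
    by_cases hc : 0 < j ∧ ¬ l1 a b < s'.reals 17 0
    · rw [Cmd.sem_ite_pos _ _ _ _ (by simpa [h18, h17, a₂] using hc)]
      refine ⟨by simp [h18], fun _ => ⟨?_, fun j' hj' b' hb' hp => ?_⟩⟩
      · simpa [h17] using (h2 hc.1).1
      · rcases Nat.lt_succ_iff_lt_or_eq.1 hj' with h | h
        · simpa [h17] using (h2 hc.1).2 j' h b' hb' hp
        · rw [huniq j' hj' b' hb' hp h]
          simpa [h17] using hc.2
    · rw [Cmd.sem_ite_neg _ _ _ _ (by simpa [h18, h17, a₂] using hc)]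
      refine ⟨by simp [h18], fun _ => ⟨⟨b, hb, by simp [a₂]⟩, fun j' hj' b' hb' hp => ?_⟩⟩
      rcases Nat.lt_succ_iff_lt_or_eq.1 hj' with h | h
      · have hlt : l1 a b < s'.reals 17 0 := by
          by_contra hcc
          exact hc ⟨by omega, hcc⟩
        simpa [a₂] using hlt.le.trans ((h2 (by omega)).2 j' h b' hb' hp)
      · rw [huniq j' hj' b' hb' hp h]
        simp [a₂]
  · rintro s' hf ⟨h1, -⟩
    have e1 := hf.ints 1 (by decide)
    have e4 := hf.ints 4 (by decide)
    simp [write_ne] at e1 e4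
    simp [h1, e1, e4, hroot, hF.root_count.2]
  · have : (0 : ℝ) ≤ B.card := Nat.cast_nonneg _
    norm_num [BExp.cost, IExp.cost]
    nlinarith
  · rintro s' hf ⟨-, h2⟩
    obtain ⟨⟨b, hb, e⟩, h3⟩ := h2 hB.card_pos
    obtain ⟨b', hb', e'⟩ := exists_distTo hB a
    obtain ⟨j, hj, hp⟩ := exists_pick_count (β := β) (N := N) hb'
    refine le_antisymm ?_ ?_
    · rw [e']; exact h3 j hj b' hb' hp
    · rw [e]; exact distTo_le hb a

/-- The distance of a stored point is a function of its bit string alone, once the memory is fixed;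
`sum_pick` then turns the sum over ranks into the sum over `A`. -/
theorem run_bruteCmd (s : State d) (hdim : s.ints 0 1 = d)
    (hroot : s.ints 1 5 = d + 1) (hN : s.ints 1 3 = N) (hF : Forest β wt N A B s)
    (hB : B.Nonempty) :
    Run n D coins seeds bruteCmd s ((A.card + 1) * ((B.card + 2) * (300 * (N + d + 3)))) fun s' =>
      s'.reals 2 0 = chamfer A B := by
  classical
  have hd0 : (0 : ℝ) ≤ d := Nat.cast_nonneg d
  have hN0 : (0 : ℝ) ≤ N := Nat.cast_nonneg N
  have hB0 : (0 : ℝ) ≤ B.card := Nat.cast_nonneg _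
  have hA0 : (0 : ℝ) ≤ A.card := Nat.cast_nonneg _
  have hBN : (0 : ℝ) ≤ B.card * (N + d) := by positivity
  -- the distance of the point with a given bit string
  set g : List Bool → ℝ := fun l => distTo (fun i => s.reals 6 (node (s.ints 2) (d + 1) l + i)) B with hg
  have hgpre : ∀ a ∈ A, g (pre β a N) = distTo a B := by
    intro a ha
    have : (fun i : Fin d => s.reals 6 (node (s.ints 2) (d + 1) (pre β a N) + i)) = a :=
      funext (hF.point a (Or.inl ha))
    rw [hg]
    exact congrArg (fun y => distTo y B) this
  refine Run.straight_seq rfl (T₂ := A.card * ((B.card + 2) * (300 * (N + d + 3))) + 40) ?_ ?_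
  · norm_num [Cmd.fuel, IExp.cost, RExp.cost]; nlinarith
  refine Run.seq' (T₁ := A.card * ((B.card + 2) * (300 * (N + d + 3))) + 20) (T₂ := 20)
    (P := fun s' => s'.reals 14 0 = chamfer A B) ?_ ?_ (by linarith)
  · refine Run.loop (T := 200 * (N + 1) + (B.card + 1) * (300 * (N + d + 3)) + 40)
      (fun i s' => s'.ints 16 0 = i ∧ s'.reals 14 0 =
        ∑ j ∈ Finset.range i, g (pick (msum β A fun _ => (1 : ℝ)) N [] j)) A.card ?_ ?_ ?_ ?_ ?_
    · simp
    · rintro i hi s' hf ⟨h1, h2⟩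
      have e0 := hf.ints 0 (by decide)
      have e1 := hf.ints 1 (by decide)
      have e2 := hf.ints 2 (by decide)
      have e3 := hf.ints 3 (by decide)
      have e4 := hf.ints 4 (by decide)
      have e5 := hf.ints 5 (by decide)
      have r5 := hf.reals 5 (by decide)
      have r6 := hf.reals 6 (by decide)
      simp [write_ne] at e0 e1 e2 e3 e4 e5 r5 r6
      refine ⟨by simp [h1, e1, e3, hroot, hF.root_count.1, hi], ?_⟩
      refine Run.straight_seq rfl (T₂ := 200 * (N + 1) + (B.card + 1) * (300 * (N + d + 3)) + 30) ?_ ?_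
      · norm_num [Cmd.fuel, IExp.cost, RExp.cost]; linarith
      refine Run.seq' (run_selectCmd (β := β) (S := A) (N := N) (Or.inl rfl) _ (by simp [e1, hroot])
        (by simp [e1, hN]) (by simpa [e2, e3] using hF.cntA))
        (T₂ := (B.card + 1) * (300 * (N + d + 3)) + 30) ?_ (by linarith)
      rintro s₁ f₁ a₁
      obtain ⟨a, ha, hpa⟩ := pick_count_mem (β := β) (S := A) (N := N) hi
      have a₁' : s₁.ints 15 0 = node (s.ints 2) (d + 1) (pre β a N) := by
        rw [a₁]; simp [h1, hpa, e2]
      have hF₁ : Forest β wt N A B s₁ := by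
        refine hF.congr ?_ ?_ ?_ ?_ ?_ ?_
        · rw [f₁.ints 2 (by decide)]; simp [e2]
        · rw [f₁.ints 3 (by decide)]; simp [e3]
        · rw [f₁.ints 4 (by decide)]; simp [e4]
        · rw [f₁.ints 5 (by decide)]; simp [e5]
        · rw [f₁.reals 5 (by decide)]; simp [write_ne, r5]
        · rw [f₁.reals 6 (by decide)]; simp [write_ne, r6]
      have e0₁ := f₁.ints 0 (by decide)
      have e1₁ := f₁.ints 1 (by decide)
      have e16₁ := f₁.ints 16 (by decide)
      have r6₁ := f₁.reals 6 (by decide)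
      have r14₁ := f₁.reals 14 (by decide)
      simp [write_ne] at e0₁ e1₁ e16₁ r6₁ r14₁
      refine Run.straight_seq rfl (T₂ := (B.card + 1) * (300 * (N + d + 3)) + 20) ?_ ?_
      · norm_num [Cmd.fuel, IExp.cost]; linarith
      refine Run.seq' (run_nearestCmd (β := β) (wt := wt) (A := A) (a := a) _ (by simp [e0₁, e0, hdim])
        (by simp [e1₁, e1, hroot]) (by simp [e1₁, e1, hN]) (hF₁.congr (by simp [write_ne])
        (by simp [write_ne]) (by simp [write_ne]) (by simp [write_ne]) rfl rfl) hB ?_) (T₂ := 20) ?_ le_rfl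
      · intro i
        simp only [Cmd.sem_setI, IExp.eval, write_apply, true_and, if_true, a₁', r6₁, r6]
        exact hF.point a (Or.inl ha) i
      · rintro s₂ f₂ a₂
        have e16₂ := f₂.ints 16 (by decide)
        have r14₂ := f₂.reals 14 (by decide)
        simp [write_ne] at e16₂ r14₂
        refine Run.straight rfl (by norm_num [Cmd.fuel, IExp.cost, RExp.cost]) ⟨?_, ?_⟩
        · simp [e16₂, e16₁, h1]
        · simp [r14₂, r14₁, h2, Finset.sum_range_succ, a₂, hpa, hgpre a ha]
    · rintro s' hf ⟨h1, -⟩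
      have e1 := hf.ints 1 (by decide)
      have e3 := hf.ints 3 (by decide)
      simp [write_ne] at e1 e3
      simp [h1, e1, e3, hroot, hF.root_count.1]
    · norm_num [BExp.cost, IExp.cost]
      nlinarith
    · rintro s' hf ⟨-, h2⟩
      have := sum_pick (β := β) (S := A) g N []
      rw [cnt_nil, msum_nil] at this
      rw [h2, this, chamfer]
      refine Finset.sum_congr rfl fun a ha => ?_
      simpa using hgpre a ha
  · rintro s₁ - h
    exact Run.straight rfl (by norm_num [Cmd.fuel, IExp.cost, RExp.cost]) (by simp [h])

end

/-! ### Queries -/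

/-- The weights of the children of the current node. -/
def weighChildrenCmd : Cmd :=
  .ite (.ilt (.const 0) (.get 4 (iv 15))) (.setR 18 (.const 0) (.get 4 (iv 13))) .skip ;;
  childCmd (iv 15) (rv 18) 0 10 ;; childCmd (iv 15) (rv 18) 1 11

/-- Asking the first `r` nearest-neighbour structures. -/
def nnQueryCmd : ℕ → Cmd
  | 0 => .skip
  | r + 1 => nnQueryCmd r ;; .nnQuery (.const r) 6 (iv 15) 16 (.const r)

/-- The largest of the answers. -/
def maxCmd (r : ℕ) : Cmd :=
  (.setR 17 (.const 0) (.get 16 (.const 0)) ;; .setI 17 (.const 0) (.const 0)) ;;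
  .while (.ilt (iv 17) (.const r))
    (.ite (.rlt (rv 17) (.get 16 (iv 17))) (.setR 17 (.const 0) (.get 16 (iv 17))) .skip ;;
      .setI 17 (.const 0) (.add (iv 17) (.const 1)))

/-- The number of answers that are at most the current one. -/
def rankCmd (r : ℕ) : Cmd :=
  (.setI 18 (.const 0) (.const 0) ;; .setI 19 (.const 0) (.const 0)) ;;
  .while (.ilt (iv 18) (.const r))
    (.ite (.rlt (.get 16 (iv 17)) (.get 16 (iv 18))) .skip
        (.setI 19 (.const 0) (.add (iv 19) (.const 1))) ;;
      .setI 18 (.const 0) (.add (iv 18) (.const 1)))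

/-- The smallest answer that is at least as large as `t + 1` of the answers. -/
def medianCmd (r t : ℕ) : Cmd :=
  maxCmd r ;; .setI 17 (.const 0) (.const 0) ;;
  .while (.ilt (iv 17) (.const r))
    (rankCmd r ;;
      .ite (.and (.ilt (.const t) (iv 19)) (.rlt (.get 16 (iv 17)) (rv 17)))
        (.setR 17 (.const 0) (.get 16 (iv 17))) .skip ;;
      .setI 17 (.const 0) (.add (iv 17) (.const 1)))

/-- The number of values among `a 0, …, a (r - 1)` that are at most `x`. -/
noncomputable def rank (r : ℕ) (a : ℕ → ℝ) (x : ℝ) : ℕ :=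
  Nat.count (fun j => open Classical in decide (a j ≤ x)) r

/-- The value of rank `t + 1` among `a 0, …, a (r - 1)`. -/
structure IsMedian (r t : ℕ) (a : ℕ → ℝ) (x : ℝ) : Prop where
  rank_lt : t < rank r a x
  le : ∀ i < r, t < rank r a (a i) → x ≤ a i

section

variable {d n : ℕ} {D : NNStructure d} {coins : ℕ → unitInterval} {seeds : ℕ → D.Seed}
variable {β : Pt d → ℕ → Bool} {wt : ℕ → ℝ} {N : ℕ} {A B S : Finset (Pt d)}

/-- Register 18 records the weight of the last depth at which `B` was still present. As soon as the
descent has left the trie of `B`, this is the estimate of every point below the current node, and it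
also supplies the weights of the deeper nodes, where the stored ones are meaningless. -/
theorem run_weighedDescendCmd (s : State d) (hroot : s.ints 1 5 = d + 1) (hN : s.ints 1 3 = N)
    (hF : Forest β wt N A B s) (hw : ∀ p < N, s.reals 4 p = wt p) (hB : B.Nonempty)
    (hwt : ∀ p, 0 ≤ wt p) (hinj : ∀ a ∈ A, ∀ b ∈ A, pre β a N = pre β b N → a = b)
    (hpos : 0 < treeSum β wt N A B) {u : unitInterval}
    (hu : s.reals 15 0 = u * treeSum β wt N A B) :
    Run n D coins seeds (descendCmd weighChildrenCmd) s (200 * (N + 1)) fun s' =>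
      s'.ints 15 0 = node (s.ints 2) (d + 1) (pre β (sample β wt N A B u) N) ∧
      s'.reals 18 0 = treeDist β wt N B (sample β wt N A B u) := by
  refine (run_descendCmd weighChildrenCmd (msum β A (treeDist β wt N B))
    (fun l c => 0 < cnt β B l ∨ cnt β B l = 0 ∧ ∀ a, pre β a l.length = l →
      treeDist β wt N B a = c) s hroot hN rfl
    (by norm_num [weighChildrenCmd, childCmd, Cmd.fuel, IExp.cost, RExp.cost, BExp.cost])
    (by simp [weighChildrenCmd, childCmd, Cmd.wI]) (by simp [weighChildrenCmd, childCmd, Cmd.wR])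
    (Or.inl ?_) ?_).mono le_rfl ?_
  · rw [cnt_nil]; exact hB.card_pos
  · intro l s' hl fI fR h15 h13 hI
    have e2 : s'.ints 2 = s.ints 2 := fI 2 (by norm_num) (by norm_num) (by norm_num)
    have e3 : s'.ints 3 = s.ints 3 := fI 3 (by norm_num) (by norm_num) (by norm_num)
    have e4 : s'.ints 4 = s.ints 4 := fI 4 (by norm_num) (by norm_num) (by norm_num)
    have r4 : s'.reals 4 = s.reals 4 := fR 4 (by norm_num) (by norm_num) (by norm_num) (by norm_num)
    have r5 : s'.reals 5 = s.reals 5 := fR 5 (by norm_num) (by norm_num) (by norm_num) (by norm_num)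
    have hbl : s'.ints 4 (s'.ints 15 0) = cnt β B l := by rw [h15, e4, hF.cntB l hl.le]
    have hcA : ∀ b : Bool, s.ints 3 (s.ints 2 (node (s.ints 2) (d + 1) l + b.toNat)) =
        cnt β A (l ++ [b]) := by
      intro b
      rw [← node_append (s.ints 2), hF.cntA _ (by simp; omega)]
    have hcB : ∀ b : Bool, s.ints 4 (s.ints 2 (node (s.ints 2) (d + 1) l + b.toNat)) =
        cnt β B (l ++ [b]) := by
      intro b
      rw [← node_append (s.ints 2), hF.cntB _ (by simp; omega)]
    -- the effect of the two commands for the children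
    have hsem : ∀ s₂ : State d, s₂.ints = s'.ints → s₂.reals 5 = s.reals 5 →
        (∀ b : Bool, (if 0 < cnt β B (l ++ [b]) then
          s.reals 5 (s.ints 2 (node (s.ints 2) (d + 1) l + b.toNat)) else
          cnt β A (l ++ [b]) * s₂.reals 18 0) = msum β A (treeDist β wt N B) (l ++ [b])) →
        ((childCmd (iv 15) (rv 18) 0 10 ;; childCmd (iv 15) (rv 18) 1 11).sem coins s₂).reals 10 0 =
          msum β A (treeDist β wt N B) (l ++ [false]) ∧
        ((childCmd (iv 15) (rv 18) 0 10 ;; childCmd (iv 15) (rv 18) 1 11).sem coins s₂).reals 11 0 =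
          msum β A (treeDist β wt N B) (l ++ [true]) ∧
        ((childCmd (iv 15) (rv 18) 0 10 ;; childCmd (iv 15) (rv 18) 1 11).sem coins s₂).reals 18 0 =
          s₂.reals 18 0 := by
      intro s₂ q1 q2 q3
      have a0 := hcA false
      have a1 := hcA true
      have b0 := hcB false
      have b1 := hcB true
      have c0 := q3 false
      have c1 := q3 true
      simp only [Bool.toNat_false, Bool.toNat_true, add_zero] at a0 a1 b0 b1 c0 c1
      rw [← c0, ← c1]
      simp only [Cmd.sem_seq, sem_childCmd]
      refine ⟨?_, ?_, ?_⟩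
      · simp [q1, q2, h15, e2, e3, e4, a0, b0]
      · simp [q1, q2, h15, e2, e3, e4, a1, b1]
      · simp
    rw [weighChildrenCmd, Cmd.sem_seq]
    by_cases hpB : 0 < cnt β B l
    · rw [Cmd.sem_ite_pos _ _ _ _ (by simpa [hbl] using hpB)]
      set s₂ := (Cmd.setR 18 (.const 0) (.get 4 (iv 13))).sem coins s' with hs₂
      have h18 : s₂.reals 18 0 = wt l.length := by
        simp [hs₂, h13, r4, hw l.length hl]
      obtain ⟨g1, g2, g3⟩ := hsem s₂ rfl (by simp [hs₂, write_ne, r5]) (fun b => by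
        have := hF.weight.child_eq hl hpB b
        rw [childWeight, node_append] at this
        rw [← this, h18])
      refine ⟨g1, g2, fun b => ?_⟩
      rw [g3, h18]
      by_cases hb : 0 < cnt β B (l ++ [b])
      · exact Or.inl hb
      · have hb0 : cnt β B (l ++ [b]) = 0 := by omega
        exact Or.inr ⟨hb0, fun a ha => treeDist_of_leave β wt N hl hpB hb0 ha⟩
    · rw [Cmd.sem_ite_neg _ _ _ _ (by simpa [hbl] using hpB), Cmd.sem_skip]
      obtain ⟨h0, hdist⟩ := hI.resolve_left hpB
      have hch : ∀ b, cnt β B (l ++ [b]) = 0 := by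
        have := cnt_split β B l
        intro b
        cases b <;> omega
      have hpre : ∀ b a, pre β a (l ++ [b]).length = l ++ [b] → treeDist β wt N B a = s'.reals 18 0 :=
        fun b a ha => hdist a ((pre_append_iff β a l b).1 ha).1
      obtain ⟨g1, g2, g3⟩ := hsem s' rfl r5 (fun b => by
        rw [if_neg (by rw [hch b]; exact lt_irrefl 0), msum_const fun a _ ha => hpre b a ha])
      refine ⟨g1, g2, fun b => Or.inr ⟨hch b, ?_⟩⟩
      rw [g3]
      exact hpre b
  · rintro s' ⟨h15, hI⟩
    obtain ⟨hm, hp, hpick⟩ := sample_mem hwt hinj hpos u.2.1 u.2.2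
    rw [hu, hpick] at h15 hI
    refine ⟨h15, ?_⟩
    -- A sample has a positive estimate, so its leaf cannot contain a point of `B`: the descent has
    -- left the trie of `B`.
    rcases hI with hI | ⟨-, hI⟩
    · obtain ⟨b, hb, e⟩ := (cnt_pos β).1 hI
      rw [pre_length] at e
      have := le_lcp β N hb le_rfl e
      rw [treeDist, if_neg (by omega)] at hp
      exact absurd hp (lt_irrefl _)
    · exact (hI _ (by rw [pre_length])).symm

/-- Each copy answers from the same history `H` with its own seed, so the answers are independent
once `H` and `a` are fixed. -/
theorem run_nnQueryCmd {a : Pt d} {H : List (NNOp d)} (hl : (nnSet H).Nonempty) (r : ℕ)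
    (s : State d) (ha : ∀ i : Fin d, s.reals 6 (s.ints 15 0 + i) = a i)
    (hH : ∀ j < r, s.hist j = H) :
    Run n D coins seeds (nnQueryCmd r) s (r * (D.time + 5) + 1) fun s' =>
      (∀ j < r, s'.hist j = H ++ [.query a]) ∧ (∀ j, r ≤ j → s'.hist j = s.hist j) ∧
        (∀ j < r, s'.reals 16 j = D.answer (seeds j) H a) ∧ s'.drawn = s.drawn ∧
        s'.ints = s.ints ∧ ∀ b, b ≠ 16 → s'.reals b = s.reals b := by
  induction r with
  | zero => exact Run.straight rfl (by norm_num [Cmd.fuel, nnQueryCmd]) (by simp [nnQueryCmd])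
  | succ r ih =>
    refine Run.seq' (ih fun j hj => hH j (by omega)) (T₂ := D.time + 5) ?_
      (by push_cast; linarith)
    rintro s₁ - ⟨a₁, b₁, c₁, d₁, e₁, f₁⟩
    have hpt : s₁.point 6 (s₁.ints 15 0) = a := by
      funext i
      simp [State.point, e₁, f₁, ha]
    have hh : s₁.hist r = H := by rw [b₁ r le_rfl, hH r (by omega)]
    refine ⟨_, _, Exec.nnQuery s₁ (.const r) 6 (iv 15) 16 (.const r) ?_, ?_, ?_, ?_, ?_, ?_, ?_, ?_⟩
    · simpa [State.Allows, hh, NNOp.Legal] using hl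
    · norm_num [IExp.cost]; linarith
    · intro j hj
      rcases Nat.lt_succ_iff_lt_or_eq.1 hj with h | rfl
      · simp [State.log, h.ne, a₁ j h]
      · simp [State.log, hh, hpt]
    · intro j hj
      have : j ≠ r := by omega
      simp [State.log, this, b₁ j (by omega)]
    · intro j hj
      rcases Nat.lt_succ_iff_lt_or_eq.1 hj with h | rfl
      · simp [h.ne, c₁ j h]
      · simp [hh, hpt]
    · simpa [State.log] using d₁
    · simpa [State.log] using e₁
    · intro b hb
      simp [write_ne, hb, f₁ b hb]

theorem rank_succ (r : ℕ) (a : ℕ → ℝ) (x : ℝ) [Decidable (a r ≤ x)] :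
    rank (r + 1) a x = rank r a x + if a r ≤ x then 1 else 0 := by
  unfold rank
  rw [Nat.count_succ]
  congr 1
  simp

theorem run_maxCmd {r : ℕ} (hr : 0 < r) (s : State d) :
    Run n D coins seeds (maxCmd r) s (50 * (r + 1)) fun s' =>
      (∃ i < r, s'.reals 17 0 = s.reals 16 i) ∧ ∀ i < r, s.reals 16 i ≤ s'.reals 17 0 := by
  refine Run.straight_seq rfl (T₂ := 50 * r + 40) ?_ ?_
  · norm_num [Cmd.fuel, IExp.cost, RExp.cost]; linarith
  refine Run.loop_straight rfl (fun t s' => s'.ints 17 0 = t ∧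
    (∃ i < r, s'.reals 17 0 = s.reals 16 i) ∧ ∀ i < t, s.reals 16 i ≤ s'.reals 17 0) r ?_ ?_ ?_ ?_ ?_
  · exact ⟨by simp, ⟨0, hr, by simp⟩, by simp⟩
  · rintro t ht s' hf ⟨h1, ⟨i, hi, h2⟩, h3⟩
    have r16 := hf.reals 16 (by simp [Cmd.wR])
    simp [write_ne] at r16
    refine ⟨by simp [h1, ht], ?_⟩
    rw [Cmd.sem_seq]
    by_cases h : s'.reals 17 0 < s.reals 16 t
    · rw [Cmd.sem_ite_pos _ _ _ _ (by simpa [h1, r16] using h)]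
      refine ⟨by simp [h1], ⟨t, ht, by simp [h1, r16]⟩, fun j hj => ?_⟩
      simp only [Cmd.sem_setI, Cmd.sem_setR, write_apply, IExp.eval, RExp.eval, h1, r16]
      rcases Nat.lt_succ_iff_lt_or_eq.1 hj with h' | rfl
      · simpa using (h3 j h').trans h.le
      · simp
    · rw [Cmd.sem_ite_neg _ _ _ _ (by simpa [h1, r16] using h)]
      refine ⟨by simp [h1], ⟨i, hi, by simpa using h2⟩, fun j hj => ?_⟩
      rcases Nat.lt_succ_iff_lt_or_eq.1 hj with h' | rfl
      · simpa using h3 j h'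
      · simpa using h
  · rintro s' hf ⟨h1, -⟩
    simp [h1]
  · norm_num [Cmd.fuel, IExp.cost, BExp.cost, RExp.cost]; linarith
  · rintro s' hf ⟨-, h2, h3⟩
    exact ⟨h2, h3⟩

theorem run_rankCmd (r : ℕ) (s : State d) :
    Run n D coins seeds (rankCmd r) s (50 * (r + 1)) fun s' =>
      s'.ints 19 0 = rank r (s.reals 16) (s.reals 16 (s.ints 17 0)) := by
  classical
  refine Run.straight_seq rfl (T₂ := 50 * r + 40) ?_ ?_
  · norm_num [Cmd.fuel, IExp.cost, RExp.cost]; linarith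
  refine Run.loop_straight rfl (fun t s' => s'.ints 18 0 = t ∧
    s'.ints 19 0 = rank t (s.reals 16) (s.reals 16 (s.ints 17 0))) r ?_ ?_ ?_ ?_ ?_
  · simp [rank]
  · rintro t ht s' hf ⟨h1, h2⟩
    have r16 := hf.reals 16 (by simp [Cmd.wR])
    have e17 := hf.ints 17 (by simp [Cmd.wI])
    simp [write_ne] at r16 e17
    refine ⟨by simp [h1, ht], ?_⟩
    rw [Cmd.sem_seq, rank_succ]
    by_cases h : s.reals 16 (s.ints 17 0) < s.reals 16 t
    · rw [Cmd.sem_ite_pos _ _ _ _ (by simpa [h1, r16, e17] using h), if_neg (by linarith)]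
      simp [h1, h2]
    · rw [Cmd.sem_ite_neg _ _ _ _ (by simpa [h1, r16, e17] using h), if_pos (by linarith)]
      simp [h1, h2]
  · rintro s' hf ⟨h1, -⟩
    simp [h1]
  · norm_num [Cmd.fuel, IExp.cost, BExp.cost, RExp.cost]; linarith
  · rintro s' hf ⟨-, h2⟩
    exact h2

theorem rank_eq_self {r : ℕ} {a : ℕ → ℝ} {x : ℝ} (h : ∀ i < r, a i ≤ x) : rank r a x = r := by
  classical
  induction r with
  | zero => simp [rank]
  | succ r ih =>
    rw [rank_succ, ih fun i hi => h i (by omega), if_pos (h r (by omega))]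

/-- The maximum has rank `r > t` and is a valid start; then the minimum over all answers of
sufficient rank is taken. Quadratic time is harmless because `r` is a constant. -/
theorem run_medianCmd {r t : ℕ} (hr : t < r) (s : State d) :
    Run n D coins seeds (medianCmd r t) s (200 * (r + 1) ^ 2) fun s' =>
      IsMedian r t (s.reals 16) (s'.reals 17 0) := by
  have hr0 : (0 : ℝ) ≤ r := Nat.cast_nonneg r
  refine Run.seq' (run_maxCmd (by omega) s) (T₂ := 200 * (r + 1) ^ 2 - 50 * (r + 1)) ?_ (by linarith)
  rintro s₁ f₁ ⟨⟨i₀, hi₀, h₁⟩, h₂⟩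
  have r16₁ := f₁.reals 16 (by simp [maxCmd, Cmd.wR])
  refine Run.straight_seq rfl (T₂ := 200 * (r + 1) ^ 2 - 50 * (r + 1) - 10) ?_ ?_
  · norm_num [Cmd.fuel, IExp.cost]; linarith
  refine Run.loop (T := 50 * (r + 1) + 40) (fun m s' => s'.ints 17 0 = m ∧
    t < rank r (s.reals 16) (s'.reals 17 0) ∧
    ∀ i < m, t < rank r (s.reals 16) (s.reals 16 i) → s'.reals 17 0 ≤ s.reals 16 i) r ?_ ?_ ?_ ?_ ?_
  · refine ⟨by simp, ?_, by simp⟩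
    rw [Cmd.sem_setI, rank_eq_self h₂]
    exact hr
  · rintro m hm s' hf ⟨h3, h4, h5⟩
    have r16 := hf.reals 16 (by simp [rankCmd, Cmd.wR])
    simp [r16₁] at r16
    refine ⟨by simp [h3, hm], ?_⟩
    refine Run.seq' (run_rankCmd r s') (T₂ := 40) ?_ (by linarith)
    rintro s₂ f₂ h6
    have r16₂ := f₂.reals 16 (by simp [rankCmd, Cmd.wR])
    have r17₂ := f₂.reals 17 (by simp [rankCmd, Cmd.wR])
    have e17₂ := f₂.ints 17 (by simp [rankCmd, Cmd.wI])
    rw [r16, h3] at h6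
    refine Run.straight rfl (by norm_num [Cmd.fuel, IExp.cost, BExp.cost, RExp.cost]) ?_
    rw [Cmd.sem_seq]
    by_cases h : t < rank r (s.reals 16) (s.reals 16 m) ∧ s.reals 16 m < s'.reals 17 0
    · rw [Cmd.sem_ite_pos _ _ _ _ (by simpa [h6, r16₂, r17₂, e17₂, r16, h3] using h)]
      refine ⟨by simp [e17₂, h3], by simpa [r16₂, e17₂, r16, h3] using h.1, fun j hj hj' => ?_⟩
      simp only [Cmd.sem_setI, Cmd.sem_setR, write_apply, IExp.eval, RExp.eval, e17₂, h3, r16₂, r16]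
      rcases Nat.lt_succ_iff_lt_or_eq.1 hj with h' | rfl
      · simpa using h.2.le.trans (h5 j h' hj')
      · simp
    · rw [Cmd.sem_ite_neg _ _ _ _ (by simpa [h6, r16₂, r17₂, e17₂, r16, h3] using h)]
      refine ⟨by simp [e17₂, h3], by simpa [r17₂] using h4, fun j hj hj' => ?_⟩
      rcases Nat.lt_succ_iff_lt_or_eq.1 hj with h' | rfl
      · simpa [r17₂] using h5 j h' hj'
      · have : ¬ s.reals 16 j < s'.reals 17 0 := fun hc => h ⟨hj', hc⟩
        simpa [r17₂] using this
  · rintro s' hf ⟨h3, -⟩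
    simp [h3]
  · norm_num [BExp.cost, IExp.cost]
    nlinarith
  · rintro s' hf ⟨-, h4, h5⟩
    exact ⟨h4, h5⟩

end

/-- The estimate of the Chamfer distance from samples; their number is the real scalar `13`,
rounded up. -/
def sampleCmd (r t : ℕ) : Cmd :=
  (.setI 16 (.const 0) (.const 0) ;; .setR 14 (.const 0) (.const 0)) ;;
  .while (.rlt (.ofInt (iv 16)) (rv 13))
    ((.rand 15 (.const 0) ;; .setR 15 (.const 0) (.mul (rv 15) (.get 5 (.get 1 (.const 5))))) ;;
      descendCmd weighChildrenCmd ;; nnQueryCmd r ;; medianCmd r t ;;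
      .setR 14 (.const 0) (.add (rv 14) (.div (rv 17) (rv 18))) ;;
      .setI 16 (.const 0) (.add (iv 16) (.const 1))) ;;
  .setR 2 (.const 0) (.div (.mul (rv 14) (.get 5 (.get 1 (.const 5))))
    (.mul (.ofInt (iv 16)) (.add (.const 1) (.div (.get 1 (.const 1)) (.const 8)))))

/-- The program for queries. -/
def queryCmd (r t n₀ : ℕ) : Cmd :=
  .setR 13 (.const 0) (.div (.mul (.const 2621440) (.ofInt (.get 1 (.const 4))))
    (.get 1 (.const 1))) ;;
  .setR 13 (.const 0) (.div (.mul (rv 13) (.ofInt (.get 1 (.const 4)))) (.get 1 (.const 1))) ;;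
  .ite (.ilt (.get 0 (.const 0)) (.const n₀)) bruteCmd
    (.ite (.rlt (.mul (.ofInt (.get 0 (.const 0))) (.ofInt (.get 0 (.const 0)))) (rv 13)) bruteCmd
      (.ite (.rlt (.const 0) (.get 5 (.get 1 (.const 5)))) (sampleCmd r t)
        (.setR 2 (.const 0) (.const 0))))

/-- The number of samples suggested by the theory. -/
noncomputable def threshold (n : ℕ) (ε : ℝ) : ℝ := 2621440 * Nat.clog 2 n / ε * Nat.clog 2 n / ε

section

variable {d n : ℕ} {D : NNStructure d} {coins : ℕ → unitInterval} {seeds : ℕ → D.Seed}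
variable {β : Pt d → ℕ → Bool} {wt : ℕ → ℝ} {N : ℕ} {A B S : Finset (Pt d)}

/-- The history of a nearest-neighbour structure after some queries. -/
def queryHist (H : List (NNOp d)) (a : ℕ → Pt d) (j : ℕ) : List (NNOp d) :=
  H ++ (List.range j).map fun i => .query (a i)

theorem queryHist_succ (H : List (NNOp d)) (a : ℕ → Pt d) (j : ℕ) :
    queryHist H a (j + 1) = queryHist H a j ++ [.query (a j)] := by
  simp [queryHist, List.range_succ]

theorem nnSet_append (H H' : List (NNOp d)) : nnSet (H ++ H') = H'.foldl NNOp.apply (nnSet H) := by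
  simp [nnSet]

theorem nnSet_queryHist (H : List (NNOp d)) (a : ℕ → Pt d) (j : ℕ) :
    nnSet (queryHist H a j) = nnSet H := by
  induction j with
  | zero => simp [queryHist]
  | succ j ih => rw [queryHist_succ, nnSet_append, ih]; rfl

/-- The answers to the queries for the samples `a 0, …, a (m - 1)`. -/
def Answers (D : NNStructure d) (seeds : ℕ → D.Seed) (r t : ℕ) (H : List (NNOp d)) (a : ℕ → Pt d)
    (m : ℕ) (y : ℕ → ℝ) : Prop :=
  ∀ j < m, IsMedian r t (fun c => D.answer (seeds c) (queryHist H a j) (a j)) (y j)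

theorem rank_congr {r : ℕ} {a a' : ℕ → ℝ} (h : ∀ i < r, a i = a' i) (x : ℝ) :
    rank r a x = rank r a' x := by
  classical
  induction r with
  | zero => simp [rank]
  | succ r ih => rw [rank_succ, rank_succ, ih fun i hi => h i (by omega), h r (by omega)]

theorem IsMedian.congr {r t : ℕ} {a a' : ℕ → ℝ} {x : ℝ} (h : IsMedian r t a x)
    (haa : ∀ i < r, a i = a' i) : IsMedian r t a' x where
  rank_lt := by rw [← rank_congr haa]; exact h.rank_lt
  le i hi := by rw [← rank_congr haa, ← haa i hi]; exact h.le i hi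

theorem Forest.root_weight {s : State d} (hF : Forest β wt N A B s) (hB : B.Nonempty) :
    s.reals 5 (d + 1) = treeSum β wt N A B := by
  have := hF.weight.eq_msum [] (by simp) (by rw [cnt_nil]; exact hB.card_pos)
  rw [msum_nil] at this
  exact this

/-- A bound for the time of a sample. -/
noncomputable def sampleTime (N r : ℕ) (τ : ℝ) : ℝ :=
  200 * (N + 1) + (r * (τ + 5) + 1) + 200 * (r + 1) ^ 2 + 100

/-- The samples are determined by the random numbers alone, and the answers enter only the
accumulated sum. The factor `W` is applied once at the end, and the divisor `1 + ε / 8` turns the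
two-sided error into an underestimate. -/
theorem run_sampleCmd {r t b : ℕ} {ε θ : ℝ} {H : List (NNOp d)} (htr : t < r) (s : State d)
    (hroot : s.ints 1 5 = d + 1) (hN : s.ints 1 3 = N) (heps : s.reals 1 1 = ε)
    (hF : Forest β wt N A B s) (hw : ∀ p < N, s.reals 4 p = wt p) (hB : B.Nonempty)
    (hwt : ∀ p, 0 ≤ wt p) (hinj : ∀ a ∈ A, ∀ b ∈ A, pre β a N = pre β b N → a = b)
    (hpos : 0 < treeSum β wt N A B) (hθ : s.reals 13 0 = θ) (hb : s.drawn = b)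
    (hH : ∀ j < r, s.hist j = H) (hHB : nnSet H = B) :
    Run n D coins seeds (sampleCmd r t) s ((⌈θ⌉₊ + 1) * sampleTime N r D.time) fun s' =>
      s'.drawn = b + ⌈θ⌉₊ ∧
      (∀ j < r, s'.hist j = queryHist H (fun j => sample β wt N A B (coins (b + j))) ⌈θ⌉₊) ∧
      ∃ y, Answers D seeds r t H (fun j => sample β wt N A B (coins (b + j))) ⌈θ⌉₊ y ∧
        s'.reals 2 0 = (∑ j ∈ Finset.range ⌈θ⌉₊, y j /
          treeDist β wt N B (sample β wt N A B (coins (b + j)))) * treeSum β wt N A B /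
          (⌈θ⌉₊ * (1 + ε / 8)) := by
  set a : ℕ → Pt d := fun j => sample β wt N A B (coins (b + j)) with ha
  have hr0 : (0 : ℝ) ≤ r := Nat.cast_nonneg r
  have hN0 : (0 : ℝ) ≤ N := Nat.cast_nonneg N
  have hτ : (0 : ℝ) ≤ D.time := D.time.2
  have hrτ : (0 : ℝ) ≤ r * (D.time + 5) := by positivity
  have hmem := fun j : ℕ => sample_mem hwt hinj hpos (coins (b + j)).2.1 (coins (b + j)).2.2
  have hwI : ∀ r, (nnQueryCmd r).wI = [] ∧ ∀ a ∈ (nnQueryCmd r).wR, a = 16 := by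
    intro r
    induction r with
    | zero => exact ⟨rfl, by simp [nnQueryCmd, Cmd.wR]⟩
    | succ r ih =>
      refine ⟨by simp [nnQueryCmd, Cmd.wI, ih.1], ?_⟩
      simpa [nnQueryCmd, Cmd.wR, or_imp, forall_and] using ih.2
  have hnI : ∀ a, a ∉ (nnQueryCmd r).wI := by simp [hwI]
  have hnR : ∀ a, a ≠ 16 → a ∉ (nnQueryCmd r).wR := fun a h h' => h ((hwI r).2 a h')
  refine Run.straight_seq rfl (T₂ := ⌈θ⌉₊ * sampleTime N r D.time + 60) ?_ ?_
  · unfold sampleTime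
    norm_num [Cmd.fuel, IExp.cost, RExp.cost]; nlinarith
  refine Run.seq' (T₁ := ⌈θ⌉₊ * sampleTime N r D.time + 20) (T₂ := 40)
    (P := fun s' => s'.ints 16 0 = ⌈θ⌉₊ ∧ s'.drawn = b + ⌈θ⌉₊ ∧
      (∀ j < r, s'.hist j = queryHist H a ⌈θ⌉₊) ∧
      ∃ y, Answers D seeds r t H a ⌈θ⌉₊ y ∧
        s'.reals 14 0 = ∑ j ∈ Finset.range ⌈θ⌉₊, y j / treeDist β wt N B (a j)) ?_ ?_ (by linarith)
  · refine Run.loop (T := 200 * (N + 1) + (r * (D.time + 5) + 1) + 200 * (r + 1) ^ 2 + 50)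
      (fun i s' => s'.ints 16 0 = i ∧ s'.drawn = b + i ∧
      (∀ j < r, s'.hist j = queryHist H a i) ∧ ∃ y, Answers D seeds r t H a i y ∧
        s'.reals 14 0 = ∑ j ∈ Finset.range i, y j / treeDist β wt N B (a j)) ⌈θ⌉₊ ?_ ?_ ?_ ?_ ?_
    · refine ⟨by simp, by simp [hb], by simpa [queryHist] using hH, 0, ?_, by simp⟩
      intro j hj
      omega
    · rintro i hi s' hf ⟨h1, h2, h3, y, h4, h5⟩
      have fI : ∀ q, q < 13 → s'.ints q = s.ints q := by
        intro q hq
        rw [hf.ints q]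
        · have : q ≠ 16 := by omega
          simp [write_ne, this]
        · simp [Cmd.wI, descendCmd, weighChildrenCmd, childCmd, hwI, medianCmd, maxCmd, rankCmd]
          omega
      have fR : ∀ q, q < 10 ∨ q = 13 → s'.reals q = s.reals q := by
        intro q hq
        rw [hf.reals q]
        · have : q ≠ 14 := by omega
          simp [write_ne, this]
        · have := hnR q (by omega)
          simp [Cmd.wR, descendCmd, weighChildrenCmd, childCmd, this, medianCmd, maxCmd, rankCmd]
          omega
      have hF' : Forest β wt N A B s' := hF.congr (fI 2 (by norm_num)) (fI 3 (by norm_num))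
        (fI 4 (by norm_num)) (fI 5 (by norm_num)) (fR 5 (by norm_num)) (fR 6 (by norm_num))
      have hroot' : s'.ints 1 5 = d + 1 := by rw [fI 1 (by norm_num), hroot]
      -- Comparing the integer counter with the real threshold yields `⌈θ⌉₊` rounds without any
      -- rounding operation.
      refine ⟨by simpa [h1, fR 13 (by norm_num), hθ] using Nat.lt_ceil.1 hi, ?_⟩
      refine Run.straight_seq rfl (T₂ := 200 * (N + 1) + (r * (D.time + 5) + 1) +
        200 * (r + 1) ^ 2 + 30) ?_ ?_
      · norm_num [Cmd.fuel, IExp.cost, RExp.cost]; linarith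
      set s₀ := (Cmd.rand 15 (.const 0) ;;
        Cmd.setR 15 (.const 0) (.mul (rv 15) (.get 5 (.get 1 (.const 5))))).sem coins s' with hs₀
      have i₀ : s₀.ints = s'.ints := by simp [hs₀]
      have r₀ : ∀ q, q ≠ 15 → s₀.reals q = s'.reals q := by
        intro q hq
        simp [hs₀, write_ne, hq]
      have d₀ : s₀.drawn = b + i + 1 := by simp [hs₀, h2]
      have h₀ : s₀.hist = s'.hist := by simp [hs₀]
      refine Run.seq' (run_weighedDescendCmd (β := β) (wt := wt) (N := N) (A := A) (B := B)
        (u := coins (b + i)) s₀ (by rw [i₀, hroot']) (by rw [i₀, fI 1 (by norm_num), hN])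
        (hF'.congr (by rw [i₀]) (by rw [i₀]) (by rw [i₀]) (by rw [i₀]) (r₀ 5 (by norm_num))
          (r₀ 6 (by norm_num)))
        (by rw [r₀ 4 (by norm_num), fR 4 (by norm_num)]; exact hw) hB hwt hinj hpos ?_)
        (T₂ := (r * (D.time + 5) + 1) + 200 * (r + 1) ^ 2 + 30) ?_ (by linarith)
      · simp [hs₀, h2, hroot', hF'.root_weight hB]
      rintro s₁ f₁ ⟨a₁, b₁⟩
      have r6₁ := f₁.reals 6 (by decide)
      have r14₁ := f₁.reals 14 (by decide)
      have e16₁ := f₁.ints 16 (by decide)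
      have d₁ := f₁.drawn rfl
      have hi₁ := f₁.hist rfl
      rw [r₀ 6 (by norm_num)] at r6₁
      rw [r₀ 14 (by norm_num)] at r14₁
      rw [i₀] at e16₁ a₁
      rw [h₀] at hi₁
      refine Run.seq' (run_nnQueryCmd (a := a i) (H := queryHist H a i)
        (by rw [nnSet_queryHist, hHB]; exact hB) r s₁ ?_ (by rw [hi₁]; exact h3))
        (T₂ := 200 * (r + 1) ^ 2 + 30) ?_ (by linarith)
      · intro q
        rw [r6₁, a₁]
        simpa using hF'.point _ (Or.inl (hmem i).1) q
      rintro s₂ - ⟨a₂, -, c₂, d₂, e₂, f₂⟩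
      refine Run.seq' (run_medianCmd htr s₂) (T₂ := 30) ?_ le_rfl
      rintro s₃ f₃ a₃
      have r14₃ := f₃.reals 14 (by simp [medianCmd, maxCmd, rankCmd, Cmd.wR])
      have r18₃ := f₃.reals 18 (by simp [medianCmd, maxCmd, rankCmd, Cmd.wR])
      have e16₃ := f₃.ints 16 (by simp [medianCmd, maxCmd, rankCmd, Cmd.wI])
      have d₃ := f₃.drawn rfl
      have hi₃ := f₃.hist rfl
      refine Run.straight rfl (by norm_num [Cmd.fuel, IExp.cost, RExp.cost]) ⟨?_, ?_, ?_, ?_⟩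
      · simp [e16₃, e₂, e16₁, h1]
      · simp [d₃, d₂, d₁, d₀, add_assoc]
      · intro j hj
        simp [hi₃, a₂ j hj, queryHist_succ]
      · refine ⟨Function.update y i (s₃.reals 17 0), ?_, ?_⟩
        · intro j hj
          rcases Nat.lt_succ_iff_lt_or_eq.1 hj with h | rfl
          · rw [Function.update_of_ne h.ne]
            exact h4 j h
          · rw [Function.update_self]
            exact a₃.congr c₂
        · rw [Finset.sum_range_succ, Function.update_self, Finset.sum_congr rfl fun j hj => by
            rw [Function.update_of_ne (Finset.mem_range.1 hj).ne]]
          simp [r14₃, f₂, r14₁, h5, r18₃, b₁, ha]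
    · rintro s' hf ⟨h1, -⟩
      have r13 : s'.reals 13 = s.reals 13 := by
        rw [hf.reals 13]
        · simp [write_ne]
        · have := hnR 13 (by norm_num)
          simp [Cmd.wR, descendCmd, weighChildrenCmd, childCmd, this, medianCmd, maxCmd, rankCmd]
      simp [h1, r13, hθ, Nat.le_ceil]
    · unfold sampleTime
      have : (0 : ℝ) ≤ (⌈θ⌉₊ : ℕ) := Nat.cast_nonneg _
      norm_num [BExp.cost, IExp.cost, RExp.cost]
      nlinarith
    · rintro s' hf h
      exact h
  · rintro s₁ f₁ ⟨h1, h2, h3, y, h4, h5⟩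
    have e1 : s₁.ints 1 = s.ints 1 := by
      rw [f₁.ints 1]
      · simp [write_ne]
      · simp [Cmd.wI, descendCmd, weighChildrenCmd, childCmd, hwI, medianCmd, maxCmd, rankCmd]
    have fR : ∀ q, q < 10 → s₁.reals q = s.reals q := by
      intro q hq
      rw [f₁.reals q]
      · have : q ≠ 14 := by omega
        simp [write_ne, this]
      · have := hnR q (by omega)
        simp [Cmd.wR, descendCmd, weighChildrenCmd, childCmd, this, medianCmd, maxCmd, rankCmd]
        omega
    refine Run.straight rfl (by norm_num [Cmd.fuel, IExp.cost, RExp.cost]) ⟨h2, h3, y, h4, ?_⟩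
    simp [h1, h5, e1, fR 5, fR 1, heps, hroot, hF.root_weight hB, ha]

/-- The Chamfer distance is computed exactly. -/
def Brute (n n₀ : ℕ) (ε : ℝ) : Prop := n < n₀ ∨ (n : ℝ) * n < threshold n ε

/-- Queries write only to the output array and to scratch arrays with numbers from 10 on, so the
trie and the parameters survive them. -/
theorem Good.congr {k r m m' : ℕ} {ε : ℝ} {H H' : List (NNOp d)} {s s' : State d}
    (h : Good n k ε coins r A B m H s) (hI : ∀ q, q < 10 → s'.ints q = s.ints q)
    (hR : ∀ q, q ≠ 2 → q < 10 → s'.reals q = s.reals q) (hm : s'.drawn = m')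
    (hH : ∀ j < r, s'.hist j = H') : Good n k ε coins r A B m' H' s' where
  env := h.env.congr (hI 0 (by norm_num)) (hI 1 (by norm_num)) (hR 0 (by norm_num) (by norm_num))
    (hR 1 (by norm_num) (by norm_num)) (hR 3 (by norm_num) (by norm_num))
  forest := h.forest.congr (hI 2 (by norm_num)) (hI 3 (by norm_num)) (hI 4 (by norm_num))
    (hI 5 (by norm_num)) (hR 5 (by norm_num) (by norm_num)) (hR 6 (by norm_num) (by norm_num))
  weights := by rw [hR 4 (by norm_num) (by norm_num)]; exact h.weights
  drawn := hm
  hist := hH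

/-- A point of `B` has estimate zero and any other point of `A` a positive one, whatever the random
numbers are. Hence whether a query samples, and how many numbers it draws, is determined by the
requests alone. -/
theorem treeSum_pos_iff {k J : ℕ} {z : ℕ → unitInterval} (hd : 0 < d) (hA : ∀ a ∈ A, a ∈ grid d (2 ^ k))
    (hBg : ∀ b ∈ B, b ∈ grid d (2 ^ k)) (hB : B.Nonempty) :
    0 < treeSum (bits k J z) (bitWeight d k J) (depth d k J) A B ↔ ¬ A ⊆ B := by
  constructor
  · intro h hAB
    refine absurd h (not_lt.2 (Finset.sum_nonpos fun a ha => ?_))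
    have := le_lcp (bits k J z) (depth d k J) (hAB ha) le_rfl rfl
    rw [treeDist, if_neg (by omega)]
  · intro h
    obtain ⟨a, ha, hab⟩ := Finset.not_subset.1 h
    refine lt_of_lt_of_le ?_ (Finset.single_le_sum (fun a _ => treeDist_nonneg (bits k J z) _ _
      bitWeight_nonneg B a) ha)
    have h1 := one_le_lcp (k := k) (J := J) (z := z) hB a
    rw [treeDist, if_pos]
    · exact bitWeight_pos (by omega)
    · refine lt_of_le_of_ne (lcp_le _ _ _ _) fun e => hab ?_
      obtain ⟨b, hb, hpre⟩ := lcp_spec (bits k J z) (depth d k J) hB a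
      rw [e] at hpre
      rwa [← pre_bits_inj hd (hBg b hb) (hA a ha) hpre]

/-- A bound for the time of a query. -/
noncomputable def queryTime (n d k r n₀ : ℕ) (ε τ : ℝ) : ℝ :=
  100 + (3 * threshold n ε + (n₀ + 1) * (n₀ + 2)) *
      (300 * (depth d k (Nat.clog 2 d) + d + 3)) +
    (threshold n ε + 2) * sampleTime (depth d k (Nat.clog 2 d)) r τ

/-- The samples of a query. -/
noncomputable def samples (k : ℕ) (coins : ℕ → unitInterval) (A B : Finset (Pt d)) (m j : ℕ) : Pt d :=
  sample (bits k (Nat.clog 2 d) coins) (bitWeight d k (Nat.clog 2 d))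
    (depth d k (Nat.clog 2 d)) A B (coins (m + j))

/-- Three cases: exact computation when `n` is small or `n²` is below the number of samples; output
0 when `A ⊆ B`, where there is nothing to sample; sampling otherwise. -/
theorem run_queryCmd {k r t m n₀ : ℕ} {ε : ℝ} {H : List (NNOp d)} (htr : t < r) (s : State d)
    (hd : 0 < d) (hn : 2 ≤ n) (hε : 0 < ε) (hs : Good n k ε coins r A B m H s)
    (hA : ∀ a ∈ A, a ∈ grid d (2 ^ k)) (hBg : ∀ b ∈ B, b ∈ grid d (2 ^ k)) (hB : B.Nonempty)
    (hAn : A.card ≤ n) (hBn : B.card ≤ n) (hHB : nnSet H = B) :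
    Run n D coins seeds (queryCmd r t n₀) s (queryTime n d k r n₀ ε D.time) fun s' =>
      (Brute n n₀ ε ∨ A ⊆ B) ∧ Good n k ε coins r A B m H s' ∧ s'.output = chamfer A B ∨
      ¬ (Brute n n₀ ε ∨ A ⊆ B) ∧ Good n k ε coins r A B (m + ⌈threshold n ε⌉₊)
        (queryHist H (samples k coins A B m) ⌈threshold n ε⌉₊) s' ∧
        ∃ y, Answers D seeds r t H (samples k coins A B m) ⌈threshold n ε⌉₊ y ∧
        s'.output = (∑ j ∈ Finset.range ⌈threshold n ε⌉₊, y j /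
          treeDist (bits k (Nat.clog 2 d) coins) (bitWeight d k (Nat.clog 2 d))
            (depth d k (Nat.clog 2 d)) B (samples k coins A B m j)) *
          treeSum (bits k (Nat.clog 2 d) coins) (bitWeight d k (Nat.clog 2 d))
            (depth d k (Nat.clog 2 d)) A B / (⌈threshold n ε⌉₊ * (1 + ε / 8)) := by
  set J := Nat.clog 2 d with hJ
  set N := depth d k J with hN
  have hthr0 : 0 ≤ threshold n ε := by unfold threshold; positivity
  have hd0 : (0 : ℝ) ≤ d := Nat.cast_nonneg d
  have hN0 : (0 : ℝ) ≤ N := Nat.cast_nonneg N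
  have hτ : (0 : ℝ) ≤ D.time := D.time.2
  have hst : 200 ≤ sampleTime N r D.time := by
    unfold sampleTime
    have : (0 : ℝ) ≤ r * (D.time + 5) := by positivity
    have : (0 : ℝ) ≤ 200 * (r + 1) ^ 2 := by positivity
    linarith
  have hbr : 0 ≤ (3 * threshold n ε + (n₀ + 1) * (n₀ + 2)) * (300 * (N + d + 3)) := by positivity
  have hsm : 400 ≤ (threshold n ε + 2) * sampleTime N r D.time := by nlinarith
  have hAn' : (A.card : ℝ) ≤ n := by exact_mod_cast hAn
  have hBn' : (B.card : ℝ) ≤ n := by exact_mod_cast hBn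
  have hn' : (2 : ℝ) ≤ n := by exact_mod_cast hn
  -- the state after the threshold has been computed
  set s₀ := (Cmd.setR 13 (.const 0) (.div (.mul (rv 13) (.ofInt (.get 1 (.const 4)))) (.get 1 (.const 1)))).sem
    coins ((Cmd.setR 13 (.const 0) (.div (.mul (.const 2621440) (.ofInt (.get 1 (.const 4))))
    (.get 1 (.const 1)))).sem coins s) with hs₀
  have i₀ : s₀.ints = s.ints := by simp [hs₀]
  have r₀ : ∀ q, q ≠ 13 → s₀.reals q = s.reals q := by
    intro q hq
    simp [hs₀, write_ne, hq]
  have hθ : s₀.reals 13 0 = threshold n ε := by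
    simp [hs₀, threshold, hs.env.logn, hs.env.eps]
  have hg : Good n k ε coins r A B m H s₀ := hs.congr (fun q _ => by rw [i₀])
    (fun q _ hq => r₀ q (by omega)) hs.drawn hs.hist
  have hbrute : Brute n n₀ ε → Run n D coins seeds bruteCmd s₀
      ((3 * threshold n ε + (n₀ + 1) * (n₀ + 2)) * (300 * (N + d + 3))) fun s' =>
      Good n k ε coins r A B m H s' ∧ s'.output = chamfer A B := by
    intro hb
    refine (run_bruteCmd s₀ hg.env.dim hg.env.root hg.env.depth hg.forest hB).framed.mono ?_ ?_
    · rw [← mul_assoc]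
      refine mul_le_mul_of_nonneg_right ?_ (by positivity)
      have h1 : ((A.card : ℝ) + 1) * (B.card + 2) ≤ (n + 1) * (n + 2) := by gcongr
      refine h1.trans ?_
      rcases hb with hb | hb
      · have hb' : (n : ℝ) ≤ n₀ := by exact_mod_cast hb.le
        have : ((n : ℝ) + 1) * (n + 2) ≤ (n₀ + 1) * (n₀ + 2) := by gcongr
        linarith
      -- Here `(n + 1) * (n + 2) ≤ 3 * n ^ 2`, which uses `n ≥ 2`, and `n ^ 2` is below the
      -- threshold.
      · have : (0 : ℝ) ≤ (n₀ + 1) * (n₀ + 2) := by positivity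
        nlinarith
    · rintro s' ⟨f, h⟩
      refine ⟨hg.congr (fun q hq => f.ints q ?_) (fun q hq hq' => f.reals q ?_) ?_ ?_, h⟩
      · have : ∀ q < 10, q ∉ bruteCmd.wI := by decide
        exact this q hq
      · have : ∀ q < 10, q ≠ 2 → q ∉ bruteCmd.wR := by decide
        exact this q hq' hq
      · rw [f.drawn rfl]; exact hg.drawn
      · rw [f.hist rfl]; exact hg.hist
  rw [queryTime, ← hJ, ← hN]
  refine Run.straight_seq rfl (T₂ := 85 + (3 * threshold n ε + (n₀ + 1) * (n₀ + 2)) *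
      (300 * (N + d + 3)) + (threshold n ε + 2) * sampleTime N r D.time) ?_ ?_
  · norm_num [Cmd.fuel, IExp.cost, RExp.cost]; linarith
  refine Run.straight_seq rfl (T₂ := 70 + (3 * threshold n ε + (n₀ + 1) * (n₀ + 2)) *
      (300 * (N + d + 3)) + (threshold n ε + 2) * sampleTime N r D.time) ?_ ?_
  · norm_num [Cmd.fuel, IExp.cost, RExp.cost]; linarith
  refine Run.ite (T := 60 + (3 * threshold n ε + (n₀ + 1) * (n₀ + 2)) *
      (300 * (N + d + 3)) + (threshold n ε + 2) * sampleTime N r D.time) (fun h => ?_) (fun h => ?_) ?_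
  · have hb : Brute n n₀ ε := Or.inl (by simpa [hs.env.size] using h)
    exact (hbrute hb).mono (by linarith) fun s' h' => Or.inl ⟨Or.inl hb, h'⟩
  · have hlt : ¬ n < n₀ := by simpa [hs.env.size] using h
    refine Run.ite (T := 40 + (3 * threshold n ε + (n₀ + 1) * (n₀ + 2)) *
      (300 * (N + d + 3)) + (threshold n ε + 2) * sampleTime N r D.time) (fun h => ?_) (fun h => ?_) ?_
    · have hb : Brute n n₀ ε := by
        have : s₀.ints 0 0 = n := hg.env.size
        simp only [BExp.Holds, RExp.eval, IExp.eval] at h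
        rw [← hs₀, hθ, this] at h
        exact Or.inr h
      exact (hbrute hb).mono (by linarith) fun s' h' => Or.inl ⟨Or.inl hb, h'⟩
    · have hnb : ¬ Brute n n₀ ε := by
        have : s₀.ints 0 0 = n := hg.env.size
        simp only [BExp.Holds, RExp.eval, IExp.eval] at h
        rw [← hs₀, hθ, this] at h
        exact fun hb => hb.elim hlt h
      have hroot : s₀.reals 5 (s₀.ints 1 5) =
          treeSum (bits k J coins) (bitWeight d k J) (depth d k J) A B := by
        rw [hg.env.root, hg.forest.root_weight hB]
      refine Run.ite (T := 20 + (3 * threshold n ε + (n₀ + 1) * (n₀ + 2)) *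
        (300 * (N + d + 3)) + (threshold n ε + 2) * sampleTime N r D.time) (fun h => ?_) (fun h => ?_) ?_
      · simp only [BExp.Holds, RExp.eval, IExp.eval] at h
        rw [← hs₀, hroot] at h
        have hpos : 0 < treeSum (bits k J coins) (bitWeight d k J) (depth d k J) A B := by
          simpa using h
        have hsub := (treeSum_pos_iff hd hA hBg hB).1 hpos
        refine (run_sampleCmd htr s₀ hg.env.root hg.env.depth hg.env.eps hg.forest hg.weights hB
          bitWeight_nonneg (fun a ha b hb hab => pre_bits_inj hd (hA a ha) (hA b hb) hab) hpos hθ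
          hg.drawn hg.hist hHB).framed.mono ?_ ?_
        · have := Nat.ceil_lt_add_one hthr0
          have : ((⌈threshold n ε⌉₊ : ℝ) + 1) * sampleTime N r D.time ≤
              (threshold n ε + 2) * sampleTime N r D.time := by
            refine mul_le_mul_of_nonneg_right ?_ (by linarith)
            linarith
          linarith
        · rintro s' ⟨f, q1, q2, q3⟩
          refine Or.inr ⟨fun hc => hc.elim hnb hsub, hg.congr (fun q hq => f.ints q ?_)
            (fun q hq hq' => f.reals q ?_) q1 q2, q3⟩
          · have hw : ∀ r, (nnQueryCmd r).wI = [] := by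
              intro r
              induction r with
              | zero => rfl
              | succ r ih => simp [nnQueryCmd, Cmd.wI, ih]
            simp [sampleCmd, Cmd.wI, descendCmd, weighChildrenCmd, childCmd, hw, medianCmd, maxCmd, rankCmd]
            omega
          · have hw : ∀ r, ∀ a ∈ (nnQueryCmd r).wR, a = 16 := by
              intro r
              induction r with
              | zero => simp [nnQueryCmd, Cmd.wR]
              | succ r ih => simpa [nnQueryCmd, Cmd.wR, or_imp, forall_and] using ih
            have hq16 : q ∉ (nnQueryCmd r).wR := fun h => by have := hw r q h; omega
            simp [sampleCmd, Cmd.wR, descendCmd, weighChildrenCmd, childCmd, hq16, medianCmd, maxCmd, rankCmd]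
            omega
      · simp only [BExp.Holds, RExp.eval, IExp.eval] at h
        rw [← hs₀, hroot] at h
        have hsub : A ⊆ B := by
          by_contra hc
          exact h (by simpa using (treeSum_pos_iff hd hA hBg hB).2 hc)
        have hch : chamfer A B = 0 := by
          refine Finset.sum_eq_zero fun a ha => le_antisymm ?_ (distTo_nonneg B a)
          exact (distTo_le (hsub ha) a).trans (l1_eq_zero.2 rfl).le
        refine Run.straight rfl ?_ (Or.inl ⟨Or.inr hsub, hg.congr (fun q hq => rfl)
          (fun q hq hq' => ?_) hg.drawn hg.hist, ?_⟩)
        · norm_num [Cmd.fuel, IExp.cost, RExp.cost]; linarith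
        · simp [write_ne, hq, hs₀]
        · simp [State.output, hch]
      · norm_num [BExp.cost, IExp.cost, RExp.cost]; linarith
    · norm_num [BExp.cost, IExp.cost, RExp.cost]; linarith
  · norm_num [BExp.cost, IExp.cost, RExp.cost]; linarith

end

/-! ### Medians of independent answers -/

theorem rank_eq_card (r : ℕ) (a : ℕ → ℝ) (x : ℝ) :
    rank r a x = ((Finset.range r).filter fun i => a i ≤ x).card := by
  classical
  rw [rank, Nat.count_eq_card_filter_range]
  simp

/-- If most values are approximations, then so is the median. -/
theorem IsMedian.isApprox {t : ℕ} {a : ℕ → ℝ} {x γ v : ℝ} (h : IsMedian (2 * t + 1) t a x)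
    (hγ : 0 ≤ γ) {S : Finset ℕ} (hS : S ⊆ Finset.range (2 * t + 1)) (hc : t < S.card)
    (ha : ∀ i ∈ S, IsApprox γ (a i) v) : IsApprox γ x v := by
  classical
  constructor
  -- The largest good value has rank above `t`, because all good values are at most as large; so the
  -- median does not exceed it.
  · obtain ⟨i, hi, hmax⟩ := S.exists_max_image a (Finset.card_pos.1 (by omega))
    refine (h.le i (Finset.mem_range.1 (hS hi)) ?_).trans (ha i hi).1
    rw [rank_eq_card]
    refine hc.trans_le (Finset.card_le_card fun j hj => ?_)
    exact Finset.mem_filter.2 ⟨hS hj, hmax j hj⟩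
  · have h1 := h.rank_lt
    rw [rank_eq_card] at h1
    -- More than `t` indices are good and more than `t` have values at most `x`; among `2t + 1`
    -- indices the two sets must meet.
    have h2 := Finset.card_union_add_card_inter S
      ((Finset.range (2 * t + 1)).filter fun i => a i ≤ x)
    have h3 := Finset.card_le_card (Finset.union_subset hS
      (Finset.filter_subset (fun i => a i ≤ x) (Finset.range (2 * t + 1))))
    rw [Finset.card_range] at h3
    obtain ⟨i, hi⟩ := Finset.card_pos.1 (show 0 < (S ∩
      (Finset.range (2 * t + 1)).filter fun i => a i ≤ x).card by omega)
    rw [Finset.mem_inter, Finset.mem_filter] at hi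
    exact (ha i hi.1).2.trans (mul_le_mul_of_nonneg_right hi.2.2 hγ)

/-- A bad median forces at least `t + 1` bad copies. Union bound over the sets of `t + 1` copies,
each contributing a product by independence. -/
theorem infinitePi_median_le {Ω : Type} [MeasurableSpace Ω] (P : Measure Ω)
    [IsProbabilityMeasure P] {f : Ω → ℝ} (hf : Measurable f) {γ v : ℝ} (hγ : 0 ≤ γ) (t : ℕ)
    {δ : ℝ≥0∞} (hδ : P {s | ¬ IsApprox γ (f s) v} ≤ δ) :
    Measure.infinitePi (fun _ : ℕ => P)
        {s | ∃ x, IsMedian (2 * t + 1) t (fun i => f (s i)) x ∧ ¬ IsApprox γ x v} ≤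
      2 ^ (2 * t + 1) * δ ^ (t + 1) := by
  classical
  have hm : MeasurableSet {s | ¬ IsApprox γ (f s) v} := by
    refine MeasurableSet.compl ?_
    exact (measurableSet_le hf measurable_const).inter
      (measurableSet_le measurable_const (hf.mul_const γ))
  have hsub : {s : ℕ → Ω | ∃ x, IsMedian (2 * t + 1) t (fun i => f (s i)) x ∧ ¬ IsApprox γ x v} ⊆
      ⋃ S ∈ (Finset.range (2 * t + 1)).powersetCard (t + 1),
        Set.pi (S : Set ℕ) fun _ => {s | ¬ IsApprox γ (f s) v} := by
    rintro s ⟨x, hx, hbad⟩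
    set G := (Finset.range (2 * t + 1)).filter fun i => IsApprox γ (f (s i)) v with hG
    have hGc : G.card ≤ t := by
      by_contra hlt
      exact hbad (hx.isApprox hγ (Finset.filter_subset _ _) (not_le.1 hlt)
        fun i hi => (Finset.mem_filter.1 hi).2)
    have h1 := Finset.card_filter_add_card_filter_not (s := Finset.range (2 * t + 1))
      (fun i => IsApprox γ (f (s i)) v)
    rw [Finset.card_range, ← hG] at h1
    obtain ⟨S, hS, hSc⟩ := Finset.exists_subset_card_eq
      (show t + 1 ≤ ((Finset.range (2 * t + 1)).filter fun i => ¬ IsApprox γ (f (s i)) v).card by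
        omega)
    refine Set.mem_biUnion (x := S) ?_ fun i hi => (Finset.mem_filter.1 (hS hi)).2
    exact Finset.mem_powersetCard.2 ⟨hS.trans (Finset.filter_subset _ _), hSc⟩
  refine (measure_mono hsub).trans ((measure_biUnion_finset_le _ _).trans ?_)
  calc ∑ S ∈ (Finset.range (2 * t + 1)).powersetCard (t + 1),
        Measure.infinitePi (fun _ : ℕ => P)
          (Set.pi (S : Set ℕ) fun _ => {s | ¬ IsApprox γ (f s) v})
      ≤ ∑ S ∈ (Finset.range (2 * t + 1)).powersetCard (t + 1), δ ^ (t + 1) := by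
        refine Finset.sum_le_sum fun S hS => ?_
        rw [Measure.infinitePi_pi _ fun _ _ => hm, Finset.prod_const,
          (Finset.mem_powersetCard.1 hS).2]
        gcongr
    _ = ((2 * t + 1).choose (t + 1) : ℝ≥0∞) * δ ^ (t + 1) := by
        simp
    _ ≤ 2 ^ (2 * t + 1) * δ ^ (t + 1) := by
        gcongr
        exact_mod_cast Nat.choose_le_two_pow _ _

/-! ### The random choices of a query -/

/-- Needed for samples: they are discrete for every fixed tree, and the tree itself is a discrete
random object. -/
theorem Discrete.bind {Ω X Y : Type*} [MeasurableSpace Ω] {T : Ω → X} (h : Discrete T)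
    {S : X → Ω → Y} (hS : ∀ x, Discrete (S x)) : Discrete fun ω => S (T ω) ω where
  countable := by
    refine (h.countable.biUnion fun x _ => (hS x).countable).mono ?_
    rintro _ ⟨ω, rfl⟩
    exact Set.mem_biUnion ⟨ω, rfl⟩ ⟨ω, rfl⟩
  fibre y := by
    have : (fun ω => S (T ω) ω) ⁻¹' {y} = ⋃ x ∈ Set.range T, T ⁻¹' {x} ∩ S x ⁻¹' {y} := by
      ext ω
      simp only [Set.mem_preimage, Set.mem_singleton_iff, Set.mem_iUnion, Set.mem_inter_iff,
        exists_prop]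
      exact ⟨fun h => ⟨T ω, ⟨ω, rfl⟩, rfl, h⟩, fun ⟨x, _, hx, hy⟩ => by rwa [hx]⟩
    rw [this]
    exact MeasurableSet.biUnion h.countable fun x _ => (h.fibre x).inter ((hS x).fibre y)

theorem discrete_samples {d : ℕ} (k : ℕ) (A B : Finset (Pt d)) (m j : ℕ) :
    Discrete fun coins => samples k coins A B m j := by
  unfold samples
  refine discrete_bits.bind (S := fun β coins => sample β (bitWeight d k (Nat.clog 2 d))
    (depth d k (Nat.clog 2 d)) A B (coins (m + j))) fun β => ?_
  unfold sample
  refine Discrete.comp (Discrete.of_countable fun l => ?_) (decode β _ A)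
  exact ((by fun_prop : Measurable fun z : ℕ → unitInterval => (z (m + j) : ℝ)).mul_const _)
    (measurable_pick _ _ _ l)

theorem discrete_queryHist {d : ℕ} (k : ℕ) (A B : Finset (Pt d)) (m j : ℕ)
    {H : (ℕ → unitInterval) → List (NNOp d)} (hH : Discrete H) :
    Discrete fun coins => queryHist (H coins) (samples k coins A B m) j := by
  unfold queryHist
  exact hH.comp₂ (Discrete.list_map (fun i coins => NNOp.query (samples k coins A B m i))
    (fun i => (discrete_samples k A B m i).comp NNOp.query) (List.range j)) (· ++ ·)

theorem nnLegal_append {d n : ℕ} (B : Finset (Pt d)) (H H' : List (NNOp d)) :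
    NNLegal n B (H ++ H') ↔ NNLegal n B H ∧ NNLegal n (H.foldl NNOp.apply B) H' := by
  induction H generalizing B with
  | nil => simp [NNLegal]
  | cons o H ih => simp [NNLegal, ih, and_assoc]

theorem nnLegal_queryHist {d n : ℕ} {H : List (NNOp d)} (hH : NNLegal n ∅ H)
    (hB : (nnSet H).Nonempty) (a : ℕ → Pt d) (j : ℕ) : NNLegal n ∅ (queryHist H a j) := by
  induction j with
  | zero => simpa [queryHist] using hH
  | succ j ih =>
    rw [queryHist_succ, nnLegal_append]
    refine ⟨ih, ?_, trivial⟩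
    change (nnSet (queryHist H a j)).Nonempty
    rwa [nnSet_queryHist]

/-- With high probability, all answers to the queries for the samples are approximations. -/
theorem randomness_answers_le {d n k t m M : ℕ} {D : NNStructure d} {β δ : ℝ}
    (hD : D.IsApproxNN n β δ) (hβ : 0 ≤ 1 + β) {A B : Finset (Pt d)} (hB : B.Nonempty)
    {H : (ℕ → unitInterval) → List (NNOp d)} (hH : Discrete H) (hHl : ∀ z, NNLegal n ∅ (H z))
    (hHB : ∀ z, nnSet (H z) = B) :
    randomness D {ρ | ∃ y, Answers D ρ.2 (2 * t + 1) t (H ρ.1) (samples k ρ.1 A B m) M y ∧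
        ∃ j < M, ¬ IsApprox (1 + β) (y j) (distTo (samples k ρ.1 A B m j) B)} ≤
      M * (2 ^ (2 * t + 1) * ENNReal.ofReal δ ^ (t + 1)) := by
  set Bad : List (NNOp d) × Pt d → Set (ℕ → D.Seed) := fun p => {seeds | ∃ x,
    IsMedian (2 * t + 1) t (fun c => D.answer (seeds c) p.1 p.2) x ∧
      ¬ IsApprox (1 + β) x (distTo p.2 B)} with hBad
  have hsub : {ρ : (ℕ → unitInterval) × (ℕ → D.Seed) |
      ∃ y, Answers D ρ.2 (2 * t + 1) t (H ρ.1) (samples k ρ.1 A B m) M y ∧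
        ∃ j < M, ¬ IsApprox (1 + β) (y j) (distTo (samples k ρ.1 A B m j) B)} ⊆
      ⋃ j ∈ Finset.range M, {ρ | ρ.2 ∈ Bad (queryHist (H ρ.1) (samples k ρ.1 A B m) j,
        samples k ρ.1 A B m j)} := by
    rintro ρ ⟨y, hy, j, hj, hbad⟩
    exact Set.mem_biUnion (x := j) (Finset.mem_coe.2 (Finset.mem_range.2 hj))
      ⟨y j, hy j hj, hbad⟩
  refine (measure_mono hsub).trans ((measure_biUnion_finset_le _ _).trans ?_)
  refine (Finset.sum_le_sum fun j _ => ?_).trans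
    (b := ∑ j ∈ Finset.range M, (2 ^ (2 * t + 1) * ENNReal.ofReal δ ^ (t + 1))) (by simp)
  refine ((discrete_queryHist k A B m j hH).prodMk (discrete_samples k A B m j)).measure_prod_le
    Bad ?_
  rintro _ ⟨z, rfl⟩
  -- With the random numbers fixed, history and query point are fixed in advance, as the guarantee
  -- for `D` demands; only the seeds remain random.
  refine infinitePi_median_le D.law (D.measurable_answer _ _) hβ t ?_
  have hne : (nnSet (H z)).Nonempty := by rw [hHB]; exact hB
  have := hD (queryHist (H z) (samples k z A B m) j) (samples k z A B m j) (by
    rw [← queryHist_succ]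
    exact nnLegal_queryHist (hHl z) hne _ _)
  rwa [nnSet_queryHist, hHB] at this

/-- The accuracy of the estimate. -/
theorem isApprox_estimate {α ε v E E' M : ℝ} (hα : 0 < α) (hε : 0 < ε) (hε1 : ε < 1) (hM : 0 < M)
    (hv : 0 ≤ v) (h₁ : E' ≤ E) (h₂ : E ≤ E' * (1 + 1 / 2 * α)) (h₃ : |E - M * v| ≤ ε / 8 * (M * v)) :
    IsApprox (1 + α + ε) (E' / (M * (1 + ε / 8))) v := by
  rw [abs_le] at h₃
  have hM' : 0 < M * (1 + ε / 8) := by positivity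
  constructor
  · rw [div_le_iff₀ hM']
    linarith
  · have hMv : 0 ≤ M * v := by positivity
    rw [div_mul_eq_mul_div, le_div_iff₀ hM']
    have h4 : M * v * (1 - ε / 8) ≤ E' * (1 + 1 / 2 * α) := by linarith
    -- The difference of the two sides is `α/2 + 3ε/4 - 3αε/16 - ε²/8`, which is positive for `ε <
    -- 1`.
    have h5 : (1 + 1 / 2 * α) * (1 + ε / 8) ≤ (1 - ε / 8) * (1 + α + ε) := by
      nlinarith [mul_pos hα hε, mul_pos hε (sub_pos.2 hε1), mul_pos hα (sub_pos.2 hε1)]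
    have h6 : 0 < 1 - ε / 8 := by linarith
    have h7 : 0 < 1 + 1 / 2 * α := by linarith
    have h8 : M * v * ((1 + 1 / 2 * α) * (1 + ε / 8)) ≤
        E' * (1 + α + ε) * (1 + 1 / 2 * α) := by
      calc M * v * ((1 + 1 / 2 * α) * (1 + ε / 8))
          ≤ M * v * ((1 - ε / 8) * (1 + α + ε)) := by gcongr
        _ = M * v * (1 - ε / 8) * (1 + α + ε) := by ring
        _ ≤ E' * (1 + 1 / 2 * α) * (1 + α + ε) := by gcongr
        _ = _ := by ring
    refine le_of_mul_le_mul_right (?_ : _ * (1 + 1 / 2 * α) ≤ _ * (1 + 1 / 2 * α)) h7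
    linarith

/-! ### The algorithm -/

/-- The dynamic algorithm, with `r` copies of the nearest-neighbour structure; the answer of rank
`t + 1` counts. -/
def chamferAlgorithm (r t n₀ : ℕ) : Algorithm where
  insert := updateCmd r true
  delete := updateCmd r false
  query := queryCmd r t n₀

section

variable {d n k φ r t n₀ : ℕ} {α ε : ℝ} {D : NNStructure d}

theorem serves_append {P : Algorithm} {coins : ℕ → unitInterval} {seeds : ℕ → D.Seed}
    {s s₁ s₂ : State d} {ops : List (Op d)} {o : Op d} {T : ℝ}
    (h : P.Serves n D coins seeds s ops s₁)
    (h' : Exec n D coins seeds (P.code o) (s₁.load o) T s₂) :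
    P.Serves n D coins seeds s (ops ++ [o]) s₂ := by
  induction ops generalizing s with
  | nil =>
    obtain rfl : s₁ = s := h
    exact ⟨T, s₂, h', rfl⟩
  | cons o' ops ih =>
    obtain ⟨T', s', h1, h2⟩ := h
    exact ⟨T', s', h1, ih h2⟩

theorem opsLegal_append {U : ℕ} (K : Config d) (ops ops' : List (Op d)) :
    OpsLegal n U φ K (ops ++ ops') ↔
      OpsLegal n U φ K ops ∧ OpsLegal n U φ (ops.foldl Op.apply K) ops' := by
  induction ops generalizing K with
  | nil => simp [OpsLegal]
  | cons o ops ih => simp [OpsLegal, ih, and_assoc]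

theorem configAfter_append (ops : List (Op d)) (o : Op d) :
    configAfter (ops ++ [o]) = o.apply (configAfter ops) := by
  simp [configAfter]

/-- The two sets consist of at most `n` points of the grid each. -/
structure Config.Bounded (n k : ℕ) (K : Config d) : Prop where
  gridA : ∀ a ∈ K.A, a ∈ grid d (2 ^ k)
  gridB : ∀ b ∈ K.B, b ∈ grid d (2 ^ k)
  cardA : K.A.card ≤ n
  cardB : K.B.card ≤ n

theorem Config.Bounded.apply {K : Config d} (h : K.Bounded n k) {o : Op d}
    (ho : o.Legal n (2 ^ k) φ K) : (o.apply K).Bounded n k := by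
  obtain ⟨h1, h2, h3, h4⟩ := h
  rcases o with ⟨S | S, x⟩ | ⟨S | S, x⟩ | _
  · obtain ⟨g, hx, hc, -⟩ := ho
    refine ⟨fun a ha => ?_, h2, ?_, h4⟩
    · rcases Finset.mem_insert.1 ha with rfl | ha
      exacts [g, h1 a ha]
    · exact (Finset.card_insert_le _ _).trans hc
  · obtain ⟨g, hx, hc, -⟩ := ho
    refine ⟨h1, fun a ha => ?_, h3, ?_⟩
    · rcases Finset.mem_insert.1 ha with rfl | ha
      exacts [g, h2 a ha]
    · exact (Finset.card_insert_le _ _).trans hc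
  · exact ⟨fun a ha => h1 a (Finset.mem_of_mem_erase ha), h2,
      (Finset.card_erase_le).trans h3, h4⟩
  · exact ⟨h1, fun a ha => h2 a (Finset.mem_of_mem_erase ha), h3,
      (Finset.card_erase_le).trans h4⟩
  · exact ⟨h1, h2, h3, h4⟩

theorem bounded_configAfter {ops : List (Op d)} (h : OpsLegal n (2 ^ k) φ (Config.empty d) ops) :
    (configAfter ops).Bounded n k := by
  induction ops using List.reverseRecOn with
  | nil => exact ⟨by simp [configAfter, Config.empty], by simp [configAfter, Config.empty],
      by simp [configAfter, Config.empty], by simp [configAfter, Config.empty]⟩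
  | append_singleton ops o ih =>
    rw [opsLegal_append] at h
    rw [configAfter_append]
    exact (ih h.1).apply h.2.1

open Classical in
/-- The number of random numbers drawn after an operation. -/
noncomputable def drawnAfter (n n₀ : ℕ) (ε : ℝ) (K : Config d) (m : ℕ) : Op d → ℕ
  | .insert _ _ => if m = 0 then 2 ^ Nat.clog 2 d + d else m
  | .delete _ _ => if m = 0 then 2 ^ Nat.clog 2 d + d else m
  | .query => if Brute n n₀ ε ∨ K.A ⊆ K.B then m else m + ⌈threshold n ε⌉₊

open Classical in
/-- The history of the nearest-neighbour structures after an operation. -/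
noncomputable def histAfter (n k n₀ : ℕ) (ε : ℝ) (coins : ℕ → unitInterval) (K : Config d) (m : ℕ)
    (H : List (NNOp d)) : Op d → List (NNOp d)
  | .insert .A _ => H
  | .insert .B x => H ++ [.insert x]
  | .delete .A _ => H
  | .delete .B x => H ++ [.delete x]
  | .query => if Brute n n₀ ε ∨ K.A ⊆ K.B then H else
      queryHist H (samples k coins K.A K.B m) ⌈threshold n ε⌉₊

/-- A bound for the time of an operation. -/
noncomputable def opTime (n d k r n₀ : ℕ) (ε τ : ℝ) : Op d → ℝ
  | .insert _ _ => updateTime n d k r τ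
  | .delete _ _ => updateTime n d k r τ
  | .query => queryTime n d k r n₀ ε τ

theorem run_update {coins : ℕ → unitInterval} {seeds : ℕ → D.Seed} (hd : 1 ≤ d) {K : Config d}
    (hK : K.Bounded n k) {m : ℕ} {H : List (NNOp d)} (hHB : nnSet H = K.B) {s : State d}
    (hs : Inv n k ε coins r K.A K.B m H s) {o : Op d} (ho : o.Legal n (2 ^ k) φ K)
    (hq : o ≠ .query) :
    Run n D coins seeds ((chamferAlgorithm r t n₀).code o) (s.load o)
      (opTime n d k r n₀ ε D.time o)
      (Good n k ε coins r (o.apply K).A (o.apply K).B (drawnAfter n n₀ ε K m o)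
        (histAfter n k n₀ ε coins K m H o)) := by
  have hAB : ∀ y, y ∈ K.A ∨ y ∈ K.B → y ∈ grid d (2 ^ k) := fun y hy =>
    hy.elim (hK.gridA y) (hK.gridB y)
  rcases o with ⟨S | S, x⟩ | ⟨S | S, x⟩ | _
  · have hx : x ∉ K.A := ho.2.1
    refine run_updateCmd .A true s hd hs ho.1 hAB (fun l => ?_) (fun l => ?_) ?_ (Or.inl ⟨rfl, rfl⟩)
    · simp only [Op.apply, Side.arr, true_and]
      refine Eq.trans (by convert cnt_insert (bits k (Nat.clog 2 d) coins) hx l) ?_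
      split_ifs <;> rfl
    · simp [Op.apply, Side.arr]
    · simp only [Op.apply, Finset.mem_insert]; tauto
  · have hx : x ∉ K.B := ho.2.1
    refine run_updateCmd .B true s hd hs ho.1 hAB (fun l => ?_) (fun l => ?_) ?_
      (Or.inr ⟨rfl, rfl, ?_⟩)
    · simp [Op.apply, Side.arr]
    · simp only [Op.apply, Side.arr, true_and]
      refine Eq.trans (by convert cnt_insert (bits k (Nat.clog 2 d) coins) hx l) ?_
      split_ifs <;> rfl
    · simp only [Op.apply, Finset.mem_insert]; tauto
    · rw [hHB]; exact ⟨ho.2.1, ho.2.2.1⟩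
  · have hx : x ∈ K.A := ho
    refine run_updateCmd .A false s hd hs (hK.gridA x ho) hAB (fun l => ?_) (fun l => ?_) ?_
      (Or.inl ⟨rfl, rfl⟩)
    · simp only [Op.apply, Side.arr, true_and]
      refine Eq.trans (by convert cnt_erase (bits k (Nat.clog 2 d) coins) hx l) ?_
      split_ifs <;> rfl
    · simp [Op.apply, Side.arr]
    · simp only [Op.apply, Finset.mem_erase]; tauto
  · have hx : x ∈ K.B := ho
    refine run_updateCmd .B false s hd hs (hK.gridB x ho) hAB (fun l => ?_) (fun l => ?_) ?_
      (Or.inr ⟨rfl, rfl, ?_⟩)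
    · simp [Op.apply, Side.arr]
    · simp only [Op.apply, Side.arr, true_and]
      refine Eq.trans (by convert cnt_erase (bits k (Nat.clog 2 d) coins) hx l) ?_
      split_ifs <;> rfl
    · simp only [Op.apply, Finset.mem_erase]; tauto
    · rw [hHB]; exact ho
  · exact absurd rfl hq

/-- A nonempty `B` requires an earlier update, and the first update initializes the memory; so
queries need no initialization. -/
theorem Inv.good {coins : ℕ → unitInterval} {A B : Finset (Pt d)} {m : ℕ} {H : List (NNOp d)}
    {s : State d} (h : Inv n k ε coins r A B m H s) (hB : B.Nonempty) :
    m ≠ 0 ∧ Good n k ε coins r A B m H s := by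
  rcases h with ⟨-, -, rfl, -⟩ | h
  · exact absurd hB Finset.not_nonempty_empty
  · exact h

theorem run_code {coins : ℕ → unitInterval} {seeds : ℕ → D.Seed} (htr : t < r) (hd : 1 ≤ d)
    (hn : 2 ≤ n) (hε : 0 < ε) {K : Config d} (hK : K.Bounded n k) {m : ℕ} {H : List (NNOp d)}
    (hHB : nnSet H = K.B) {s : State d} (hs : Inv n k ε coins r K.A K.B m H s) {o : Op d}
    (ho : o.Legal n (2 ^ k) φ K) :
    Run n D coins seeds ((chamferAlgorithm r t n₀).code o) (s.load o)
      (opTime n d k r n₀ ε D.time o)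
      (Inv n k ε coins r (o.apply K).A (o.apply K).B (drawnAfter n n₀ ε K m o)
        (histAfter n k n₀ ε coins K m H o)) := by
  have h0 : (if m = 0 then 2 ^ Nat.clog 2 d + d else m) ≠ 0 := by
    split_ifs with h
    · positivity
    · exact h
  by_cases hq : o = .query
  · subst hq
    obtain ⟨hm, hg⟩ := hs.good ho
    refine (run_queryCmd htr s hd hn hε hg hK.gridA hK.gridB ho hK.cardA hK.cardB hHB).mono le_rfl ?_
    rintro s' (⟨h1, h2, -⟩ | ⟨h1, h2, -⟩)
    · simp only [drawnAfter, histAfter, if_pos h1]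
      exact Or.inr ⟨hm, h2⟩
    · simp only [drawnAfter, histAfter, if_neg h1]
      exact Or.inr ⟨by omega, h2⟩
  · refine (run_update hd hK hHB hs ho hq).mono le_rfl fun s' h => Or.inr ⟨?_, h⟩
    rcases o with ⟨S, x⟩ | ⟨S, x⟩ | _
    exacts [h0, h0, absurd rfl hq]

theorem nnLegal_histAfter (z : ℕ → unitInterval) {K : Config d} {m : ℕ} {H : List (NNOp d)}
    (hHl : NNLegal n ∅ H) (hHB : nnSet H = K.B) {o : Op d} (ho : o.Legal n (2 ^ k) φ K) :
    NNLegal n ∅ (histAfter n k n₀ ε z K m H o) ∧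
      nnSet (histAfter n k n₀ ε z K m H o) = (o.apply K).B := by
  have happ : ∀ o' : NNOp d, o'.Legal n K.B →
      NNLegal n ∅ (H ++ [o']) ∧ nnSet (H ++ [o']) = o'.apply K.B := by
    intro o' ho'
    rw [nnLegal_append, nnSet_append, hHB]
    refine ⟨⟨hHl, ?_, trivial⟩, rfl⟩
    change o'.Legal n (nnSet H)
    rwa [hHB]
  rcases o with ⟨S | S, x⟩ | ⟨S | S, x⟩ | _
  · exact ⟨hHl, hHB⟩
  · exact happ (.insert x) ⟨ho.2.1, ho.2.2.1⟩
  · exact ⟨hHl, hHB⟩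
  · exact happ (.delete x) ho
  · simp only [histAfter]
    split_ifs
    · exact ⟨hHl, hHB⟩
    · refine ⟨nnLegal_queryHist hHl (by rw [hHB]; exact ho) _ _, ?_⟩
      rw [nnSet_queryHist, hHB]
      rfl

theorem discrete_histAfter {K : Config d} {m : ℕ} {H : (ℕ → unitInterval) → List (NNOp d)}
    (hH : Discrete H) (o : Op d) :
    Discrete fun z => histAfter n k n₀ ε z K m (H z) o := by
  rcases o with ⟨S | S, x⟩ | ⟨S | S, x⟩ | _
  · exact hH
  · exact hH.comp (· ++ [.insert x])
  · exact hH
  · exact hH.comp (· ++ [.delete x])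
  · simp only [histAfter]
    split_ifs
    · exact hH
    · exact discrete_queryHist k K.A K.B m _ hH

/-- What is known after the requests `ops`: `m` random numbers have been drawn, and the history of
the nearest-neighbour structures depends on the random numbers only. -/
structure Served (r t n₀ k φ : ℕ) (α ε : ℝ) (n : ℕ) (D : NNStructure d) (ops : List (Op d)) (m : ℕ)
    (H : (ℕ → unitInterval) → List (NNOp d)) : Prop where
  discrete : Discrete H
  le : m ≠ 0 → 2 ^ Nat.clog 2 d + d ≤ m
  legal : ∀ z, NNLegal n ∅ (H z)
  set : ∀ z, nnSet (H z) = (configAfter ops).B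
  serves : ∀ z seeds, ∃ s, (chamferAlgorithm r t n₀).Serves n D z seeds
    (initState n d (2 ^ k) φ α ε) ops s ∧
    Inv n k ε z r (configAfter ops).A (configAfter ops).B m (H z) s

/-- Two features matter for correctness: `m` is chosen before the random outcomes, so the samples of
a query use a fixed range of random numbers; and `H` depends on the random numbers but not on the
seeds, because answers only flow into the output. -/
theorem exists_served (htr : t < r) (hd : 1 ≤ d) (hn : 2 ≤ n) (hε : 0 < ε) {ops : List (Op d)}
    (h : OpsLegal n (2 ^ k) φ (Config.empty d) ops) :
    ∃ m H, Served r t n₀ k φ α ε n D ops m H := by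
  induction ops using List.reverseRecOn with
  | nil =>
    refine ⟨0, fun _ => [], .const _, fun h => absurd rfl h, fun _ => trivial, fun _ => rfl,
      fun z seeds => ⟨_, rfl, Or.inl ⟨?_, rfl, rfl, rfl, rfl⟩⟩⟩
    constructor <;> simp +contextual [initState]
    intro a ha
    simp [show a ≠ 1 by omega]
  | append_singleton ops o ih =>
    rw [opsLegal_append] at h
    obtain ⟨m, H, hS⟩ := ih h.1
    have hb := bounded_configAfter h.1
    have ho : o.Legal n (2 ^ k) φ (configAfter ops) := h.2.1
    refine ⟨drawnAfter n n₀ ε (configAfter ops) m o,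
      fun z => histAfter n k n₀ ε z (configAfter ops) m (H z) o, discrete_histAfter hS.discrete o,
      ?_, fun z => (nnLegal_histAfter z (hS.legal z) (hS.set z) ho).1, fun z => ?_, fun z seeds => ?_⟩
    · have h1 : ∀ j, 2 ^ Nat.clog 2 d + d ≤
          (if m = 0 then 2 ^ Nat.clog 2 d + d else m) + j := by
        intro j
        split_ifs with h0
        · omega
        · have := hS.le h0; omega
      rcases o with ⟨S, x⟩ | ⟨S, x⟩ | _
      · exact fun _ => h1 0
      · exact fun _ => h1 0
      -- Since `m` is the same for all outcomes, a single outcome shows `m ≠ 0`. Seeds exist because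
      -- their law is a probability measure.
      · have hm := (((hS.serves 0 fun _ => Classical.choice (nonempty_of_isProbabilityMeasure D.law)).choose_spec.2).good ho).1
        simp only [drawnAfter]
        have := hS.le hm
        split_ifs <;> omega
    · rw [configAfter_append]
      exact (nnLegal_histAfter z (hS.legal z) (hS.set z) ho).2
    · obtain ⟨s, h1, h2⟩ := hS.serves z seeds
      obtain ⟨T, s', h3, -, h4⟩ := run_code (D := D) (seeds := seeds) (n₀ := n₀) htr hd hn hε hb
        (hS.set z) h2 ho
      refine ⟨s', serves_append h1 h3, ?_⟩
      rw [configAfter_append]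
      exact h4

end

/-! ### Correctness -/

section

variable {d n k φ r t n₀ : ℕ} {α ε : ℝ} {D : NNStructure d}

theorem exists_serves_query (htr : t < r) (hd : 1 ≤ d) (hn : 2 ≤ n) (hε : 0 < ε)
    {ops : List (Op d)} (h : OpsLegal n (2 ^ k) φ (Config.empty d) (ops ++ [.query])) {m : ℕ}
    {H : (ℕ → unitInterval) → List (NNOp d)} (hS : Served r t n₀ k φ α ε n D ops m H)
    (z : ℕ → unitInterval) (seeds : ℕ → D.Seed) :
    ∃ s, (chamferAlgorithm r t n₀).Serves n D z seeds (initState n d (2 ^ k) φ α ε)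
      (ops ++ [.query]) s ∧ ((Brute n n₀ ε ∨ (configAfter ops).A ⊆ (configAfter ops).B) ∧
        s.output = chamfer (configAfter ops).A (configAfter ops).B ∨
      ¬ (Brute n n₀ ε ∨ (configAfter ops).A ⊆ (configAfter ops).B) ∧
        ∃ y, Answers D seeds r t (H z) (samples k z (configAfter ops).A (configAfter ops).B m)
            ⌈threshold n ε⌉₊ y ∧
          s.output = (∑ j ∈ Finset.range ⌈threshold n ε⌉₊,
            y j / treeDist (bits k (Nat.clog 2 d) z) (bitWeight d k (Nat.clog 2 d))
              (depth d k (Nat.clog 2 d)) (configAfter ops).B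
              (samples k z (configAfter ops).A (configAfter ops).B m j)) *
            treeSum (bits k (Nat.clog 2 d) z) (bitWeight d k (Nat.clog 2 d))
              (depth d k (Nat.clog 2 d)) (configAfter ops).A (configAfter ops).B /
            (⌈threshold n ε⌉₊ * (1 + ε / 8))) := by
  rw [opsLegal_append] at h
  have hb := bounded_configAfter h.1
  have hB : (configAfter ops).B.Nonempty := h.2.1
  obtain ⟨s, h1, h2⟩ := hS.serves z seeds
  obtain ⟨T, s', h3, -, h4⟩ := run_queryCmd (seeds := seeds) (n₀ := n₀) htr s hd hn hε
    (h2.good hB).2 hb.gridA hb.gridB hB hb.cardA hb.cardB (hS.set z)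
  refine ⟨s', serves_append h1 h3, ?_⟩
  rcases h4 with ⟨q1, -, q2⟩ | ⟨q1, -, q2⟩
  · exact Or.inl ⟨q1, q2⟩
  · exact Or.inr ⟨q1, q2⟩

theorem threshold_pos (hn : 2 ≤ n) (hε : 0 < ε) : 0 < threshold n ε := by
  have : 0 < Nat.clog 2 n := Nat.clog_pos (by norm_num) hn
  unfold threshold
  positivity

/-- If the random numbers and the answers are good, then so is the output. -/
theorem isApprox_output (hα : 0 < α) (hε : 0 < ε) (hε1 : ε < 1) (hd : 1 ≤ d) {A B : Finset (Pt d)}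
    (hA : ∀ a ∈ A, a ∈ grid d (2 ^ k)) (hBg : ∀ b ∈ B, b ∈ grid d (2 ^ k)) (hB : B.Nonempty)
    (hAB : ¬ A ⊆ B) {M m : ℕ} (hM : 0 < M) {z : ℕ → unitInterval} {y : ℕ → ℝ}
    (hz : ¬ (0 < treeSum (bits k (Nat.clog 2 d) z) (bitWeight d k (Nat.clog 2 d))
        (depth d k (Nat.clog 2 d)) A B ∧ ε / 8 * (M * chamfer A B) ≤
        |estimator k (Nat.clog 2 d) A B m M z - M * chamfer A B|))
    (hy : ∀ j < M, IsApprox (1 + 1 / 2 * α) (y j) (distTo (samples k z A B m j) B)) :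
    IsApprox (1 + α + ε) ((∑ j ∈ Finset.range M,
        y j / treeDist (bits k (Nat.clog 2 d) z) (bitWeight d k (Nat.clog 2 d))
          (depth d k (Nat.clog 2 d)) B (samples k z A B m j)) *
        treeSum (bits k (Nat.clog 2 d) z) (bitWeight d k (Nat.clog 2 d))
          (depth d k (Nat.clog 2 d)) A B / (M * (1 + ε / 8))) (chamfer A B) := by
  have hpos := (treeSum_pos_iff (z := z) (J := Nat.clog 2 d) hd hA hBg hB).2 hAB
  have hz' := le_of_lt (not_le.1 fun h => hz ⟨hpos, h⟩)
  have hD : ∀ j, 0 < treeDist (bits k (Nat.clog 2 d) z) (bitWeight d k (Nat.clog 2 d))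
      (depth d k (Nat.clog 2 d)) B (samples k z A B m j) := fun j =>
    (sample_mem bitWeight_nonneg (fun a ha b hb hab => pre_bits_inj hd (hA a ha) (hA b hb) hab)
      hpos (z (m + j)).2.1 (z (m + j)).2.2).2.1
  refine isApprox_estimate hα hε hε1 (by exact_mod_cast hM) (chamfer_nonneg A B) ?_ ?_ hz'
  · rw [estimator, Finset.sum_mul]
    refine Finset.sum_le_sum fun j hj => ?_
    rw [div_mul_eq_mul_div]
    have := (hy j (Finset.mem_range.1 hj)).1
    have := hD j
    unfold samples at *
    gcongr
  · rw [estimator, Finset.sum_mul, Finset.sum_mul]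
    refine Finset.sum_le_sum fun j hj => ?_
    rw [div_mul_eq_mul_div, div_mul_eq_mul_div, mul_right_comm]
    have := (hy j (Finset.mem_range.1 hj)).2
    have := hD j
    unfold samples at *
    gcongr

/-- The choice of `t` gives `q * (t + 1) ≥ 4`, so one median fails with probability at most `2 ^
(2t+1) / n ^ 4`. With at most `n²` medians the total is `2 ^ (2t+1) / n²`, and the lower bound on
`n` pushes this below 1/32. -/
theorem failure_bound {q : ℝ} (hq : 0 < q) (ht : 4 / q ≤ t) {M : ℕ} (hn₀ : 2 ^ (2 * t + 1 + 6) ≤ n)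
    (hM : M ≤ n * n) :
    (M : ℝ≥0∞) * (2 ^ (2 * t + 1) * ENNReal.ofReal ((n : ℝ) ^ (-q)) ^ (t + 1)) ≤
      ENNReal.ofReal (1 / 32) := by
  have hn1 : 1 ≤ n := Nat.one_le_two_pow.trans hn₀
  have hn1' : (1 : ℝ) ≤ n := by exact_mod_cast hn1
  have hn0 : (0 : ℝ) < n := by linarith
  have h1 : ((n : ℝ) ^ (-q)) ^ (t + 1) ≤ ((n : ℝ) ^ 4)⁻¹ := by
    rw [← Real.rpow_natCast, ← Real.rpow_mul hn0.le, ← Real.rpow_natCast (n : ℝ) 4,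
      ← Real.rpow_neg hn0.le]
    refine Real.rpow_le_rpow_of_exponent_le hn1' ?_
    rw [div_le_iff₀ hq] at ht
    push_cast
    nlinarith
  have h2 : (M : ℝ) * (2 ^ (2 * t + 1) * ((n : ℝ) ^ (-q)) ^ (t + 1)) ≤ 1 / 32 := by
    have h3 : (2 : ℝ) ^ (2 * t + 1) * 64 ≤ n := by
      have : (2 : ℝ) ^ (2 * t + 1 + 6) ≤ n := by exact_mod_cast hn₀
      rw [pow_add] at this
      linarith
    calc (M : ℝ) * (2 ^ (2 * t + 1) * ((n : ℝ) ^ (-q)) ^ (t + 1))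
        ≤ (n * n) * (2 ^ (2 * t + 1) * ((n : ℝ) ^ 4)⁻¹) := by
          gcongr
          exact_mod_cast hM
      _ = 2 ^ (2 * t + 1) / (n * n) := by field_simp
      _ ≤ 1 / 32 := by
          rw [div_le_div_iff₀ (by positivity) (by norm_num)]
          nlinarith
  have h4 : (0 : ℝ) ≤ (n : ℝ) ^ (-q) := by positivity
  rw [← ENNReal.ofReal_pow h4, ← ENNReal.ofReal_natCast,
    show (2 : ℝ≥0∞) ^ (2 * t + 1) = ENNReal.ofReal (2 ^ (2 * t + 1)) by
      rw [ENNReal.ofReal_pow (by norm_num)]; norm_num,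
    ← ENNReal.ofReal_mul (by positivity), ← ENNReal.ofReal_mul (by positivity)]
  exact ENNReal.ofReal_le_ofReal h2

/-- Outside the exact cases the output can fail only if the estimator with exact distances is far
off (7/32) or some median of answers is wrong (1/32). -/
theorem correct_chamferAlgorithm {q : ℝ} (hq : 0 < q) (ht : 4 / q ≤ t) (hn : 2 ≤ n) (hd : 1 ≤ d)
    (hα : 0 < α) (hε : 0 < ε) (hε1 : ε < 1)
    (hD : D.IsApproxNN n (1 / 2 * α) ((n : ℝ) ^ (-q))) :
    (chamferAlgorithm (2 * t + 1) t (2 ^ (2 * t + 1 + 6))).Correct n (2 ^ k) φ α ε D (1 + α + ε)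
      (1 / 4) := by
  intro ops h
  obtain ⟨m, H, hS⟩ := exists_served (D := D) (α := α) (t := t) (r := 2 * t + 1)
    (n₀ := 2 ^ (2 * t + 1 + 6)) (by omega) hd hn hε ((opsLegal_append _ _ _).1 h).1
  have hrun := exists_serves_query (by omega) hd hn hε h hS
  have hb := bounded_configAfter ((opsLegal_append _ _ _).1 h).1
  have hB : (configAfter ops).B.Nonempty := ((opsLegal_append _ _ _).1 h).2.1
  have hm : 2 ^ Nat.clog 2 d + d ≤ m := by
    have seeds : ℕ → D.Seed := fun _ =>
      Classical.choice (nonempty_of_isProbabilityMeasure D.law)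
    obtain ⟨s, -, hs⟩ := hS.serves 0 seeds
    exact hS.le (hs.good hB).1
  have hset := hS.set
  generalize configAfter ops = K at *
  set M := ⌈threshold n ε⌉₊ with hMdef
  have hM : 0 < M := Nat.ceil_pos.2 (threshold_pos hn hε)
  set E₁ : Set ((ℕ → unitInterval) × (ℕ → D.Seed)) :=
    {z | 0 < treeSum (bits k (Nat.clog 2 d) z) (bitWeight d k (Nat.clog 2 d))
        (depth d k (Nat.clog 2 d)) K.A K.B ∧ ε / 8 * (M * chamfer K.A K.B) ≤
        |estimator k (Nat.clog 2 d) K.A K.B m M z - M * chamfer K.A K.B|} ×ˢ Set.univ with hE₁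
  set E₂ : Set ((ℕ → unitInterval) × (ℕ → D.Seed)) :=
    {ρ | ∃ y, Answers D ρ.2 (2 * t + 1) t (H ρ.1) (samples k ρ.1 K.A K.B m) M y ∧
        ∃ j < M, ¬ IsApprox (1 + 1 / 2 * α) (y j) (distTo (samples k ρ.1 K.A K.B m j) K.B)} with hE₂
  by_cases hbr : Brute n (2 ^ (2 * t + 1 + 6)) ε ∨ K.A ⊆ K.B
  · refine (measure_mono_null (t := ∅) (fun ρ hρ => (hρ ?_).elim) measure_empty).le.trans zero_le
    obtain ⟨s, h1, ⟨-, h2⟩ | ⟨h2, -⟩⟩ := hrun ρ.1 ρ.2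
    · refine ⟨s, h1, ?_⟩
      rw [h2]
      refine ⟨le_rfl, le_mul_of_one_le_right (chamfer_nonneg _ _) (by linarith)⟩
    · exact absurd hbr h2
  have hsub : {ρ | ¬ ∃ s : State d,
      (chamferAlgorithm (2 * t + 1) t (2 ^ (2 * t + 1 + 6))).Serves n D ρ.1 ρ.2
        (initState n d (2 ^ k) φ α ε) (ops ++ [.query]) s ∧
      IsApprox (1 + α + ε) s.output (chamfer K.A K.B)} ⊆ E₁ ∪ E₂ := by
    intro ρ hρ
    by_contra hc
    rw [Set.mem_union, not_or] at hc
    refine hρ ?_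
    obtain ⟨s, h1, ⟨h2, -⟩ | ⟨-, y, h2, h3⟩⟩ := hrun ρ.1 ρ.2
    · exact absurd h2 hbr
    refine ⟨s, h1, ?_⟩
    rw [h3]
    refine isApprox_output hα hε hε1 hd hb.gridA hb.gridB hB (fun hs => hbr (Or.inr hs)) hM
      (fun hz => hc.1 ⟨hz, trivial⟩) fun j hj => ?_
    by_contra hj'
    exact hc.2 ⟨y, h2, j, hj, hj'⟩
  have hLg : 1 ≤ Nat.clog 2 n := Nat.clog_pos (by norm_num) hn
  have hm₁ : randomness D E₁ ≤ ENNReal.ofReal (7 / 32) := by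
    rw [hE₁, randomness, Measure.prod_prod, measure_univ, mul_one]
    refine coinLaw_bad_estimator_le hd (Nat.le_pow_clog (by norm_num) d) hb.gridA hb.gridB hB
      hb.cardA hb.cardB hLg (Nat.le_pow_clog (by norm_num) n) hε hm ?_ hM
    refine le_trans (le_of_eq ?_) (Nat.le_ceil (threshold n ε))
    unfold threshold
    field_simp
  have hm₂ : randomness D E₂ ≤ ENNReal.ofReal (1 / 32) := by
    refine (randomness_answers_le hD (by linarith) hB hS.discrete hS.legal hset).trans ?_
    rw [not_or, Brute, not_or, not_lt, not_lt] at hbr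
    refine failure_bound hq ht hbr.1.1 (Nat.ceil_le.2 ?_)
    exact_mod_cast hbr.1.2
  -- The two failure probabilities add up to exactly 1/4.
  refine (measure_mono hsub).trans ((measure_union_le _ _).trans ((add_le_add hm₁ hm₂).trans ?_))
  rw [← ENNReal.ofReal_add (by norm_num) (by norm_num)]
  refine le_of_eq ?_
  rw [show (7 / 32 + 1 / 32 : ℝ) = 1 / 4 by norm_num, ENNReal.ofReal_div_of_pos (by norm_num)]
  norm_num

/-! ### Running time -/

/-- Bounds `log n` away from zero, which lets constants and lower powers of `log n` be absorbed in
the estimates below. -/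
theorem half_le_log (hn : 2 ≤ n) : 1 / 2 ≤ Real.log n := by
  have h1 : Real.log 2 ≤ Real.log n := Real.log_le_log (by norm_num) (by exact_mod_cast hn)
  have := Real.log_two_gt_d9
  linarith

theorem clog_le_log (hn : 2 ≤ n) : (Nat.clog 2 n : ℝ) ≤ 4 * Real.log n := by
  have h1 := Nat.pow_pred_clog_lt_self (b := 2) (by norm_num) (show 1 < n by omega)
  have h2 : ((Nat.clog 2 n).pred : ℝ) * Real.log 2 ≤ Real.log n := by
    rw [← Real.log_pow]
    exact Real.log_le_log (by positivity) (by exact_mod_cast h1.le)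
  have h3 := Real.log_two_gt_d9
  have h4 := half_le_log hn
  have h5 : (Nat.clog 2 n : ℝ) ≤ (Nat.clog 2 n).pred + 1 := by
    exact_mod_cast (by rw [Nat.pred_eq_sub_one]; omega : Nat.clog 2 n ≤ (Nat.clog 2 n).pred + 1)
  have h6 : (0 : ℝ) ≤ (Nat.clog 2 n).pred := Nat.cast_nonneg _
  nlinarith

theorem le_log_of_two_pow_le {c : ℕ} (h : 2 ^ k ≤ n ^ c) :
    (k : ℝ) ≤ 2 * c * Real.log n := by
  have h2 : (k : ℝ) * Real.log 2 ≤ c * Real.log n := by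
    rw [← Real.log_pow, ← Real.log_pow]
    exact Real.log_le_log (by positivity) (by exact_mod_cast h)
  have h3 := Real.log_two_gt_d9
  have h6 : (0 : ℝ) ≤ k := Nat.cast_nonneg _
  nlinarith

theorem two_pow_clog_le (hd : 1 ≤ d) : (2 : ℝ) ^ Nat.clog 2 d ≤ 2 * d := by
  rcases hd.eq_or_lt with rfl | hd
  · norm_num
  · have h1 := Nat.pow_pred_clog_lt_self (b := 2) (by norm_num) hd
    have h2 : 0 < Nat.clog 2 d := Nat.clog_pos (by norm_num) hd
    have h3 : 2 ^ Nat.clog 2 d ≤ 2 * d := by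
      obtain ⟨e, he⟩ := Nat.exists_eq_succ_of_ne_zero h2.ne'
      rw [he, Nat.pred_succ] at h1
      rw [he, pow_succ]
      omega
    exact_mod_cast h3

/-- All terms except the calls of the nearest-neighbour copies are absorbed by multiples of `d * log
n`: the depth because `k ≤ 2c log n` and `2 ^ Nat.clog 2 d ≤ 2d`. -/
theorem updateTime_le {c : ℕ} (hn : 2 ≤ n) (hd : 1 ≤ d) (hk : 2 ^ k ≤ n ^ c) {τ : ℝ}
    (hτ : 0 ≤ τ) : updateTime n d k r τ ≤
      (2000 * (4 * c + 16) + 6 * r + 2 + r) * (d * Real.log n + Real.log n ^ 2 + τ) := by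
  have h1 := half_le_log hn
  have h2 := clog_le_log hn
  have h3 := le_log_of_two_pow_le hk
  have h4 := two_pow_clog_le hd
  have hd' : (1 : ℝ) ≤ d := by exact_mod_cast hd
  have hr : (0 : ℝ) ≤ r := Nat.cast_nonneg r
  have hc : (0 : ℝ) ≤ c := Nat.cast_nonneg c
  unfold updateTime
  set ℓ := Real.log n
  set Q := d * ℓ with hQ
  have hdQ : (d : ℝ) ≤ 2 * Q := by rw [hQ]; nlinarith
  have hlQ : ℓ ≤ Q := by rw [hQ]; nlinarith
  have hdk : (d : ℝ) * k ≤ 2 * c * Q := by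
    calc (d : ℝ) * k ≤ d * (2 * c * ℓ) := by gcongr
      _ = 2 * c * Q := by rw [hQ]; ring
  have hkQ : (k : ℝ) ≤ 2 * c * Q := h3.trans (by gcongr)
  have hQ1 : 1 ≤ 2 * Q := hd'.trans hdQ
  have h5 : 2000 * ((2 : ℝ) ^ Nat.clog 2 d + d * (k + 2) + k + Nat.clog 2 n + 2) +
      (r * (τ + 3) + 1) ≤ 2000 * ((4 * c + 16) * Q) + (r * τ + 6 * r * Q + 2 * Q) := by
    have : (r : ℝ) * 3 ≤ 6 * r * Q := by nlinarith
    linarith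
  refine h5.trans ?_
  have hl2 : 0 ≤ ℓ ^ 2 := sq_nonneg _
  have h6 : 0 ≤ 2000 * (4 * (c : ℝ) + 16) + 6 * r + 2 := by positivity
  have h7 : 0 ≤ Q := by linarith
  nlinarith [mul_nonneg h6 hl2, mul_nonneg h6 hτ, mul_nonneg hr h7, mul_nonneg hr hl2]

theorem threshold_le (hn : 2 ≤ n) (hε : 0 < ε) :
    threshold n ε ≤ 41943040 * (Real.log n ^ 2 * (ε ^ 2)⁻¹) := by
  have h2 := clog_le_log hn
  have : threshold n ε = 2621440 * ((Nat.clog 2 n : ℝ) ^ 2 * (ε ^ 2)⁻¹) := by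
    unfold threshold
    field_simp
  rw [this, show (41943040 : ℝ) * (Real.log n ^ 2 * (ε ^ 2)⁻¹) =
    2621440 * ((4 * Real.log n) ^ 2 * (ε ^ 2)⁻¹) by ring]
  gcongr

theorem depth_le {c : ℕ} (hn : 2 ≤ n) (hd : 1 ≤ d) (hk : 2 ^ k ≤ n ^ c) :
    (depth d k (Nat.clog 2 d) : ℝ) + d + 3 ≤ (4 * c + 28) * (d * Real.log n ^ 2) := by
  have h1 := half_le_log hn
  have h3 := le_log_of_two_pow_le hk
  have h4 := two_pow_clog_le hd
  have hd' : (1 : ℝ) ≤ d := by exact_mod_cast hd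
  have hc : (0 : ℝ) ≤ c := Nat.cast_nonneg c
  unfold depth
  push_cast
  set ℓ := Real.log n
  have h5 : ℓ ≤ 2 * ℓ ^ 2 := by nlinarith
  have h6 : 1 ≤ 4 * ℓ ^ 2 := by nlinarith
  have hk' : (k : ℝ) ≤ 4 * c * ℓ ^ 2 := by
    calc (k : ℝ) ≤ 2 * c * ℓ := h3
      _ ≤ 2 * c * (2 * ℓ ^ 2) := by gcongr
      _ = _ := by ring
  have h7 : (d : ℝ) * k ≤ d * (4 * c * ℓ ^ 2) := by gcongr
  have h8 : (d : ℝ) * 1 ≤ d * (4 * ℓ ^ 2) := by gcongr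
  linarith

/-- The constant in the bound for the query time. -/
noncomputable def queryConst (c r n₀ : ℕ) : ℝ :=
  1600 + (3 * 41943040 + 4 * ((n₀ + 1) * (n₀ + 2))) * (300 * (4 * c + 28)) +
    (41943040 + 8) * (200 * (4 * c + 28) + r + 4 * (5 * r + 101 + 200 * (r + 1) ^ 2))

/-- Both the samples and the exact computation cost a multiple of `log² n / ε²` times the depth; for
small `n` the exact computation costs a constant times the depth. The depth is at most a multiple of
`d * log² n`. -/
theorem queryTime_le {c : ℕ} (hn : 2 ≤ n) (hd : 1 ≤ d) (hk : 2 ^ k ≤ n ^ c) (hε : 0 < ε)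
    (hε1 : ε < 1) {τ : ℝ} (hτ : 0 ≤ τ) : queryTime n d k r n₀ ε τ ≤
      queryConst c r n₀ * (Real.log n ^ 2 * (ε ^ 2)⁻¹ * (d * Real.log n ^ 2 + τ)) := by
  have h1 := half_le_log hn
  have h2 := threshold_le hn hε
  have h3 := depth_le hn hd hk
  have h0 := (threshold_pos hn hε).le
  have hd' : (1 : ℝ) ≤ d := by exact_mod_cast hd
  have hr : (0 : ℝ) ≤ r := Nat.cast_nonneg r
  have hc : (0 : ℝ) ≤ c := Nat.cast_nonneg c
  unfold queryTime sampleTime queryConst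
  set ℓ := Real.log n
  set N : ℝ := (depth d k (Nat.clog 2 d) : ℝ)
  set θ := threshold n ε
  have hN : 0 ≤ N := Nat.cast_nonneg _
  set X := ℓ ^ 2 * (ε ^ 2)⁻¹ with hX
  set G := d * ℓ ^ 2 + τ with hG
  have hl : 1 ≤ 4 * ℓ ^ 2 := by nlinarith
  have hdl : ℓ ^ 2 ≤ d * ℓ ^ 2 := le_mul_of_one_le_left (sq_nonneg _) hd'
  have hG1 : 1 ≤ 4 * G := by rw [hG]; linarith
  have hG0 : 0 ≤ G := by linarith
  have hτG : τ ≤ G := by rw [hG]; nlinarith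
  have hX1 : 1 ≤ 4 * X := by
    have : 1 ≤ (ε ^ 2)⁻¹ := (one_le_inv₀ (by positivity)).2 (by nlinarith)
    rw [hX]
    nlinarith
  have hX0 : 0 ≤ X := by linarith
  have hNG : N + d + 3 ≤ (4 * c + 28) * G := by
    refine h3.trans ?_
    gcongr
    rw [hG]
    linarith
  have hS : 200 * (N + 1) + (r * (τ + 5) + 1) + 200 * ((r : ℝ) + 1) ^ 2 + 100 ≤
      (200 * (4 * c + 28) + r + 4 * (5 * r + 101 + 200 * (r + 1) ^ 2)) * G := by
    have e1 : (r : ℝ) * τ ≤ r * G := by gcongr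
    have e2 : (5 * (r : ℝ) + 101 + 200 * (r + 1) ^ 2) * 1 ≤
        (5 * (r : ℝ) + 101 + 200 * (r + 1) ^ 2) * (4 * G) := by gcongr
    linarith
  have hS0 : 0 ≤ (200 * (4 * (c : ℝ) + 28) + r + 4 * (5 * r + 101 + 200 * (r + 1) ^ 2)) * G := by
    positivity
  -- From `1 ≤ 4 * X` and `1 ≤ 4 * G`; in the same way all additive constants below pick up factors
  -- of 4.
  have a1 : (100 : ℝ) ≤ 1600 * (X * G) := by nlinarith
  have a2 : (3 * θ + ((n₀ : ℝ) + 1) * (n₀ + 2)) * (300 * (N + d + 3)) ≤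
      ((3 * 41943040 + 4 * ((n₀ + 1) * (n₀ + 2))) * X) * (300 * ((4 * c + 28) * G)) := by
    have : ((n₀ : ℝ) + 1) * (n₀ + 2) * 1 ≤ (n₀ + 1) * (n₀ + 2) * (4 * X) := by gcongr
    gcongr
    linarith
  have a3 : (θ + 2) * (200 * (N + 1) + (r * (τ + 5) + 1) + 200 * ((r : ℝ) + 1) ^ 2 + 100) ≤
      ((41943040 + 8) * X) *
        ((200 * (4 * c + 28) + r + 4 * (5 * r + 101 + 200 * (r + 1) ^ 2)) * G) := by
    gcongr
    linarith
  refine (add_le_add (add_le_add a1 a2) a3).trans (le_of_eq ?_)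
  ring

theorem worstCaseTime_chamferAlgorithm (htr : t < r) (hn : 2 ≤ n) (hd : 1 ≤ d) (hε : 0 < ε)
    {Tu Tq : ℝ} (hu : updateTime n d k r D.time ≤ Tu) (hq : queryTime n d k r n₀ ε D.time ≤ Tq) :
    (chamferAlgorithm r t n₀).WorstCaseTime n (2 ^ k) φ α ε D Tu Tq := by
  intro z seeds ops o h
  have h' := (opsLegal_append _ _ _).1 h
  obtain ⟨m, H, hS⟩ := exists_served (D := D) (α := α) (n₀ := n₀) htr hd hn hε h'.1
  obtain ⟨s, h1, h2⟩ := hS.serves z seeds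
  obtain ⟨T, s', h3, h4, -⟩ := run_code (D := D) (seeds := seeds) (n₀ := n₀) htr hd hn hε
    (bounded_configAfter h'.1) (hS.set z) h2 h'.2.1
  refine ⟨s, s', T, h1, h3, h4.trans ?_⟩
  rcases o with _ | _ | _
  exacts [hu, hu, hq]

end

end DynChamfer

/-- The constant `κ` (so that `κ * α = Θ(α)`) is absolute; `c` and `q` are the exponents of the
polynomials in `n` that bound the coordinates, the aspect ratio, and the inverse failure probability
of the nearest-neighbour structure. The algorithm and the constant of the time bounds depend on
`c` and `q` only. -/
theorem theorem2 :
    ∃ κ : ℝ, 0 < κ ∧ ∀ (c : ℕ) (q : ℝ), 0 < q →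
      ∃ (P : DynChamfer.Algorithm) (C : ℝ), 0 < C ∧
        ∀ (n d U φ : ℕ) (α ε : ℝ) (D : DynChamfer.NNStructure d),
          2 ≤ n → 1 ≤ d →
          (∃ k : ℕ, U = 2 ^ k) → U ≤ n ^ c →
          (∃ L : ℕ, φ = 2 ^ L) → φ ≤ n ^ c →
          0 < α → 0 < ε → ε < 1 →
          D.IsApproxNN n (κ * α) ((n : ℝ) ^ (-q)) →
          P.WorstCaseTime n U φ α ε D
            (C * (d * Real.log n + Real.log n ^ 2 + D.time))
            (C * (Real.log n ^ 2 * (ε ^ 2)⁻¹ * max (α ^ 2) 1 *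
              (d * Real.log n ^ 2 + D.time))) ∧
          P.Correct n U φ α ε D (1 + α + ε) (1 / 4) := by
  -- Half of the allowed error `α` goes to the nearest-neighbour answers; the slack pays for the
  -- products with the sampling error in `isApprox_estimate`.
  refine ⟨1 / 2, by norm_num, fun c q hq => ?_⟩
  -- This makes `q * (t + 1) ≥ 4` in `failure_bound`; the bound `2 ^ (r + 6)` for small `n` below is
  -- the one required there.
  set t := ⌈4 / q⌉₊
  set r := 2 * t + 1 with hr
  set Cu : ℝ := 2000 * (4 * c + 16) + 6 * r + 2 + r
  set Cq := DynChamfer.queryConst c r (2 ^ (r + 6))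
  have hCu : 0 < Cu := by positivity
  have hCq : 0 < Cq := by
    simp only [Cq, DynChamfer.queryConst]
    positivity
  -- One constant has to serve both time bounds, hence the sum.
  refine ⟨DynChamfer.chamferAlgorithm r t (2 ^ (r + 6)), Cu + Cq, by positivity, ?_⟩
  rintro n d _ φ α ε D hn hd ⟨k, rfl⟩ hU - - hα hε hε1 hD
  have hτ : (0 : ℝ) ≤ D.time := D.time.2
  have hlog := DynChamfer.half_le_log hn
  refine ⟨DynChamfer.worstCaseTime_chamferAlgorithm (by omega) hn hd hε ?_ ?_,
    DynChamfer.correct_chamferAlgorithm hq (Nat.le_ceil _) hn hd hα hε hε1 hD⟩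
  · refine (DynChamfer.updateTime_le hn hd hU hτ).trans ?_
    gcongr ?_ * _
    exact le_add_of_nonneg_right hCq.le
  · refine (DynChamfer.queryTime_le hn hd hU hε hε1 hτ).trans ?_
    gcongr ?_ * (?_ * _)
    · exact le_add_of_nonneg_left hCu.le
    · exact le_mul_of_one_le_right (by positivity) (le_max_right _ _)
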